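/- **The language.** Fix a set of type constants $\alpha$ and a set of constant terms $c$, each with an assigned type of the form $!A_c$. Types are $A,B ::= \alpha \mid A\multimap B \mid A\otimes B \mid 1 \mid {!A}$; write $!^nA$ for $n$ exclamation marks. Subtyping $<:$ is generated, under the side condition $m=0$ or $n\ge 1$, by $!^n\alpha<:{!^m\alpha}$; $!^n1<:{!^m1}$; $!^n(A'\multimap B)<:{!^m(A\multimap B')}$ and $!^n(A\otimes B)<:{!^m(A'\otimes B')}$ whenever $A<:A'$ and $B<:B'$. Terms (up to renaming of bound variables) are $M,N::= x^A\mid c^A\mid *^n\mid \lambda^nx^A.M\mid MN\mid \langle M,N\rangle^n\mid \mathrm{let}\,\langle x^A,y^B\rangle^n=M\,\mathrm{in}\,N\mid \mathrm{let}\,*=M\,\mathrm{in}\,N$, where $\mathrm{let}\,x^A=M\,\mathrm{in}\,N$ abbreviates $(\lambda^0x^A.N)M$, $\lambda{*}.M$ abbreviates $\lambda^0u^1.\mathrm{let}\,*=u\,\mathrm{in}\,M$ ($u$ fresh), and an index $0$ is omitted. Values are $V,W::= x^A\mid c^A\mid *^n\mid\lambda^nx^A.M\mid\langle V,W\rangle^n\mid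 \mathrm{let}\,x^A=V\,\mathrm{in}\,W\mid\mathrm{let}\,\langle x^A,y^B\rangle^n=V\,\mathrm{in}\,W\mid\mathrm{let}\,*=V\,\mathrm{in}\,W$. Typing ($!\Delta$ is a context all of whose types have the form $!A$; contexts separated by commas are disjoint): $!\Delta,x{:}A\vdash x^B:B$ if $A<:B$; $!\Delta\vdash c^B:B$ if $!A_c<:B$; $!\Delta\vdash *^n:{!^n1}$; if $\Delta,x{:}A\vdash M:B$ then $\Delta\vdash\lambda^0x^A.M:A\multimap B$, and, if moreover $\Delta={!\Delta'}$, also $\Delta\vdash\lambda^{n+1}x^A.M:{!^{n+1}(A\multimap B)}$. With $!\Delta,\Gamma_1$ the context of $M$ and $!\Delta,\Gamma_2$ (extended by the bound variables) that of $N$, the following are typed in $!\Delta,\Gamma_1,\Gamma_2$: $MN:B$ if $M:A\multimap B$, $N:A$; $\langle M,N\rangle^n:{!^n(A\otimes B)}$ if $M:{!^nA}$, $N:{!^nB}$; $\mathrm{let}\,\langle x^A,y^B\rangle^n=M\,\mathrm{in}\,N:C$ if $M:{!^n(A\otimes B)}$ and $N:C$ with $x:{!^nA},y:{!^nB}$;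 $\mathrm{let}\,*=M\,\mathrm{in}\,N:C$ if $M:1$, $N:C$. If $\Delta\vdash M:A$ and $A<:A'$, let $[M]_{A'}$ be the canonical change of the annotations of $M$ such that $\Delta\vdash[M]_{A'}:A'$ (change the annotation of $x$, $c$, $*$; for $\lambda$ and pairs change the indices and cast the components; for $MN$ cast $M$; for a let, cast its body; annotations of variables need no change when types in the context get smaller). In $M[V/x]$ each free occurrence $x^{A'}$ is replaced by $[V]_{A'}$. Axiomatic equivalence $\Delta\vdash M\approx N:A$ is the least congruence and equivalence relation on valid typing judgments that contains the following pairs whenever both sides are validly typed ($V,W$ values, $-$ any of $x,*,\langle x,y\rangle^n$): (1) $\mathrm{let}\,x=V\,\mathrm{in}\,M\approx M[V/x]$; (2) $\mathrm{let}\,\langle x,y\rangle^n=\langle V,W\rangle^n\,\mathrm{in}\,M\approx M[V/x,W/y]$; (3) $\mathrm{let}\,*=*\,\mathrm{in}\,M\approx M$; (4) $\lambda^nx^A.[V]_{A\multimap B}\,x^A\approx V$ for $V:{!^n(A\multimap B)}$; (5) $\mathrm{let}\,x^A=N\,\mathrm{in}\,x^A\approx N$; (6) $\mathrm{let}\,\langle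 x^A,y^B\rangle^n=N\,\mathrm{in}\,\langle x^{!^nA},y^{!^nB}\rangle^n\approx N$; (7) $\mathrm{let}\,*=[N]_1\,\mathrm{in}\,*^n\approx N$ for $N:{!^n1}$; (8) $\mathrm{let}\,{-_1}=(\mathrm{let}\,{-_2}=M\,\mathrm{in}\,N)\,\mathrm{in}\,P\approx\mathrm{let}\,{-_2}=M\,\mathrm{in}\,\mathrm{let}\,{-_1}=N\,\mathrm{in}\,P$; (9) $\mathrm{let}\,{-_1}=V\,\mathrm{in}\,\mathrm{let}\,{-_2}=W\,\mathrm{in}\,M\approx\mathrm{let}\,{-_2}=W\,\mathrm{in}\,\mathrm{let}\,{-_1}=V\,\mathrm{in}\,M$; (10) $\mathrm{let}\,x^{A\multimap B}=M\,\mathrm{in}\,\mathrm{let}\,y^A=N\,\mathrm{in}\,xy\approx MN$; (11) $\mathrm{let}\,x^D=V\,\mathrm{in}\,\lambda^ny^A.M\approx\lambda^ny^A.\mathrm{let}\,x^D=V\,\mathrm{in}\,M$; (12) $\mathrm{let}\,x^A=M\,\mathrm{in}\,\mathrm{let}\,y^B=N\,\mathrm{in}\,\langle x^A,y^B\rangle^n\approx\langle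 M,N\rangle^n$; (13) $[M]_{B\multimap D'}[N]_B\approx[\,[M]_{A\multimap D}[N]_A\,]_{D'}$ for $M:{!^n(A\multimap D)}$, $N:C$, $C<:B<:A$, $D<:D'$; (14) $\mathrm{let}\,\langle x^{A'},y^{B'}\rangle^{n'}=[M]\,\mathrm{in}\,N\approx\mathrm{let}\,\langle x^A,y^B\rangle^n=M\,\mathrm{in}\,N$ for $[M]$ the cast of $M$ along $!^n(A\otimes B)<:{!^{n'}(A'\otimes B')}$; (15) $\mathrm{let}\,x^{A'}=[M]_{A'}\,\mathrm{in}\,N\approx\mathrm{let}\,x^A=M\,\mathrm{in}\,N$ for $A<:A'$; (16) $\mathrm{let}\,*=[[M]_{!^n1}]_1\,\mathrm{in}\,N\approx\mathrm{let}\,*=[M]_1\,\mathrm{in}\,N$ for $M:{!^m1}<:{!^n1}$. (Bound variables are never captured.) **The category $\mathbf{YAQ}$.** Objects are types; arrows $A\to B$ are the $\approx$-classes of valid judgments $x:A\vdash V:B$ with $V$ a value; the composite of $x:A\vdash V:B$ and $y:B\vdash W:C$ is $x:A\vdash\mathrm{let}\,y=V\,\mathrm{in}\,W:C$; the identity is $x:A\vdash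 x:A$. **Linear categories for duplication.** These are categories $\mathcal C$ with (i) a symmetric monoidal structure $(\otimes,1,\alpha,\lambda,\rho,\sigma)$, $\alpha_{A,B,C}:A\otimes(B\otimes C)\to(A\otimes B)\otimes C$; (ii) a symmetric monoidal comonad $(L,\delta,\varepsilon,d_{A,B},d_1)$ that is idempotent ($\delta$ is invertible) and strong monoidal ($d_{A,B}:LA\otimes LB\to L(A\otimes B)$ and $d_1:1\to L1$ are invertible) and is a linear exponential comonad: each $LA$ is a commutative comonoid $(\triangle_A:LA\to LA\otimes LA,\ \Diamond_A:LA\to1)$ where $\triangle,\Diamond$ are monoidal natural transformations and consist of $L$-coalgebra morphisms, and every $\delta_A$ is a comonoid morphism; (iii) a strong monad $(T,\eta,\mu,t_{A,B}:A\otimes TB\to T(A\otimes B))$; (iv) Kleisli exponentials: a bifunctor $\multimap:\mathcal C^{op}\times\mathcal C\to\mathcal C$ and a natural bijection $\Phi:\mathcal C(A,B\multimap C)\cong\mathcal C(A\otimes B,TC)$. **Theorem.** For every choice of type constants and typed constant terms, $\mathbf{YAQ}$ is a well-defined category and it is a linear category for duplication, with the connectives $\otimes,1,\multimap$ on objects,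 $LA={!A}$, $TA=1\multimap A$, and the following (well-defined) structure, in which omitted annotations of variables are their declared types: - $\alpha_{A,B,C}=x:A\otimes(B\otimes C)\vdash\mathrm{let}\,\langle y,z\rangle=x\,\mathrm{in}\,\mathrm{let}\,\langle t,u\rangle=z\,\mathrm{in}\,\langle\langle y,t\rangle,u\rangle$; - $\lambda_A=x:1\otimes A\vdash\mathrm{let}\,\langle y,z\rangle=x\,\mathrm{in}\,\mathrm{let}\,*=y\,\mathrm{in}\,z$; $\rho_A=x:A\otimes1\vdash\mathrm{let}\,\langle y,z\rangle=x\,\mathrm{in}\,\mathrm{let}\,*=z\,\mathrm{in}\,y$; - $\sigma_{A,B}=x:A\otimes B\vdash\mathrm{let}\,\langle y,z\rangle=x\,\mathrm{in}\,\langle z,y\rangle$; - $\eta_A=x:A\vdash\lambda{*}.x$; $\mu_A=x:T(TA)\vdash\lambda{*}.(x*)*$; $t_{A,B}=z:A\otimes TB\vdash\mathrm{let}\,\langle x,y\rangle=z\,\mathrm{in}\,\lambda{*}.\langle x,y*\rangle$; - $\varepsilon_A=x:{!A}\vdash x^A$; $\delta_A=x:{!A}\vdash x^{!!A}$; $d_{A,B}=z:{!A}\otimes{!B}\vdash\mathrm{let}\,\langle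 x,y\rangle=z\,\mathrm{in}\,\langle x,y\rangle^1$; $d_1=z:1\vdash\mathrm{let}\,*=z\,\mathrm{in}\,*^1$; $\triangle_A=x:{!A}\vdash\langle x,x\rangle$; $\Diamond_A=x:{!A}\vdash *$; - for $V:A\to C$ and $W:B\to D$: $V\otimes W=z:A\otimes B\vdash\mathrm{let}\,\langle x,y\rangle=z\,\mathrm{in}\,\langle V,W\rangle:C\otimes D$; - for $V:A\to B$ and $W:C\to D$: $V\multimap W=z:B\multimap C\vdash\lambda x.\mathrm{let}\,y=zV\,\mathrm{in}\,W:A\multimap D$; - for $V:A\to TB$: $V^*:=TV;\mu_B=y:TA\vdash\lambda{*}.\mathrm{let}\,x=y*\,\mathrm{in}\,V*:TB$; - for $V:A\to B\multimap C$: $\Phi(V)=t:A\otimes B\vdash\lambda{*}.\mathrm{let}\,\langle x,y\rangle=t\,\mathrm{in}\,Vy:TC$; - $L$ sends the class of $x:A\vdash V:B$ to the class of $x:{!A}\vdash V':{!B}$, where $V'$ is the canonical value that differs from $V$ only in its annotations: $(x^A)'=x^{!A}$, $(c^A)'=c^{!A}$, $(*^n)'=*^{n+1}$, $(\lambda^nx^A.M)'=\lambda^{n+1}x^A.M$,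 $(\langle V,W\rangle^n)'=\langle V',W'\rangle^{n+1}$, $(\mathrm{let}\,x^A=V\,\mathrm{in}\,W)'=\mathrm{let}\,x^{!A}=V'\,\mathrm{in}\,W'$, $(\mathrm{let}\,\langle x^A,y^B\rangle^n=V\,\mathrm{in}\,W)'=\mathrm{let}\,\langle x^A,y^B\rangle^{n+1}=V'\,\mathrm{in}\,W'$, $(\mathrm{let}\,*=V\,\mathrm{in}\,W)'=\mathrm{let}\,*=V\,\mathrm{in}\,W'$. -/

import Mathlib

open CategoryTheory MonoidalCategory

namespace LinLam

universe u w

/-! ### Types and subtyping -/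

/-- Types over a set `α` of type constants. -/
inductive Ty (α : Type u) : Type u
  | const (a : α)
  | lolli (A B : Ty α)
  | tensor (A B : Ty α)
  | unit
  | bang (A : Ty α)

namespace Ty
variable {α : Type u}

/-- `bangs n A` is `!…!A` with `n` exclamation marks. -/
def bangs : ℕ → Ty α → Ty α
  | 0, A => A
  | n + 1, A => bang (bangs n A)

/-- The number of leading exclamation marks. -/
def bangCount : Ty α → ℕ
  | bang A => A.bangCount + 1
  | _ => 0

/-- The type without its leading exclamation marks. -/
def core : Ty α → Ty α
  | bang A => A.core
  | A => A

/-- Remove (at most) `n` leading exclamation marks. -/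
def unbang : ℕ → Ty α → Ty α
  | n + 1, bang A => unbang n A
  | _, A => A

/-- Left component of `A ⊸ B` and of `A ⊗ B`; irrelevant elsewhere. -/
def left : Ty α → Ty α
  | lolli A _ => A
  | tensor A _ => A
  | A => A

/-- Right component of `A ⊸ B` and of `A ⊗ B`. -/
def right : Ty α → Ty α
  | lolli _ B => B
  | tensor _ B => B
  | A => A

/-- The subtyping relation `A <: B`. -/
inductive Sub : Ty α → Ty α → Prop
  | const {n m : ℕ} (h : m = 0 ∨ 1 ≤ n) (a : α) : Sub (bangs n (const a)) (bangs m (const a))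
  | unit {n m : ℕ} (h : m = 0 ∨ 1 ≤ n) : Sub (bangs n unit) (bangs m unit)
  | lolli {n m : ℕ} (h : m = 0 ∨ 1 ≤ n) {A A' B B' : Ty α} (hA : Sub A A') (hB : Sub B B') :
      Sub (bangs n (lolli A' B)) (bangs m (lolli A B'))
  | tensor {n m : ℕ} (h : m = 0 ∨ 1 ≤ n) {A A' B B' : Ty α} (hA : Sub A A') (hB : Sub B B') :
      Sub (bangs n (tensor A B)) (bangs m (tensor A' B'))

theorem Sub.refl : ∀ A : Ty α, Sub A A := by
  have key : ∀ (A : Ty α) (n : ℕ), Sub (bangs n A) (bangs n A) := by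
    intro A
    induction A with
    | const a => intro n; exact Sub.const (by omega) a
    | unit => intro n; exact Sub.unit (by omega)
    | lolli A B hA hB => intro n; exact Sub.lolli (by omega) (hA 0) (hB 0)
    | tensor A B hA hB => intro n; exact Sub.tensor (by omega) (hA 0) (hB 0)
    | bang A hA =>
      intro n
      have h : ∀ n : ℕ, bangs n (bang A) = bangs (n + 1) A := by
        intro n
        induction n with
        | zero => rfl
        | succ n ih => simp only [bangs] at ih ⊢; rw [ih]
      rw [h]; exact hA (n + 1)
  exact fun A => key A 0

theorem Sub.bang_of {A B : Ty α} (h : Sub A B) : Sub (bang A) B := by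
  cases h with
  | @const n m h a => exact Sub.const (n := n + 1) (by omega) a
  | @unit n m h => exact Sub.unit (n := n + 1) (by omega)
  | @lolli n m h _ _ _ _ hA hB => exact Sub.lolli (n := n + 1) (by omega) hA hB
  | @tensor n m h _ _ _ _ hA hB => exact Sub.tensor (n := n + 1) (by omega) hA hB

theorem Sub.bang_bang {A B : Ty α} (h : Sub A B) : Sub (bang A) (bang B) := by
  cases h with
  | @const n m h a => exact Sub.const (n := n + 1) (m := m + 1) (by omega) a
  | @unit n m h => exact Sub.unit (n := n + 1) (m := m + 1) (by omega)
  | @lolli n m h _ _ _ _ hA hB => exact Sub.lolli (n := n + 1) (m := m + 1) (by omega) hA hB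
  | @tensor n m h _ _ _ _ hA hB => exact Sub.tensor (n := n + 1) (m := m + 1) (by omega) hA hB

theorem Sub.digging (A : Ty α) : Sub (bang A) (bang (bang A)) := by
  have key : ∀ {A B : Ty α}, Sub A B → Sub (bang A) (bang (bang B)) := by
    intro A B h
    cases h with
    | @const n m h a => exact Sub.const (n := n + 1) (m := m + 2) (by omega) a
    | @unit n m h => exact Sub.unit (n := n + 1) (m := m + 2) (by omega)
    | @lolli n m h _ _ _ _ hA hB => exact Sub.lolli (n := n + 1) (m := m + 2) (by omega) hA hB
    | @tensor n m h _ _ _ _ hA hB => exact Sub.tensor (n := n + 1) (m := m + 2) (by omega) hA hB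
  exact key (Sub.refl A)

end Ty

/-! ### Indexed terms -/

/-- Indexed terms over type constants `α` and constant terms `K`, with de Bruijn indices for the
variables (so that α-equivalent terms are equal). `var i A` is `x^A`, `const c A` is `c^A`,
`star n` is `*^n`, `lam n A M` is `λ^n x^A. M`, `pair n M N` is `⟨M, N⟩^n`, `letPair n A B M N` is
`let ⟨x^A, y^B⟩^n = M in N` where `y` is the variable `0` and `x` the variable `1` of `N`, and
`letUnit M N` is `let * = M in N`. -/
inductive Term (α : Type u) (K : Type w) : Type (max u w)
  | var (i : ℕ) (A : Ty α)
  | const (c : K) (A : Ty α)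
  | star (n : ℕ)
  | lam (n : ℕ) (A : Ty α) (M : Term α K)
  | app (M N : Term α K)
  | pair (n : ℕ) (M N : Term α K)
  | letPair (n : ℕ) (A B : Ty α) (M N : Term α K)
  | letUnit (M N : Term α K)

/-- The map on variables that fixes the `k` innermost variables and acts as `ρ` on the others. -/
def liftVar (k : ℕ) (ρ : ℕ → ℕ) : ℕ → ℕ := fun i => if i < k then i else ρ (i - k) + k

/-- Exchange of the block of the `a` innermost variables with the block of the next `b` ones. -/
def swapVar (a b : ℕ) : ℕ → ℕ := fun i => if i < a then i + b else if i < a + b then i - a else i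

namespace Term
variable {α : Type u} {K : Type w}

/-- Renaming of the free variables. -/
def rename (ρ : ℕ → ℕ) : Term α K → Term α K
  | var i A => var (ρ i) A
  | const c A => const c A
  | star n => star n
  | lam n A M => lam n A (M.rename (liftVar 1 ρ))
  | app M N => app (M.rename ρ) (N.rename ρ)
  | pair n M N => pair n (M.rename ρ) (N.rename ρ)
  | letPair n A B M N => letPair n A B (M.rename ρ) (N.rename (liftVar 2 ρ))
  | letUnit M N => letUnit (M.rename ρ) (N.rename ρ)


/-- The type of a (well-typed) term, which its annotations determine. -/
def tyOf : Term α K → Ty α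
  | var _ A => A
  | const _ A => A
  | star n => Ty.bangs n Ty.unit
  | lam n A M => Ty.bangs n (Ty.lolli A M.tyOf)
  | app M _ => M.tyOf.right
  | pair n M N => Ty.bangs n (Ty.tensor (Ty.unbang n M.tyOf) (Ty.unbang n N.tyOf))
  | letPair _ _ _ _ N => N.tyOf
  | letUnit _ N => N.tyOf

/-- Type casting: if `Δ ⊢ M : A` and `A <: A'` then `M.castTo A'` is the canonical indexation of
the erasure of `M` with `Δ ⊢ M.castTo A' : A'`. The same term is also typed by every context
`Δ' <: Δ`, because an occurrence of a variable is annotated with the type at which it is used. -/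
def castTo : Term α K → Ty α → Term α K
  | var i _, A' => var i A'
  | const c _, A' => const c A'
  | star _, A' => star A'.bangCount
  | lam _ _ M, A' => lam A'.bangCount A'.core.left (M.castTo A'.core.right)
  | app M N, A' => app (M.castTo (Ty.lolli M.tyOf.left A')) N
  | pair _ M N, A' =>
      pair A'.bangCount (M.castTo (Ty.bangs A'.bangCount A'.core.left))
        (N.castTo (Ty.bangs A'.bangCount A'.core.right))
  | letPair n A B M N, A' => letPair n A B M (N.castTo A')
  | letUnit M N, A' => letUnit M (N.castTo A')

/-- Simultaneous capture-avoiding substitution; `σ i A` replaces the occurrences `x^A` of the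
variable `x` with index `i`. -/
def subst (σ : ℕ → Ty α → Term α K) : Term α K → Term α K
  | var i A => σ i A
  | const c A => const c A
  | star n => star n
  | lam n A M => lam n A (M.subst (liftSubst 1 σ))
  | app M N => app (M.subst σ) (N.subst σ)
  | pair n M N => pair n (M.subst σ) (N.subst σ)
  | letPair n A B M N => letPair n A B (M.subst σ) (N.subst (liftSubst 2 σ))
  | letUnit M N => letUnit (M.subst σ) (N.subst σ)
where
  /-- The substitution below `k` binders. -/
  liftSubst (k : ℕ) (σ : ℕ → Ty α → Term α K) : ℕ → Ty α → Term α K :=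
    fun i A => if i < k then var i A else (σ (i - k) A).rename (fun j => j + k)

/-- `M[V/x]` for `x` the variable `0` of `M`: every occurrence `x^A` is replaced by `V`, cast to
the type `A`. -/
def subst₁ (V M : Term α K) : Term α K :=
  M.subst fun i A => match i with
    | 0 => V.castTo A
    | i + 1 => var i A

/-- `M[V/x, W/y]` for `y` the variable `0` and `x` the variable `1` of `M`. -/
def subst₂ (V W M : Term α K) : Term α K :=
  M.subst fun i A => match i with
    | 0 => W.castTo A
    | 1 => V.castTo A
    | i + 2 => var i A

/-- Values. The clause `letVar` is `let x^A = V in W`, that is `(λ^0 x^A. W) V`. -/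
inductive Value : Term α K → Prop
  | var (i : ℕ) (A : Ty α) : Value (var i A)
  | const (c : K) (A : Ty α) : Value (const c A)
  | star (n : ℕ) : Value (star n)
  | lam (n : ℕ) (A : Ty α) (M : Term α K) : Value (lam n A M)
  | pair (n : ℕ) {V W : Term α K} (hV : Value V) (hW : Value W) : Value (pair n V W)
  | letVar (A : Ty α) {V W : Term α K} (hV : Value V) (hW : Value W) : Value (app (lam 0 A W) V)
  | letPair (n : ℕ) (A B : Ty α) {V W : Term α K} (hV : Value V) (hW : Value W) :
      Value (letPair n A B V W)
  | letUnit {V W : Term α K} (hV : Value V) (hW : Value W) : Value (letUnit V W)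

/-- The canonical indexation with `!Δ ⊢ V.promote : !A` of the erasure of a value `V` such that
`Δ ⊢ V : A`. On terms that are not values it is irrelevant. -/
def promote : Term α K → Term α K
  | var i A => var i (Ty.bang A)
  | const c A => const c (Ty.bang A)
  | star n => star (n + 1)
  | lam n A M => lam (n + 1) A M
  | pair n V W => pair (n + 1) V.promote W.promote
  | app (lam _ A W) V => app (lam 0 (Ty.bang A) W.promote) V.promote
  | letPair n A B V W => letPair (n + 1) A B V.promote W.promote
  | letUnit V W => letUnit V W.promote
  | app M N => app M N

/-- `λ*. M`, that is `λ^0 u^1. let * = u in M` with `u` fresh. -/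
def thunk (M : Term α K) : Term α K :=
  lam 0 Ty.unit (letUnit (var 0 Ty.unit) (M.rename (fun i => i + 1)))

end Term

/-! ### Typing -/

/-- Typing contexts, as partial maps from variables to types. -/
def Ctx (α : Type u) : Type u := ℕ → Option (Ty α)

namespace Ctx
variable {α : Type u}

/-- The empty context. -/
def empty : Ctx α := fun _ => none

/-- Extension by a new innermost variable, of type `A` for `some A`, undeclared for `none`. -/
def cons (o : Option (Ty α)) (Γ : Ctx α) : Ctx α
  | 0 => o
  | i + 1 => Γ i

/-- The context with the single variable `0`, of type `A`. -/
def single (A : Ty α) : Ctx α := cons (some A) empty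

/-- All variables of the context have a type of the form `!A`. -/
def IsBang (Γ : Ctx α) : Prop := ∀ i A, Γ i = some A → ∃ B, A = Ty.bang B

/-- `Γ = (!Δ, Γ₁', Γ₂')`, `Γ₁ = (!Δ, Γ₁')` and `Γ₂ = (!Δ, Γ₂')` for some disjoint contexts
`!Δ`, `Γ₁'` and `Γ₂'`. -/
def Split (Γ Γ₁ Γ₂ : Ctx α) : Prop :=
  ∀ i, (Γ₁ i = Γ i ∧ Γ₂ i = none) ∨ (Γ₁ i = none ∧ Γ₂ i = Γ i) ∨
    (Γ₁ i = Γ i ∧ Γ₂ i = Γ i ∧ ∃ A, Γ i = some (Ty.bang A))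

end Ctx

section Typing
variable {α : Type u} {K : Type w}

/-- Valid typing judgments `Γ ⊢ M : A`. The constant term `c` has been assigned the type
`!(cty c)`. -/
inductive Typed (cty : K → Ty α) : Ctx α → Term α K → Ty α → Prop
  | var {Γ : Ctx α} {i : ℕ} {A B : Ty α} (hi : Γ i = some A)
      (hΓ : ∀ j C, j ≠ i → Γ j = some C → ∃ D, C = Ty.bang D) (h : Ty.Sub A B) :
      Typed cty Γ (Term.var i B) B
  | const {Γ : Ctx α} {c : K} {B : Ty α} (hΓ : Γ.IsBang) (h : Ty.Sub (Ty.bang (cty c)) B) :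
      Typed cty Γ (Term.const c B) B
  | star {Γ : Ctx α} (hΓ : Γ.IsBang) (n : ℕ) :
      Typed cty Γ (Term.star n) (Ty.bangs n Ty.unit)
  | lam {Γ : Ctx α} {A B : Ty α} {M : Term α K} (hM : Typed cty (Γ.cons (some A)) M B) :
      Typed cty Γ (Term.lam 0 A M) (Ty.lolli A B)
  | lamBang {Γ : Ctx α} (hΓ : Γ.IsBang) (n : ℕ) {A B : Ty α} {M : Term α K}
      (hM : Typed cty (Γ.cons (some A)) M B) :
      Typed cty Γ (Term.lam (n + 1) A M) (Ty.bangs (n + 1) (Ty.lolli A B))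
  | app {Γ Γ₁ Γ₂ : Ctx α} (hΓ : Γ.Split Γ₁ Γ₂) {A B : Ty α} {M N : Term α K}
      (hM : Typed cty Γ₁ M (Ty.lolli A B)) (hN : Typed cty Γ₂ N A) :
      Typed cty Γ (Term.app M N) B
  | pair {Γ Γ₁ Γ₂ : Ctx α} (hΓ : Γ.Split Γ₁ Γ₂) (n : ℕ) {A B : Ty α} {M N : Term α K}
      (hM : Typed cty Γ₁ M (Ty.bangs n A)) (hN : Typed cty Γ₂ N (Ty.bangs n B)) :
      Typed cty Γ (Term.pair n M N) (Ty.bangs n (Ty.tensor A B))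
  | letPair {Γ Γ₁ Γ₂ : Ctx α} (hΓ : Γ.Split Γ₁ Γ₂) {n : ℕ} {A B C : Ty α} {M N : Term α K}
      (hM : Typed cty Γ₁ M (Ty.bangs n (Ty.tensor A B)))
      (hN : Typed cty ((Γ₂.cons (some (Ty.bangs n A))).cons (some (Ty.bangs n B))) N C) :
      Typed cty Γ (Term.letPair n A B M N) C
  | letUnit {Γ Γ₁ Γ₂ : Ctx α} (hΓ : Γ.Split Γ₁ Γ₂) {C : Ty α} {M N : Term α K}
      (hM : Typed cty Γ₁ M Ty.unit) (hN : Typed cty Γ₂ N C) :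
      Typed cty Γ (Term.letUnit M N) C

end Typing

/-! ### Axiomatic equivalence -/

/-- The place holder `-` of a binding `let - = M in N`: one of `x^A`, `*` and `⟨x^A, y^B⟩^n`. -/
inductive Pat (α : Type u) : Type u
  | var (A : Ty α)
  | unit
  | pair (n : ℕ) (A B : Ty α)

namespace Pat
variable {α : Type u} {K : Type w}

/-- The number of variables that are bound. -/
def size : Pat α → ℕ
  | var _ => 1
  | unit => 0
  | pair _ _ _ => 2

/-- `let p = M in N`. -/
def bind : Pat α → Term α K → Term α K → Term α K
  | var A, M, N => Term.app (Term.lam 0 A N) M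
  | unit, M, N => Term.letUnit M N
  | pair n A B, M, N => Term.letPair n A B M N

end Pat

section Equivalence
variable {α : Type u} {K : Type w}

open Term in
/-- Axiomatic equivalence `Γ ⊢ M ≈ N : A`: the reflexive, symmetric, transitive and congruence
closure of the axioms, restricted to pairs of valid typing judgments. -/
inductive AxEq (cty : K → Ty α) : Ctx α → Term α K → Term α K → Ty α → Prop
  | refl {Γ : Ctx α} {M : Term α K} {A : Ty α} (h : Typed cty Γ M A) : AxEq cty Γ M M A
  | symm {Γ : Ctx α} {M N : Term α K} {A : Ty α} (h : AxEq cty Γ M N A) : AxEq cty Γ N M A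
  | trans {Γ : Ctx α} {M N P : Term α K} {A : Ty α} (h : AxEq cty Γ M N A)
      (h' : AxEq cty Γ N P A) : AxEq cty Γ M P A
  -- congruence
  | lam {Γ : Ctx α} {A B : Ty α} {M M' : Term α K}
      (hM : AxEq cty (Γ.cons (some A)) M M' B) :
      AxEq cty Γ (lam 0 A M) (lam 0 A M') (Ty.lolli A B)
  | lamBang {Γ : Ctx α} (hΓ : Γ.IsBang) (n : ℕ) {A B : Ty α} {M M' : Term α K}
      (hM : AxEq cty (Γ.cons (some A)) M M' B) :
      AxEq cty Γ (lam (n + 1) A M) (lam (n + 1) A M') (Ty.bangs (n + 1) (Ty.lolli A B))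
  | app {Γ Γ₁ Γ₂ : Ctx α} (hΓ : Γ.Split Γ₁ Γ₂) {A B : Ty α} {M M' N N' : Term α K}
      (hM : AxEq cty Γ₁ M M' (Ty.lolli A B)) (hN : AxEq cty Γ₂ N N' A) :
      AxEq cty Γ (app M N) (app M' N') B
  | pair {Γ Γ₁ Γ₂ : Ctx α} (hΓ : Γ.Split Γ₁ Γ₂) (n : ℕ) {A B : Ty α} {M M' N N' : Term α K}
      (hM : AxEq cty Γ₁ M M' (Ty.bangs n A)) (hN : AxEq cty Γ₂ N N' (Ty.bangs n B)) :
      AxEq cty Γ (pair n M N) (pair n M' N') (Ty.bangs n (Ty.tensor A B))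
  | letPair {Γ Γ₁ Γ₂ : Ctx α} (hΓ : Γ.Split Γ₁ Γ₂) {n : ℕ} {A B C : Ty α}
      {M M' N N' : Term α K} (hM : AxEq cty Γ₁ M M' (Ty.bangs n (Ty.tensor A B)))
      (hN : AxEq cty ((Γ₂.cons (some (Ty.bangs n A))).cons (some (Ty.bangs n B))) N N' C) :
      AxEq cty Γ (letPair n A B M N) (letPair n A B M' N') C
  | letUnit {Γ Γ₁ Γ₂ : Ctx α} (hΓ : Γ.Split Γ₁ Γ₂) {C : Ty α} {M M' N N' : Term α K}
      (hM : AxEq cty Γ₁ M M' Ty.unit) (hN : AxEq cty Γ₂ N N' C) :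
      AxEq cty Γ (letUnit M N) (letUnit M' N') C
  -- `let x = V in M ≈ M[V/x]`
  | betaLam {Γ : Ctx α} {A B : Ty α} {V M : Term α K} (hV : V.Value)
      (hl : Typed cty Γ ((Pat.var A).bind V M) B) (hr : Typed cty Γ (subst₁ V M) B) :
      AxEq cty Γ ((Pat.var A).bind V M) (subst₁ V M) B
  -- `let ⟨x, y⟩^n = ⟨V, W⟩^n in M ≈ M[V/x, W/y]`
  | betaPair {Γ : Ctx α} {n : ℕ} {A B C : Ty α} {V W M : Term α K} (hV : V.Value)
      (hW : W.Value) (hl : Typed cty Γ (letPair n A B (pair n V W) M) C)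
      (hr : Typed cty Γ (subst₂ V W M) C) :
      AxEq cty Γ (letPair n A B (pair n V W) M) (subst₂ V W M) C
  -- `let * = * in M ≈ M`
  | betaUnit {Γ : Ctx α} {C : Ty α} {M : Term α K}
      (hl : Typed cty Γ (letUnit (star 0) M) C) (hr : Typed cty Γ M C) :
      AxEq cty Γ (letUnit (star 0) M) M C
  -- `λ^n x^A. V x^A ≈ V` with `V` cast from `!^n (A ⊸ B)` to `A ⊸ B` on the left
  | etaLam {Γ : Ctx α} {n : ℕ} {A B : Ty α} {V : Term α K} (hV : V.Value)
      (hl : Typed cty Γ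
        (lam n A (app ((V.castTo (Ty.lolli A B)).rename (fun i => i + 1)) (var 0 A)))
        (Ty.bangs n (Ty.lolli A B)))
      (hr : Typed cty Γ V (Ty.bangs n (Ty.lolli A B))) :
      AxEq cty Γ
        (lam n A (app ((V.castTo (Ty.lolli A B)).rename (fun i => i + 1)) (var 0 A))) V
        (Ty.bangs n (Ty.lolli A B))
  -- `let x^A = N in x^A ≈ N`
  | etaLet {Γ : Ctx α} {A : Ty α} {N : Term α K}
      (hl : Typed cty Γ ((Pat.var A).bind N (var 0 A)) A) (hr : Typed cty Γ N A) :
      AxEq cty Γ ((Pat.var A).bind N (var 0 A)) N A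
  -- `let ⟨x^A, y^B⟩^n = N in ⟨x, y⟩^n ≈ N`
  | etaPair {Γ : Ctx α} {n : ℕ} {A B : Ty α} {N : Term α K}
      (hl : Typed cty Γ
        (letPair n A B N (pair n (var 1 (Ty.bangs n A)) (var 0 (Ty.bangs n B))))
        (Ty.bangs n (Ty.tensor A B)))
      (hr : Typed cty Γ N (Ty.bangs n (Ty.tensor A B))) :
      AxEq cty Γ (letPair n A B N (pair n (var 1 (Ty.bangs n A)) (var 0 (Ty.bangs n B)))) N
        (Ty.bangs n (Ty.tensor A B))
  -- `let * = N in *^n ≈ N` for `N : !^n 1`, cast to the type `1` on the left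
  | etaUnit {Γ : Ctx α} {n : ℕ} {N : Term α K}
      (hl : Typed cty Γ (letUnit (N.castTo Ty.unit) (star n)) (Ty.bangs n Ty.unit))
      (hr : Typed cty Γ N (Ty.bangs n Ty.unit)) :
      AxEq cty Γ (letUnit (N.castTo Ty.unit) (star n)) N (Ty.bangs n Ty.unit)
  -- `let p = (let q = M in N) in P ≈ let q = M in let p = N in P`
  | letAssoc {Γ : Ctx α} (p q : Pat α) {C : Ty α} {M N P : Term α K}
      (hl : Typed cty Γ (p.bind (q.bind M N) P) C)
      (hr : Typed cty Γ
        (q.bind M (p.bind N (P.rename (liftVar p.size fun i => i + q.size)))) C) :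
      AxEq cty Γ (p.bind (q.bind M N) P)
        (q.bind M (p.bind N (P.rename (liftVar p.size fun i => i + q.size)))) C
  -- `let p = V in let q = W in M ≈ let q = W in let p = V in M`
  | letSwap {Γ : Ctx α} (p q : Pat α) {C : Ty α} {V W M : Term α K} (hV : V.Value)
      (hW : W.Value)
      (hl : Typed cty Γ (p.bind V (q.bind (W.rename fun i => i + p.size) M)) C)
      (hr : Typed cty Γ (q.bind W
        (p.bind (V.rename fun i => i + q.size) (M.rename (swapVar q.size p.size)))) C) :
      AxEq cty Γ (p.bind V (q.bind (W.rename fun i => i + p.size) M))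
        (q.bind W (p.bind (V.rename fun i => i + q.size) (M.rename (swapVar q.size p.size)))) C
  -- `let x^(A ⊸ B) = M in let y^A = N in x y ≈ M N`
  | letApp {Γ : Ctx α} {A B : Ty α} {M N : Term α K}
      (hl : Typed cty Γ ((Pat.var (Ty.lolli A B)).bind M
        ((Pat.var A).bind (N.rename fun i => i + 1)
          (app (var 1 (Ty.lolli A B)) (var 0 A)))) B)
      (hr : Typed cty Γ (app M N) B) :
      AxEq cty Γ ((Pat.var (Ty.lolli A B)).bind M
        ((Pat.var A).bind (N.rename fun i => i + 1)
          (app (var 1 (Ty.lolli A B)) (var 0 A)))) (app M N) B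
  -- `let x^D = V in λ^n y^A. M ≈ λ^n y^A. let x^D = V in M`
  | letLam {Γ : Ctx α} {n : ℕ} {D A C : Ty α} {V M : Term α K} (hV : V.Value)
      (hl : Typed cty Γ ((Pat.var D).bind V (lam n A M)) C)
      (hr : Typed cty Γ
        (lam n A ((Pat.var D).bind (V.rename fun i => i + 1) (M.rename (swapVar 1 1)))) C) :
      AxEq cty Γ ((Pat.var D).bind V (lam n A M))
        (lam n A ((Pat.var D).bind (V.rename fun i => i + 1) (M.rename (swapVar 1 1)))) C
  -- `let x^A = M in let y^B = N in ⟨x^A, y^B⟩^n ≈ ⟨M, N⟩^n`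
  | letTensor {Γ : Ctx α} {n : ℕ} {A B C : Ty α} {M N : Term α K}
      (hl : Typed cty Γ ((Pat.var A).bind M
        ((Pat.var B).bind (N.rename fun i => i + 1) (pair n (var 1 A) (var 0 B)))) C)
      (hr : Typed cty Γ (pair n M N) C) :
      AxEq cty Γ ((Pat.var A).bind M
        ((Pat.var B).bind (N.rename fun i => i + 1) (pair n (var 1 A) (var 0 B))))
        (pair n M N) C
  -- casts in an application
  | castApp {Γ Γ₁ Γ₂ : Ctx α} (hΓ : Γ.Split Γ₁ Γ₂) {n : ℕ} {A B C D D' : Ty α}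
      {M N : Term α K} (hM : Typed cty Γ₁ M (Ty.bangs n (Ty.lolli A D)))
      (hN : Typed cty Γ₂ N C)
      (hs : Ty.Sub (Ty.bangs n (Ty.lolli A D)) (Ty.lolli B D')) (hs' : Ty.Sub C B)
      (hl : Typed cty Γ (app (M.castTo (Ty.lolli B D')) (N.castTo B)) D')
      (hr : Typed cty Γ ((app (M.castTo (Ty.lolli A D)) (N.castTo A)).castTo D') D') :
      AxEq cty Γ (app (M.castTo (Ty.lolli B D')) (N.castTo B))
        ((app (M.castTo (Ty.lolli A D)) (N.castTo A)).castTo D') D'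
  -- a cast in `let ⟨x, y⟩ = M in N`
  | castPair {Γ Γ₁ : Ctx α} {n n' : ℕ} {A A' B B' C : Ty α} {M N : Term α K}
      (hM : Typed cty Γ₁ M (Ty.bangs n (Ty.tensor A B)))
      (hs : Ty.Sub (Ty.bangs n (Ty.tensor A B)) (Ty.bangs n' (Ty.tensor A' B')))
      (hl : Typed cty Γ
        (letPair n' A' B' (M.castTo (Ty.bangs n' (Ty.tensor A' B'))) N) C)
      (hr : Typed cty Γ (letPair n A B M N) C) :
      AxEq cty Γ (letPair n' A' B' (M.castTo (Ty.bangs n' (Ty.tensor A' B'))) N)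
        (letPair n A B M N) C
  -- a cast in `let x = M in N`
  | castLet {Γ : Ctx α} {A A' C : Ty α} {M N : Term α K} (hs : Ty.Sub A A')
      (hl : Typed cty Γ ((Pat.var A').bind (M.castTo A') N) C)
      (hr : Typed cty Γ ((Pat.var A).bind M N) C) :
      AxEq cty Γ ((Pat.var A').bind (M.castTo A') N) ((Pat.var A).bind M N) C
  -- a cast in `let * = M in N`, for `M : !^m 1`
  | castUnit {Γ Γ₁ : Ctx α} {m n : ℕ} {C : Ty α} {M N : Term α K}
      (hM : Typed cty Γ₁ M (Ty.bangs m Ty.unit))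
      (hs : Ty.Sub (α := α) (Ty.bangs m Ty.unit) (Ty.bangs n Ty.unit))
      (hl : Typed cty Γ (letUnit ((M.castTo (Ty.bangs n Ty.unit)).castTo Ty.unit) N) C)
      (hr : Typed cty Γ (letUnit (M.castTo Ty.unit) N) C) :
      AxEq cty Γ (letUnit ((M.castTo (Ty.bangs n Ty.unit)).castTo Ty.unit) N)
        (letUnit (M.castTo Ty.unit) N) C

end Equivalence

/-! ### Renaming -/

section Renaming
variable {α : Type u} {K : Type w}

theorem liftVar_comp (k : ℕ) (ρ ρ' : ℕ → ℕ) (i : ℕ) :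
    liftVar k ρ (liftVar k ρ' i) = liftVar k (fun j => ρ (ρ' j)) i := by
  unfold liftVar
  by_cases h : i < k
  · simp [h]
  · simp [h]

theorem liftVar_injective (k : ℕ) {ρ : ℕ → ℕ} (h : Function.Injective ρ) :
    Function.Injective (liftVar k ρ) := by
  intro i j hij
  unfold liftVar at hij
  split_ifs at hij with h1 h2 h2
  · exact hij
  · omega
  · omega
  · have := @h (i - k) (j - k) (by omega)
    omega

namespace Term

theorem rename_rename (M : Term α K) : ∀ (ρ ρ' : ℕ → ℕ),
    (M.rename ρ').rename ρ = M.rename (fun i => ρ (ρ' i)) := by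
  induction M with
  | var i A => intros; rfl
  | const c A => intros; rfl
  | star n => intros; rfl
  | lam n A M ih => intro ρ ρ'; simp only [rename, ih]; congr 2; funext i; exact liftVar_comp _ _ _ _
  | app M N ihM ihN => intro ρ ρ'; simp only [rename, ihM, ihN]
  | pair n M N ihM ihN => intro ρ ρ'; simp only [rename, ihM, ihN]
  | letPair n A B M N ihM ihN =>
    intro ρ ρ'; simp only [rename, ihM, ihN]; congr 2; funext i; exact liftVar_comp _ _ _ _
  | letUnit M N ihM ihN => intro ρ ρ'; simp only [rename, ihM, ihN]

theorem tyOf_rename (M : Term α K) : ∀ ρ : ℕ → ℕ, (M.rename ρ).tyOf = M.tyOf := by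
  induction M <;> intro ρ <;> simp_all [rename, tyOf]

theorem castTo_rename (M : Term α K) : ∀ (ρ : ℕ → ℕ) (A : Ty α),
    (M.rename ρ).castTo A = (M.castTo A).rename ρ := by
  induction M <;> intro ρ A <;> simp_all [rename, castTo, tyOf_rename]

theorem Value.rename {V : Term α K} (hV : V.Value) : ∀ ρ : ℕ → ℕ, (V.rename ρ).Value := by
  induction hV <;> intro ρ <;> simp only [Term.rename] <;> constructor <;> simp_all

theorem rename_subst (M : Term α K) : ∀ (ρ : ℕ → ℕ) (σ : ℕ → Ty α → Term α K),
    (M.subst σ).rename ρ = M.subst fun i A => (σ i A).rename ρ := by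
  have key : ∀ (k : ℕ) (ρ : ℕ → ℕ) (σ : ℕ → Ty α → Term α K),
      (fun i A => (subst.liftSubst k σ i A).rename (liftVar k ρ)) =
        subst.liftSubst k fun i A => (σ i A).rename ρ := by
    intro k ρ σ
    funext i A
    by_cases h : i < k
    · simp [subst.liftSubst, h, Term.rename, liftVar]
    · simp only [subst.liftSubst, h, if_false, rename_rename]
      congr 1
      funext j
      simp [liftVar]
  induction M with
  | var i A => intros; rfl
  | const c A => intros; rfl
  | star n => intros; rfl
  | lam n A M ih => intro ρ σ; simp only [Term.rename, subst, ih, key]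
  | app M N ihM ihN => intro ρ σ; simp only [Term.rename, subst, ihM, ihN]
  | pair n M N ihM ihN => intro ρ σ; simp only [Term.rename, subst, ihM, ihN]
  | letPair n A B M N ihM ihN => intro ρ σ; simp only [Term.rename, subst, ihM, ihN, key]
  | letUnit M N ihM ihN => intro ρ σ; simp only [Term.rename, subst, ihM, ihN]

theorem subst_rename (M : Term α K) : ∀ (ρ : ℕ → ℕ) (σ : ℕ → Ty α → Term α K),
    (M.rename ρ).subst σ = M.subst fun i A => σ (ρ i) A := by
  have key : ∀ (k : ℕ) (ρ : ℕ → ℕ) (σ : ℕ → Ty α → Term α K),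
      (fun i A => subst.liftSubst k σ (liftVar k ρ i) A) =
        subst.liftSubst k fun i A => σ (ρ i) A := by
    intro k ρ σ
    funext i A
    by_cases h : i < k
    · simp [subst.liftSubst, h, liftVar]
    · simp [subst.liftSubst, h, liftVar]
  induction M with
  | var i A => intros; rfl
  | const c A => intros; rfl
  | star n => intros; rfl
  | lam n A M ih => intro ρ σ; simp only [Term.rename, subst, ih, key]
  | app M N ihM ihN => intro ρ σ; simp only [Term.rename, subst, ihM, ihN]
  | pair n M N ihM ihN => intro ρ σ; simp only [Term.rename, subst, ihM, ihN]
  | letPair n A B M N ihM ihN => intro ρ σ; simp only [Term.rename, subst, ihM, ihN, key]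
  | letUnit M N ihM ihN => intro ρ σ; simp only [Term.rename, subst, ihM, ihN]

theorem subst₁_rename (ρ : ℕ → ℕ) (V M : Term α K) :
    (subst₁ V M).rename ρ = subst₁ (V.rename ρ) (M.rename (liftVar 1 ρ)) := by
  simp only [subst₁, rename_subst, subst_rename]
  congr 1
  funext i A
  rcases i with _ | i
  · simp [liftVar, castTo_rename]
  · simp [liftVar, Term.rename]

theorem subst₂_rename (ρ : ℕ → ℕ) (V W M : Term α K) :
    (subst₂ V W M).rename ρ = subst₂ (V.rename ρ) (W.rename ρ) (M.rename (liftVar 2 ρ)) := by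
  simp only [subst₂, rename_subst, subst_rename]
  congr 1
  funext i A
  rcases i with _ | _ | i
  · simp [liftVar, castTo_rename]
  · simp [liftVar, castTo_rename]
  · simp [liftVar, Term.rename]

end Term

theorem Pat.bind_rename (p : Pat α) (ρ : ℕ → ℕ) (M N : Term α K) :
    (p.bind M N).rename ρ = p.bind (M.rename ρ) (N.rename (liftVar p.size ρ)) := by
  cases p with
  | unit =>
    simp only [Pat.bind, Term.rename, Pat.size]
    congr 2
  | _ => rfl

/-- The image of a context under an injective renaming. -/
noncomputable def Ctx.map (ρ : ℕ → ℕ) (Γ : Ctx α) : Ctx α := Function.extend ρ Γ fun _ => none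

theorem Ctx.map_apply {ρ : ℕ → ℕ} (hρ : Function.Injective ρ) (Γ : Ctx α) (i : ℕ) :
    Γ.map ρ (ρ i) = Γ i := hρ.extend_apply _ _ _

theorem Ctx.map_of_not_mem {ρ : ℕ → ℕ} (Γ : Ctx α) {j : ℕ} (h : ¬ ∃ i, ρ i = j) :
    Γ.map ρ j = none := Function.extend_apply' _ _ _ h

theorem Ctx.map_cons {ρ : ℕ → ℕ} (hρ : Function.Injective ρ) (Γ : Ctx α) (o : Option (Ty α)) :
    (Γ.cons o).map (liftVar 1 ρ) = (Γ.map ρ).cons o := by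
  have hρ' := liftVar_injective 1 hρ
  funext j
  rcases j with _ | j
  · exact Ctx.map_apply hρ' (Γ.cons o) 0
  · by_cases h : ∃ i, ρ i = j
    · obtain ⟨i, rfl⟩ := h
      have := Ctx.map_apply hρ' (Γ.cons o) (i + 1)
      simp only [liftVar, Nat.add_sub_cancel, Nat.add_lt_iff_lt_sub_right] at this
      exact this.trans (Ctx.map_apply hρ Γ i).symm
    · have h' : ¬ ∃ i, liftVar 1 ρ i = j + 1 := by
        rintro ⟨i, hi⟩
        rcases i with _ | i
        · simp [liftVar] at hi
        · exact h ⟨i, by simpa [liftVar] using hi⟩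
      exact (Ctx.map_of_not_mem _ h').trans (Ctx.map_of_not_mem Γ h).symm

theorem liftVar_two (ρ : ℕ → ℕ) : liftVar 2 ρ = liftVar 1 (liftVar 1 ρ) := by
  funext i
  rcases i with _ | _ | i <;> simp [liftVar]

theorem Ctx.map_cons₂ {ρ : ℕ → ℕ} (hρ : Function.Injective ρ) (Γ : Ctx α)
    (o o' : Option (Ty α)) :
    ((Γ.cons o).cons o').map (liftVar 2 ρ) = ((Γ.map ρ).cons o).cons o' := by
  rw [liftVar_two, Ctx.map_cons (liftVar_injective 1 hρ), Ctx.map_cons hρ]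

theorem Ctx.IsBang.map {ρ : ℕ → ℕ} (hρ : Function.Injective ρ) {Γ : Ctx α} (h : Γ.IsBang) :
    (Γ.map ρ).IsBang := by
  intro j A hj
  by_cases hi : ∃ i, ρ i = j
  · obtain ⟨i, rfl⟩ := hi
    rw [Ctx.map_apply hρ] at hj
    exact h i A hj
  · rw [Ctx.map_of_not_mem Γ hi] at hj
    exact absurd hj (by simp)

theorem Ctx.Split.map {ρ : ℕ → ℕ} (hρ : Function.Injective ρ) {Γ Γ₁ Γ₂ : Ctx α}
    (h : Γ.Split Γ₁ Γ₂) : (Γ.map ρ).Split (Γ₁.map ρ) (Γ₂.map ρ) := by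
  intro j
  by_cases hi : ∃ i, ρ i = j
  · obtain ⟨i, rfl⟩ := hi
    simp only [Ctx.map_apply hρ]
    exact h i
  · simp only [Ctx.map_of_not_mem _ hi]
    simp

theorem Typed.rename {cty : K → Ty α} {Γ : Ctx α} {M : Term α K} {A : Ty α}
    (h : Typed cty Γ M A) : ∀ {ρ : ℕ → ℕ}, Function.Injective ρ →
      Typed cty (Γ.map ρ) (M.rename ρ) A := by
  induction h with
  | @var Γ i A B hi hΓ h =>
    intro ρ hρ
    refine Typed.var (A := A) ((Ctx.map_apply hρ Γ i).trans hi) ?_ h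
    intro j C hj hC
    by_cases hk : ∃ k, ρ k = j
    · obtain ⟨k, rfl⟩ := hk
      rw [Ctx.map_apply hρ] at hC
      exact hΓ k C (fun e => hj (by rw [e])) hC
    · rw [Ctx.map_of_not_mem Γ hk] at hC
      exact absurd hC (by simp)
  | const hΓ h => intro ρ hρ; exact Typed.const (hΓ.map hρ) h
  | star hΓ n => intro ρ hρ; exact Typed.star (hΓ.map hρ) n
  | lam hM ih =>
    intro ρ hρ
    exact Typed.lam (by rw [← Ctx.map_cons hρ]; exact ih (liftVar_injective 1 hρ))
  | lamBang hΓ n hM ih =>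
    intro ρ hρ
    exact Typed.lamBang (hΓ.map hρ) n
      (by rw [← Ctx.map_cons hρ]; exact ih (liftVar_injective 1 hρ))
  | app hΓ hM hN ihM ihN => intro ρ hρ; exact Typed.app (hΓ.map hρ) (ihM hρ) (ihN hρ)
  | pair hΓ n hM hN ihM ihN => intro ρ hρ; exact Typed.pair (hΓ.map hρ) n (ihM hρ) (ihN hρ)
  | letPair hΓ hM hN ihM ihN =>
    intro ρ hρ
    exact Typed.letPair (hΓ.map hρ) (ihM hρ)
      (by rw [← Ctx.map_cons₂ hρ]; exact ihN (liftVar_injective 2 hρ))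
  | letUnit hΓ hM hN ihM ihN => intro ρ hρ; exact Typed.letUnit (hΓ.map hρ) (ihM hρ) (ihN hρ)

theorem AxEq.typed {cty : K → Ty α} {Γ : Ctx α} {M N : Term α K} {A : Ty α}
    (h : AxEq cty Γ M N A) : Typed cty Γ M A ∧ Typed cty Γ N A := by
  induction h with
  | refl h => exact ⟨h, h⟩
  | symm _ ih => exact ⟨ih.2, ih.1⟩
  | trans _ _ ih ih' => exact ⟨ih.1, ih'.2⟩
  | lam _ ih => exact ⟨.lam ih.1, .lam ih.2⟩
  | lamBang hΓ n _ ih => exact ⟨.lamBang hΓ n ih.1, .lamBang hΓ n ih.2⟩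
  | app hΓ _ _ ihM ihN => exact ⟨.app hΓ ihM.1 ihN.1, .app hΓ ihM.2 ihN.2⟩
  | pair hΓ n _ _ ihM ihN => exact ⟨.pair hΓ n ihM.1 ihN.1, .pair hΓ n ihM.2 ihN.2⟩
  | letPair hΓ _ _ ihM ihN => exact ⟨.letPair hΓ ihM.1 ihN.1, .letPair hΓ ihM.2 ihN.2⟩
  | letUnit hΓ _ _ ihM ihN => exact ⟨.letUnit hΓ ihM.1 ihN.1, .letUnit hΓ ihM.2 ihN.2⟩
  | _ => exact ⟨by assumption, by assumption⟩

theorem rename_shift (M : Term α K) (ρ : ℕ → ℕ) (k : ℕ) :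
    (M.rename fun i => i + k).rename (liftVar k ρ) = (M.rename ρ).rename fun i => i + k := by
  simp only [Term.rename_rename]
  congr 1
  funext i
  simp [liftVar]

theorem rename_skip (M : Term α K) (ρ : ℕ → ℕ) (k l : ℕ) :
    (M.rename (liftVar k fun i => i + l)).rename (liftVar k (liftVar l ρ)) =
      (M.rename (liftVar k ρ)).rename (liftVar k fun i => i + l) := by
  simp only [Term.rename_rename]
  congr 1
  funext i
  simp only [liftVar_comp]
  congr 1
  funext j
  simp [liftVar]

theorem rename_swap (M : Term α K) (ρ : ℕ → ℕ) (k l : ℕ) :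
    (M.rename (swapVar l k)).rename (liftVar k (liftVar l ρ)) =
      (M.rename (liftVar l (liftVar k ρ))).rename (swapVar l k) := by
  simp only [Term.rename_rename]
  congr 1
  funext i
  rcases lt_or_ge i l with h | h
  · simp [liftVar, swapVar, h]
  · rcases lt_or_ge i (l + k) with h' | h'
    · have h1 : i - l < k := by omega
      have h2 : ¬ i < l := by omega
      have h3 : i - l + l = i := by omega
      simp [liftVar, swapVar, h', h1, h2, h3]
    · have h1 : ¬ i < l := by omega
      have h2 : ¬ i < l + k := by omega
      have h3 : ¬ i < k := by omega
      have h4 : ¬ i - k < l := by omega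
      have h5 : ¬ i - l < k := by omega
      have h6 : i - k - l = i - l - k := by omega
      have h7 : ¬ ρ (i - l - k) + k + l < l + k := by omega
      simp [liftVar, swapVar, h1, h2, h3, h4, h5, h6, h7]
      omega

theorem AxEq.rename {cty : K → Ty α} {Γ : Ctx α} {M N : Term α K} {A : Ty α}
    (h : AxEq cty Γ M N A) : ∀ {ρ : ℕ → ℕ}, Function.Injective ρ →
      AxEq cty (Γ.map ρ) (M.rename ρ) (N.rename ρ) A := by
  induction h with
  | refl h => intro ρ hρ; exact .refl (h.rename hρ)
  | symm _ ih => intro ρ hρ; exact (ih hρ).symm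
  | trans _ _ ih ih' => intro ρ hρ; exact (ih hρ).trans (ih' hρ)
  | lam _ ih =>
    intro ρ hρ
    exact .lam (by rw [← Ctx.map_cons hρ]; exact ih (liftVar_injective 1 hρ))
  | lamBang hΓ n _ ih =>
    intro ρ hρ
    exact .lamBang (hΓ.map hρ) n (by rw [← Ctx.map_cons hρ]; exact ih (liftVar_injective 1 hρ))
  | app hΓ _ _ ihM ihN => intro ρ hρ; exact .app (hΓ.map hρ) (ihM hρ) (ihN hρ)
  | pair hΓ n _ _ ihM ihN => intro ρ hρ; exact .pair (hΓ.map hρ) n (ihM hρ) (ihN hρ)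
  | letPair hΓ _ _ ihM ihN =>
    intro ρ hρ
    exact .letPair (hΓ.map hρ) (ihM hρ)
      (by rw [← Ctx.map_cons₂ hρ]; exact ihN (liftVar_injective 2 hρ))
  | letUnit hΓ _ _ ihM ihN => intro ρ hρ; exact .letUnit (hΓ.map hρ) (ihM hρ) (ihN hρ)
  | betaLam hV hl hr =>
    intro ρ hρ
    have hl' := hl.rename hρ
    have hr' := hr.rename hρ
    rw [Term.subst₁_rename] at hr' ⊢
    rw [Pat.bind_rename] at hl' ⊢
    exact .betaLam (hV.rename ρ) hl' hr'
  | betaPair hV hW hl hr =>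
    intro ρ hρ
    have hl' := hl.rename hρ
    have hr' := hr.rename hρ
    rw [Term.subst₂_rename] at hr' ⊢
    exact .betaPair (hV.rename ρ) (hW.rename ρ) hl' hr'
  | betaUnit hl hr => intro ρ hρ; exact .betaUnit (hl.rename hρ) (hr.rename hρ)
  | etaLam hV hl hr =>
    intro ρ hρ
    have hl' := hl.rename hρ
    simp only [Term.rename, rename_shift, ← Term.castTo_rename _ ρ] at hl' ⊢
    exact .etaLam (hV.rename ρ) hl' (hr.rename hρ)
  | etaLet hl hr => intro ρ hρ; exact .etaLet (hl.rename hρ) (hr.rename hρ)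
  | etaPair hl hr => intro ρ hρ; exact .etaPair (hl.rename hρ) (hr.rename hρ)
  | etaUnit hl hr =>
    intro ρ hρ
    have hl' := hl.rename hρ
    simp only [Term.rename, ← Term.castTo_rename] at hl' ⊢
    exact .etaUnit hl' (hr.rename hρ)
  | letAssoc p q hl hr =>
    intro ρ hρ
    have hl' := hl.rename hρ
    have hr' := hr.rename hρ
    simp only [Pat.bind_rename, rename_skip] at hl' hr' ⊢
    exact .letAssoc p q hl' hr'
  | letSwap p q hV hW hl hr =>
    intro ρ hρ
    have hl' := hl.rename hρ
    have hr' := hr.rename hρ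
    simp only [Pat.bind_rename, rename_shift, rename_swap] at hl' hr' ⊢
    exact .letSwap p q (hV.rename ρ) (hW.rename ρ) hl' hr'
  | letApp hl hr =>
    intro ρ hρ
    have hl' := hl.rename hρ
    have hr' := hr.rename hρ
    simp only [Pat.bind_rename, Pat.size, rename_shift] at hl' hr' ⊢
    exact .letApp hl' hr'
  | letLam hV hl hr =>
    intro ρ hρ
    have hl' := hl.rename hρ
    have hr' := hr.rename hρ
    simp only [Pat.bind_rename, Pat.size, Term.rename, rename_shift, rename_swap] at hl' hr' ⊢
    exact .letLam (hV.rename ρ) hl' hr'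
  | letTensor hl hr =>
    intro ρ hρ
    have hl' := hl.rename hρ
    have hr' := hr.rename hρ
    simp only [Pat.bind_rename, Pat.size, rename_shift] at hl' hr' ⊢
    exact .letTensor hl' hr'
  | castApp hΓ hM hN hs hs' hl hr =>
    intro ρ hρ
    have hl' := hl.rename hρ
    have hr' := hr.rename hρ
    simp only [Term.rename, ← Term.castTo_rename] at hl' hr' ⊢
    exact .castApp (hΓ.map hρ) (hM.rename hρ) (hN.rename hρ) hs hs' hl' hr'
  | castPair hM hs hl hr =>
    intro ρ hρ
    have hl' := hl.rename hρ
    simp only [Term.rename, ← Term.castTo_rename] at hl' ⊢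
    exact .castPair (hM.rename hρ) hs hl' (hr.rename hρ)
  | castLet hs hl hr =>
    intro ρ hρ
    have hl' := hl.rename hρ
    have hr' := hr.rename hρ
    simp only [Pat.bind_rename, ← Term.castTo_rename] at hl' hr' ⊢
    exact .castLet hs hl' hr'
  | castUnit hM hs hl hr =>
    intro ρ hρ
    have hl' := hl.rename hρ
    have hr' := hr.rename hρ
    simp only [Term.rename, ← Term.castTo_rename] at hl' hr' ⊢
    exact .castUnit (hM.rename hρ) hs hl' hr'

end Renaming

/-! ### Auxiliary facts on contexts, typing and promotion -/

section Auxiliary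
variable {α : Type u} {K : Type w}

theorem Ctx.cons_none_empty : Ctx.cons none (Ctx.empty : Ctx α) = Ctx.empty := by
  funext i; rcases i with _ | i <;> rfl

theorem Ctx.map_succ (Γ : Ctx α) : Γ.map (fun i => i + 1) = Γ.cons none := by
  have h : Function.Injective (fun i : ℕ => i + 1) := fun i j hij => by simpa using hij
  funext j
  rcases j with _ | j
  · exact Ctx.map_of_not_mem Γ (by simp)
  · exact Ctx.map_apply h Γ j

theorem Ctx.IsBang.empty : (Ctx.empty : Ctx α).IsBang := fun _ _ h => by cases h

theorem Ctx.Split.empty_left (Γ : Ctx α) : Γ.Split Ctx.empty Γ := fun _ => Or.inr (Or.inl ⟨rfl, rfl⟩)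

theorem Ctx.Split.empty_right (Γ : Ctx α) : Γ.Split Γ Ctx.empty := fun _ => Or.inl ⟨rfl, rfl⟩

theorem Ctx.Split.cons_left {Γ Γ₁ Γ₂ : Ctx α} (h : Γ.Split Γ₁ Γ₂) (o : Option (Ty α)) :
    (Γ.cons o).Split (Γ₁.cons o) (Γ₂.cons none) := by
  intro i; rcases i with _ | i
  · exact Or.inl ⟨rfl, rfl⟩
  · exact h i

theorem Ctx.Split.cons_right {Γ Γ₁ Γ₂ : Ctx α} (h : Γ.Split Γ₁ Γ₂) (o : Option (Ty α)) :
    (Γ.cons o).Split (Γ₁.cons none) (Γ₂.cons o) := by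
  intro i; rcases i with _ | i
  · exact Or.inr (Or.inl ⟨rfl, rfl⟩)
  · exact h i

theorem Ctx.Split.single_bang (A : Ty α) :
    (Ctx.single (Ty.bang A)).Split (Ctx.single (Ty.bang A)) (Ctx.single (Ty.bang A)) := by
  intro i; rcases i with _ | i
  · exact Or.inr (Or.inr ⟨rfl, rfl, A, rfl⟩)
  · exact Or.inl ⟨rfl, rfl⟩

theorem Ctx.Split.some_left {Γ Γ₁ Γ₂ : Ctx α} (h : Γ.Split Γ₁ Γ₂) {i : ℕ} {A : Ty α}
    (hi : Γ₁ i = some A) : Γ i = some A := by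
  rcases h i with h | h | h
  · exact h.1 ▸ hi
  · rw [h.1] at hi; cases hi
  · exact h.1 ▸ hi

theorem Ctx.Split.some_right {Γ Γ₁ Γ₂ : Ctx α} (h : Γ.Split Γ₁ Γ₂) {i : ℕ} {A : Ty α}
    (hi : Γ₂ i = some A) : Γ i = some A := by
  rcases h i with h | h | h
  · rw [h.2] at hi; cases hi
  · exact h.2 ▸ hi
  · exact h.2.1 ▸ hi

theorem Typed.rename_succ {cty : K → Ty α} {Γ : Ctx α} {M : Term α K} {A : Ty α}
    (h : Typed cty Γ M A) : Typed cty (Γ.cons none) (M.rename fun i => i + 1) A := by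
  rw [← Ctx.map_succ]; exact h.rename fun i j hij => by simpa using hij

theorem AxEq.rename_succ {cty : K → Ty α} {Γ : Ctx α} {M N : Term α K} {A : Ty α}
    (h : AxEq cty Γ M N A) :
    AxEq cty (Γ.cons none) (M.rename fun i => i + 1) (N.rename fun i => i + 1) A := by
  rw [← Ctx.map_succ]; exact h.rename fun i j hij => by simpa using hij

/-- Renamings that fix the declared variables do nothing. -/
theorem Typed.rename_eq {cty : K → Ty α} {Γ : Ctx α} {M : Term α K} {A : Ty α}
    (h : Typed cty Γ M A) : ∀ {ρ : ℕ → ℕ}, (∀ i C, Γ i = some C → ρ i = i) → M.rename ρ = M := by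
  have key : ∀ {ρ : ℕ → ℕ} {Γ : Ctx α} (o : Option (Ty α)), (∀ i C, Γ i = some C → ρ i = i) →
      ∀ i C, Γ.cons o i = some C → liftVar 1 ρ i = i := by
    intro ρ Γ o h i C hi
    rcases i with _ | i
    · rfl
    · have := h i C hi
      simp [liftVar, this]
  induction h with
  | var hi hΓ h => intro ρ hρ; simp only [Term.rename]; rw [hρ _ _ hi]
  | const hΓ h => intro ρ hρ; rfl
  | star hΓ n => intro ρ hρ; rfl
  | lam hM ih => intro ρ hρ; simp only [Term.rename]; rw [ih (key _ hρ)]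
  | lamBang hΓ n hM ih => intro ρ hρ; simp only [Term.rename]; rw [ih (key _ hρ)]
  | app hΓ hM hN ihM ihN =>
    intro ρ hρ; simp only [Term.rename]
    rw [ihM fun i C hi => hρ i C (hΓ.some_left hi), ihN fun i C hi => hρ i C (hΓ.some_right hi)]
  | pair hΓ n hM hN ihM ihN =>
    intro ρ hρ; simp only [Term.rename]
    rw [ihM fun i C hi => hρ i C (hΓ.some_left hi), ihN fun i C hi => hρ i C (hΓ.some_right hi)]
  | letPair hΓ hM hN ihM ihN =>
    intro ρ hρ; simp only [Term.rename, liftVar_two]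
    rw [ihM fun i C hi => hρ i C (hΓ.some_left hi),
      ihN (key _ (key _ fun i C hi => hρ i C (hΓ.some_right hi)))]
  | letUnit hΓ hM hN ihM ihN =>
    intro ρ hρ; simp only [Term.rename]
    rw [ihM fun i C hi => hρ i C (hΓ.some_left hi), ihN fun i C hi => hρ i C (hΓ.some_right hi)]

/-- Substitutions that fix the declared variables do nothing. -/
theorem Typed.subst_eq {cty : K → Ty α} {Γ : Ctx α} {M : Term α K} {A : Ty α}
    (h : Typed cty Γ M A) : ∀ {σ : ℕ → Ty α → Term α K},
      (∀ i C, Γ i = some C → ∀ B, σ i B = Term.var i B) → M.subst σ = M := by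
  have key : ∀ {σ : ℕ → Ty α → Term α K} {Γ : Ctx α} (o : Option (Ty α)),
      (∀ i C, Γ i = some C → ∀ B, σ i B = Term.var i B) →
      ∀ i C, Γ.cons o i = some C → ∀ B, Term.subst.liftSubst 1 σ i B = Term.var i B := by
    intro σ Γ o h i C hi B
    rcases i with _ | i
    · rfl
    · have := h i C hi B
      simp [Term.subst.liftSubst, this, Term.rename]
  have two : ∀ σ : ℕ → Ty α → Term α K,
      Term.subst.liftSubst 2 σ = Term.subst.liftSubst 1 (Term.subst.liftSubst 1 σ) := by
    intro σ
    funext i B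
    rcases i with _ | _ | i <;>
      simp [Term.subst.liftSubst, Term.rename, Term.rename_rename]
  induction h with
  | var hi hΓ h => intro σ hσ; simp only [Term.subst]; rw [hσ _ _ hi]
  | const hΓ h => intro σ hσ; rfl
  | star hΓ n => intro σ hσ; rfl
  | lam hM ih => intro σ hσ; simp only [Term.subst]; rw [ih (key _ hσ)]
  | lamBang hΓ n hM ih => intro σ hσ; simp only [Term.subst]; rw [ih (key _ hσ)]
  | app hΓ hM hN ihM ihN =>
    intro σ hσ; simp only [Term.subst]
    rw [ihM fun i C hi => hσ i C (hΓ.some_left hi), ihN fun i C hi => hσ i C (hΓ.some_right hi)]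
  | pair hΓ n hM hN ihM ihN =>
    intro σ hσ; simp only [Term.subst]
    rw [ihM fun i C hi => hσ i C (hΓ.some_left hi), ihN fun i C hi => hσ i C (hΓ.some_right hi)]
  | letPair hΓ hM hN ihM ihN =>
    intro σ hσ; simp only [Term.subst, two]
    rw [ihM fun i C hi => hσ i C (hΓ.some_left hi),
      ihN (key _ (key _ fun i C hi => hσ i C (hΓ.some_right hi)))]
  | letUnit hΓ hM hN ihM ihN =>
    intro σ hσ; simp only [Term.subst]
    rw [ihM fun i C hi => hσ i C (hΓ.some_left hi), ihN fun i C hi => hσ i C (hΓ.some_right hi)]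

/-- The context `!Γ`. -/
def Ctx.bang (Γ : Ctx α) : Ctx α := fun i => (Γ i).map Ty.bang

theorem Ctx.bang_isBang (Γ : Ctx α) : Γ.bang.IsBang := by
  intro i A h
  obtain ⟨B, -, rfl⟩ := Option.map_eq_some_iff.1 h
  exact ⟨B, rfl⟩

theorem Ctx.bang_cons (Γ : Ctx α) (A : Ty α) :
    (Γ.cons (some A)).bang = Γ.bang.cons (some (Ty.bang A)) := by
  funext i; rcases i with _ | i <;> rfl

theorem Ctx.bang_single (A : Ty α) : (Ctx.single A).bang = Ctx.single (Ty.bang A) := by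
  funext i; rcases i with _ | i <;> rfl

theorem Ctx.Split.bang {Γ Γ₁ Γ₂ : Ctx α} (h : Γ.Split Γ₁ Γ₂) :
    Γ.bang.Split Γ₁.bang Γ₂.bang := by
  intro i
  unfold Ctx.bang
  rcases h i with h | h | h
  · exact Or.inl ⟨by rw [h.1], by rw [h.2]; rfl⟩
  · exact Or.inr (Or.inl ⟨by rw [h.1]; rfl, by rw [h.2]⟩)
  · obtain ⟨h1, h2, A, hA⟩ := h
    exact Or.inr (Or.inr ⟨by rw [h1], by rw [h2], Ty.bang A, by rw [hA]; rfl⟩)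

/-- Some variables of type `A` may be given the smaller type `!A`. -/
theorem Typed.narrow {cty : K → Ty α} {Γ : Ctx α} {M : Term α K} {A : Ty α}
    (h : Typed cty Γ M A) : ∀ {Γ' : Ctx α},
      (∀ i, Γ' i = Γ i ∨ Γ' i = (Γ i).map Ty.bang) → Typed cty Γ' M A := by
  have hcons : ∀ {Γ Γ' : Ctx α} (o : Option (Ty α)),
      (∀ i, Γ' i = Γ i ∨ Γ' i = (Γ i).map Ty.bang) →
      ∀ i, Γ'.cons o i = Γ.cons o i ∨ Γ'.cons o i = (Γ.cons o i).map Ty.bang := by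
    intro Γ Γ' o h i
    rcases i with _ | i
    · exact Or.inl rfl
    · exact h i
  have hbang : ∀ {Γ Γ' : Ctx α}, (∀ i, Γ' i = Γ i ∨ Γ' i = (Γ i).map Ty.bang) →
      Γ.IsBang → Γ'.IsBang := by
    intro Γ Γ' h hΓ i A hi
    rcases h i with h | h
    · exact hΓ i A (h ▸ hi)
    · obtain ⟨B, -, rfl⟩ := Option.map_eq_some_iff.1 (h ▸ hi)
      exact ⟨B, rfl⟩
  have hsplit : ∀ {Γ Γ₁ Γ₂ Γ' : Ctx α}, (∀ i, Γ' i = Γ i ∨ Γ' i = (Γ i).map Ty.bang) →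
      Γ.Split Γ₁ Γ₂ → ∃ Γ₁' Γ₂', Γ'.Split Γ₁' Γ₂' ∧
        (∀ i, Γ₁' i = Γ₁ i ∨ Γ₁' i = (Γ₁ i).map Ty.bang) ∧
        (∀ i, Γ₂' i = Γ₂ i ∨ Γ₂' i = (Γ₂ i).map Ty.bang) := by
    intro Γ Γ₁ Γ₂ Γ' h hs
    have : ∀ i, ∃ o₁ o₂ : Option (Ty α),
        ((o₁ = Γ' i ∧ o₂ = none) ∨ (o₁ = none ∧ o₂ = Γ' i) ∨
          (o₁ = Γ' i ∧ o₂ = Γ' i ∧ ∃ A, Γ' i = some (Ty.bang A))) ∧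
        (o₁ = Γ₁ i ∨ o₁ = (Γ₁ i).map Ty.bang) ∧ (o₂ = Γ₂ i ∨ o₂ = (Γ₂ i).map Ty.bang) := by
      intro i
      rcases hs i with hi | hi | hi
      · exact ⟨Γ' i, none, Or.inl ⟨rfl, rfl⟩, by rw [hi.1]; exact h i, by rw [hi.2]; simp⟩
      · exact ⟨none, Γ' i, Or.inr (Or.inl ⟨rfl, rfl⟩), by rw [hi.1]; simp, by rw [hi.2]; exact h i⟩
      · obtain ⟨h1, h2, A, hA⟩ := hi
        refine ⟨Γ' i, Γ' i, Or.inr (Or.inr ⟨rfl, rfl, ?_⟩), by rw [h1]; exact h i,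
          by rw [h2]; exact h i⟩
        rcases h i with h | h
        · exact ⟨A, h.trans hA⟩
        · exact ⟨Ty.bang A, by rw [h, hA]; rfl⟩
    choose Γ₁' Γ₂' h1 h2 h3 using this
    exact ⟨Γ₁', Γ₂', h1, h2, h3⟩
  induction h with
  | @var Γ i A B hi hΓ h =>
    intro Γ' hΓ'
    have hrest : ∀ j C, j ≠ i → Γ' j = some C → ∃ D, C = Ty.bang D := by
      intro j C hj hC
      rcases hΓ' j with h | h
      · exact hΓ j C hj (h ▸ hC)
      · obtain ⟨B, -, rfl⟩ := Option.map_eq_some_iff.1 (h ▸ hC)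
        exact ⟨B, rfl⟩
    rcases hΓ' i with h' | h'
    · exact .var (h'.trans hi) hrest h
    · exact .var (by rw [h', hi]; rfl) hrest h.bang_of
  | const hΓ h => intro Γ' hΓ'; exact .const (hbang hΓ' hΓ) h
  | star hΓ n => intro Γ' hΓ'; exact .star (hbang hΓ' hΓ) n
  | lam hM ih => intro Γ' hΓ'; exact .lam (ih (hcons _ hΓ'))
  | lamBang hΓ n hM ih => intro Γ' hΓ'; exact .lamBang (hbang hΓ' hΓ) n (ih (hcons _ hΓ'))
  | app hΓ hM hN ihM ihN =>
    intro Γ' hΓ'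
    obtain ⟨Γ₁', Γ₂', hs, h1, h2⟩ := hsplit hΓ' hΓ
    exact .app hs (ihM h1) (ihN h2)
  | pair hΓ n hM hN ihM ihN =>
    intro Γ' hΓ'
    obtain ⟨Γ₁', Γ₂', hs, h1, h2⟩ := hsplit hΓ' hΓ
    exact .pair hs n (ihM h1) (ihN h2)
  | letPair hΓ hM hN ihM ihN =>
    intro Γ' hΓ'
    obtain ⟨Γ₁', Γ₂', hs, h1, h2⟩ := hsplit hΓ' hΓ
    exact .letPair hs (ihM h1) (ihN (hcons _ (hcons _ h2)))
  | letUnit hΓ hM hN ihM ihN =>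
    intro Γ' hΓ'
    obtain ⟨Γ₁', Γ₂', hs, h1, h2⟩ := hsplit hΓ' hΓ
    exact .letUnit hs (ihM h1) (ihN h2)

theorem Typed.bang_narrow {cty : K → Ty α} {Γ : Ctx α} {M : Term α K} {A : Ty α}
    (h : Typed cty Γ M A) : Typed cty Γ.bang M A := h.narrow fun _ => Or.inr rfl

theorem Term.Value.promote_value {V : Term α K} (hV : V.Value) : V.promote.Value := by
  induction hV with
  | var i A => exact .var _ _
  | const c A => exact .const _ _
  | star n => exact .star _
  | lam n A M => exact .lam _ _ _
  | pair n _ _ ihV ihW => exact .pair _ ihV ihW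
  | letVar A _ _ ihV ihW => exact .letVar _ ihV ihW
  | letPair n A B _ _ ihV ihW => exact .letPair _ _ _ ihV ihW
  | letUnit hV _ _ ihW => exact .letUnit hV ihW

theorem Term.Value.promote_typed {cty : K → Ty α} {V : Term α K} (hV : V.Value) :
    ∀ {Γ : Ctx α} {A : Ty α}, Typed cty Γ V A → Typed cty Γ.bang V.promote (Ty.bang A) := by
  induction hV with
  | var i A =>
    intro Γ A h
    cases h with
    | var hi hΓ h =>
      refine .var (A := Ty.bang _) (by unfold Ctx.bang; rw [hi]; rfl)
        (fun j C _ hC => Ctx.bang_isBang Γ j C hC) h.bang_bang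
  | const c A =>
    intro Γ A h
    cases h with
    | const hΓ h =>
      refine .const Γ.bang_isBang ?_
      have key : ∀ {A B : Ty α}, Ty.Sub (Ty.bang A) B → Ty.Sub (Ty.bang A) (Ty.bang B) := by
        intro A B h
        generalize hX : Ty.bang A = X at h
        cases h with
        | @const n m h a =>
          rcases n with _ | n
          · cases hX
          · exact Ty.Sub.const (m := m + 1) (by omega) a
        | @unit n m h =>
          rcases n with _ | n
          · cases hX
          · exact Ty.Sub.unit (m := m + 1) (by omega)
        | @lolli n m h _ _ _ _ hA hB =>
          rcases n with _ | n
          · cases hX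
          · exact Ty.Sub.lolli (m := m + 1) (by omega) hA hB
        | @tensor n m h _ _ _ _ hA hB =>
          rcases n with _ | n
          · cases hX
          · exact Ty.Sub.tensor (m := m + 1) (by omega) hA hB
      exact key h
  | star n =>
    intro Γ A h
    cases h with
    | star hΓ n => exact .star Γ.bang_isBang (n + 1)
  | lam n A M =>
    intro Γ B h
    have hc : ∀ i, Γ.bang.cons (some A) i = Γ.cons (some A) i ∨
        Γ.bang.cons (some A) i = (Γ.cons (some A) i).map Ty.bang := by
      intro i; rcases i with _ | i
      · exact Or.inl rfl
      · exact Or.inr rfl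
    cases h with
    | lam hM => exact .lamBang Γ.bang_isBang 0 (hM.narrow hc)
    | lamBang hΓ n hM => exact .lamBang Γ.bang_isBang (n + 1) (hM.narrow hc)
  | pair n _ _ ihV ihW =>
    intro Γ A h
    cases h with
    | pair hΓ n hM hN => exact .pair hΓ.bang (n + 1) (ihV hM) (ihW hN)
  | letVar A _ _ ihV ihW =>
    intro Γ C h
    cases h with
    | app hΓ hM hN =>
      generalize hX : Ty.lolli _ C = X at hM
      generalize hL : Term.lam 0 A _ = L at hM
      cases hM with
      | lam hM =>
        cases hX; cases hL
        exact .app hΓ.bang (.lam (by rw [← Ctx.bang_cons]; exact ihW hM)) (ihV hN)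
      | _ => cases hL
  | letPair n A B _ _ ihV ihW =>
    intro Γ C h
    cases h with
    | letPair hΓ hM hN =>
      refine .letPair (n := n + 1) hΓ.bang (ihV hM) ?_
      have := ihW hN
      rw [Ctx.bang_cons, Ctx.bang_cons] at this
      exact this
  | letUnit _ _ _ ihW =>
    intro Γ C h
    cases h with
    | letUnit hΓ hM hN => exact .letUnit hΓ.bang hM.bang_narrow (ihW hN)

theorem AxEq.thunk {cty : K → Ty α} {Γ : Ctx α} {M N : Term α K} {A : Ty α}
    (h : AxEq cty Γ M N A) : AxEq cty Γ M.thunk N.thunk (Ty.lolli Ty.unit A) :=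
  .lam (.letUnit ((Ctx.Split.empty_left Γ).cons_left _)
    (.refl (.var rfl (by intro j C hj h; rcases j with _ | j <;> cases h; contradiction)
      (Ty.Sub.refl _))) h.rename_succ)

theorem Typed.thunk {cty : K → Ty α} {Γ : Ctx α} {M : Term α K} {A : Ty α}
    (h : Typed cty Γ M A) : Typed cty Γ M.thunk (Ty.lolli Ty.unit A) := (AxEq.refl h).thunk.typed.1

theorem Typed.var_zero {cty : K → Ty α} {A B : Ty α} (h : Ty.Sub A B) :
    Typed cty (Ctx.single A) (Term.var 0 B) B :=
  .var rfl (by intro j C hj h; rcases j with _ | j <;> cases h; contradiction) h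

end Auxiliary

/-! ### Linear categories for duplication -/

/-- The operations of a linear category for duplication, without any law: tensor, tensor unit and
structure maps; `L` on objects (`bang`), the graph `bangMap` of its action on arrows, the counit,
comultiplication, coherence maps and comonoids of `L`; `T` on objects (`comp`), its unit,
multiplication, strength and Kleisli extension `f ↦ f^*`; the exponential `⊸` and the map `Φ`. -/
@[ext]
structure DuplicationData (C : Type u) [Category.{w} C] where
  tensorUnit : C
  tensorObj : C → C → C
  tensorHom : ∀ {A B A' B' : C}, (A ⟶ A') → (B ⟶ B') → (tensorObj A B ⟶ tensorObj A' B')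
  assoc : ∀ A B D : C, tensorObj A (tensorObj B D) ⟶ tensorObj (tensorObj A B) D
  leftUnitor : ∀ A : C, tensorObj tensorUnit A ⟶ A
  rightUnitor : ∀ A : C, tensorObj A tensorUnit ⟶ A
  braiding : ∀ A B : C, tensorObj A B ⟶ tensorObj B A
  bang : C → C
  bangMap : ∀ {A B : C}, (A ⟶ B) → (bang A ⟶ bang B) → Prop
  counit : ∀ A : C, bang A ⟶ A
  comult : ∀ A : C, bang A ⟶ bang (bang A)
  cohTensor : ∀ A B : C, tensorObj (bang A) (bang B) ⟶ bang (tensorObj A B)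
  cohUnit : tensorUnit ⟶ bang tensorUnit
  comonMul : ∀ A : C, bang A ⟶ tensorObj (bang A) (bang A)
  comonUnit : ∀ A : C, bang A ⟶ tensorUnit
  comp : C → C
  unit : ∀ A : C, A ⟶ comp A
  mult : ∀ A : C, comp (comp A) ⟶ comp A
  strength : ∀ A B : C, tensorObj A (comp B) ⟶ comp (tensorObj A B)
  star : ∀ {A B : C}, (A ⟶ comp B) → (comp A ⟶ comp B)
  lolli : C → C → C
  lolliMap : ∀ {A B D E : C}, (A ⟶ B) → (D ⟶ E) → (lolli B D ⟶ lolli A E)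
  Phi : ∀ {A B D : C}, (A ⟶ lolli B D) → (tensorObj A B ⟶ comp D)

/-- Linear categories for duplication. -/
structure LinearCategoryForDuplication (C : Type u) [Category.{w} C] where
  /-- the symmetric monoidal structure -/
  [monoidal : MonoidalCategory C]
  [symmetric : SymmetricCategory C]
  /-- the comonad `L`, a symmetric monoidal comonad -/
  L : Comonad C
  [lax : L.toFunctor.LaxBraided]
  [counit_monoidal : NatTrans.IsMonoidal L.ε]
  [comult_monoidal : NatTrans.IsMonoidal L.δ]
  /-- `L` is idempotent -/
  [idempotent : ∀ A, IsIso (L.δ.app A)]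
  /-- `L` is strong monoidal -/
  [strong_unit : IsIso (Functor.LaxMonoidal.ε L.toFunctor)]
  [strong_tensor : ∀ A B, IsIso (Functor.LaxMonoidal.μ L.toFunctor A B)]
  /-- every object `L A` is a commutative comonoid -/
  [comon : ∀ A, ComonObj (L.obj A)]
  [comm : ∀ A, IsCommComonObj (L.obj A)]
  /-- the comultiplication and the counit of these comonoids are natural … -/
  comul_natural : ∀ {A B : C} (f : A ⟶ B),
    L.map f ≫ ComonObj.comul = ComonObj.comul ≫ (L.map f ⊗ₘ L.map f)
  counit_natural : ∀ {A B : C} (f : A ⟶ B),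
    L.map f ≫ (ComonObj.counit : L.obj B ⟶ 𝟙_ C) = ComonObj.counit
  /-- … and monoidal -/
  comul_tensor : ∀ A B : C,
    Functor.LaxMonoidal.μ L.toFunctor A B ≫ ComonObj.comul =
      (ComonObj.comul ⊗ₘ ComonObj.comul) ≫
        tensorμ (L.obj A) (L.obj A) (L.obj B) (L.obj B) ≫
          (Functor.LaxMonoidal.μ L.toFunctor A B ⊗ₘ Functor.LaxMonoidal.μ L.toFunctor A B)
  comul_unit :
    Functor.LaxMonoidal.ε L.toFunctor ≫ ComonObj.comul =
      (λ_ (𝟙_ C)).inv ≫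
        (Functor.LaxMonoidal.ε L.toFunctor ⊗ₘ Functor.LaxMonoidal.ε L.toFunctor)
  counit_tensor : ∀ A B : C,
    Functor.LaxMonoidal.μ L.toFunctor A B ≫ ComonObj.counit =
      ((ComonObj.counit : L.obj A ⟶ 𝟙_ C) ⊗ₘ (ComonObj.counit : L.obj B ⟶ 𝟙_ C)) ≫
        (λ_ (𝟙_ C)).hom
  counit_unit :
    Functor.LaxMonoidal.ε L.toFunctor ≫ (ComonObj.counit : L.obj (𝟙_ C) ⟶ 𝟙_ C) = 𝟙 _
  /-- they are morphisms of `L`-coalgebras -/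
  comul_coalgebra : ∀ A : C,
    L.δ.app A ≫ L.map (ComonObj.comul : L.obj A ⟶ L.obj A ⊗ L.obj A) =
      ComonObj.comul ≫ (L.δ.app A ⊗ₘ L.δ.app A) ≫
        Functor.LaxMonoidal.μ L.toFunctor (L.obj A) (L.obj A)
  counit_coalgebra : ∀ A : C,
    L.δ.app A ≫ L.map (ComonObj.counit : L.obj A ⟶ 𝟙_ C) =
      ComonObj.counit ≫ Functor.LaxMonoidal.ε L.toFunctor
  /-- the comultiplication of `L` consists of morphisms of comonoids -/
  comult_comul : ∀ A : C,
    L.δ.app A ≫ (ComonObj.comul : L.obj (L.obj A) ⟶ L.obj (L.obj A) ⊗ L.obj (L.obj A)) =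
      ComonObj.comul ≫ (L.δ.app A ⊗ₘ L.δ.app A)
  comult_counit : ∀ A : C,
    L.δ.app A ≫ (ComonObj.counit : L.obj (L.obj A) ⟶ 𝟙_ C) = ComonObj.counit
  /-- the monad `T` and its tensorial strength -/
  T : Monad C
  strength : ∀ A B : C, A ⊗ T.obj B ⟶ T.obj (A ⊗ B)
  strength_natural : ∀ {A A' B B' : C} (f : A ⟶ A') (g : B ⟶ B'),
    (f ⊗ₘ T.map g) ≫ strength A' B' = strength A B ≫ T.map (f ⊗ₘ g)
  strength_leftUnitor : ∀ A : C,
    strength (𝟙_ C) A ≫ T.map (λ_ A).hom = (λ_ (T.obj A)).hom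
  strength_associator : ∀ A B D : C,
    strength (A ⊗ B) D ≫ T.map (α_ A B D).hom =
      (α_ A B (T.obj D)).hom ≫ (A ◁ strength B D) ≫ strength A (B ⊗ D)
  strength_unit : ∀ A B : C, (A ◁ T.η.app B) ≫ strength A B = T.η.app (A ⊗ B)
  strength_mult : ∀ A B : C,
    (A ◁ T.μ.app B) ≫ strength A B =
      strength A (T.obj B) ≫ T.map (strength A B) ≫ T.μ.app (A ⊗ B)
  /-- the Kleisli exponentials: a bifunctor `⊸` and a natural bijection `Φ` -/
  lolli : Cᵒᵖ ⥤ C ⥤ C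
  Phi : ∀ {A B D : C}, (A ⟶ (lolli.obj (.op B)).obj D) ≃ (A ⊗ B ⟶ T.obj D)
  Phi_natural_left : ∀ {A A' B D : C} (f : A' ⟶ A) (g : A ⟶ (lolli.obj (.op B)).obj D),
    Phi (f ≫ g) = (f ▷ B) ≫ Phi g
  Phi_natural_middle : ∀ {A B B' D : C} (f : B' ⟶ B) (g : A ⟶ (lolli.obj (.op B)).obj D),
    Phi (g ≫ (lolli.map f.op).app D) = (A ◁ f) ≫ Phi g
  Phi_natural_right : ∀ {A B D D' : C} (f : D ⟶ D') (g : A ⟶ (lolli.obj (.op B)).obj D),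
    Phi (g ≫ (lolli.obj (.op B)).map f) = Phi g ≫ T.map f

namespace LinearCategoryForDuplication

/-- The operations of a linear category for duplication. -/
def toData {C : Type u} [Category.{w} C] (S : LinearCategoryForDuplication C) :
    DuplicationData C :=
  letI := S.monoidal
  letI := S.symmetric
  letI := S.lax
  letI := S.comon
  { tensorUnit := 𝟙_ C
    tensorObj := fun A B => A ⊗ B
    tensorHom := fun f g => f ⊗ₘ g
    assoc := fun A B D => (α_ A B D).inv
    leftUnitor := fun A => (λ_ A).hom
    rightUnitor := fun A => (ρ_ A).hom
    braiding := fun A B => (β_ A B).hom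
    bang := S.L.obj
    bangMap := fun f g => S.L.map f = g
    counit := fun A => S.L.ε.app A
    comult := fun A => S.L.δ.app A
    cohTensor := fun A B => Functor.LaxMonoidal.μ S.L.toFunctor A B
    cohUnit := Functor.LaxMonoidal.ε S.L.toFunctor
    comonMul := fun A => (ComonObj.comul : S.L.obj A ⟶ S.L.obj A ⊗ S.L.obj A)
    comonUnit := fun A => (ComonObj.counit : S.L.obj A ⟶ 𝟙_ C)
    comp := S.T.obj
    unit := fun A => S.T.η.app A
    mult := fun A => S.T.μ.app A
    strength := S.strength
    star := fun f => S.T.map f ≫ S.T.μ.app _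
    lolli := fun A B => (S.lolli.obj (.op A)).obj B
    lolliMap := fun {A _ D _} f g => (S.lolli.map f.op).app D ≫ (S.lolli.obj (.op A)).map g
    Phi := fun f => S.Phi f }

end LinearCategoryForDuplication

/-! ### The category `YAQ` -/

section YAQ
variable {α : Type u} {K : Type w}

/-- Valid typing judgments `x : A ⊢ V : B` with `V` a value; `x` is the variable `0`. -/
structure ValueJudgment (cty : K → Ty α) (A B : Ty α) where
  term : Term α K
  value : term.Value
  typed : Typed cty (Ctx.single A) term B

/-- Axiomatic equivalence of value judgments. -/
def ValueJudgment.setoid (cty : K → Ty α) (A B : Ty α) : Setoid (ValueJudgment cty A B) where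
  r V W := AxEq cty (Ctx.single A) V.term W.term B
  iseqv := ⟨fun V => .refl V.typed, fun h => h.symm, fun h h' => h.trans h'⟩

/-- The objects of `YAQ` are the types. -/
def YAQ (_ : K → Ty α) : Type u := Ty α

/-- The arrows of `YAQ` are the axiomatic classes of value judgments. -/
def YAQ.Hom (cty : K → Ty α) (A B : Ty α) : Type (max u w) :=
  Quotient (ValueJudgment.setoid cty A B)

/-- The class of a value judgment. -/
def ValueJudgment.cls {cty : K → Ty α} {A B : Ty α} (V : ValueJudgment cty A B) :
    YAQ.Hom cty A B := Quotient.mk _ V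

namespace ValueJudgment
variable {cty : K → Ty α}

theorem comp_congr {A B C : Ty α} {V V' : ValueJudgment cty A B} {W W' : ValueJudgment cty B C}
    (hV : AxEq cty (Ctx.single A) V.term V'.term B)
    (hW : AxEq cty (Ctx.single B) W.term W'.term C) :
    AxEq cty (Ctx.single A) ((Pat.var B).bind V.term W.term) ((Pat.var B).bind V'.term W'.term) C :=
  .app (Ctx.Split.empty_left _) (.lam hW) hV

/-- `x : A ⊢ let y = V in W : C`. -/
def comp {A B C : Ty α} (V : ValueJudgment cty A B) (W : ValueJudgment cty B C) :
    ValueJudgment cty A C where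
  term := (Pat.var B).bind V.term W.term
  value := .letVar B V.value W.value
  typed := (comp_congr (V := V) (W := W) (.refl V.typed) (.refl W.typed)).typed.1

/-- `x : A ⊢ x : A`. -/
def id (A : Ty α) : ValueJudgment cty A A := ⟨.var 0 A, .var 0 A, .var_zero (Ty.Sub.refl A)⟩

end ValueJudgment

instance YAQ.category (cty : K → Ty α) : Category.{max u w} (YAQ cty) where
  Hom A B := YAQ.Hom cty A B
  id A := (ValueJudgment.id (cty := cty) A).cls
  comp f g := Quotient.map₂ ValueJudgment.comp
    (fun _ _ hV _ _ hW => ValueJudgment.comp_congr hV hW) f g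
  id_comp {A B} f := by
    induction f using Quotient.inductionOn with
    | h V =>
      refine Quotient.sound ?_
      have h : Term.subst₁ (Term.var 0 A) V.term = V.term := by
        refine V.typed.subst_eq ?_
        intro i C hi D
        rcases i with _ | i
        · rfl
        · cases hi
      have hb := AxEq.betaLam (cty := cty) (Γ := Ctx.single A) (A := A) (B := B)
        (M := V.term) (.var 0 A) ((ValueJudgment.id A).comp V).typed (h.symm ▸ V.typed)
      rw [h] at hb
      exact hb
  comp_id {A B} f := by
    induction f using Quotient.inductionOn with
    | h V =>
      refine Quotient.sound ?_
      exact AxEq.etaLet (V.comp (ValueJudgment.id B)).typed V.typed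
  assoc {A B C D} f g h := by
    induction f using Quotient.inductionOn with
    | h U =>
    induction g using Quotient.inductionOn with
    | h V =>
    induction h using Quotient.inductionOn with
    | h W =>
      refine Quotient.sound ?_
      have hr : W.term.rename (liftVar 1 fun i => i + 1) = W.term := by
        refine W.typed.rename_eq ?_
        intro i E hi
        rcases i with _ | i
        · rfl
        · cases hi
      have ha := AxEq.letAssoc (cty := cty) (Γ := Ctx.single A) (C := D) (.var C) (.var B)
        (M := U.term) (N := V.term) (P := W.term) ((U.comp V).comp W).typed
        (by simp only [Pat.size]; rw [hr]; exact (U.comp (V.comp W)).typed)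
      simp only [Pat.size] at ha
      rw [hr] at ha
      exact ha

end YAQ

namespace ValueJudgment
variable {α : Type u} {K : Type w} {cty : K → Ty α}

open Term

/-! Valid judgments that define the operations of `YAQ`. -/

theorem pair_var_one (A B : Ty α) :
    Typed cty (((Ctx.empty.cons (some A))).cons none) (var 1 A) A ∧
      Typed cty (Ctx.single B) (var 0 B) B :=
  ⟨(Typed.var_zero (Ty.Sub.refl A)).rename_succ, .var_zero (Ty.Sub.refl B)⟩

/-- Context splitting below `let ⟨x, y⟩ = z in …`, where `x` goes to the left and `y` to the
right. -/
theorem split_pair (A B : Ty α) :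
    ((Ctx.single A).cons (some B)).Split ((Ctx.single A).cons none) (Ctx.single B) := by
  have h := ((Ctx.Split.empty_right (Ctx.empty : Ctx α)).cons_left (some A)).cons_right (some B)
  rwa [Ctx.cons_none_empty] at h

theorem split_pair' (A B : Ty α) :
    ((Ctx.single A).cons (some B)).Split (Ctx.single B) ((Ctx.single A).cons none) := by
  have h := ((Ctx.Split.empty_left (Ctx.empty : Ctx α)).cons_right (some A)).cons_left (some B)
  rwa [Ctx.cons_none_empty] at h

theorem letPair_congr {A B C : Ty α} {M N : Term α K}
    (h : AxEq cty ((Ctx.single A).cons (some B)) M N C) :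
    AxEq cty (Ctx.single (Ty.tensor A B)) (letPair 0 A B (var 0 (Ty.tensor A B)) M)
      (letPair 0 A B (var 0 (Ty.tensor A B)) N) C :=
  .letPair (n := 0) (Ctx.Split.empty_right _) (.refl (.var_zero (Ty.Sub.refl _))) h

theorem letPair_typed {A B C : Ty α} {M : Term α K}
    (h : Typed cty ((Ctx.single A).cons (some B)) M C) :
    Typed cty (Ctx.single (Ty.tensor A B)) (letPair 0 A B (var 0 (Ty.tensor A B)) M) C :=
  (letPair_congr (.refl h)).typed.1

/-- `x : A ⊗ (B ⊗ C) ⊢ let ⟨y, z⟩ = x in let ⟨t, u⟩ = z in ⟨⟨y, t⟩, u⟩ : (A ⊗ B) ⊗ C`. -/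
def assoc (A B C : Ty α) :
    ValueJudgment cty (Ty.tensor A (Ty.tensor B C)) (Ty.tensor (Ty.tensor A B) C) where
  term := letPair 0 A (Ty.tensor B C) (var 0 (Ty.tensor A (Ty.tensor B C)))
    (letPair 0 B C (var 0 (Ty.tensor B C)) (pair 0 (pair 0 (var 3 A) (var 1 B)) (var 0 C)))
  value := .letPair _ _ _ (.var _ _) (.letPair _ _ _ (.var _ _)
    (.pair _ (.pair _ (.var _ _) (.var _ _)) (.var _ _)))
  typed := by
    refine letPair_typed (.letPair (n := 0) (split_pair' _ _) (.var_zero (Ty.Sub.refl _)) ?_)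
    have hA : Typed cty ((((Ctx.single A).cons none).cons none).cons none) (var 3 A) A :=
      (Typed.var_zero (Ty.Sub.refl A)).rename_succ.rename_succ.rename_succ
    have hB : Typed cty ((Ctx.single B).cons none) (var 1 B) B :=
      (Typed.var_zero (Ty.Sub.refl B)).rename_succ
    have hs := ((((Ctx.Split.empty_right (Ctx.single A)).cons_left none).cons_right
      (some B)).cons_left none)
    rw [Ctx.cons_none_empty] at hs
    have hs' := (Ctx.Split.empty_right
      ((((Ctx.single A).cons none).cons (some B)))).cons_right (some C)
    exact .pair hs' 0 (.pair hs 0 hA hB) (.var_zero (Ty.Sub.refl C))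

/-- `x : 1 ⊗ A ⊢ let ⟨y, z⟩ = x in let * = y in z : A`. -/
def leftUnitor (A : Ty α) : ValueJudgment cty (Ty.tensor Ty.unit A) A where
  term := letPair 0 Ty.unit A (var 0 (Ty.tensor Ty.unit A))
    (letUnit (var 1 Ty.unit) (var 0 A))
  value := .letPair _ _ _ (.var _ _) (.letUnit (.var _ _) (.var _ _))
  typed := letPair_typed (.letUnit (split_pair _ _)
    (Typed.var_zero (Ty.Sub.refl _)).rename_succ (.var_zero (Ty.Sub.refl A)))

/-- `x : A ⊗ 1 ⊢ let ⟨y, z⟩ = x in let * = z in y : A`. -/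
def rightUnitor (A : Ty α) : ValueJudgment cty (Ty.tensor A Ty.unit) A where
  term := letPair 0 A Ty.unit (var 0 (Ty.tensor A Ty.unit))
    (letUnit (var 0 Ty.unit) (var 1 A))
  value := .letPair _ _ _ (.var _ _) (.letUnit (.var _ _) (.var _ _))
  typed := letPair_typed (.letUnit (split_pair' _ _) (.var_zero (Ty.Sub.refl _))
    (Typed.var_zero (Ty.Sub.refl A)).rename_succ)

/-- `x : A ⊗ B ⊢ let ⟨y, z⟩ = x in ⟨z, y⟩ : B ⊗ A`. -/
def braiding (A B : Ty α) : ValueJudgment cty (Ty.tensor A B) (Ty.tensor B A) where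
  term := letPair 0 A B (var 0 (Ty.tensor A B)) (pair 0 (var 0 B) (var 1 A))
  value := .letPair _ _ _ (.var _ _) (.pair _ (.var _ _) (.var _ _))
  typed := letPair_typed (.pair (split_pair' _ _) 0 (.var_zero (Ty.Sub.refl B))
    (Typed.var_zero (Ty.Sub.refl A)).rename_succ)

theorem tensorHom_congr {A B A' B' : Ty α} {V V' : ValueJudgment cty A A'}
    {W W' : ValueJudgment cty B B'} (hV : AxEq cty (Ctx.single A) V.term V'.term A')
    (hW : AxEq cty (Ctx.single B) W.term W'.term B') :
    AxEq cty (Ctx.single (Ty.tensor A B))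
      (letPair 0 A B (var 0 (Ty.tensor A B)) (pair 0 (V.term.rename fun i => i + 1) W.term))
      (letPair 0 A B (var 0 (Ty.tensor A B)) (pair 0 (V'.term.rename fun i => i + 1) W'.term))
      (Ty.tensor A' B') :=
  letPair_congr (.pair (split_pair _ _) 0 hV.rename_succ hW)

/-- `z : A ⊗ B ⊢ let ⟨x, y⟩ = z in ⟨V, W⟩ : A' ⊗ B'`. -/
def tensorHom {A B A' B' : Ty α} (V : ValueJudgment cty A A') (W : ValueJudgment cty B B') :
    ValueJudgment cty (Ty.tensor A B) (Ty.tensor A' B') where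
  term := letPair 0 A B (var 0 (Ty.tensor A B)) (pair 0 (V.term.rename fun i => i + 1) W.term)
  value := .letPair _ _ _ (.var _ _) (.pair _ (V.value.rename _) W.value)
  typed := (tensorHom_congr (V := V) (W := W) (.refl V.typed) (.refl W.typed)).typed.1

/-- `x : !A ⊢ V' : !B`, for `V'` the canonical value of type `!B` with the erasure of `V`. -/
def promote {A B : Ty α} (V : ValueJudgment cty A B) :
    ValueJudgment cty (Ty.bang A) (Ty.bang B) where
  term := V.term.promote
  value := V.value.promote_value
  typed := by rw [← Ctx.bang_single]; exact V.value.promote_typed V.typed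

/-- `x : !A ⊢ x^A : A`. -/
def counit (A : Ty α) : ValueJudgment cty (Ty.bang A) A :=
  ⟨var 0 A, .var _ _, .var_zero (Ty.Sub.refl A).bang_of⟩

/-- `x : !A ⊢ x^(!!A) : !!A`. -/
def comult (A : Ty α) : ValueJudgment cty (Ty.bang A) (Ty.bang (Ty.bang A)) :=
  ⟨var 0 (Ty.bang (Ty.bang A)), .var _ _, .var_zero (Ty.Sub.digging A)⟩

/-- `z : !A ⊗ !B ⊢ let ⟨x, y⟩ = z in ⟨x, y⟩^1 : !(A ⊗ B)`. -/
def cohTensor (A B : Ty α) :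
    ValueJudgment cty (Ty.tensor (Ty.bang A) (Ty.bang B)) (Ty.bang (Ty.tensor A B)) where
  term := letPair 0 (Ty.bang A) (Ty.bang B) (var 0 (Ty.tensor (Ty.bang A) (Ty.bang B)))
    (pair 1 (var 1 (Ty.bang A)) (var 0 (Ty.bang B)))
  value := .letPair _ _ _ (.var _ _) (.pair _ (.var _ _) (.var _ _))
  typed := letPair_typed (.pair (split_pair _ _) 1
    (Typed.var_zero (Ty.Sub.refl _)).rename_succ (.var_zero (Ty.Sub.refl _)))

/-- `z : 1 ⊢ let * = z in *^1 : !1`. -/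
def cohUnit : ValueJudgment cty Ty.unit (Ty.bang Ty.unit) where
  term := letUnit (var 0 Ty.unit) (star 1)
  value := .letUnit (.var _ _) (.star _)
  typed := .letUnit (Ctx.Split.empty_right _) (.var_zero (Ty.Sub.refl _))
    (.star Ctx.IsBang.empty 1)

/-- `x : !A ⊢ ⟨x, x⟩ : !A ⊗ !A`. -/
def comonMul (A : Ty α) :
    ValueJudgment cty (Ty.bang A) (Ty.tensor (Ty.bang A) (Ty.bang A)) where
  term := pair 0 (var 0 (Ty.bang A)) (var 0 (Ty.bang A))
  value := .pair _ (.var _ _) (.var _ _)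
  typed := .pair (Ctx.Split.single_bang A) 0 (.var_zero (Ty.Sub.refl _))
    (.var_zero (Ty.Sub.refl _))

/-- `x : !A ⊢ * : 1`. -/
def comonUnit (A : Ty α) : ValueJudgment cty (Ty.bang A) Ty.unit where
  term := star 0
  value := .star _
  typed := .star (by rw [← Ctx.bang_single]; exact Ctx.bang_isBang _) 0

/-- The type `T A = 1 ⊸ A`. -/
abbrev _root_.LinLam.Ty.comp (A : Ty α) : Ty α := Ty.lolli Ty.unit A

theorem force_congr {Γ : Ctx α} {A : Ty α} {M N : Term α K} (h : AxEq cty Γ M N (Ty.comp A)) :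
    AxEq cty Γ (app M (star 0)) (app N (star 0)) A :=
  .app (Ctx.Split.empty_right Γ) h (.refl (.star Ctx.IsBang.empty 0))

theorem force_typed {Γ : Ctx α} {A : Ty α} {M : Term α K} (h : Typed cty Γ M (Ty.comp A)) :
    Typed cty Γ (app M (star 0)) A := (force_congr (.refl h)).typed.1

/-- `x : A ⊢ λ*. x : T A`. -/
def unit (A : Ty α) : ValueJudgment cty A (Ty.comp A) :=
  ⟨thunk (var 0 A), .lam _ _ _, (Typed.var_zero (Ty.Sub.refl A)).thunk⟩

/-- `x : T (T A) ⊢ λ*. (x *) * : T A`. -/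
def mult (A : Ty α) : ValueJudgment cty (Ty.comp (Ty.comp A)) (Ty.comp A) where
  term := thunk (app (app (var 0 (Ty.comp (Ty.comp A))) (star 0)) (star 0))
  value := .lam _ _ _
  typed := (force_typed (force_typed (.var_zero (Ty.Sub.refl _)))).thunk

/-- `z : A ⊗ T B ⊢ let ⟨x, y⟩ = z in λ*. ⟨x, y *⟩ : T (A ⊗ B)`. -/
def strength (A B : Ty α) :
    ValueJudgment cty (Ty.tensor A (Ty.comp B)) (Ty.comp (Ty.tensor A B)) where
  term := letPair 0 A (Ty.comp B) (var 0 (Ty.tensor A (Ty.comp B)))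
    (thunk (pair 0 (var 1 A) (app (var 0 (Ty.comp B)) (star 0))))
  value := .letPair _ _ _ (.var _ _) (.lam _ _ _)
  typed := letPair_typed (Typed.thunk (.pair (split_pair _ _) 0
    (Typed.var_zero (Ty.Sub.refl A)).rename_succ (force_typed (.var_zero (Ty.Sub.refl _)))))

theorem star_congr {A B : Ty α} {V V' : ValueJudgment cty A (Ty.comp B)}
    (hV : AxEq cty (Ctx.single A) V.term V'.term (Ty.comp B)) :
    AxEq cty (Ctx.single (Ty.comp A))
      (thunk ((Pat.var A).bind (app (var 0 (Ty.comp A)) (Term.star 0)) (app V.term (Term.star 0))))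
      (thunk ((Pat.var A).bind (app (var 0 (Ty.comp A)) (Term.star 0)) (app V'.term (Term.star 0))))
      (Ty.comp B) :=
  AxEq.thunk (.app (Ctx.Split.empty_left _) (.lam (force_congr hV))
    (.refl (force_typed (.var_zero (Ty.Sub.refl _)))))

/-- `y : T A ⊢ λ*. let x = y * in V * : T B`. -/
def star {A B : Ty α} (V : ValueJudgment cty A (Ty.comp B)) :
    ValueJudgment cty (Ty.comp A) (Ty.comp B) where
  term := thunk
    ((Pat.var A).bind (app (var 0 (Ty.comp A)) (Term.star 0)) (app V.term (Term.star 0)))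
  value := .lam _ _ _
  typed := (star_congr (V := V) (.refl V.typed)).typed.1

theorem lolliMap_congr {A B D E : Ty α} {V V' : ValueJudgment cty A B}
    {W W' : ValueJudgment cty D E} (hV : AxEq cty (Ctx.single A) V.term V'.term B)
    (hW : AxEq cty (Ctx.single D) W.term W'.term E) :
    AxEq cty (Ctx.single (Ty.lolli B D))
      (lam 0 A ((Pat.var D).bind (app (var 1 (Ty.lolli B D)) V.term) W.term))
      (lam 0 A ((Pat.var D).bind (app (var 1 (Ty.lolli B D)) V'.term) W'.term))
      (Ty.lolli A E) :=
  .lam (.app (Ctx.Split.empty_left _) (.lam hW)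
    (.app (split_pair _ _) (.refl (Typed.var_zero (Ty.Sub.refl _)).rename_succ) hV))

/-- `z : B ⊸ D ⊢ λ x. let y = z V in W : A ⊸ E`. -/
def lolliMap {A B D E : Ty α} (V : ValueJudgment cty A B) (W : ValueJudgment cty D E) :
    ValueJudgment cty (Ty.lolli B D) (Ty.lolli A E) where
  term := lam 0 A ((Pat.var D).bind (app (var 1 (Ty.lolli B D)) V.term) W.term)
  value := .lam _ _ _
  typed := (lolliMap_congr (V := V) (W := W) (.refl V.typed) (.refl W.typed)).typed.1

theorem Phi_congr {A B D : Ty α} {V V' : ValueJudgment cty A (Ty.lolli B D)}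
    (hV : AxEq cty (Ctx.single A) V.term V'.term (Ty.lolli B D)) :
    AxEq cty (Ctx.single (Ty.tensor A B))
      (thunk (letPair 0 A B (var 0 (Ty.tensor A B))
        (app (V.term.rename fun i => i + 1) (var 0 B))))
      (thunk (letPair 0 A B (var 0 (Ty.tensor A B))
        (app (V'.term.rename fun i => i + 1) (var 0 B))))
      (Ty.comp D) :=
  AxEq.thunk (letPair_congr (.app (split_pair _ _) hV.rename_succ
    (.refl (.var_zero (Ty.Sub.refl B)))))

/-- `t : A ⊗ B ⊢ λ*. let ⟨x, y⟩ = t in V y : T D`. -/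
def Phi {A B D : Ty α} (V : ValueJudgment cty A (Ty.lolli B D)) :
    ValueJudgment cty (Ty.tensor A B) (Ty.comp D) where
  term := thunk (letPair 0 A B (var 0 (Ty.tensor A B))
    (app (V.term.rename fun i => i + 1) (var 0 B)))
  value := .lam _ _ _
  typed := (Phi_congr (V := V) (.refl V.typed)).typed.1

end ValueJudgment

/-- The operations of `YAQ`. The action of `L = !` on arrows sends the class of every value judgment
`x : A ⊢ V : B` to the class of its promotion `x : !A ⊢ V' : !B`; it is given through its graph. -/
def YAQ.data {α : Type u} {K : Type w} (cty : K → Ty α) : DuplicationData (YAQ cty) where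
  tensorUnit := Ty.unit
  tensorObj A B := Ty.tensor A B
  tensorHom f g := Quotient.map₂ ValueJudgment.tensorHom
    (fun _ _ hV _ _ hW => ValueJudgment.tensorHom_congr hV hW) f g
  assoc A B D := (ValueJudgment.assoc A B D).cls
  leftUnitor A := (ValueJudgment.leftUnitor A).cls
  rightUnitor A := (ValueJudgment.rightUnitor A).cls
  braiding A B := (ValueJudgment.braiding A B).cls
  bang A := Ty.bang A
  bangMap {A B} f g := ∃ V : ValueJudgment cty A B, f = V.cls ∧ g = V.promote.cls
  counit A := (ValueJudgment.counit A).cls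
  comult A := (ValueJudgment.comult A).cls
  cohTensor A B := (ValueJudgment.cohTensor A B).cls
  cohUnit := ValueJudgment.cohUnit.cls
  comonMul A := (ValueJudgment.comonMul A).cls
  comonUnit A := (ValueJudgment.comonUnit A).cls
  comp A := Ty.comp A
  unit A := (ValueJudgment.unit A).cls
  mult A := (ValueJudgment.mult A).cls
  strength A B := (ValueJudgment.strength A B).cls
  star f := Quotient.map ValueJudgment.star (fun _ _ hV => ValueJudgment.star_congr hV) f
  lolli A B := Ty.lolli A B
  lolliMap f g := Quotient.map₂ ValueJudgment.lolliMap
    (fun _ _ hV _ _ hW => ValueJudgment.lolliMap_congr hV hW) f g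
  Phi f := Quotient.map ValueJudgment.Phi (fun _ _ hV => ValueJudgment.Phi_congr hV) f

end LinLam

open CategoryTheory MonoidalCategory

/-! Two obstacles shape the argument. An axiom applies only where both of its sides are typed, so a
chain of equations has to carry typing along. And `L` is defined on representatives, although a
chain of equivalences between two values may run through terms that are not values, for which
promotion has no meaning.

Against the first obstacle, equations between arrows are turned into equations between terms without
a fixed context. `Conv` relates two terms that have a given type in the same contexts and are
equivalent in all of these; `Tm` is the quotient, on which an arrow acts by `let x = t in V`
(`Tm.ap`). Every `let` can be moved outwards (`Conv.let_assoc`, `Conv.let_swap` and their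
consequences), so that the action of a structural arrow on a pair needs to be computed for pairs of
variables only. The η-rules for `⊗` and `1` allow a variable to be split into a pattern, hence an
arrow is determined by its action on a pattern of variables (`Detects`, `Tm.Det`); the η-rule for
`⊸` allows arrows into `T B` and `B ⊸ C` to be compared after application to `*` or to a fresh
variable (`Tm.force_ext`, `Tm.lolli_ext`). Most laws then follow by rewriting both sides to the same
term. Components of a pair are evaluated from left to right, so exchanging them requires one of them
to be a value (`Tm.IsVal`); copying requires a value that lives over a context `!Δ` (`Tm.Dup`).

Against the second obstacle, `AxEq.promote` is proved by evaluation. Over a context `!Γ` a value is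
evaluated in an environment of semantic values (`Sem`, `Ev`), each of which stands for a duplicable
value and can be read back at every supertype of `!A`. Evaluation may get stuck on terms that are
not values, but never on values. A logical relation `Rel` implies equivalence of the read-backs.
Three facts carry the proof: evaluation is compatible with casts and substitutions
(`Typed.fundamental`), equivalent terms have related evaluations (`AxEq.ev`), and the promotion of a
value is equivalent to the read-back of its evaluation (`Term.Value.adequate`). If `V ≈ W` are
values, then `V'` and `W'` are equivalent to related read-backs, hence to each other.

After this, `L` preserves composition by definition; the naturality of `ε` and `δ` says that casting
a promoted value back to `A`, or on to `!!A`, gives the original value, or its second promotion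
(`AxEq.promote_castTo`, `AxEq.promote_promote`). The rules for promoted structural arrows are the
rules for the arrows themselves with the index `n` of pairs and `*` raised by one, which is why
those rules are stated for arbitrary `n`.

The groundwork is the metatheory of the linear type system: narrowing of contexts, uniqueness of
types, idempotence of casts, simultaneous substitution that tracks which term owns which linear
variable (`SubstEq`), and strengthening. -/

namespace LinLam
universe u w

/-! ### Subtyping -/

namespace Ty
variable {α : Type u}

/-- Types that are not of the form `!A`. -/
def NotBang : Ty α → Prop
  | bang _ => False
  | _ => True

theorem bangs_core : ∀ A : Ty α, bangs A.bangCount A.core = A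
  | const _ | lolli _ _ | tensor _ _ | unit => rfl
  | bang A => congrArg bang (bangs_core A)

theorem bangs_bang (n : ℕ) (A : Ty α) : bangs n (bang A) = bang (bangs n A) := by
  induction n with
  | zero => rfl
  | succ n ih => simp only [bangs, ih]

@[simp] theorem core_bangs (n : ℕ) (A : Ty α) : (bangs n A).core = A.core := by
  induction n with
  | zero => rfl
  | succ n ih => exact ih

theorem bangCount_bangs (n : ℕ) (A : Ty α) : (bangs n A).bangCount = n + A.bangCount := by
  induction n with
  | zero => simp [bangs]
  | succ n ih => simp only [bangs, bangCount, ih]; omega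

theorem unbang_bangs (n : ℕ) (A : Ty α) : unbang n (bangs n A) = A := by
  induction n with
  | zero => rfl
  | succ n ih => exact ih

/-- Subtyping of types without leading exclamation marks. -/
def CoreSub : Ty α → Ty α → Prop
  | const a, const b => a = b
  | unit, unit => True
  | lolli A B, lolli A' B' => Sub A' A ∧ Sub B B'
  | tensor A B, tensor A' B' => Sub A A' ∧ Sub B B'
  | _, _ => False

/-- Peels off one layer. The indices `bangs n _` of the generating rules are not constructor forms
and resist case analysis against concrete types; once the marks are counted separately, the cores
can be analysed by their constructors. -/
theorem sub_iff {A B : Ty α} :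
    Sub A B ↔ (B.bangCount = 0 ∨ 1 ≤ A.bangCount) ∧ CoreSub A.core B.core := by
  constructor
  · intro h
    cases h <;> simp only [bangCount_bangs, core_bangs, core, bangCount, CoreSub, add_zero] <;>
      exact ⟨by assumption, by simp_all⟩
  · rintro ⟨h, hc⟩
    rw [← bangs_core A, ← bangs_core B]
    generalize A.core = A₀ at *
    generalize B.core = B₀ at *
    cases A₀ <;> cases B₀ <;> simp only [CoreSub] at hc
    · subst hc; exact .const h _
    · exact .lolli h hc.1 hc.2
    · exact .tensor h hc.1 hc.2
    · exact .unit h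

theorem size_core_le : ∀ A : Ty α, sizeOf A.core ≤ sizeOf A
  | const _ | lolli _ _ | tensor _ _ | unit => le_rfl
  | bang A => by have := size_core_le A; simp only [core, bang.sizeOf_spec]; omega

/-- Induction on the size of the middle type: contravariance exchanges the outer types in the
argument position of `⊸`, but the middle one stays in the middle. -/
theorem Sub.trans : ∀ {A B C : Ty α}, Sub A B → Sub B C → Sub A C := by
  have key : ∀ (n : ℕ) {A B C : Ty α}, sizeOf B ≤ n → Sub A B → Sub B C → Sub A C := by
    intro n
    induction n with
    | zero => intro A B C h; cases B <;> simp at h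
    | succ n ih =>
      intro A B C hn h h'
      rw [sub_iff] at h h' ⊢
      refine ⟨by omega, ?_⟩
      obtain ⟨-, h⟩ := h
      obtain ⟨-, h'⟩ := h'
      have hs := (size_core_le B).trans hn
      generalize A.core = A₀ at *
      generalize B.core = B₀ at *
      generalize C.core = C₀ at *
      cases A₀ <;> cases B₀ <;> simp only [CoreSub] at h <;> cases C₀ <;>
        simp only [CoreSub] at h' ⊢
      · exact h.trans h'
      · simp only [lolli.sizeOf_spec] at hs
        exact ⟨ih (by omega) h'.1 h.1, ih (by omega) h.2 h'.2⟩
      · simp only [tensor.sizeOf_spec] at hs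
        exact ⟨ih (by omega) h.1 h'.1, ih (by omega) h.2 h'.2⟩
  exact fun {_ B _} h h' => key (sizeOf B) le_rfl h h'

/-- This is what the side condition `m = 0` or `n ≥ 1` is for: contexts `!Δ` stay of this form when
types get smaller. -/
theorem Sub.exists_bang {A B : Ty α} (h : Sub A (bang B)) : ∃ A', A = bang A' := by
  have := (sub_iff.1 h).1
  cases A <;> simp [bangCount] at this
  exact ⟨_, rfl⟩

theorem Sub.lolli_inv {m n : ℕ} {A B A' B' : Ty α}
    (h : Sub (bangs m (Ty.lolli A B)) (bangs n (Ty.lolli A' B'))) : Sub A' A ∧ Sub B B' := by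
  have := (sub_iff.1 h).2
  simpa [core, CoreSub] using this

theorem Sub.count {A B : Ty α} (h : Sub A B) : B.bangCount = 0 ∨ 1 ≤ A.bangCount := (sub_iff.1 h).1

theorem Sub.of_lolli {n : ℕ} {A B C : Ty α} (h : Sub (bangs n (Ty.lolli A B)) C) :
    ∃ A' B', C = bangs C.bangCount (Ty.lolli A' B') ∧ C.core = Ty.lolli A' B' ∧ Sub A' A ∧ Sub B B' := by
  have h' := (sub_iff.1 h).2
  have hC := bangs_core C
  simp only [core_bangs, core] at h'
  generalize C.core = C₀ at *
  cases C₀ <;> simp only [CoreSub] at h'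
  exact ⟨_, _, hC.symm, rfl, h'.1, h'.2⟩

theorem Sub.of_tensor {n : ℕ} {A B C : Ty α} (h : Sub (bangs n (Ty.tensor A B)) C) :
    ∃ A' B', C = bangs C.bangCount (Ty.tensor A' B') ∧ C.core = Ty.tensor A' B' ∧ Sub A A' ∧ Sub B B' := by
  have h' := (sub_iff.1 h).2
  have hC := bangs_core C
  simp only [core_bangs, core] at h'
  generalize C.core = C₀ at *
  cases C₀ <;> simp only [CoreSub] at h'
  exact ⟨_, _, hC.symm, rfl, h'.1, h'.2⟩

theorem Sub.of_unit {n : ℕ} {C : Ty α} (h : Sub (bangs n Ty.unit) C) :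
    C = bangs C.bangCount Ty.unit := by
  have h' := (sub_iff.1 h).2
  have hC := bangs_core C
  simp only [core_bangs, core] at h'
  generalize C.core = C₀ at *
  cases C₀ <;> simp only [CoreSub] at h'
  exact hC.symm

theorem Sub.bangs_of {A B : Ty α} {m n : ℕ} (h : m = 0 ∨ 1 ≤ n) (hAB : Sub A B) :
    Sub (bangs n A) (bangs m B) := by
  rw [sub_iff] at hAB ⊢
  simp only [core_bangs, bangCount_bangs]
  exact ⟨by omega, hAB.2⟩

theorem Sub.lolli_lolli {A A' B B' : Ty α} (hA : Sub A' A) (hB : Sub B B') :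
    Sub (Ty.lolli A B) (Ty.lolli A' B') := Sub.lolli (n := 0) (m := 0) (Or.inl rfl) hA hB

theorem Sub.tensor_tensor {A A' B B' : Ty α} (hA : Sub A A') (hB : Sub B B') :
    Sub (Ty.tensor A B) (Ty.tensor A' B') := Sub.tensor (n := 0) (m := 0) (Or.inl rfl) hA hB

theorem notBang_or (A : Ty α) : A.NotBang ∨ ∃ B, A = bang B := by
  cases A
  case bang B => exact Or.inr ⟨B, rfl⟩
  all_goals exact Or.inl trivial

/-- One mark on the left already pays for any number of marks on the right; this is the source of
the idempotence of `L`. -/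
theorem Sub.bang_right {A B : Ty α} (h : Sub (bang A) B) : Sub (bang A) (bang B) := by
  rw [sub_iff] at h ⊢
  exact ⟨Or.inr (by simp [bangCount]), h.2⟩

end Ty

/-! ### Weakening and narrowing -/

section Mono
variable {α : Type u} {K : Type w} {cty : K → Ty α}

/-- `Γ.Le Γ'`: the variables of `Γ'` have smaller types in `Γ`, and the other variables of `Γ`
have types of the form `!A`. -/
def Ctx.Le (Γ Γ' : Ctx α) : Prop :=
  ∀ i, (∃ A B, Γ i = some A ∧ Γ' i = some B ∧ Ty.Sub A B) ∨
    (Γ' i = none ∧ ∀ A, Γ i = some A → ∃ B, A = Ty.bang B)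

theorem Ctx.Le.refl (Γ : Ctx α) : Γ.Le Γ := by
  intro i
  cases h : Γ i with
  | none => exact Or.inr ⟨rfl, by simp⟩
  | some A => exact Or.inl ⟨A, A, rfl, rfl, Ty.Sub.refl A⟩

theorem Ctx.Le.cons {Γ Γ' : Ctx α} (h : Γ.Le Γ') {A B : Ty α} (hAB : Ty.Sub A B) :
    (Γ.cons (some A)).Le (Γ'.cons (some B)) := by
  intro i; rcases i with _ | i
  · exact Or.inl ⟨A, B, rfl, rfl, hAB⟩
  · exact h i

theorem Ctx.Le.isBang {Γ Γ' : Ctx α} (h : Γ.Le Γ') (hΓ : Γ'.IsBang) : Γ.IsBang := by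
  intro i A hi
  rcases h i with ⟨B, C, h1, h2, hs⟩ | ⟨-, h⟩
  · obtain ⟨D, rfl⟩ := hΓ i C h2
    cases h1.symm.trans hi
    exact hs.exists_bang
  · exact h A hi

/-- A variable shared by the two parts has a type `!C` in the larger context, so by
`Ty.Sub.exists_bang` its smaller type may be shared as well. -/
theorem Ctx.Le.split {Γ Γ' Γ₁' Γ₂' : Ctx α} (h : Γ.Le Γ') (hs : Γ'.Split Γ₁' Γ₂') :
    ∃ Γ₁ Γ₂, Γ.Split Γ₁ Γ₂ ∧ Γ₁.Le Γ₁' ∧ Γ₂.Le Γ₂' := by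
  have : ∀ i, ∃ o₁ o₂ : Option (Ty α),
      ((o₁ = Γ i ∧ o₂ = none) ∨ (o₁ = none ∧ o₂ = Γ i) ∨
        (o₁ = Γ i ∧ o₂ = Γ i ∧ ∃ A, Γ i = some (Ty.bang A))) ∧
      ((∃ A B, o₁ = some A ∧ Γ₁' i = some B ∧ Ty.Sub A B) ∨
        (Γ₁' i = none ∧ ∀ A, o₁ = some A → ∃ B, A = Ty.bang B)) ∧
      ((∃ A B, o₂ = some A ∧ Γ₂' i = some B ∧ Ty.Sub A B) ∨
        (Γ₂' i = none ∧ ∀ A, o₂ = some A → ∃ B, A = Ty.bang B)) := by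
    intro i
    rcases hs i with ⟨h1, h2⟩ | ⟨h1, h2⟩ | ⟨h1, h2, C, hC⟩
    · exact ⟨Γ i, none, by simp, by rw [h1]; exact h i, by simp [h2]⟩
    · exact ⟨none, Γ i, by simp, by simp [h1], by rw [h2]; exact h i⟩
    · refine ⟨Γ i, Γ i, ?_, by rw [h1]; exact h i, by rw [h2]; exact h i⟩
      rcases h i with ⟨A, B, hA, hB, hAB⟩ | ⟨h, -⟩
      · cases hB.symm.trans hC
        obtain ⟨D, rfl⟩ := hAB.exists_bang
        exact Or.inr (Or.inr ⟨rfl, rfl, D, hA⟩)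
      · cases h.symm.trans hC
  choose Γ₁ Γ₂ h1 h2 h3 using this
  exact ⟨Γ₁, Γ₂, h1, h2, h3⟩

/-- The term does not change, because an occurrence of a variable carries the type at which it is
used; only the variable rule notices the smaller declared type, through transitivity. -/
theorem Typed.mono {Γ' : Ctx α} {M : Term α K} {A : Ty α} (h : Typed cty Γ' M A) :
    ∀ {Γ : Ctx α}, Γ.Le Γ' → Typed cty Γ M A := by
  induction h with
  | @var Γ' i A B hi hΓ h =>
    intro Γ hle
    rcases hle i with ⟨A', A'', h1, h2, hA⟩ | ⟨h', -⟩
    · cases h2.symm.trans hi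
      refine .var h1 ?_ (hA.trans h)
      intro j C hj hC
      rcases hle j with ⟨D, D', h1, h2, hD⟩ | ⟨-, h'⟩
      · obtain ⟨E, rfl⟩ := hΓ j _ hj h2
        cases h1.symm.trans hC
        exact hD.exists_bang
      · exact h' C hC
    · cases h'.symm.trans hi
  | const hΓ h => intro Γ hle; exact .const (hle.isBang hΓ) h
  | star hΓ n => intro Γ hle; exact .star (hle.isBang hΓ) n
  | lam hM ih => intro Γ hle; exact .lam (ih (hle.cons (Ty.Sub.refl _)))
  | lamBang hΓ n hM ih =>
    intro Γ hle; exact .lamBang (hle.isBang hΓ) n (ih (hle.cons (Ty.Sub.refl _)))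
  | app hΓ hM hN ihM ihN =>
    intro Γ hle
    obtain ⟨Γ₁, Γ₂, hs, h1, h2⟩ := hle.split hΓ
    exact .app hs (ihM h1) (ihN h2)
  | pair hΓ n hM hN ihM ihN =>
    intro Γ hle
    obtain ⟨Γ₁, Γ₂, hs, h1, h2⟩ := hle.split hΓ
    exact .pair hs n (ihM h1) (ihN h2)
  | letPair hΓ hM hN ihM ihN =>
    intro Γ hle
    obtain ⟨Γ₁, Γ₂, hs, h1, h2⟩ := hle.split hΓ
    exact .letPair hs (ihM h1) (ihN ((h2.cons (Ty.Sub.refl _)).cons (Ty.Sub.refl _)))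
  | letUnit hΓ hM hN ihM ihN =>
    intro Γ hle
    obtain ⟨Γ₁, Γ₂, hs, h1, h2⟩ := hle.split hΓ
    exact .letUnit hs (ihM h1) (ihN h2)

theorem AxEq.mono {Γ' : Ctx α} {M N : Term α K} {A : Ty α} (h : AxEq cty Γ' M N A) :
    ∀ {Γ : Ctx α}, Γ.Le Γ' → AxEq cty Γ M N A := by
  induction h with
  | refl h => intro Γ hle; exact .refl (h.mono hle)
  | symm _ ih => intro Γ hle; exact (ih hle).symm
  | trans _ _ ih ih' => intro Γ hle; exact (ih hle).trans (ih' hle)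
  | lam hM ih => intro Γ hle; exact .lam (ih (hle.cons (Ty.Sub.refl _)))
  | lamBang hΓ n hM ih =>
    intro Γ hle; exact .lamBang (hle.isBang hΓ) n (ih (hle.cons (Ty.Sub.refl _)))
  | app hΓ hM hN ihM ihN =>
    intro Γ hle
    obtain ⟨Γ₁, Γ₂, hs, h1, h2⟩ := hle.split hΓ
    exact .app hs (ihM h1) (ihN h2)
  | pair hΓ n hM hN ihM ihN =>
    intro Γ hle
    obtain ⟨Γ₁, Γ₂, hs, h1, h2⟩ := hle.split hΓ
    exact .pair hs n (ihM h1) (ihN h2)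
  | letPair hΓ hM hN ihM ihN =>
    intro Γ hle
    obtain ⟨Γ₁, Γ₂, hs, h1, h2⟩ := hle.split hΓ
    exact .letPair hs (ihM h1) (ihN ((h2.cons (Ty.Sub.refl _)).cons (Ty.Sub.refl _)))
  | letUnit hΓ hM hN ihM ihN =>
    intro Γ hle
    obtain ⟨Γ₁, Γ₂, hs, h1, h2⟩ := hle.split hΓ
    exact .letUnit hs (ihM h1) (ihN h2)
  | betaLam hV hl hr => intro Γ hle; exact .betaLam hV (hl.mono hle) (hr.mono hle)
  | betaPair hV hW hl hr => intro Γ hle; exact .betaPair hV hW (hl.mono hle) (hr.mono hle)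
  | betaUnit hl hr => intro Γ hle; exact .betaUnit (hl.mono hle) (hr.mono hle)
  | etaLam hV hl hr => intro Γ hle; exact .etaLam hV (hl.mono hle) (hr.mono hle)
  | etaLet hl hr => intro Γ hle; exact .etaLet (hl.mono hle) (hr.mono hle)
  | etaPair hl hr => intro Γ hle; exact .etaPair (hl.mono hle) (hr.mono hle)
  | etaUnit hl hr => intro Γ hle; exact .etaUnit (hl.mono hle) (hr.mono hle)
  | letAssoc p q hl hr => intro Γ hle; exact .letAssoc p q (hl.mono hle) (hr.mono hle)
  | letSwap p q hV hW hl hr =>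
    intro Γ hle; exact .letSwap p q hV hW (hl.mono hle) (hr.mono hle)
  | letApp hl hr => intro Γ hle; exact .letApp (hl.mono hle) (hr.mono hle)
  | letLam hV hl hr => intro Γ hle; exact .letLam hV (hl.mono hle) (hr.mono hle)
  | letTensor hl hr => intro Γ hle; exact .letTensor (hl.mono hle) (hr.mono hle)
  | castApp hΓ hM hN hs hs' hl hr =>
    intro Γ hle
    obtain ⟨Γ₁, Γ₂, h, h1, h2⟩ := hle.split hΓ
    exact .castApp h (hM.mono h1) (hN.mono h2) hs hs' (hl.mono hle) (hr.mono hle)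
  | castPair hM hs hl hr => intro Γ hle; exact .castPair hM hs (hl.mono hle) (hr.mono hle)
  | castLet hs hl hr => intro Γ hle; exact .castLet hs (hl.mono hle) (hr.mono hle)
  | castUnit hM hs hl hr => intro Γ hle; exact .castUnit hM hs (hl.mono hle) (hr.mono hle)

end Mono

/-! ### Type casting -/

section Casting
variable {α : Type u} {K : Type w} {cty : K → Ty α}

/-- Uniqueness of types, independently of the context. It recovers the argument type that the
application rule hides. -/
theorem Typed.tyOf_eq {Γ : Ctx α} {M : Term α K} {A : Ty α} (h : Typed cty Γ M A) :
    M.tyOf = A := by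
  induction h <;> simp_all [Term.tyOf, Ty.right, Ty.unbang_bangs, Ty.bangs]

theorem Typed.lam_bangs {Γ : Ctx α} {n : ℕ} (hΓ : n = 0 ∨ Γ.IsBang) {A B : Ty α} {M : Term α K}
    (hM : Typed cty (Γ.cons (some A)) M B) :
    Typed cty Γ (Term.lam n A M) (Ty.bangs n (Ty.lolli A B)) := by
  rcases n with _ | n
  · exact .lam hM
  · exact .lamBang (by simpa using hΓ) n hM

theorem AxEq.lam_bangs {Γ : Ctx α} {n : ℕ} (hΓ : n = 0 ∨ Γ.IsBang) {A B : Ty α}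
    {M N : Term α K} (hM : AxEq cty (Γ.cons (some A)) M N B) :
    AxEq cty Γ (Term.lam n A M) (Term.lam n A N) (Ty.bangs n (Ty.lolli A B)) := by
  rcases n with _ | n
  · exact .lam hM
  · exact .lamBang (by simpa using hΓ) n hM

theorem Typed.castTo {Γ : Ctx α} {M : Term α K} {A : Ty α} (h : Typed cty Γ M A) :
    ∀ {B : Ty α}, Ty.Sub A B → Typed cty Γ (M.castTo B) B := by
  induction h with
  | var hi hΓ h => intro C hC; exact .var hi hΓ (h.trans hC)
  | const hΓ h => intro C hC; exact .const hΓ (h.trans hC)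
  | star hΓ n =>
    intro C hC
    simp only [Term.castTo]
    have := hC.of_unit
    rw [this]
    simp only [Ty.bangCount_bangs, Ty.bangCount, add_zero]
    exact .star hΓ _
  | @lam Γ A B M hM ih =>
    intro C hC
    obtain ⟨A', B', h1, h2, hA, hB⟩ := Ty.Sub.of_lolli (n := 0) hC
    have hc : C.bangCount = 0 := by simpa [Ty.bangCount] using hC.count
    simp only [Term.castTo, h2, Ty.left, Ty.right]
    rw [hc] at h1 ⊢
    subst h1
    -- The cast shrinks the annotation of the bound variable, and narrowing absorbs this.
    exact .lam ((ih hB).mono ((Ctx.Le.refl Γ).cons hA))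
  | lamBang hΓ n hM ih =>
    intro C hC
    obtain ⟨A', B', h1, h2, hA, hB⟩ := Ty.Sub.of_lolli hC
    simp only [Term.castTo, h2, Ty.left, Ty.right]
    generalize C.bangCount = k at *
    subst h1
    exact .lam_bangs (Or.inr hΓ) ((ih hB).mono ((Ctx.Le.refl _).cons hA))
  | app hΓ hM hN ihM ihN =>
    intro C hC
    simp only [Term.castTo, hM.tyOf_eq, Ty.left]
    exact .app hΓ (ihM (Ty.Sub.lolli_lolli (Ty.Sub.refl _) hC)) hN
  | pair hΓ n hM hN ihM ihN =>
    intro C hC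
    obtain ⟨A', B', h1, h2, hA, hB⟩ := Ty.Sub.of_tensor hC
    have hc := hC.count
    simp only [Ty.bangCount_bangs, Ty.bangCount, add_zero] at hc
    simp only [Term.castTo, h2, Ty.left, Ty.right]
    generalize C.bangCount = k at *
    subst h1
    exact .pair hΓ k (ihM (hA.bangs_of hc)) (ihN (hB.bangs_of hc))
  | letPair hΓ hM hN ihM ihN => intro C hC; exact .letPair hΓ hM (ihN hC)
  | letUnit hΓ hM hN ihM ihN => intro C hC; exact .letUnit hΓ hM (ihN hC)

theorem Typed.castTo_self {Γ : Ctx α} {M : Term α K} {A : Ty α} (h : Typed cty Γ M A) :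
    M.castTo A = M := by
  induction h with
  | lamBang hΓ n hM ih =>
    simp [Term.castTo, Ty.bangCount_bangs, Ty.bangCount, Ty.core, Ty.left, Ty.right, ih]
  | app hΓ hM hN ihM ihN => simp only [Term.castTo, hM.tyOf_eq, Ty.left, ihM]
  | lam hM ih => simp [Term.castTo, Ty.bangCount, Ty.core, Ty.left, Ty.right, ih]
  | _ => simp_all [Term.castTo, Ty.bangCount_bangs, Ty.bangCount, Ty.core, Ty.left, Ty.right]

/-- The second cast overwrites whatever the first one changed. Typing is needed because the cast of
an application reads the argument type off the function. -/
theorem Typed.castTo_castTo {Γ : Ctx α} {M : Term α K} {A : Ty α} (h : Typed cty Γ M A) :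
    ∀ {B : Ty α}, Ty.Sub A B → ∀ C : Ty α, (M.castTo B).castTo C = M.castTo C := by
  induction h with
  | lam hM ih =>
    intro B hB C
    obtain ⟨A', B', h1, h2, hA, hB⟩ := Ty.Sub.of_lolli (n := 0) hB
    simp only [Term.castTo, h2, Ty.right, ih hB]
  | lamBang hΓ n hM ih =>
    intro B hB C
    obtain ⟨A', B', h1, h2, hA, hB⟩ := Ty.Sub.of_lolli hB
    simp only [Term.castTo, h2, Ty.right, ih hB]
  | @app Γ Γ₁ Γ₂ hΓ A' B' M N hM hN ihM ihN =>
    intro B hB C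
    have hs := Ty.Sub.lolli_lolli (Ty.Sub.refl A') hB
    have := (hM.castTo hs).tyOf_eq
    simp only [Term.castTo, hM.tyOf_eq, Ty.left, this, ihM hs]
  | pair hΓ n hM hN ihM ihN =>
    intro B hB C
    obtain ⟨A', B', h1, h2, hA, hB'⟩ := Ty.Sub.of_tensor hB
    have hc := hB.count
    simp only [Ty.bangCount_bangs, Ty.bangCount, add_zero] at hc
    simp only [Term.castTo, h2, Ty.left, Ty.right, ihM (hA.bangs_of hc), ihN (hB'.bangs_of hc)]
  | letPair hΓ hM hN ihM ihN => intro B hB C; simp only [Term.castTo, ihN hB]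
  | letUnit hΓ hM hN ihM ihN => intro B hB C; simp only [Term.castTo, ihN hB]
  | _ => intros; rfl

theorem Term.Value.castTo {V : Term α K} (hV : V.Value) : ∀ A : Ty α, (V.castTo A).Value := by
  induction hV with
  | letVar A hV hW ihV ihW => intro B; exact .letVar _ hV (ihW _)
  | letPair n A B hV hW ihV ihW => intro C; exact .letPair _ _ _ hV (ihW _)
  | letUnit hV hW ihV ihW => intro C; exact .letUnit hV (ihW _)
  | pair n hV hW ihV ihW => intro C; exact .pair _ (ihV _) (ihW _)
  | _ => intro B; constructor

end Casting

/-! ### Simultaneous substitution -/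

section Substitution
variable {α : Type u} {K : Type w} {cty : K → Ty α}

theorem liftSubst_two (σ : ℕ → Ty α → Term α K) :
    Term.subst.liftSubst 2 σ = Term.subst.liftSubst 1 (Term.subst.liftSubst 1 σ) := by
  funext i B
  rcases i with _ | _ | i <;> simp [Term.subst.liftSubst, Term.rename, Term.rename_rename]

open Classical in
/-- The context `Γ` without the variables of a type not of the form `!A` that do not satisfy `p`. -/
noncomputable def Ctx.restrict (Γ : Ctx α) (p : ℕ → Prop) : Ctx α :=
  fun j => if p j ∨ ∃ A, Γ j = some (Ty.bang A) then Γ j else none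

theorem Ctx.restrict_of {Γ : Ctx α} {p : ℕ → Prop} {j : ℕ} (h : p j) : Γ.restrict p j = Γ j :=
  if_pos (Or.inl h)

theorem Ctx.restrict_bang {Γ : Ctx α} (p : ℕ → Prop) {j : ℕ} {A : Ty α}
    (h : Γ j = some (Ty.bang A)) : Γ.restrict p j = some (Ty.bang A) :=
  (if_pos (Or.inr ⟨A, h⟩)).trans h

theorem Ctx.restrict_none {Γ : Ctx α} (p : ℕ → Prop) {j : ℕ} (h : Γ j = none) :
    Γ.restrict p j = none := by
  unfold Ctx.restrict; split_ifs <;> simp [h]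

theorem Ctx.restrict_of_not {Γ : Ctx α} {p : ℕ → Prop} {j : ℕ} {A : Ty α} (h : Γ j = some A)
    (hA : A.NotBang) (hj : ¬ p j) : Γ.restrict p j = none := by
  refine if_neg ?_
  rintro (h' | ⟨B, hB⟩)
  · exact hj h'
  · cases h.symm.trans hB; exact hA

theorem Ctx.restrict_some {Γ : Ctx α} {p : ℕ → Prop} {j : ℕ} {A : Ty α}
    (h : Γ.restrict p j = some A) : Γ j = some A ∧ (A.NotBang → p j) := by
  unfold Ctx.restrict at h
  split_ifs at h with h'
  refine ⟨h, fun hA => ?_⟩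
  rcases h' with h' | ⟨B, hB⟩
  · exact h'
  · cases h.symm.trans hB; exact hA.elim

/-- `σ` and `σ'` are axiomatically equal substitutions of terms over `Γ` for the variables of `Δ`;
a variable `j` of `Γ` whose type is not of the form `!A` occurs in the term for `own j` only. -/
structure SubstEq (cty : K → Ty α) (Δ Γ : Ctx α) (σ σ' : ℕ → Ty α → Term α K) (own : ℕ → ℕ) :
    Prop where
  eq : ∀ {i A C}, Δ i = some A → Ty.Sub A C →
    AxEq cty (Γ.restrict fun j => own j = i) (σ i C) (σ' i C) C
  own : ∀ {j A}, Γ j = some A → A.NotBang → ∃ B, Δ (own j) = some B ∧ B.NotBang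

/-- Linear variables of `Γ` are owned by linear variables of `Δ`. In particular a variable of a type
`!A` owns none, so the term substituted for it, which may be copied or dropped, lives over variables
of types `!B` only. -/
theorem SubstEq.isBang {Δ Γ : Ctx α} {σ σ' : ℕ → Ty α → Term α K} {own : ℕ → ℕ}
    (h : SubstEq cty Δ Γ σ σ' own) (hΔ : Δ.IsBang) : Γ.IsBang := by
  intro j A hj
  rcases A.notBang_or with hA | hA
  · obtain ⟨B, hB, hB'⟩ := h.own hj hA
    obtain ⟨C, rfl⟩ := hΔ _ _ hB
    exact hB'.elim
  · exact hA

/-- Each linear variable of `Γ` follows its owner, and all other variables go to both sides. The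
owner is linear, hence lies on one side only. -/
theorem SubstEq.split {Δ Δ₁ Δ₂ Γ : Ctx α} {σ σ' : ℕ → Ty α → Term α K} {own : ℕ → ℕ}
    (h : SubstEq cty Δ Γ σ σ' own) (hs : Δ.Split Δ₁ Δ₂) :
    ∃ Γ₁ Γ₂, Γ.Split Γ₁ Γ₂ ∧ SubstEq cty Δ₁ Γ₁ σ σ' own ∧ SubstEq cty Δ₂ Γ₂ σ σ' own := by
  have key : ∀ {Δ' : Ctx α}, (∀ {i A}, Δ' i = some A → Δ i = some A) →
      SubstEq cty Δ' (Γ.restrict fun j => ∃ A, Δ' (own j) = some A) σ σ' own := by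
    intro Δ' hΔ'
    refine ⟨fun {i A C} hi hA => ?_, fun {j A} hj hA => ?_⟩
    · have : (Γ.restrict fun j => ∃ A, Δ' (own j) = some A).restrict (fun j => own j = i) =
          Γ.restrict fun j => own j = i := by
        funext j
        cases hj : Γ j with
        | none => rw [Ctx.restrict_none _ hj, Ctx.restrict_none _ (Ctx.restrict_none _ hj)]
        | some B =>
          rcases B.notBang_or with hB | ⟨B, rfl⟩
          · by_cases hji : own j = i
            · have hp : ∃ A, Δ' (own j) = some A := ⟨A, hji ▸ hi⟩
              exact (Ctx.restrict_of (p := fun j => own j = i) hji).trans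
                ((Ctx.restrict_of (p := fun j => ∃ A, Δ' (own j) = some A) hp).trans
                  (Ctx.restrict_of (p := fun j => own j = i) hji).symm)
            · rw [Ctx.restrict_of_not hj hB hji]
              by_cases hp : ∃ A, Δ' (own j) = some A
              · exact Ctx.restrict_of_not ((Ctx.restrict_of hp).trans hj) hB hji
              · exact Ctx.restrict_none _ (Ctx.restrict_of_not hj hB hp)
          · rw [Ctx.restrict_bang _ hj, Ctx.restrict_bang _ (Ctx.restrict_bang _ hj)]
      rw [this]
      exact h.eq (hΔ' hi) hA
    · obtain ⟨hj, hp⟩ := Ctx.restrict_some hj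
      obtain ⟨B, hB⟩ := hp hA
      obtain ⟨B', hB', hn⟩ := h.own hj hA
      cases (hΔ' hB).symm.trans hB'
      exact ⟨B, hB, hn⟩
  refine ⟨_, _, ?_, key hs.some_left, key hs.some_right⟩
  intro j
  cases hj : Γ j with
  | none => exact Or.inl ⟨Ctx.restrict_none _ hj, Ctx.restrict_none _ hj⟩
  | some A =>
    rcases A.notBang_or with hA | ⟨A, rfl⟩
    · obtain ⟨B, hB, hn⟩ := h.own hj hA
      rcases hs (own j) with ⟨h1, h2⟩ | ⟨h1, h2⟩ | ⟨h1, h2, C, hC⟩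
      · refine Or.inl ⟨(Ctx.restrict_of ⟨B, h1.trans hB⟩).trans hj,
          Ctx.restrict_of_not hj hA (by simp [h2])⟩
      · refine Or.inr (Or.inl ⟨Ctx.restrict_of_not hj hA (by simp [h1]),
          (Ctx.restrict_of ⟨B, h2.trans hB⟩).trans hj⟩)
      · cases hB.symm.trans hC
        exact hn.elim
    · exact Or.inr (Or.inr ⟨Ctx.restrict_bang _ hj, Ctx.restrict_bang _ hj, A, rfl⟩)

theorem SubstEq.lift {Δ Γ : Ctx α} {σ σ' : ℕ → Ty α → Term α K} {own : ℕ → ℕ}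
    (h : SubstEq cty Δ Γ σ σ' own) (A : Ty α) :
    SubstEq cty (Δ.cons (some A)) (Γ.cons (some A)) (Term.subst.liftSubst 1 σ)
      (Term.subst.liftSubst 1 σ') (liftVar 1 own) := by
  refine ⟨fun {i B C} hi hB => ?_, fun {j B} hj hB => ?_⟩
  · rcases i with _ | i
    · cases hi
      refine .refl (.var (A := A) (Ctx.restrict_of rfl) ?_ hB)
      intro j D hj hD
      obtain ⟨hD', hp⟩ := Ctx.restrict_some hD
      rcases D.notBang_or with hn | hD
      · have := hp hn
        rcases j with _ | j
        · exact absurd rfl hj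
        · simp [liftVar] at this
      · exact hD
    · have := (h.eq (i := i) hi hB).rename_succ
      simp only [Term.subst.liftSubst, Nat.add_sub_cancel, Nat.add_lt_iff_lt_sub_right]
      refine AxEq.mono this ?_
      intro j
      rcases j with _ | j
      · refine Or.inr ⟨rfl, fun D hD => ?_⟩
        obtain ⟨hD', hp⟩ := Ctx.restrict_some hD
        rcases D.notBang_or with hn | hD
        · have := hp hn
          simp [liftVar] at this
        · exact hD
      · have : (Γ.cons (some A)).restrict (fun j => liftVar 1 own j = i + 1) (j + 1) =
            Γ.restrict (fun j => own j = i) j := by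
          have e : liftVar 1 own (j + 1) = i + 1 ↔ own j = i := by simp [liftVar]
          exact @if_congr _ _ _ (_) (_) _ _ _ _ (or_congr e Iff.rfl) rfl rfl
        rw [this]
        exact Ctx.Le.refl (Γ.restrict fun j => own j = i) j
  · rcases j with _ | j
    · cases hj
      exact ⟨A, rfl, hB⟩
    · obtain ⟨C, hC, hn⟩ := h.own (j := j) hj hB
      exact ⟨C, by simpa [liftVar] using (show Δ.cons (some A) (own j + 1) = some C from hC), hn⟩

/-- Axiomatically equal substitutions give axiomatically equal results. -/
theorem Typed.subst_congr {Δ : Ctx α} {M : Term α K} {A : Ty α} (h : Typed cty Δ M A) :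
    ∀ {Γ : Ctx α} {σ σ' : ℕ → Ty α → Term α K} {own : ℕ → ℕ}, SubstEq cty Δ Γ σ σ' own →
      AxEq cty Γ (M.subst σ) (M.subst σ') A := by
  induction h with
  | @var Δ i A B hi hΔ h =>
    intro Γ σ σ' own hσ
    refine AxEq.mono (hσ.eq hi h) ?_
    intro j
    cases hj : Γ j with
    | none => exact Or.inr ⟨Ctx.restrict_none _ hj, by simp⟩
    | some C =>
      rcases C.notBang_or with hC | ⟨C, rfl⟩
      -- All variables of `Δ` except `i` have types `!D`, so the owner of a linear variable can only
      -- be `i`: the restriction to the variables owned by `i` loses nothing.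
      · obtain ⟨D, hD, hn⟩ := hσ.own hj hC
        have : own j = i := by
          by_contra hne
          obtain ⟨E, rfl⟩ := hΔ _ _ hne hD
          exact hn
        exact Or.inl ⟨C, C, rfl, (Ctx.restrict_of (p := fun j => own j = i) this).trans hj, Ty.Sub.refl _⟩
      · exact Or.inl ⟨_, _, rfl, Ctx.restrict_bang _ hj, Ty.Sub.refl _⟩
  | const hΔ h => intro Γ σ σ' own hσ; exact .refl (.const (hσ.isBang hΔ) h)
  | star hΔ n => intro Γ σ σ' own hσ; exact .refl (.star (hσ.isBang hΔ) n)
  | lam hM ih => intro Γ σ σ' own hσ; exact .lam (ih (hσ.lift _))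
  | lamBang hΔ n hM ih => intro Γ σ σ' own hσ; exact .lamBang (hσ.isBang hΔ) n (ih (hσ.lift _))
  | app hΔ hM hN ihM ihN =>
    intro Γ σ σ' own hσ
    obtain ⟨Γ₁, Γ₂, hs, h1, h2⟩ := hσ.split hΔ
    exact .app hs (ihM h1) (ihN h2)
  | pair hΔ n hM hN ihM ihN =>
    intro Γ σ σ' own hσ
    obtain ⟨Γ₁, Γ₂, hs, h1, h2⟩ := hσ.split hΔ
    exact .pair hs n (ihM h1) (ihN h2)
  | letPair hΔ hM hN ihM ihN =>
    intro Γ σ σ' own hσ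
    obtain ⟨Γ₁, Γ₂, hs, h1, h2⟩ := hσ.split hΔ
    simp only [Term.subst, liftSubst_two]
    exact .letPair hs (ihM h1) (ihN ((h2.lift _).lift _))
  | letUnit hΔ hM hN ihM ihN =>
    intro Γ σ σ' own hσ
    obtain ⟨Γ₁, Γ₂, hs, h1, h2⟩ := hσ.split hΔ
    exact .letUnit hs (ihM h1) (ihN h2)

/-- The substitution lemma is the diagonal case of the congruence, since equivalent terms are typed.
-/
theorem Typed.subst {Δ Γ : Ctx α} {M : Term α K} {A : Ty α} (h : Typed cty Δ M A)
    {σ : ℕ → Ty α → Term α K} {own : ℕ → ℕ} (hσ : SubstEq cty Δ Γ σ σ own) :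
    Typed cty Γ (M.subst σ) A := (h.subst_congr hσ).typed.1

/-- Substitutions that agree on the declared variables give the same result. -/
theorem Typed.subst_ext {Δ : Ctx α} {M : Term α K} {A : Ty α} (h : Typed cty Δ M A) :
    ∀ {σ σ' : ℕ → Ty α → Term α K},
      (∀ i B C, Δ i = some B → Ty.Sub B C → σ i C = σ' i C) → M.subst σ = M.subst σ' := by
  have key : ∀ {Δ : Ctx α} {σ σ' : ℕ → Ty α → Term α K} (o : Option (Ty α)),
      (∀ i B C, Δ i = some B → Ty.Sub B C → σ i C = σ' i C) →
      ∀ i B C, Δ.cons o i = some B → Ty.Sub B C →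
        Term.subst.liftSubst 1 σ i C = Term.subst.liftSubst 1 σ' i C := by
    intro Δ σ σ' o h i B C hi hB
    rcases i with _ | i
    · rfl
    · have := h i B C hi hB
      simp [Term.subst.liftSubst, this]
  induction h with
  | var hi hΔ h => intro σ σ' hσ; exact hσ _ _ _ hi h
  | const hΔ h => intro σ σ' hσ; rfl
  | star hΔ n => intro σ σ' hσ; rfl
  | lam hM ih => intro σ σ' hσ; simp only [Term.subst]; rw [ih (key _ hσ)]
  | lamBang hΔ n hM ih => intro σ σ' hσ; simp only [Term.subst]; rw [ih (key _ hσ)]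
  | letPair hΔ hM hN ihM ihN =>
    intro σ σ' hσ; simp only [Term.subst, liftSubst_two]
    rw [ihM fun i B C hi => hσ i B C (hΔ.some_left hi),
      ihN (key _ (key _ fun i B C hi => hσ i B C (hΔ.some_right hi)))]
  | _ hΔ =>
    intro σ σ' hσ; simp only [Term.subst]
    rename_i ihM ihN
    rw [ihM fun i B C hi => hσ i B C (hΔ.some_left hi),
      ihN fun i B C hi => hσ i B C (hΔ.some_right hi)]

/-! ### Substitution in substitutions -/

namespace Term

theorem liftSubst_comp (k : ℕ) (σ τ : ℕ → Ty α → Term α K) :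
    (fun i A => (subst.liftSubst k σ i A).subst (subst.liftSubst k τ)) =
      subst.liftSubst k fun i A => (σ i A).subst τ := by
  funext i A
  by_cases h : i < k
  · simp [subst.liftSubst, h, subst]
  · simp only [subst.liftSubst, h, if_false, subst_rename, rename_subst]
    congr 1
    funext j B
    simp

theorem subst_subst (M : Term α K) : ∀ (σ τ : ℕ → Ty α → Term α K),
    (M.subst σ).subst τ = M.subst fun i A => (σ i A).subst τ := by
  induction M with
  | lam n A M ih => intro σ τ; simp only [subst, ih, liftSubst_comp]
  | app M N ihM ihN => intro σ τ; simp only [subst, ihM, ihN]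
  | pair n M N ihM ihN => intro σ τ; simp only [subst, ihM, ihN]
  | letPair n A B M N ihM ihN => intro σ τ; simp only [subst, ihM, ihN, liftSubst_comp]
  | letUnit M N ihM ihN => intro σ τ; simp only [subst, ihM, ihN]
  | _ => intros; rfl

theorem rename_id (M : Term α K) : M.rename (fun i => i) = M := by
  have key : ∀ k, liftVar k (fun i => i) = fun i => i := by
    intro k; funext i; unfold liftVar; split_ifs
    · rfl
    · exact Nat.sub_add_cancel (by omega)
  induction M <;> simp_all [rename]

theorem subst_shift (M : Term α K) (σ : ℕ → Ty α → Term α K) (k : ℕ) :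
    (M.rename fun i => i + k).subst (subst.liftSubst k σ) = (M.subst σ).rename fun i => i + k := by
  simp only [subst_rename, rename_subst]
  congr 1
  funext i A
  simp [subst.liftSubst]

/-- This commutation and the next one carry a substitution through the renamings that occur in the
axioms for nested and for exchanged bindings. -/
theorem subst_skip (M : Term α K) (σ : ℕ → Ty α → Term α K) (k l : ℕ) :
    (M.rename (liftVar k fun i => i + l)).subst (subst.liftSubst k (subst.liftSubst l σ)) =
      (M.subst (subst.liftSubst k σ)).rename (liftVar k fun i => i + l) := by
  simp only [subst_rename, rename_subst]
  congr 1
  funext i A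
  by_cases h : i < k
  · simp [subst.liftSubst, liftVar, h, rename]
  · simp only [subst.liftSubst, liftVar, h, if_false]
    simp [rename_rename, liftVar]

theorem subst_swap (M : Term α K) (σ : ℕ → Ty α → Term α K) (k l : ℕ) :
    (M.rename (swapVar l k)).subst (subst.liftSubst k (subst.liftSubst l σ)) =
      (M.subst (subst.liftSubst l (subst.liftSubst k σ))).rename (swapVar l k) := by
  simp only [subst_rename, rename_subst]
  congr 1
  funext i A
  rcases lt_or_ge i l with h | h
  · simp [subst.liftSubst, swapVar, h, rename]
  · rcases lt_or_ge i (l + k) with h' | h'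
    · have h1 : i - l < k := by omega
      have h2 : ¬ i < l := by omega
      have h3 : i - l + l = i := by omega
      simp [subst.liftSubst, swapVar, h', h1, h2, h3, rename]
    · have h1 : ¬ i < l := by omega
      have h2 : ¬ i < l + k := by omega
      have h3 : ¬ i < k := by omega
      have h4 : ¬ i - k < l := by omega
      have h5 : ¬ i - l < k := by omega
      have h6 : i - k - l = i - l - k := by omega
      simp only [subst.liftSubst, swapVar, h1, h2, h3, h4, h5, h6, if_false, rename_rename]
      congr 1
      funext j
      have h7 : ¬ j + k + l < l := by omega
      have h8 : ¬ j + k + l < l + k := by omega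
      simp [h7, h8]
      omega

end Term

theorem Pat.bind_subst (p : Pat α) (σ : ℕ → Ty α → Term α K) (M N : Term α K) :
    (p.bind M N).subst σ = p.bind (M.subst σ) (N.subst (Term.subst.liftSubst p.size σ)) := by
  cases p with
  | unit =>
    simp only [Pat.bind, Term.subst, Pat.size]
    congr 2
    funext i A
    simp [Term.subst.liftSubst, Term.rename_id]
  | _ => rfl

namespace Term

theorem liftSubst_var (k : ℕ) :
    subst.liftSubst k (var : ℕ → Ty α → Term α K) = var := by
  funext i A
  by_cases h : i < k
  · simp [subst.liftSubst, h]
  · simp only [subst.liftSubst, h, if_false, rename]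
    congr 1
    omega

theorem subst_var (M : Term α K) : M.subst var = M := by
  induction M <;> simp_all [subst, liftSubst_var]

theorem rename_eq_subst (M : Term α K) (ρ : ℕ → ℕ) :
    M.rename ρ = M.subst fun i A => var (ρ i) A := by
  conv_rhs => rw [← subst_rename M ρ var, subst_var]

theorem Value.subst {V : Term α K} (hV : V.Value) :
    ∀ {σ : ℕ → Ty α → Term α K}, (∀ i A, (σ i A).Value) → (V.subst σ).Value := by
  have key : ∀ (k : ℕ) {σ : ℕ → Ty α → Term α K}, (∀ i A, (σ i A).Value) →
      ∀ i A, (Term.subst.liftSubst k σ i A).Value := by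
    intro k σ hσ i A
    by_cases h : i < k
    · simp only [Term.subst.liftSubst, h, if_true]; exact .var _ _
    · simp only [Term.subst.liftSubst, h, if_false]; exact (hσ _ _).rename _
  induction hV with
  | var i A => intro σ hσ; exact hσ i A
  | letVar A hV hW ihV ihW => intro σ hσ; exact .letVar _ (ihV hσ) (ihW (key 1 hσ))
  | letPair n A B hV hW ihV ihW => intro σ hσ; exact .letPair _ _ _ (ihV hσ) (ihW (key 2 hσ))
  | letUnit hV hW ihV ihW => intro σ hσ; exact .letUnit (ihV hσ) (ihW hσ)
  | pair n hV hW ihV ihW => intro σ hσ; exact .pair _ (ihV hσ) (ihW hσ)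
  | _ => intro σ hσ; constructor

end Term

/-- Well-typed substitutions of values that are compatible with casts. -/
structure ValSubst (cty : K → Ty α) (Δ Γ : Ctx α) (σ : ℕ → Ty α → Term α K) (own : ℕ → ℕ) :
    Prop extends SubstEq cty Δ Γ σ σ own where
  value : ∀ i A, (σ i A).Value
  cast : ∀ {i A B C}, Δ i = some A → Ty.Sub A B → Ty.Sub B C → (σ i B).castTo C = σ i C

theorem ValSubst.split {Δ Δ₁ Δ₂ Γ : Ctx α} {σ : ℕ → Ty α → Term α K} {own : ℕ → ℕ}
    (h : ValSubst cty Δ Γ σ own) (hs : Δ.Split Δ₁ Δ₂) :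
    ∃ Γ₁ Γ₂, Γ.Split Γ₁ Γ₂ ∧ ValSubst cty Δ₁ Γ₁ σ own ∧ ValSubst cty Δ₂ Γ₂ σ own := by
  obtain ⟨Γ₁, Γ₂, hs', h1, h2⟩ := h.toSubstEq.split hs
  exact ⟨Γ₁, Γ₂, hs', ⟨h1, h.value, fun hi => h.cast (hs.some_left hi)⟩,
    ⟨h2, h.value, fun hi => h.cast (hs.some_right hi)⟩⟩

theorem ValSubst.lift {Δ Γ : Ctx α} {σ : ℕ → Ty α → Term α K} {own : ℕ → ℕ}
    (h : ValSubst cty Δ Γ σ own) (A : Ty α) :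
    ValSubst cty (Δ.cons (some A)) (Γ.cons (some A)) (Term.subst.liftSubst 1 σ)
      (liftVar 1 own) := by
  refine ⟨h.toSubstEq.lift A, fun i B => ?_, fun {i B C D} hi hB hC => ?_⟩
  · by_cases hi : i < 1
    · simp only [Term.subst.liftSubst, hi, if_true]; exact .var _ _
    · simp only [Term.subst.liftSubst, hi, if_false]; exact (h.value _ _).rename _
  · rcases i with _ | i
    · rfl
    · simp only [Term.subst.liftSubst, Nat.add_sub_cancel, Nat.add_lt_iff_lt_sub_right]
      simp only [Nat.sub_self, Nat.not_lt_zero, if_false]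
      rw [Term.castTo_rename, h.cast (i := i) hi hB hC]

theorem Typed.castTo_subst {Δ : Ctx α} {M : Term α K} {A : Ty α} (h : Typed cty Δ M A) :
    ∀ {Γ : Ctx α} {σ : ℕ → Ty α → Term α K} {own : ℕ → ℕ}, ValSubst cty Δ Γ σ own →
      ∀ {B : Ty α}, Ty.Sub A B → (M.castTo B).subst σ = (M.subst σ).castTo B := by
  induction h with
  | var hi hΔ h => intro Γ σ own hσ B hB; exact (hσ.cast hi h hB).symm
  | const hΔ h => intros; rfl
  | star hΔ n => intros; rfl
  | lam hM ih =>
    intro Γ σ own hσ C hC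
    obtain ⟨A', B', h1, h2, hA, hB⟩ := Ty.Sub.of_lolli (n := 0) hC
    simp only [Term.castTo, Term.subst, h2, Ty.right, ih (hσ.lift _) hB]
  | lamBang hΔ n hM ih =>
    intro Γ σ own hσ C hC
    obtain ⟨A', B', h1, h2, hA, hB⟩ := Ty.Sub.of_lolli hC
    simp only [Term.castTo, Term.subst, h2, Ty.right, ih (hσ.lift _) hB]
  | app hΔ hM hN ihM ihN =>
    intro Γ σ own hσ C hC
    obtain ⟨Γ₁, Γ₂, hs, h1, h2⟩ := hσ.split hΔ
    have := (hM.subst h1.toSubstEq).tyOf_eq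
    simp only [Term.castTo, Term.subst, this, hM.tyOf_eq, Ty.left,
      ihM h1 (Ty.Sub.lolli_lolli (Ty.Sub.refl _) hC)]
  | pair hΔ n hM hN ihM ihN =>
    intro Γ σ own hσ C hC
    obtain ⟨A', B', h1, h2, hA, hB⟩ := Ty.Sub.of_tensor hC
    have hc := hC.count
    simp only [Ty.bangCount_bangs, Ty.bangCount, add_zero] at hc
    obtain ⟨Γ₁, Γ₂, hs, h3, h4⟩ := hσ.split hΔ
    simp only [Term.castTo, Term.subst, h2, Ty.left, Ty.right, ihM h3 (hA.bangs_of hc),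
      ihN h4 (hB.bangs_of hc)]
  | letPair hΔ hM hN ihM ihN =>
    intro Γ σ own hσ C hC
    obtain ⟨Γ₁, Γ₂, hs, h3, h4⟩ := hσ.split hΔ
    simp only [Term.castTo, Term.subst, liftSubst_two, ihN ((h4.lift _).lift _) hC]
  | letUnit hΔ hM hN ihM ihN =>
    intro Γ σ own hσ C hC
    obtain ⟨Γ₁, Γ₂, hs, h3, h4⟩ := hσ.split hΔ
    simp only [Term.castTo, Term.subst, ihN h4 hC]

theorem Typed.bind_var_inv {Γ : Ctx α} {A B : Ty α} {M N : Term α K}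
    (h : Typed cty Γ ((Pat.var A).bind M N) B) :
    ∃ Γ₁ Γ₂, Γ.Split Γ₁ Γ₂ ∧ Typed cty (Γ₁.cons (some A)) N B ∧ Typed cty Γ₂ M A := by
  cases h with
  | app hΓ hM hN =>
    generalize hX : Ty.lolli _ B = X at hM
    generalize hL : Term.lam 0 A _ = L at hM
    cases hM with
    | lam hM => cases hX; cases hL; exact ⟨_, _, hΓ, hM, hN⟩
    | _ => cases hL

theorem Typed.pair_inv {Γ : Ctx α} {n : ℕ} {A B : Ty α} {M N : Term α K}
    (h : Typed cty Γ (Term.pair n M N) (Ty.bangs n (Ty.tensor A B))) :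
    ∃ Γ₁ Γ₂, Γ.Split Γ₁ Γ₂ ∧ Typed cty Γ₁ M (Ty.bangs n A) ∧ Typed cty Γ₂ N (Ty.bangs n B) := by
  generalize hX : Ty.bangs n (Ty.tensor A B) = X at h
  cases h with
  | pair hs _ hM hN =>
    have := congrArg (Ty.unbang n) hX
    simp only [Ty.unbang_bangs] at this
    cases this
    exact ⟨_, _, hs, hM, hN⟩

theorem Typed.subst₁_subst {Δ : Ctx α} {A B : Ty α} {M : Term α K}
    (hM : Typed cty (Δ.cons (some A)) M B) {V : Term α K} {σ : ℕ → Ty α → Term α K}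
    (hV : ∀ {C}, Ty.Sub A C → (V.castTo C).subst σ = (V.subst σ).castTo C) :
    (Term.subst₁ V M).subst σ =
      Term.subst₁ (V.subst σ) (M.subst (Term.subst.liftSubst 1 σ)) := by
  simp only [Term.subst₁, Term.subst_subst]
  refine hM.subst_ext ?_
  intro i D C hi hD
  rcases i with _ | i
  · cases hi
    simpa [Term.subst.liftSubst, Term.subst] using hV hD
  · simp [Term.subst.liftSubst, Term.subst, Term.subst_rename, Term.subst_var]

theorem Typed.subst₂_subst {Δ : Ctx α} {A B D : Ty α} {M : Term α K}
    (hM : Typed cty ((Δ.cons (some A)).cons (some B)) M D) {V W : Term α K}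
    {σ : ℕ → Ty α → Term α K}
    (hV : ∀ {C}, Ty.Sub A C → (V.castTo C).subst σ = (V.subst σ).castTo C)
    (hW : ∀ {C}, Ty.Sub B C → (W.castTo C).subst σ = (W.subst σ).castTo C) :
    (Term.subst₂ V W M).subst σ =
      Term.subst₂ (V.subst σ) (W.subst σ) (M.subst (Term.subst.liftSubst 2 σ)) := by
  simp only [Term.subst₂, Term.subst_subst]
  refine hM.subst_ext ?_
  intro i E C hi hE
  rcases i with _ | _ | i
  · cases hi
    simpa [Term.subst.liftSubst, Term.subst] using hW hE
  · cases hi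
    simpa [Term.subst.liftSubst, Term.subst] using hV hE
  · simp [Term.subst.liftSubst, Term.subst, Term.subst_rename, Term.subst_var]

theorem _root_.LinLam.Ty.Sub.of_bangs (n : ℕ) (A : Ty α) : Ty.Sub (Ty.bangs n A) A :=
  (Ty.Sub.refl A).bangs_of (m := 0) (Or.inl rfl)

/-- Axiomatic equivalence is stable under substitution of values. -/
theorem AxEq.subst {Δ : Ctx α} {M N : Term α K} {A : Ty α} (h : AxEq cty Δ M N A) :
    ∀ {Γ : Ctx α} {σ : ℕ → Ty α → Term α K} {own : ℕ → ℕ}, ValSubst cty Δ Γ σ own →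
      AxEq cty Γ (M.subst σ) (N.subst σ) A := by
  induction h with
  | refl h => intro Γ σ own hσ; exact .refl (h.subst hσ.toSubstEq)
  | symm _ ih => intro Γ σ own hσ; exact (ih hσ).symm
  | trans _ _ ih ih' => intro Γ σ own hσ; exact (ih hσ).trans (ih' hσ)
  | lam hM ih => intro Γ σ own hσ; exact .lam (ih (hσ.lift _))
  | lamBang hΔ n hM ih => intro Γ σ own hσ; exact .lamBang (hσ.isBang hΔ) n (ih (hσ.lift _))
  | app hΔ hM hN ihM ihN =>
    intro Γ σ own hσ
    obtain ⟨Γ₁, Γ₂, hs, h1, h2⟩ := hσ.split hΔ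
    exact .app hs (ihM h1) (ihN h2)
  | pair hΔ n hM hN ihM ihN =>
    intro Γ σ own hσ
    obtain ⟨Γ₁, Γ₂, hs, h1, h2⟩ := hσ.split hΔ
    exact .pair hs n (ihM h1) (ihN h2)
  | letPair hΔ hM hN ihM ihN =>
    intro Γ σ own hσ
    obtain ⟨Γ₁, Γ₂, hs, h1, h2⟩ := hσ.split hΔ
    simp only [Term.subst, liftSubst_two]
    exact .letPair hs (ihM h1) (ihN ((h2.lift _).lift _))
  | letUnit hΔ hM hN ihM ihN =>
    intro Γ σ own hσ
    obtain ⟨Γ₁, Γ₂, hs, h1, h2⟩ := hσ.split hΔ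
    exact .letUnit hs (ihM h1) (ihN h2)
  | betaLam hV hl hr =>
    intro Γ σ own hσ
    have hl' := hl.subst hσ.toSubstEq
    have hr' := hr.subst hσ.toSubstEq
    obtain ⟨Δ₁, Δ₂, hs, hM, hV'⟩ := hl.bind_var_inv
    obtain ⟨Γ₁, Γ₂, -, -, h2⟩ := hσ.split hs
    -- The reduct contains casts of `V`, so moving the outer substitution inside requires it to
    -- commute with them.
    rw [hM.subst₁_subst (hV'.castTo_subst h2)] at hr' ⊢
    rw [Pat.bind_subst] at hl' ⊢
    exact .betaLam (hV.subst hσ.value) hl' hr'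
  | betaPair hV hW hl hr =>
    intro Γ σ own hσ
    have hl' := hl.subst hσ.toSubstEq
    have hr' := hr.subst hσ.toSubstEq
    have hl'' := hl
    cases hl'' with
    | letPair hs hP hM =>
      obtain ⟨Γ₁, Γ₂, -, h1, -⟩ := hσ.split hs
      obtain ⟨Δ₁, Δ₂, hs', hV', hW'⟩ := hP.pair_inv
      obtain ⟨_, _, -, h3, h4⟩ := h1.split hs'
      rw [hM.subst₂_subst (hV'.castTo_subst h3) (hW'.castTo_subst h4)] at hr' ⊢
      exact .betaPair (hV.subst hσ.value) (hW.subst hσ.value) hl' hr'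
  | betaUnit hl hr =>
    intro Γ σ own hσ; exact .betaUnit (hl.subst hσ.toSubstEq) (hr.subst hσ.toSubstEq)
  | etaLam hV hl hr =>
    intro Γ σ own hσ
    have hl' := hl.subst hσ.toSubstEq
    simp only [Term.subst, Term.subst_shift, hr.castTo_subst hσ (.of_bangs _ _)] at hl' ⊢
    exact .etaLam (hV.subst hσ.value) hl' (hr.subst hσ.toSubstEq)
  | etaLet hl hr =>
    intro Γ σ own hσ; exact .etaLet (hl.subst hσ.toSubstEq) (hr.subst hσ.toSubstEq)
  | etaPair hl hr =>
    intro Γ σ own hσ; exact .etaPair (hl.subst hσ.toSubstEq) (hr.subst hσ.toSubstEq)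
  | etaUnit hl hr =>
    intro Γ σ own hσ
    have hl' := hl.subst hσ.toSubstEq
    simp only [Term.subst, hr.castTo_subst hσ (.of_bangs _ _)] at hl' ⊢
    exact .etaUnit hl' (hr.subst hσ.toSubstEq)
  | letAssoc p q hl hr =>
    intro Γ σ own hσ
    have hl' := hl.subst hσ.toSubstEq
    have hr' := hr.subst hσ.toSubstEq
    simp only [Pat.bind_subst, Term.subst_skip] at hl' hr' ⊢
    exact .letAssoc p q hl' hr'
  | letSwap p q hV hW hl hr =>
    intro Γ σ own hσ
    have hl' := hl.subst hσ.toSubstEq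
    have hr' := hr.subst hσ.toSubstEq
    simp only [Pat.bind_subst, Term.subst_shift, Term.subst_swap] at hl' hr' ⊢
    exact .letSwap p q (hV.subst hσ.value) (hW.subst hσ.value) hl' hr'
  | letApp hl hr =>
    intro Γ σ own hσ
    have hl' := hl.subst hσ.toSubstEq
    have hr' := hr.subst hσ.toSubstEq
    simp only [Pat.bind_subst, Pat.size, Term.subst_shift] at hl' hr' ⊢
    exact .letApp hl' hr'
  | letLam hV hl hr =>
    intro Γ σ own hσ
    have hl' := hl.subst hσ.toSubstEq
    have hr' := hr.subst hσ.toSubstEq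
    simp only [Pat.bind_subst, Pat.size, Term.subst, Term.subst_shift, Term.subst_swap]
      at hl' hr' ⊢
    exact .letLam (hV.subst hσ.value) hl' hr'
  | letTensor hl hr =>
    intro Γ σ own hσ
    have hl' := hl.subst hσ.toSubstEq
    have hr' := hr.subst hσ.toSubstEq
    simp only [Pat.bind_subst, Pat.size, Term.subst_shift] at hl' hr' ⊢
    exact .letTensor hl' hr'
  | castApp hΔ hM hN hs hs' hl hr =>
    intro Γ σ own hσ
    have hl' := hl.subst hσ.toSubstEq
    have hr' := hr.subst hσ.toSubstEq
    obtain ⟨Γ₁, Γ₂, hΓ, h1, h2⟩ := hσ.split hΔ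
    obtain ⟨hA, hD⟩ := Ty.Sub.lolli_inv (n := 0) hs
    have happ := Typed.app hΔ (hM.castTo (.of_bangs _ _)) (hN.castTo (hs'.trans hA))
    rw [happ.castTo_subst hσ hD] at hr' ⊢
    simp only [Term.subst, hM.castTo_subst h1 hs, hM.castTo_subst h1 (.of_bangs _ _),
      hN.castTo_subst h2 hs', hN.castTo_subst h2 (hs'.trans hA)] at hl' hr' ⊢
    exact .castApp hΓ (hM.subst h1.toSubstEq) (hN.subst h2.toSubstEq) hs hs' hl' hr'
  | castPair _ hs hl hr =>
    intro Γ σ own hσ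
    have hl' := hl.subst hσ.toSubstEq
    have hr' := hr.subst hσ.toSubstEq
    -- The context of `M` in the axiom is unrelated to `Δ`; a typing of `M` over a part of `Δ` is
    -- taken from the right-hand side instead.
    have hr'' := hr
    cases hr'' with
    | letPair hΔ hM hN =>
      obtain ⟨Γ₁, Γ₂, hΓ, h1, h2⟩ := hσ.split hΔ
      simp only [Term.subst, hM.castTo_subst h1 hs] at hl' hr' ⊢
      exact .castPair (hM.subst h1.toSubstEq) hs hl' hr'
  | castLet hs hl hr =>
    intro Γ σ own hσ
    have hl' := hl.subst hσ.toSubstEq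
    have hr' := hr.subst hσ.toSubstEq
    obtain ⟨Δ₁, Δ₂, hΔ, hN, hM⟩ := hr.bind_var_inv
    obtain ⟨Γ₁, Γ₂, hΓ, h1, h2⟩ := hσ.split hΔ
    simp only [Pat.bind_subst, hM.castTo_subst h2 hs] at hl' hr' ⊢
    exact .castLet hs hl' hr'
  | castUnit hM hs hl hr =>
    intro Γ σ own hσ
    -- Two successive casts are one, so the two sides of this axiom are the same term.
    rw [hM.castTo_castTo hs]
    exact .refl (hr.subst hσ.toSubstEq)

end Substitution

/-! ### Substitution of values -/

section ValueSubstitution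
variable {α : Type u} {K : Type w} {cty : K → Ty α}

theorem Ctx.Split.symm {Γ Γ₁ Γ₂ : Ctx α} (h : Γ.Split Γ₁ Γ₂) : Γ.Split Γ₂ Γ₁ := by
  intro i
  rcases h i with ⟨h1, h2⟩ | ⟨h1, h2⟩ | ⟨h1, h2, h3⟩
  · exact Or.inr (Or.inl ⟨h2, h1⟩)
  · exact Or.inl ⟨h2, h1⟩
  · exact Or.inr (Or.inr ⟨h2, h1, h3⟩)

/-- The union of two contexts. -/
def Ctx.join (Γ₁ Γ₂ : Ctx α) : Ctx α := fun i => (Γ₁ i).or (Γ₂ i)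

/-- All parts take their types from `Γ`, so `Γ₂` and `Γ₃` agree where both are defined and the bias
of `Ctx.join` does no harm. -/
theorem Ctx.Split.assoc {Γ Γ' Γ₁ Γ₂ Γ₃ : Ctx α} (h : Γ.Split Γ' Γ₃) (h' : Γ'.Split Γ₁ Γ₂) :
    Γ.Split Γ₁ (Γ₂.join Γ₃) ∧ (Γ₂.join Γ₃).Split Γ₂ Γ₃ := by
  have key : ∀ i, ((Γ₁ i = Γ i ∧ (Γ₂.join Γ₃) i = none) ∨ (Γ₁ i = none ∧ (Γ₂.join Γ₃) i = Γ i) ∨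
      (Γ₁ i = Γ i ∧ (Γ₂.join Γ₃) i = Γ i ∧ ∃ A, Γ i = some (Ty.bang A))) ∧
      ((Γ₂ i = (Γ₂.join Γ₃) i ∧ Γ₃ i = none) ∨ (Γ₂ i = none ∧ Γ₃ i = (Γ₂.join Γ₃) i) ∨
      (Γ₂ i = (Γ₂.join Γ₃) i ∧ Γ₃ i = (Γ₂.join Γ₃) i ∧
        ∃ A, (Γ₂.join Γ₃) i = some (Ty.bang A))) := by
    intro i
    unfold Ctx.join
    rcases h i with ⟨h1, h2⟩ | ⟨h1, h2⟩ | ⟨h1, h2, A, hA⟩ <;>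
    rcases h' i with ⟨h3, h4⟩ | ⟨h3, h4⟩ | ⟨h3, h4, B, hB⟩ <;>
    cases hi : Γ i <;> simp_all
    exact ⟨_, h1.symm⟩
  exact ⟨fun i => (key i).1, fun i => (key i).2⟩

theorem Ctx.IsBang.split_self {Γ : Ctx α} (h : Γ.IsBang) : Γ.Split Γ Γ := by
  intro i
  cases hi : Γ i with
  | none => exact Or.inl ⟨rfl, rfl⟩
  | some A =>
    obtain ⟨B, rfl⟩ := h i A hi
    exact Or.inr (Or.inr ⟨rfl, rfl, B, rfl⟩)

theorem Ctx.IsBang.of_split {Γ Γ₁ Γ₂ : Ctx α} (h : Γ.Split Γ₁ Γ₂) (h1 : Γ₁.IsBang)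
    (h2 : Γ₂.IsBang) : Γ.IsBang := by
  intro i A hi
  rcases h i with h | h | h
  · exact h1 i A (h.1.trans hi)
  · exact h2 i A (h.2.trans hi)
  · exact h1 i A (h.1.trans hi)

theorem Ctx.Split.le_left {Γ Γ₁ Γ₂ : Ctx α} (h : Γ.Split Γ₁ Γ₂) (h2 : Γ₂.IsBang) : Γ.Le Γ₁ := by
  intro i
  rcases h i with h | h | h
  · rw [h.1]; exact Ctx.Le.refl Γ i
  · exact Or.inr ⟨h.1, fun A hA => h2 i A (h.2.trans hA)⟩
  · rw [h.1]; exact Ctx.Le.refl Γ i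

theorem Ctx.Split.le_right {Γ Γ₁ Γ₂ : Ctx α} (h : Γ.Split Γ₁ Γ₂) (h1 : Γ₁.IsBang) : Γ.Le Γ₂ :=
  h.symm.le_left h1

/-- Values that do not start with a `let`. -/
inductive Term.Simple : Term α K → Prop
  | var (i : ℕ) (A : Ty α) : Simple (var i A)
  | const (c : K) (A : Ty α) : Simple (const c A)
  | star (n : ℕ) : Simple (star n)
  | lam (n : ℕ) (A : Ty α) (M : Term α K) : Simple (lam n A M)
  | pair (n : ℕ) {V W : Term α K} (hV : Simple V) (hW : Simple W) : Simple (pair n V W)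

theorem Term.Simple.value {V : Term α K} (hV : V.Simple) : V.Value := by
  induction hV with
  | pair n _ _ ihV ihW => exact .pair n ihV ihW
  | _ => constructor

/-- A simple value of type `!A` has a context of the form `!Δ`. -/
theorem Term.Simple.isBang {V : Term α K} (hV : V.Simple) :
    ∀ {Γ : Ctx α} {A : Ty α}, Typed cty Γ V (Ty.bang A) → Γ.IsBang := by
  induction hV with
  | var i A =>
    intro Γ B h
    cases h with
    | var hi hΓ h =>
      intro j C hj
      by_cases hji : j = i
      · subst hji
        cases hi.symm.trans hj
        exact h.exists_bang
      · exact hΓ j C hji hj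
  | const c A => intro Γ B h; cases h with | const hΓ h => exact hΓ
  | star n =>
    intro Γ B h
    generalize Ty.bang B = X at h
    cases h with | star hΓ n => exact hΓ
  | lam n A M =>
    intro Γ B h
    generalize hX : Ty.bang B = X at h
    cases h with
    | lam hM => cases hX
    | lamBang hΓ n hM => exact hΓ
  | pair n _ _ ihV ihW =>
    intro Γ A h
    generalize hX : Ty.bang A = X at h
    cases h with
    | pair hΓ _ hM hN =>
      rcases n with _ | n
      · cases hX
      · exact Ctx.IsBang.of_split hΓ (ihV hM) (ihW hN)

/-- The substitution of `V`, cast to the required types, for the variable `0`, and of `σ` for the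
other ones. -/
def consSubst (V : Term α K) (σ : ℕ → Ty α → Term α K) : ℕ → Ty α → Term α K
  | 0 => fun A => V.castTo A
  | i + 1 => σ i

theorem subst₁_eq (V M : Term α K) : Term.subst₁ V M = M.subst (consSubst V Term.var) := by
  unfold Term.subst₁
  congr 1
  funext i A
  rcases i with _ | i <;> rfl

theorem subst₂_eq (V W M : Term α K) :
    Term.subst₂ V W M = M.subst (consSubst W (consSubst V Term.var)) := by
  unfold Term.subst₂
  congr 1
  funext i A
  rcases i with _ | _ | i <;> rfl

theorem ValSubst.id (Γ : Ctx α) : ValSubst cty Γ Γ Term.var fun j => j := by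
  refine ⟨⟨fun {i A C} hi hA => .refl (.var ((Ctx.restrict_of (p := fun j => j = i) rfl).trans hi)
    ?_ hA), fun {j A} hj hA => ⟨A, hj, hA⟩⟩, fun i A => .var i A, fun _ _ _ => rfl⟩
  intro j C hj hC
  obtain ⟨hC', hp⟩ := Ctx.restrict_some hC
  exact C.notBang_or.resolve_left fun hn => hj (hp hn)

/-- The new variable takes the linear variables of `Γ` outside `Γ₁`, and the owners of the others
are shifted. If `A` has the form `!B`, then `hA` makes `Γ₂` a context `!Δ'`, so the new variable has
nothing to own, as required. -/
theorem ValSubst.cons {Δ Γ Γ₁ Γ₂ : Ctx α} {σ : ℕ → Ty α → Term α K} {own : ℕ → ℕ}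
    (h : ValSubst cty Δ Γ₁ σ own) (hs : Γ.Split Γ₁ Γ₂) {V : Term α K} (hV : V.Value) {A : Ty α}
    (hVA : Typed cty Γ₂ V A) (hA : A.NotBang ∨ Γ₂.IsBang) :
    ∃ own', ValSubst cty (Δ.cons (some A)) Γ (consSubst V σ) own' := by
  classical
  have key : ∀ {Γ' : Ctx α} {p q : ℕ → Prop}, (∀ {j B}, Γ' j = some B → Γ j = some B) →
      (∀ {j B}, Γ j = some B → B.NotBang → p j → Γ' j = some B ∧ q j) →
      (∀ {j B}, Γ' j = some B → B.NotBang → q j → p j) →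
      (Γ.restrict p).Le (Γ'.restrict q) := by
    intro Γ' p q h1 h2 h3 j
    cases hj : Γ'.restrict q j with
    | some B =>
      obtain ⟨hj', hq⟩ := Ctx.restrict_some hj
      refine Or.inl ⟨B, B, ?_, rfl, Ty.Sub.refl B⟩
      rcases B.notBang_or with hB | ⟨B, rfl⟩
      · exact (Ctx.restrict_of (h3 hj' hB (hq hB))).trans (h1 hj')
      · exact Ctx.restrict_bang _ (h1 hj')
    | none =>
      refine Or.inr ⟨rfl, fun B hB => B.notBang_or.resolve_left fun hn => ?_⟩
      obtain ⟨hj', hp⟩ := Ctx.restrict_some hB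
      obtain ⟨h4, h5⟩ := h2 hj' hn (hp hn)
      cases ((Ctx.restrict_of h5).trans h4).symm.trans hj
  refine ⟨fun j => if Γ₁ j = none then 0 else own j + 1,
    ⟨⟨fun {i B C} hi hB => ?_, fun {j B} hj hB => ?_⟩, fun i B => ?_, fun {i B C D} hi hB hC => ?_⟩⟩
  · rcases i with _ | i
    · cases hi
      refine AxEq.mono (.refl (hVA.castTo hB)) ?_
      have : Γ₂.restrict (fun _ => True) = Γ₂ := by
        funext j; exact Ctx.restrict_of trivial
      rw [← this]
      refine key hs.some_right (fun {j B} hj hB hp => ⟨?_, trivial⟩) (fun {j B} hj hB _ => ?_)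
      · rcases hs j with h | h | h
        · rw [h.1] at hp; simp [hj] at hp
        · exact h.2.trans hj
        · exact h.2.1.trans hj
      · rcases hs j with h | h | ⟨-, h2, C, hC⟩
        · cases h.2.symm.trans hj
        · simp [h.1]
        · cases (h2.symm.trans hj).symm.trans hC; exact hB.elim
    · refine AxEq.mono (h.eq (i := i) hi hB) ?_
      refine key hs.some_left (fun {j B} hj hB hp => ?_) (fun {j B} hj hB hq => ?_)
      · by_cases hn : Γ₁ j = none
        · simp [hn] at hp
        · simp only [hn, if_false, Nat.add_right_cancel_iff] at hp
          refine ⟨?_, hp⟩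
          rcases hs j with h | h | h
          · exact h.1.trans hj
          · exact absurd h.1 hn
          · exact h.1.trans hj
      · simp [hj, hq]
  · by_cases hn : Γ₁ j = none
    · simp only [hn, if_true]
      refine ⟨A, rfl, hA.resolve_right fun hb => ?_⟩
      rcases hs j with h | h | h
      · cases (h.1.symm.trans hn).symm.trans hj
      · obtain ⟨C, rfl⟩ := hb j B (h.2.trans hj)
        exact hB
      · cases (h.1.symm.trans hn).symm.trans hj
    · simp only [hn, if_false]
      refine h.own (j := j) ?_ hB
      rcases hs j with h | h | h
      · exact h.1.trans hj
      · exact absurd h.1 hn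
      · exact h.1.trans hj
  · rcases i with _ | i
    · exact hV.castTo B
    · exact h.value i B
  · rcases i with _ | i
    · cases hi; exact hVA.castTo_castTo hB D
    · exact h.cast (i := i) hi hB hC

/-- The condition `hA` cannot be dropped: `let * = y in *^1` is a value of type `!1` over the linear
variable `y : 1`, and it must not be substituted for a variable that is used twice or never. This is
why β is available without further thought only for values in `Term.Simple`. -/
theorem Typed.subst₁ {Γ Γ₁ Γ₂ : Ctx α} {A B : Ty α} {M V : Term α K} (hs : Γ.Split Γ₁ Γ₂)
    (hM : Typed cty (Γ₁.cons (some A)) M B) (hV : V.Value) (hVA : Typed cty Γ₂ V A)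
    (hA : A.NotBang ∨ Γ₂.IsBang) : Typed cty Γ (Term.subst₁ V M) B := by
  rw [subst₁_eq]
  obtain ⟨own, h⟩ := (ValSubst.id Γ₁).cons hs hV hVA hA
  exact hM.subst h.toSubstEq

theorem Typed.subst₂ {Γ Γ₁ Γ₂ Δ₁ Δ₂ : Ctx α} {A B C : Ty α} {M V W : Term α K}
    (hs : Γ.Split Γ₁ Γ₂) (hs' : Γ₁.Split Δ₁ Δ₂)
    (hM : Typed cty ((Γ₂.cons (some A)).cons (some B)) M C)
    (hV : V.Value) (hVA : Typed cty Δ₁ V A) (hA : A.NotBang ∨ Δ₁.IsBang)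
    (hW : W.Value) (hWB : Typed cty Δ₂ W B) (hB : B.NotBang ∨ Δ₂.IsBang) :
    Typed cty Γ (Term.subst₂ V W M) C := by
  rw [subst₂_eq]
  obtain ⟨h1, h2⟩ := hs.assoc hs'.symm
  have h3 : (Δ₁.join Γ₂).Split Γ₂ Δ₁ := h2.symm
  obtain ⟨own, h⟩ := (ValSubst.id Γ₂).cons h3 hV hVA hA
  obtain ⟨own', h'⟩ := h.cons h1.symm hW hWB hB
  exact hM.subst h'.toSubstEq

end ValueSubstitution

/-! ### Strengthening -/

section Strengthening
variable {α : Type u} {K : Type w} {cty : K → Ty α}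

/-- The context without its innermost variable. -/
def Ctx.tail (Γ : Ctx α) : Ctx α := fun i => Γ (i + 1)

theorem Ctx.Split.tail {Γ Γ₁ Γ₂ : Ctx α} (h : Γ.Split Γ₁ Γ₂) : Γ.tail.Split Γ₁.tail Γ₂.tail :=
  fun i => h (i + 1)

/-- The context of `M` in which `M.rename ρ` has the context `Γ`. -/
def Ctx.comap (ρ : ℕ → ℕ) (Γ : Ctx α) : Ctx α := fun i => Γ (ρ i)

/-- A derivation is pulled back rule by rule. Injectivity enters at variables: the other variables
of the pulled-back context must map to other variables of `Γ`, whose types have the form `!D`. -/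
theorem Typed.of_rename {M : Term α K} : ∀ {Γ : Ctx α} {A : Ty α} {ρ : ℕ → ℕ},
    Function.Injective ρ → Typed cty Γ (M.rename ρ) A → Typed cty (Γ.comap ρ) M A := by
  have hcons : ∀ (Γ : Ctx α) (o : Option (Ty α)) (ρ : ℕ → ℕ),
      (Γ.cons o).comap (liftVar 1 ρ) = (Γ.comap ρ).cons o := by
    intro Γ o ρ
    funext i
    rcases i with _ | i
    · rfl
    · simp [Ctx.comap, liftVar, Ctx.cons]
  have lamCase : ∀ (Γ : Ctx α) (n : ℕ) (A C : Ty α) (M : Term α K) (ρ : ℕ → ℕ),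
      (∀ B, Typed cty (Γ.cons (some A)) (M.rename (liftVar 1 ρ)) B →
        Typed cty ((Γ.comap ρ).cons (some A)) M B) →
      Typed cty Γ (Term.lam n A (M.rename (liftVar 1 ρ))) C →
      Typed cty (Γ.comap ρ) (Term.lam n A M) C := by
    intro Γ n A C M ρ ih h
    generalize hL : Term.lam n A (M.rename (liftVar 1 ρ)) = L at h
    cases h with
    | lam hM => cases hL; exact .lam (ih _ hM)
    | lamBang hΓ n hM => cases hL; exact .lamBang (fun i => hΓ (ρ i)) _ (ih _ hM)
    | _ => cases hL
  induction M with
  | var i A =>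
    intro Γ B ρ hρ h
    cases h with
    | var hi hΓ h => exact .var hi (fun j C hj => hΓ (ρ j) C fun e => hj (hρ e)) h
  | const c A =>
    intro Γ B ρ hρ h
    cases h with | const hΓ h => exact .const (fun i => hΓ (ρ i)) h
  | star n =>
    intro Γ B ρ hρ h
    cases h with | star hΓ => exact .star (fun i => hΓ (ρ i)) n
  | lam n A M ih =>
    intro Γ B ρ hρ h
    exact lamCase Γ n A B M ρ
      (fun B hB => by rw [← hcons]; exact ih (liftVar_injective 1 hρ) hB) h
  | app M N ihM ihN =>
    intro Γ B ρ hρ h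
    cases h with
    | app hs hM hN => exact .app (fun i => hs (ρ i)) (ihM hρ hM) (ihN hρ hN)
  | pair n M N ihM ihN =>
    intro Γ B ρ hρ h
    cases h with
    | pair hs _ hM hN => exact .pair (fun i => hs (ρ i)) n (ihM hρ hM) (ihN hρ hN)
  | letPair n A B M N ihM ihN =>
    intro Γ C ρ hρ h
    cases h with
    | @letPair _ _ Γ₂ hs _ _ _ _ _ _ hM hN =>
      refine .letPair (fun i => hs (ρ i)) (ihM hρ hM) ?_
      have h := ihN (liftVar_injective 2 hρ) hN
      rw [liftVar_two] at h
      rw [hcons, hcons] at h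
      exact h
  | letUnit M N ihM ihN =>
    intro Γ B ρ hρ h
    cases h with
    | letUnit hs hM hN => exact .letUnit (fun i => hs (ρ i)) (ihM hρ hM) (ihN hρ hN)

theorem Typed.lam_inv {Γ : Ctx α} {n : ℕ} {A C : Ty α} {M : Term α K}
    (h : Typed cty Γ (Term.lam n A M) C) :
    ∃ B, C = Ty.bangs n (Ty.lolli A B) ∧ (n = 0 ∨ Γ.IsBang) ∧
      Typed cty (Γ.cons (some A)) M B := by
  generalize hL : Term.lam n A M = L at h
  cases h with
  | lam hM => cases hL; exact ⟨_, rfl, Or.inl rfl, hM⟩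
  | lamBang hΓ n hM => cases hL; exact ⟨_, rfl, Or.inr hΓ, hM⟩
  | _ => cases hL

/-- A variable of a type that is not of the form `!A` is declared in all contexts of a term. -/
theorem Typed.linear_used {Γ : Ctx α} {M : Term α K} {A : Ty α} (h : Typed cty Γ M A) :
    ∀ {j : ℕ} {X : Ty α}, Γ j = some X → X.NotBang →
      ∀ {Δ : Ctx α} {B : Ty α}, Typed cty Δ M B → ∃ Y, Δ j = some Y := by
  have hb : ∀ {Γ : Ctx α}, Γ.IsBang → ∀ {j X}, Γ j = some X → X.NotBang → False := by
    intro Γ hΓ j X hj hX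
    obtain ⟨B, rfl⟩ := hΓ j X hj
    exact hX
  have hsp : ∀ {Γ Γ₁ Γ₂ : Ctx α}, Γ.Split Γ₁ Γ₂ → ∀ {j X}, Γ j = some X →
      Γ₁ j = some X ∨ Γ₂ j = some X := by
    intro Γ Γ₁ Γ₂ hs j X hj
    rcases hs j with h | h | h
    · exact Or.inl (h.1.trans hj)
    · exact Or.inr (h.2.trans hj)
    · exact Or.inl (h.1.trans hj)
  induction h with
  | @var Γ i A B hi hΓ h =>
    intro j X hj hX Δ C h'
    by_cases hji : j = i
    · cases h' with | var hi' _ _ => exact ⟨_, hji ▸ hi'⟩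
    · obtain ⟨D, rfl⟩ := hΓ j X hji hj
      exact hX.elim
  | const hΓ h => intro j X hj hX Δ C h'; exact (hb hΓ hj hX).elim
  | star hΓ n => intro j X hj hX Δ C h'; exact (hb hΓ hj hX).elim
  | lam hM ih =>
    intro j X hj hX Δ C h'
    obtain ⟨B, -, -, hM'⟩ := h'.lam_inv
    exact ih (j := j + 1) hj hX hM'
  | lamBang hΓ n hM ih => intro j X hj hX Δ C h'; exact (hb hΓ hj hX).elim
  | app hs hM hN ihM ihN =>
    intro j X hj hX Δ C h'
    cases h' with
    | app hs' hM' hN' =>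
      rcases hsp hs hj with h | h
      · obtain ⟨Y, hY⟩ := ihM h hX hM'; exact ⟨Y, hs'.some_left hY⟩
      · obtain ⟨Y, hY⟩ := ihN h hX hN'; exact ⟨Y, hs'.some_right hY⟩
  | pair hs n hM hN ihM ihN =>
    intro j X hj hX Δ C h'
    cases h' with
    | pair hs' _ hM' hN' =>
      rcases hsp hs hj with h | h
      · obtain ⟨Y, hY⟩ := ihM h hX hM'; exact ⟨Y, hs'.some_left hY⟩
      · obtain ⟨Y, hY⟩ := ihN h hX hN'; exact ⟨Y, hs'.some_right hY⟩
  | letPair hs hM hN ihM ihN =>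
    intro j X hj hX Δ C h'
    cases h' with
    | letPair hs' hM' hN' =>
      rcases hsp hs hj with h | h
      · obtain ⟨Y, hY⟩ := ihM h hX hM'; exact ⟨Y, hs'.some_left hY⟩
      · obtain ⟨Y, hY⟩ := ihN (j := j + 2) h hX hN'; exact ⟨Y, hs'.some_right hY⟩
  | letUnit hs hM hN ihM ihN =>
    intro j X hj hX Δ C h'
    cases h' with
    | letUnit hs' hM' hN' =>
      rcases hsp hs hj with h | h
      · obtain ⟨Y, hY⟩ := ihM h hX hM'; exact ⟨Y, hs'.some_left hY⟩
      · obtain ⟨Y, hY⟩ := ihN h hX hN'; exact ⟨Y, hs'.some_right hY⟩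

theorem Ctx.map_comap {ρ : ℕ → ℕ} (hρ : Function.Injective ρ) (Γ : Ctx α) (i : ℕ) :
    (Γ.comap ρ).map ρ (ρ i) = Γ (ρ i) := Ctx.map_apply hρ (Γ.comap ρ) i

/-- A linear variable outside the range of `ρ` would, by `Typed.linear_used`, be declared in every
context of the renamed term, but the image of the pulled-back context does not declare it. -/
theorem Typed.le_map_comap {Γ : Ctx α} {M : Term α K} {A : Ty α} {ρ : ℕ → ℕ}
    (hρ : Function.Injective ρ) (h : Typed cty Γ (M.rename ρ) A) :
    Γ.Le ((Γ.comap ρ).map ρ) := by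
  intro j
  by_cases hj : ∃ i, ρ i = j
  · obtain ⟨i, rfl⟩ := hj
    rw [Ctx.map_comap hρ]
    exact Ctx.Le.refl Γ (ρ i)
  · have hn := Ctx.map_of_not_mem (Γ.comap ρ) hj
    refine Or.inr ⟨hn, fun X hX => X.notBang_or.resolve_left fun hX' => ?_⟩
    obtain ⟨Y, hY⟩ := h.linear_used hX hX' ((h.of_rename hρ).rename hρ)
    cases hn.symm.trans hY

theorem Typed.of_rename_succ {Γ : Ctx α} {M : Term α K} {A : Ty α}
    (h : Typed cty Γ (M.rename fun i => i + 1) A) :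
    Γ.Le (Γ.tail.cons none) ∧ Typed cty Γ.tail M A := by
  have hi : Function.Injective (fun i : ℕ => i + 1) := add_left_injective 1
  have h1 := h.le_map_comap hi
  rw [Ctx.map_succ] at h1
  exact ⟨h1, h.of_rename hi⟩

end Strengthening

/-! ### Convertible terms -/

section Convertible
variable {α : Type u} {K : Type w} {cty : K → Ty α}

theorem Typed.let₁ {Γ Γ₁ Γ₂ : Ctx α} (hs : Γ.Split Γ₁ Γ₂) {A B : Ty α} {M N : Term α K}
    (hN : Typed cty (Γ₁.cons (some A)) N B) (hM : Typed cty Γ₂ M A) :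
    Typed cty Γ ((Pat.var A).bind M N) B := .app hs (.lam hN) hM

theorem Ctx.comap_cons (Γ : Ctx α) (o : Option (Ty α)) (ρ : ℕ → ℕ) :
    (Γ.cons o).comap (liftVar 1 ρ) = (Γ.comap ρ).cons o := by
  funext i
  rcases i with _ | i
  · rfl
  · simp [Ctx.comap, liftVar, Ctx.cons]

theorem swapVar_one_one_injective : Function.Injective (swapVar 1 1) := by
  intro i j h
  unfold swapVar at h
  split_ifs at h <;> omega

theorem Term.rename_swapVar_swapVar (M : Term α K) :
    (M.rename (swapVar 1 1)).rename (swapVar 1 1) = M := by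
  rw [Term.rename_rename]
  convert M.rename_id using 2
  funext i
  unfold swapVar
  split_ifs <;> omega

theorem Ctx.map_swapVar (Γ : Ctx α) (o o' : Option (Ty α)) :
    ((Γ.cons o).cons o').map (swapVar 1 1) = (Γ.cons o').cons o := by
  funext i
  have h := Ctx.map_apply swapVar_one_one_injective ((Γ.cons o).cons o') (swapVar 1 1 i)
  have e : swapVar 1 1 (swapVar 1 1 i) = i := by unfold swapVar; split_ifs <;> omega
  rw [e] at h
  rw [h]
  rcases i with _ | _ | i <;> rfl

theorem Typed.rename_swapVar {Γ : Ctx α} {o o' : Option (Ty α)} {M : Term α K} {C : Ty α}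
    (h : Typed cty ((Γ.cons o).cons o') M C) :
    Typed cty ((Γ.cons o').cons o) (M.rename (swapVar 1 1)) C := by
  rw [← Ctx.map_swapVar]
  exact h.rename swapVar_one_one_injective

/-- If the left part does not use the innermost variable linearly, then the right part may have it
in any case: either it has it already, or the type is of the form `!B` and the variable is weakened
in. -/
theorem Ctx.Split.cons_le_right {Γ Γ₁ Γ₂ : Ctx α} {A : Ty α}
    (h : (Γ.cons (some A)).Split Γ₁ Γ₂) (h1 : ∀ X, Γ₁ 0 = some X → ∃ B, X = Ty.bang B) :
    (Γ₂.tail.cons (some A)).Le Γ₂ := by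
  intro i
  rcases i with _ | i
  · rcases h 0 with h0 | h0 | h0
    · obtain ⟨B, rfl⟩ := h1 A h0.1
      exact Or.inr ⟨h0.2, by rintro X ⟨⟩; exact ⟨B, rfl⟩⟩
    · exact Or.inl ⟨A, A, rfl, h0.2, Ty.Sub.refl A⟩
    · exact Or.inl ⟨A, A, rfl, h0.2.1, Ty.Sub.refl A⟩
  · exact Ctx.Le.refl Γ₂ (i + 1)

theorem Ctx.Le.bang_of_none {Γ Γ' : Ctx α} (h : Γ.Le Γ') {i : ℕ} (hi : Γ' i = none) :
    ∀ X, Γ i = some X → ∃ B, X = Ty.bang B := by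
  rcases h i with ⟨A, B, -, hB, -⟩ | h
  · cases hi.symm.trans hB
  · exact h.2

/-- Two terms are convertible at the type `A` if they have this type in the same contexts, where
they are axiomatically equivalent. -/
def Conv (cty : K → Ty α) (A : Ty α) (M N : Term α K) : Prop :=
  ∀ Γ, (Typed cty Γ M A ↔ Typed cty Γ N A) ∧ (Typed cty Γ M A → AxEq cty Γ M N A)

namespace Conv
variable {A B C : Ty α} {M M' N N' P P' : Term α K}

theorem refl (A : Ty α) (M : Term α K) : Conv cty A M M := fun _ => ⟨Iff.rfl, .refl⟩

theorem symm (h : Conv cty A M N) : Conv cty A N M :=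
  fun Γ => ⟨(h Γ).1.symm, fun hN => ((h Γ).2 ((h Γ).1.2 hN)).symm⟩

theorem trans (h : Conv cty A M N) (h' : Conv cty A N P) : Conv cty A M P :=
  fun Γ => ⟨(h Γ).1.trans (h' Γ).1, fun hM => ((h Γ).2 hM).trans ((h' Γ).2 ((h Γ).1.1 hM))⟩

theorem let₁ (hM : Conv cty A M M') (hN : Conv cty B N N') :
    Conv cty B ((Pat.var A).bind M N) ((Pat.var A).bind M' N') := by
  intro Γ
  refine ⟨⟨fun h => ?_, fun h => ?_⟩, fun h => ?_⟩ <;>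
  obtain ⟨Γ₁, Γ₂, hs, h1, h2⟩ := h.bind_var_inv
  · exact .let₁ hs ((hN _).1.1 h1) ((hM _).1.1 h2)
  · exact .let₁ hs ((hN _).1.2 h1) ((hM _).1.2 h2)
  · exact .app hs (.lam ((hN _).2 h1)) ((hM _).2 h2)

end Conv

/-- The result type alone leaves the argument type open; the annotation of `M` fixes it. -/
theorem Typed.app_iff {Γ : Ctx α} {A B : Ty α} {M N : Term α K} (hM : M.tyOf = Ty.lolli A B) :
    Typed cty Γ (Term.app M N) B ↔
      ∃ Γ₁ Γ₂, Γ.Split Γ₁ Γ₂ ∧ Typed cty Γ₁ M (Ty.lolli A B) ∧ Typed cty Γ₂ N A := by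
  refine ⟨fun h => ?_, fun ⟨_, _, hs, h1, h2⟩ => .app hs h1 h2⟩
  cases h with
  | app hs h1 h2 =>
    cases h1.tyOf_eq.symm.trans hM
    exact ⟨_, _, hs, h1, h2⟩

theorem Typed.pair_iff {Γ : Ctx α} {n : ℕ} {A B : Ty α} {M N : Term α K} :
    Typed cty Γ (Term.pair n M N) (Ty.bangs n (Ty.tensor A B)) ↔
      ∃ Γ₁ Γ₂, Γ.Split Γ₁ Γ₂ ∧ Typed cty Γ₁ M (Ty.bangs n A) ∧ Typed cty Γ₂ N (Ty.bangs n B) :=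
  ⟨fun h => h.pair_inv, fun ⟨_, _, hs, h1, h2⟩ => .pair hs n h1 h2⟩

theorem Typed.var_rest {Γ : Ctx α} {i : ℕ} {A B : Ty α} (h : Typed cty Γ (Term.var i A) B) :
    ∀ j C, j ≠ i → Γ j = some C → ∃ D, C = Ty.bang D := by
  cases h with | var _ hΓ _ => exact hΓ

/-- The body `G` uses just the two bound variables, so whatever else is in its context has a type
`!D` and can be absorbed by the context of `N`. -/
theorem Typed.let_let_var_iff {Γ : Ctx α} {A B C : Ty α} {M N G : Term α K}
    (hG : ∀ Γ, Typed cty Γ G C ↔ ∃ Γ₁ Γ₂, Γ.Split Γ₁ Γ₂ ∧ Typed cty Γ₁ (Term.var 1 A) A ∧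
      Typed cty Γ₂ (Term.var 0 B) B) :
    Typed cty Γ ((Pat.var A).bind M ((Pat.var B).bind (N.rename fun i => i + 1) G)) C ↔
      ∃ Γ₁ Γ₂, Γ.Split Γ₁ Γ₂ ∧ Typed cty Γ₁ M A ∧ Typed cty Γ₂ N B := by
  constructor
  · intro h
    obtain ⟨Γ₁, Γ₂, hs, h1, hM⟩ := h.bind_var_inv
    obtain ⟨E₁, E₂, hE, h2, hN⟩ := h1.bind_var_inv
    obtain ⟨D₁, D₂, hD, h3, h4⟩ := (hG _).1 h2
    have hb : E₁.tail.IsBang := by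
      refine Ctx.IsBang.of_split hD.tail.tail ?_ ?_
      · exact fun i X hX => h3.var_rest (i + 2) X (by omega) hX
      · exact fun i X hX => h4.var_rest (i + 2) X (by omega) hX
    exact ⟨Γ₂, Γ₁, hs.symm, hM, (hN.of_rename_succ.2).mono (hE.tail.le_right hb)⟩
  · rintro ⟨Γ₁, Γ₂, hs, hM, hN⟩
    refine .let₁ hs.symm (.let₁ ((Ctx.Split.empty_left Γ₂).cons_left (some A)) ?_
      hN.rename_succ) hM
    exact (hG _).2 ⟨_, _, ValueJudgment.split_pair A B, (Typed.var_zero (Ty.Sub.refl A)).rename_succ,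
      .var_zero (Ty.Sub.refl B)⟩

/-- `M N` is convertible to `let x = M in let y = N in x y`. -/
theorem Conv.app_let_let {A B : Ty α} {M : Term α K} (hM : M.tyOf = Ty.lolli A B) (N : Term α K) :
    Conv cty B (Term.app M N) ((Pat.var (Ty.lolli A B)).bind M
      ((Pat.var A).bind (N.rename fun i => i + 1)
        (Term.app (Term.var 1 (Ty.lolli A B)) (Term.var 0 A)))) := by
  intro Γ
  have h : Typed cty Γ (Term.app M N) B ↔ Typed cty Γ ((Pat.var (Ty.lolli A B)).bind M
      ((Pat.var A).bind (N.rename fun i => i + 1)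
        (Term.app (Term.var 1 (Ty.lolli A B)) (Term.var 0 A)))) B := by
    rw [Typed.let_let_var_iff (fun Γ => Typed.app_iff rfl), Typed.app_iff hM]
  exact ⟨h, fun hl => (AxEq.letApp (h.1 hl) hl).symm⟩

/-- `⟨M, N⟩^n` is convertible to `let x = M in let y = N in ⟨x, y⟩^n`. -/
theorem Conv.pair_let_let (n : ℕ) (A B : Ty α) (M N : Term α K) :
    Conv cty (Ty.bangs n (Ty.tensor A B)) (Term.pair n M N) ((Pat.var (Ty.bangs n A)).bind M
      ((Pat.var (Ty.bangs n B)).bind (N.rename fun i => i + 1)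
        (Term.pair n (Term.var 1 (Ty.bangs n A)) (Term.var 0 (Ty.bangs n B))))) := by
  intro Γ
  have h : Typed cty Γ (Term.pair n M N) (Ty.bangs n (Ty.tensor A B)) ↔
      Typed cty Γ ((Pat.var (Ty.bangs n A)).bind M
      ((Pat.var (Ty.bangs n B)).bind (N.rename fun i => i + 1)
        (Term.pair n (Term.var 1 (Ty.bangs n A)) (Term.var 0 (Ty.bangs n B)))))
          (Ty.bangs n (Ty.tensor A B)) := by
    rw [Typed.let_let_var_iff (fun Γ => Typed.pair_iff), Typed.pair_iff]
  exact ⟨h, fun hl => (AxEq.letTensor (h.1 hl) hl).symm⟩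

/-- The axiom supplies the equation; the content is that both sides have the same contexts, also
from right to left. -/
theorem Conv.let_assoc (A B C : Ty α) (M N P : Term α K) :
    Conv cty C ((Pat.var B).bind ((Pat.var A).bind M N) P)
      ((Pat.var A).bind M ((Pat.var B).bind N (P.rename (liftVar 1 fun i => i + 1)))) := by
  have hi : Function.Injective (fun i : ℕ => i + 1) := add_left_injective 1
  intro Γ
  have h1 : Typed cty Γ ((Pat.var B).bind ((Pat.var A).bind M N) P) C → Typed cty Γ
      ((Pat.var A).bind M ((Pat.var B).bind N (P.rename (liftVar 1 fun i => i + 1)))) C := by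
    intro h
    obtain ⟨Γ₁, Γ₂, hs, hP, h1⟩ := h.bind_var_inv
    obtain ⟨Δ₁, Δ₂, hs', hN, hM⟩ := h1.bind_var_inv
    obtain ⟨h3, h4⟩ := hs.symm.assoc hs'.symm
    refine .let₁ h3.symm (.let₁ (h4.symm.cons_right (some A)) ?_ hN) hM
    have := hP.rename (liftVar_injective 1 hi)
    rwa [Ctx.map_cons hi, Ctx.map_succ] at this
  have h2 : Typed cty Γ
      ((Pat.var A).bind M ((Pat.var B).bind N (P.rename (liftVar 1 fun i => i + 1)))) C →
      Typed cty Γ ((Pat.var B).bind ((Pat.var A).bind M N) P) C := by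
    intro h
    obtain ⟨Γ₁, Γ₂, hs, h1, hM⟩ := h.bind_var_inv
    obtain ⟨E₁, E₂, hE, hP, hN⟩ := h1.bind_var_inv
    have hle := hP.le_map_comap (liftVar_injective 1 hi)
    have hP' := hP.of_rename (liftVar_injective 1 hi)
    rw [Ctx.comap_cons] at hP' hle
    rw [Ctx.map_cons hi, Ctx.map_succ] at hle
    -- The shifted `P` does not mention the variable bound to `M`, so if this variable went to the
    -- context of `P`, its type has the form `!D` and it can be given to `N`.
    have hN' := hN.mono (hE.cons_le_right (hle.bang_of_none (i := 1) rfl))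
    obtain ⟨h3, h4⟩ := hs.assoc hE.tail
    exact .let₁ h3 hP' (.let₁ h4 hN' hM)
  exact ⟨⟨h1, h2⟩, fun h => AxEq.letAssoc (.var B) (.var A) h (h1 h)⟩

theorem Conv.lam_let {A B C : Ty α} {V : Term α K} (hV : V.Value) (P : Term α K) :
    Conv cty (Ty.lolli B C)
      (Term.lam 0 B ((Pat.var A).bind (V.rename fun i => i + 1) (P.rename (swapVar 1 1))))
      ((Pat.var A).bind V (Term.lam 0 B P)) := by
  intro Γ
  have h1 : Typed cty Γ
      (Term.lam 0 B ((Pat.var A).bind (V.rename fun i => i + 1) (P.rename (swapVar 1 1))))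
      (Ty.lolli B C) → Typed cty Γ ((Pat.var A).bind V (Term.lam 0 B P)) (Ty.lolli B C) := by
    intro h
    obtain ⟨C', hC, -, h⟩ := h.lam_inv
    cases hC
    obtain ⟨E₁, E₂, hE, hP, hVA⟩ := h.bind_var_inv
    obtain ⟨hle, hVA⟩ := hVA.of_rename_succ
    have hle := (hE.symm.cons_le_right (hle.bang_of_none rfl)).cons (Ty.Sub.refl A)
    have hP := (hP.mono hle).rename_swapVar
    rw [Term.rename_swapVar_swapVar] at hP
    exact .let₁ hE.tail (.lam hP) hVA
  have h2 : Typed cty Γ ((Pat.var A).bind V (Term.lam 0 B P)) (Ty.lolli B C) → Typed cty Γ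
      (Term.lam 0 B ((Pat.var A).bind (V.rename fun i => i + 1) (P.rename (swapVar 1 1))))
      (Ty.lolli B C) := by
    intro h
    obtain ⟨Γ₁, Γ₂, hs, hP, hVA⟩ := h.bind_var_inv
    obtain ⟨C', hC, -, hP⟩ := hP.lam_inv
    cases hC
    exact .lam (.let₁ (hs.cons_left (some B)) hP.rename_swapVar hVA.rename_succ)
  exact ⟨⟨h1, h2⟩, fun h => (AxEq.letLam hV (h1 h) h).symm⟩

theorem Conv.let_var (A : Ty α) (M : Term α K) :
    Conv cty A ((Pat.var A).bind M (Term.var 0 A)) M := by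
  intro Γ
  have h1 : Typed cty Γ ((Pat.var A).bind M (Term.var 0 A)) A → Typed cty Γ M A := by
    intro h
    obtain ⟨Γ₁, Γ₂, hs, h1, hM⟩ := h.bind_var_inv
    exact hM.mono (hs.le_right fun i X hX => h1.var_rest (i + 1) X (by omega) hX)
  have h2 : Typed cty Γ M A → Typed cty Γ ((Pat.var A).bind M (Term.var 0 A)) A := fun h =>
    .let₁ (Ctx.Split.empty_left Γ) (.var_zero (Ty.Sub.refl A)) h
  exact ⟨⟨h1, h2⟩, fun h => AxEq.etaLet h (h1 h)⟩

theorem Conv.app {A B : Ty α} {M M' N N' : Term α K} (hM : Conv cty (Ty.lolli A B) M M')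
    (hN : Conv cty A N N') (h : M.tyOf = Ty.lolli A B) (h' : M'.tyOf = Ty.lolli A B) :
    Conv cty B (Term.app M N) (Term.app M' N') := by
  intro Γ
  refine ⟨?_, fun hl => ?_⟩
  · rw [Typed.app_iff h, Typed.app_iff h']
    simp only [(hM _).1, (hN _).1]
  · obtain ⟨Γ₁, Γ₂, hs, h1, h2⟩ := (Typed.app_iff h).1 hl
    exact .app hs ((hM _).2 h1) ((hN _).2 h2)

theorem Conv.pair {n : ℕ} {A B : Ty α} {M M' N N' : Term α K} (hM : Conv cty (Ty.bangs n A) M M')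
    (hN : Conv cty (Ty.bangs n B) N N') :
    Conv cty (Ty.bangs n (Ty.tensor A B)) (Term.pair n M N) (Term.pair n M' N') := by
  intro Γ
  refine ⟨?_, fun hl => ?_⟩
  · rw [Typed.pair_iff, Typed.pair_iff]
    simp only [(hM _).1, (hN _).1]
  · obtain ⟨Γ₁, Γ₂, hs, h1, h2⟩ := Typed.pair_iff.1 hl
    exact .pair hs n ((hM _).2 h1) ((hN _).2 h2)

/-- A context of the renamed term is pulled back, the equation is used there, and the result is
pushed forward and weakened by the variables outside the range of `ρ`. -/
theorem Conv.rename {A : Ty α} {M N : Term α K} (h : Conv cty A M N) {ρ : ℕ → ℕ}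
    (hρ : Function.Injective ρ) : Conv cty A (M.rename ρ) (N.rename ρ) := by
  have key : ∀ {M N : Term α K}, Conv cty A M N → ∀ {Γ}, Typed cty Γ (M.rename ρ) A →
      AxEq cty Γ (M.rename ρ) (N.rename ρ) A := by
    intro M N h Γ hM
    exact (((h _).2 (hM.of_rename hρ)).rename hρ).mono (hM.le_map_comap hρ)
  exact fun Γ => ⟨⟨fun hM => (key h hM).typed.2, fun hN => (key h.symm hN).typed.2⟩, key h⟩

/-- Function and argument are named by `let`, the bindings are reassociated, and the names are
removed again. The same scheme gives the rules for pairs below. -/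
theorem Conv.app_let {A B D : Ty α} (M : Term α K) {L : Term α K} (hL : L.tyOf = Ty.lolli A B)
    (N : Term α K) :
    Conv cty B (Term.app ((Pat.var D).bind M L) N)
      ((Pat.var D).bind M (Term.app L (N.rename fun i => i + 1))) := by
  refine (Conv.app_let_let (A := A) (M := (Pat.var D).bind M L) hL N).trans
    ((Conv.let_assoc _ _ _ _ _ _).trans ((Conv.refl D M).let₁ (Conv.symm ?_)))
  have := Conv.app_let_let (cty := cty) hL (N.rename fun i => i + 1)
  simpa [Pat.bind_rename, Term.rename, Term.rename_rename, Pat.size, liftVar] using this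

/-- Stronger than the exchange axiom, which asks both terms to be values: `let x = V in let y = N in
P` is `(let x = V in λy. P) N`, and the binding of the value `V` moves under the `λ`. -/
theorem Conv.let_swap {A B C : Ty α} {V : Term α K} (hV : V.Value) (N : Term α K) {P : Term α K}
    (hP : P.tyOf = C) :
    Conv cty C ((Pat.var A).bind V ((Pat.var B).bind (N.rename fun i => i + 1) P))
      ((Pat.var B).bind N
        ((Pat.var A).bind (V.rename fun i => i + 1) (P.rename (swapVar 1 1)))) := by
  have hP' : Term.tyOf (Term.lam 0 B P) = Ty.lolli B C := by rw [← hP]; rfl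
  refine (Conv.app_let (D := A) V hP' N).symm.trans
    ((Conv.lam_let hV P).symm.app (Conv.refl B N) hP' ?_)
  simp only [Term.tyOf, Pat.bind, Ty.bangs, Ty.right, Term.tyOf_rename, hP]

theorem Conv.pair_let_left (n : ℕ) (A B D : Ty α) (M N P : Term α K) :
    Conv cty (Ty.bangs n (Ty.tensor A B)) (Term.pair n ((Pat.var D).bind M N) P)
      ((Pat.var D).bind M (Term.pair n N (P.rename fun i => i + 1))) := by
  refine (Conv.pair_let_let n A B _ _).trans
    ((Conv.let_assoc _ _ _ _ _ _).trans ((Conv.refl D M).let₁ (Conv.symm ?_)))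
  have := Conv.pair_let_let (cty := cty) n A B N (P.rename fun i => i + 1)
  simpa [Pat.bind_rename, Term.rename, Term.rename_rename, Pat.size, liftVar] using this

theorem Term.rename_skip_swap (N : Term α K) :
    (N.rename (liftVar 1 fun i => i + 1)).rename (swapVar 1 1) = N.rename fun i => i + 1 := by
  rw [Term.rename_rename]
  congr 1
  funext i
  rcases i with _ | i <;> simp [liftVar, swapVar]

/-- The function is evaluated before the argument, so `M` can move to the front only past a value;
`Conv.let_swap` does this. -/
theorem Conv.app_let_right {A B D : Ty α} (M N : Term α K) {V : Term α K} (hV : V.Value)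
    (hVA : V.tyOf = Ty.lolli A B) :
    Conv cty B (Term.app V ((Pat.var D).bind M N))
      ((Pat.var D).bind M (Term.app (V.rename fun i => i + 1) N)) := by
  refine (Conv.app_let_let (A := A) hVA _).trans ?_
  rw [Pat.bind_rename]
  refine ((Conv.refl _ V).let₁ (Conv.let_assoc _ _ _ _ _ _)).trans
    ((Conv.let_swap (C := B) hV M rfl).trans ((Conv.refl D M).let₁ ?_))
  have := (Conv.app_let_let (cty := cty) (A := A) (B := B) (M := V.rename fun i => i + 1)
    (by rw [Term.tyOf_rename, hVA]) N).symm
  rw [Pat.bind_rename, Pat.size, Pat.size, Term.rename_skip_swap]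
  simpa [Term.rename, liftVar, swapVar] using this

theorem Conv.pair_let_right (n : ℕ) (A B D : Ty α) (M N : Term α K) {V : Term α K}
    (hV : V.Value) :
    Conv cty (Ty.bangs n (Ty.tensor A B)) (Term.pair n V ((Pat.var D).bind M N))
      ((Pat.var D).bind M (Term.pair n (V.rename fun i => i + 1) N)) := by
  refine (Conv.pair_let_let n A B _ _).trans ?_
  rw [Pat.bind_rename]
  refine ((Conv.refl _ V).let₁ (Conv.let_assoc _ _ _ _ _ _)).trans
    ((Conv.let_swap hV M ?_).trans ((Conv.refl D M).let₁ ?_))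
  · simp [Pat.bind, Term.tyOf, Term.rename, Ty.right, Ty.bangs, Ty.unbang_bangs]
  have := (Conv.pair_let_let (cty := cty) n A B (V.rename fun i => i + 1) N).symm
  rw [Pat.bind_rename, Pat.size, Pat.size, Term.rename_skip_swap]
  simpa [Term.rename, liftVar, swapVar] using this

end Convertible

/-! ### Application of arrows to terms -/

section At
variable {α : Type u} {K : Type w} {cty : K → Ty α}

namespace ValueJudgment
variable {A B C : Ty α}

/-- `let x = M in V`. -/
def ap (V : ValueJudgment cty A B) (M : Term α K) : Term α K := (Pat.var A).bind M V.term

/-- The term of `V` with its variable `x^A` replaced by `s A`. -/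
def inst (V : ValueJudgment cty A B) (s : Ty α → Term α K) : Term α K := V.term.subst fun _ => s

theorem tyOf_ap (V : ValueJudgment cty A B) (M : Term α K) : (V.ap M).tyOf = B := V.typed.tyOf_eq

theorem value_ap (V : ValueJudgment cty A B) {M : Term α K} (hM : M.Value) : (V.ap M).Value :=
  .letVar A hM V.value

theorem subst_term (V : ValueJudgment cty A B) (σ : ℕ → Ty α → Term α K) :
    V.term.subst σ = V.inst (σ 0) := by
  refine V.typed.subst_ext ?_
  intro i D C hi _
  rcases i with _ | i
  · rfl
  · cases hi

theorem rename_term (V : ValueJudgment cty A B) (ρ : ℕ → ℕ) :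
    V.term.rename ρ = V.inst fun X => Term.var (ρ 0) X := by
  rw [Term.rename_eq_subst, subst_term]

theorem inst_var_zero (V : ValueJudgment cty A B) : (V.inst fun X => Term.var 0 X) = V.term := by
  rw [← V.rename_term fun i => i, Term.rename_id]

theorem rename_inst (V : ValueJudgment cty A B) (s : Ty α → Term α K) (ρ : ℕ → ℕ) :
    (V.inst s).rename ρ = V.inst fun X => (s X).rename ρ := Term.rename_subst _ _ _

theorem subst_inst (V : ValueJudgment cty A B) (s : Ty α → Term α K) (σ : ℕ → Ty α → Term α K) :
    (V.inst s).subst σ = V.inst fun X => (s X).subst σ := Term.subst_subst _ _ _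

/-- The term of an arrow has no free variable besides its argument, so renamings act on `M` only;
likewise for substitutions. -/
theorem rename_ap (V : ValueJudgment cty A B) (M : Term α K) (ρ : ℕ → ℕ) :
    (V.ap M).rename ρ = V.ap (M.rename ρ) := by
  unfold ValueJudgment.ap
  rw [Pat.bind_rename, rename_term]
  congr 1
  exact V.inst_var_zero

theorem subst_ap (V : ValueJudgment cty A B) (M : Term α K) (σ : ℕ → Ty α → Term α K) :
    (V.ap M).subst σ = V.ap (M.subst σ) := by
  unfold ValueJudgment.ap
  rw [Pat.bind_subst, subst_term]
  congr 1
  exact V.inst_var_zero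

/-- By `Typed.linear_used` the body of the `let` takes no linear variable of `Γ`, so its share of
the context can be handed to `M`. Hence arrows do not affect contexts. -/
theorem typed_ap_iff (V : ValueJudgment cty A B) {Γ : Ctx α} {M : Term α K} :
    Typed cty Γ (V.ap M) B ↔ Typed cty Γ M A := by
  refine ⟨fun h => ?_, fun h => .let₁ (Ctx.Split.empty_left Γ) V.typed h⟩
  obtain ⟨Γ₁, Γ₂, hs, h1, hM⟩ := h.bind_var_inv
  refine hM.mono (hs.le_right fun i X hX => X.notBang_or.resolve_left fun hn => ?_)
  obtain ⟨Y, hY⟩ := h1.linear_used (j := i + 1) hX hn V.typed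
  cases hY

theorem ap_congr {V V' : ValueJudgment cty A B}
    (h : AxEq cty (Ctx.single A) V.term V'.term B) {M M' : Term α K} (hM : Conv cty A M M') :
    Conv cty B (V.ap M) (V'.ap M') := by
  intro Γ
  refine ⟨by rw [V.typed_ap_iff, V'.typed_ap_iff, (hM Γ).1], fun hl => ?_⟩
  exact .app (Ctx.Split.empty_left Γ) (.lam h) ((hM Γ).2 (V.typed_ap_iff.1 hl))

theorem ap_let (V : ValueJudgment cty A B) (D : Ty α) (M N : Term α K) :
    Conv cty B (V.ap ((Pat.var D).bind M N)) ((Pat.var D).bind M (V.ap N)) := by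
  have h := Conv.let_assoc (cty := cty) D A B M N V.term
  rw [V.rename_term] at h
  have e := V.inst_var_zero
  simp only [liftVar] at h
  simp only [Nat.lt_one_iff, if_true, e] at h
  exact h

end ValueJudgment

end At

/-! ### Reduction to equivalent terms -/

section Reduction
variable {α : Type u} {K : Type w} {cty : K → Ty α}

/-- `M` is equivalent to `N` wherever it is typed. -/
def Red (cty : K → Ty α) (M N : Term α K) : Prop :=
  ∀ Γ A, Typed cty Γ M A → AxEq cty Γ M N A

namespace Red
variable {M M' N N' P : Term α K}

theorem refl (M : Term α K) : Red cty M M := fun _ _ h => .refl h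

theorem trans (h : Red cty M N) (h' : Red cty N P) : Red cty M P :=
  fun Γ A hM => (h Γ A hM).trans (h' Γ A (h Γ A hM).typed.2)

theorem app (hM : Red cty M M') (hN : Red cty N N') :
    Red cty (Term.app M N) (Term.app M' N') := by
  intro Γ A h
  cases h with | app hs h1 h2 => exact .app hs (hM _ _ h1) (hN _ _ h2)

theorem pair (n : ℕ) (hM : Red cty M M') (hN : Red cty N N') :
    Red cty (Term.pair n M N) (Term.pair n M' N') := by
  intro Γ A h
  cases h with | pair hs _ h1 h2 => exact .pair hs n (hM _ _ h1) (hN _ _ h2)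

theorem let₁ (A : Ty α) (hM : Red cty M M') (hN : Red cty N N') :
    Red cty ((Pat.var A).bind M N) ((Pat.var A).bind M' N') := by
  intro Γ B h
  obtain ⟨Γ₁, Γ₂, hs, h1, h2⟩ := h.bind_var_inv
  exact .app hs (.lam (hN _ _ h1)) (hM _ _ h2)

/-- β can erase variables, so that a reduct may be typed in more contexts than the redex. A common
reduct therefore gives convertibility only together with a comparison of contexts. -/
theorem conv {A : Ty α} (hM : Red cty M P) (hN : Red cty N P)
    (h : ∀ Γ, Typed cty Γ M A ↔ Typed cty Γ N A) : Conv cty A M N :=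
  fun Γ => ⟨h Γ, fun hl => (hM Γ A hl).trans (hN Γ A ((h Γ).1 hl)).symm⟩

theorem of_conv_tyOf {A : Ty α} (h : Conv cty A M N) (hM : M.tyOf = A) : Red cty M N := by
  intro Γ B hl
  cases hl.tyOf_eq.symm.trans hM
  exact (h Γ).2 hl

/-- Simple values satisfy the side condition of `Typed.subst₁`, so typing of the redex suffices. -/
theorem beta (A : Ty α) {V : Term α K} (hV : V.Simple) (M : Term α K) :
    Red cty ((Pat.var A).bind V M) (Term.subst₁ V M) := by
  intro Γ B h
  obtain ⟨Γ₁, Γ₂, hs, h1, h2⟩ := h.bind_var_inv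
  refine .betaLam hV.value h (Typed.subst₁ hs h1 hV.value h2 ?_)
  rcases A.notBang_or with hA | ⟨C, rfl⟩
  · exact Or.inl hA
  · exact Or.inr (hV.isBang h2)

theorem betaPair (n : ℕ) (A B : Ty α) {V W : Term α K} (hV : V.Simple) (hW : W.Simple)
    (M : Term α K) :
    Red cty (Term.letPair n A B (Term.pair n V W) M) (Term.subst₂ V W M) := by
  have key : ∀ {X : Ty α} {U : Term α K} {Γ : Ctx α}, U.Simple → Typed cty Γ U X →
      X.NotBang ∨ Γ.IsBang := by
    intro X U Γ hU hX
    rcases X.notBang_or with hA | ⟨C, rfl⟩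
    · exact Or.inl hA
    · exact Or.inr (hU.isBang hX)
  intro Γ C h
  have h' := h
  cases h with
  | letPair hs h1 h2 =>
    obtain ⟨Δ₁, Δ₂, hs', h3, h4⟩ := h1.pair_inv
    exact .betaPair hV.value hW.value h'
      (Typed.subst₂ hs hs' h2 hV.value h3 (key hV h3) hW.value h4 (key hW h4))

theorem betaUnit (M : Term α K) : Red cty (Term.letUnit (Term.star 0) M) M := by
  intro Γ C h
  have h' := h
  cases h with
  | letUnit hs h1 h2 =>
    refine .betaUnit h' (h2.mono (hs.le_right ?_))
    generalize Ty.unit = X at h1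
    cases h1 with | star hΓ _ => exact hΓ

theorem force_thunk (M : Term α K) : Red cty (Term.app (Term.thunk M) (Term.star 0)) M := by
  refine (beta Ty.unit (.star 0) _).trans ?_
  have : Term.subst₁ (Term.star 0) (Term.letUnit (Term.var 0 Ty.unit)
      (M.rename fun i => i + 1)) = Term.letUnit (Term.star 0) M := by
    simp only [Term.subst₁, Term.subst, Term.subst_rename, Term.castTo, Ty.bangCount]
    rw [Term.subst_var]
  rw [this]
  exact betaUnit M

theorem ap {A B : Ty α} (V : ValueJudgment cty A B) {v : Term α K} (hv : v.Simple) :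
    Red cty (V.ap v) (V.inst v.castTo) := by
  have := beta (cty := cty) A hv V.term
  rw [subst₁_eq, V.subst_term] at this
  exact this

theorem ap_var {A B : Ty α} (V : ValueJudgment cty A B) (i : ℕ) :
    Red cty (V.ap (Term.var i A)) (V.inst fun X => Term.var i X) := Red.ap V (.var i A)

end Red

end Reduction

/-! ### Values at variables -/

section Rules
variable {α : Type u} {K : Type w} {cty : K → Ty α}

open Term

/-- The contexts of a pair are given by a product of predicates over splittings. That this product
is commutative and associative, with `Ctx.IsBang` as a unit for typability, settles the context part
of the rules for the structural arrows. -/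
theorem Ctx.exists_split_comm {Γ : Ctx α} {p q : Ctx α → Prop} :
    (∃ Γ₁ Γ₂, Γ.Split Γ₁ Γ₂ ∧ p Γ₁ ∧ q Γ₂) ↔ ∃ Γ₁ Γ₂, Γ.Split Γ₁ Γ₂ ∧ q Γ₁ ∧ p Γ₂ :=
  ⟨fun ⟨_, _, hs, h1, h2⟩ => ⟨_, _, hs.symm, h2, h1⟩, fun ⟨_, _, hs, h1, h2⟩ => ⟨_, _, hs.symm, h2, h1⟩⟩

theorem Ctx.exists_split_assoc {Γ : Ctx α} {p q r : Ctx α → Prop} :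
    (∃ Γ₁ Γ₂, Γ.Split Γ₁ Γ₂ ∧ p Γ₁ ∧ ∃ Δ₁ Δ₂, Γ₂.Split Δ₁ Δ₂ ∧ q Δ₁ ∧ r Δ₂) ↔
      ∃ Γ₁ Γ₂, Γ.Split Γ₁ Γ₂ ∧ (∃ Δ₁ Δ₂, Γ₁.Split Δ₁ Δ₂ ∧ p Δ₁ ∧ q Δ₂) ∧ r Γ₂ := by
  constructor
  · rintro ⟨Γ₁, Γ₂, hs, h1, Δ₁, Δ₂, hs', h2, h3⟩
    obtain ⟨h4, h5⟩ := hs.symm.assoc hs'.symm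
    exact ⟨_, _, h4.symm, ⟨_, _, h5.symm, h1, h2⟩, h3⟩
  · rintro ⟨Γ₁, Γ₂, hs, ⟨Δ₁, Δ₂, hs', h2, h3⟩, h1⟩
    obtain ⟨h4, h5⟩ := hs.assoc hs'
    exact ⟨_, _, h4, h2, _, _, h5, h3, h1⟩

theorem Typed.star_iff {Γ : Ctx α} {n : ℕ} :
    Typed cty Γ (Term.star n : Term α K) (Ty.bangs n Ty.unit) ↔ Γ.IsBang := by
  refine ⟨fun h => ?_, fun h => .star h n⟩
  generalize Ty.bangs n Ty.unit = X at h
  cases h with | star hΓ _ => exact hΓ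

theorem Ctx.exists_split_isBang_left {Γ : Ctx α} {M : Term α K} {A : Ty α} :
    (∃ Γ₁ Γ₂, Γ.Split Γ₁ Γ₂ ∧ Γ₁.IsBang ∧ Typed cty Γ₂ M A) ↔ Typed cty Γ M A :=
  ⟨fun ⟨_, _, hs, h1, h2⟩ => h2.mono (hs.le_right h1),
    fun h => ⟨_, _, Ctx.Split.empty_left Γ, Ctx.IsBang.empty, h⟩⟩

theorem Ctx.exists_split_isBang_right {Γ : Ctx α} {M : Term α K} {A : Ty α} :
    (∃ Γ₁ Γ₂, Γ.Split Γ₁ Γ₂ ∧ Typed cty Γ₁ M A ∧ Γ₂.IsBang) ↔ Typed cty Γ M A :=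
  ⟨fun ⟨_, _, hs, h1, h2⟩ => h1.mono (hs.le_left h2),
    fun h => ⟨_, _, Ctx.Split.empty_right Γ, h, Ctx.IsBang.empty⟩⟩

theorem Typed.force_iff {Γ : Ctx α} {A : Ty α} {M : Term α K} (hM : M.tyOf = Ty.comp A) :
    Typed cty Γ (Term.app M (Term.star 0)) A ↔ Typed cty Γ M (Ty.comp A) := by
  rw [Typed.app_iff hM]
  have : ∀ Γ : Ctx α, Typed cty Γ (Term.star 0 : Term α K) Ty.unit ↔ Γ.IsBang :=
    fun Γ => Typed.star_iff (n := 0)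
  simp only [this]
  exact Ctx.exists_split_isBang_right

theorem Typed.pair_zero_iff {Γ : Ctx α} {A B : Ty α} {M N : Term α K} :
    Typed cty Γ (Term.pair 0 M N) (Ty.tensor A B) ↔
      ∃ Γ₁ Γ₂, Γ.Split Γ₁ Γ₂ ∧ Typed cty Γ₁ M A ∧ Typed cty Γ₂ N B := Typed.pair_iff (n := 0)

theorem castTo_pair (n : ℕ) (A B : Ty α) (V W : Term α K) :
    (Term.pair n V W).castTo (Ty.bangs n (Ty.tensor A B)) =
      Term.pair n (V.castTo (Ty.bangs n A)) (W.castTo (Ty.bangs n B)) := by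
  simp [Term.castTo, Ty.bangCount_bangs, Ty.bangCount, Ty.core, Ty.left, Ty.right]

theorem castTo_star (n : ℕ) :
    (Term.star n : Term α K).castTo (Ty.bangs n Ty.unit) = Term.star n := by
  simp [Term.castTo, Ty.bangCount_bangs, Ty.bangCount]

theorem liftSubst_one_zero (σ : ℕ → Ty α → Term α K) :
    subst.liftSubst 1 σ 0 = fun X => var 0 X := rfl

/-- The substitution of simple values for the components of a pair. -/
theorem Red.ap_pair {n : ℕ} {A B C : Ty α}
    {T : ValueJudgment cty (Ty.bangs n (Ty.tensor A B)) C} {G : Term α K}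
    (hT : T.term = letPair n A B (var 0 (Ty.bangs n (Ty.tensor A B))) G) {v w : Term α K}
    (hv : v.Simple) (hw : w.Simple) (hv' : v.castTo (Ty.bangs n A) = v)
    (hw' : w.castTo (Ty.bangs n B) = w) {R : Term α K}
    (hR : Term.subst₂ v w (G.subst (Term.subst.liftSubst 2 fun _ => (Term.pair n v w).castTo)) = R) :
    Red cty (T.ap (Term.pair n v w)) R := by
  refine (Red.ap T (.pair n hv hw)).trans ?_
  rw [ValueJudgment.inst, hT]
  simp only [Term.subst]
  rw [castTo_pair, hv', hw', ← hR]
  exact Red.betaPair n A B hv hw _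


section VariableRules
variable {n m : ℕ} {A B C A' B' : Ty α}

/-- Here and below an arrow `T` enters only through its underlying term, and the index `n` is
arbitrary: `n = 0` yields the rule for the arrow of the theorem, `n = 1` the rule for its image
under `L`. -/
theorem conv_ap_tensor
    {T : ValueJudgment cty (Ty.bangs n (Ty.tensor A B)) (Ty.bangs n (Ty.tensor A' B'))}
    {V : ValueJudgment cty (Ty.bangs n A) (Ty.bangs n A')}
    {W : ValueJudgment cty (Ty.bangs n B) (Ty.bangs n B')}
    (hT : T.term = letPair n A B (var 0 (Ty.bangs n (Ty.tensor A B)))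
      (pair n (V.term.rename fun i => i + 1) W.term)) :
    Conv cty (Ty.bangs n (Ty.tensor A' B'))
      (T.ap (pair n (var 1 (Ty.bangs n A)) (var 0 (Ty.bangs n B))))
      (pair n (V.ap (var 1 (Ty.bangs n A))) (W.ap (var 0 (Ty.bangs n B)))) := by
  refine Red.conv (P := pair n (V.inst fun X => var 1 X) (W.inst fun X => var 0 X))
    (Red.ap_pair hT (.var _ _) (.var _ _) rfl rfl ?_) (Red.pair n (Red.ap_var V 1)
      (Red.ap_var W 0)) fun Γ => ?_
  · simp [subst₂, subst, subst.liftSubst, ValueJudgment.rename_term, ValueJudgment.subst_inst,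
      ValueJudgment.subst_term, castTo]
  · simp only [ValueJudgment.typed_ap_iff, Typed.pair_iff]

theorem conv_ap_assoc
    {T : ValueJudgment cty (Ty.bangs n (Ty.tensor A (Ty.tensor B C)))
      (Ty.bangs n (Ty.tensor (Ty.tensor A B) C))}
    (hT : T.term = letPair n A (Ty.tensor B C) (var 0 (Ty.bangs n (Ty.tensor A (Ty.tensor B C))))
      (letPair n B C (var 0 (Ty.bangs n (Ty.tensor B C)))
        (pair n (pair n (var 3 (Ty.bangs n A)) (var 1 (Ty.bangs n B)))
          (var 0 (Ty.bangs n C))))) :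
    Conv cty (Ty.bangs n (Ty.tensor (Ty.tensor A B) C))
      (T.ap (pair n (var 2 (Ty.bangs n A)) (pair n (var 1 (Ty.bangs n B)) (var 0 (Ty.bangs n C)))))
      (pair n (pair n (var 2 (Ty.bangs n A)) (var 1 (Ty.bangs n B)))
        (var 0 (Ty.bangs n C))) := by
  refine Red.conv (P := (pair n (pair n (var 2 (Ty.bangs n A)) (var 1 (Ty.bangs n B)))
        (var 0 (Ty.bangs n C)))) ((Red.ap_pair hT (.var _ _) (.pair n (.var _ _) (.var _ _)) rfl
      (by rw [castTo_pair]; rfl)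
      (R := letPair n B C (pair n (var 1 (Ty.bangs n B)) (var 0 (Ty.bangs n C)))
        (pair n (pair n (var 4 (Ty.bangs n A)) (var 1 (Ty.bangs n B)))
          (var 0 (Ty.bangs n C)))) ?_).trans ?_) (Red.refl _) fun Γ => ?_
  · simp [subst₂, subst, subst.liftSubst, rename, castTo, Ty.bangCount_bangs, Ty.bangCount,
      Ty.core, Ty.left, Ty.right]
  -- The first β-step exposes the inner pair to the inner `let`; this is the second one.
  · refine (Red.betaPair n B C (.var _ _) (.var _ _) _).trans ?_
    simp only [subst₂, subst, castTo]
    exact Red.refl _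
  · simp only [ValueJudgment.typed_ap_iff, Typed.pair_iff]
    exact Ctx.exists_split_assoc

theorem conv_ap_leftUnitor
    {T : ValueJudgment cty (Ty.bangs n (Ty.tensor Ty.unit A)) (Ty.bangs n A)}
    (hT : T.term = letPair n Ty.unit A (var 0 (Ty.bangs n (Ty.tensor Ty.unit A)))
      (letUnit (var 1 Ty.unit) (var 0 (Ty.bangs n A)))) :
    Conv cty (Ty.bangs n A) (T.ap (pair n (star n) (var 0 (Ty.bangs n A))))
      (var 0 (Ty.bangs n A)) := by
  refine Red.conv (P := var 0 (Ty.bangs n A)) ((Red.ap_pair hT (.star _) (.var _ _)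
    (castTo_star n) rfl (R := letUnit (star 0) (var 0 (Ty.bangs n A))) ?_).trans (Red.betaUnit _))
    (Red.refl _) fun Γ => ?_
  · simp [subst₂, subst, subst.liftSubst, castTo, Ty.bangCount]
  · simp only [ValueJudgment.typed_ap_iff, Typed.pair_iff, Typed.star_iff]
    exact Ctx.exists_split_isBang_left

theorem conv_ap_rightUnitor
    {T : ValueJudgment cty (Ty.bangs n (Ty.tensor A Ty.unit)) (Ty.bangs n A)}
    (hT : T.term = letPair n A Ty.unit (var 0 (Ty.bangs n (Ty.tensor A Ty.unit)))
      (letUnit (var 0 Ty.unit) (var 1 (Ty.bangs n A)))) :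
    Conv cty (Ty.bangs n A) (T.ap (pair n (var 0 (Ty.bangs n A)) (star n)))
      (var 0 (Ty.bangs n A)) := by
  refine Red.conv (P := var 0 (Ty.bangs n A)) ((Red.ap_pair hT (.var _ _) (.star _) rfl
    (castTo_star n) (R := letUnit (star 0) (var 0 (Ty.bangs n A))) ?_).trans (Red.betaUnit _))
    (Red.refl _) fun Γ => ?_
  · simp [subst₂, subst, subst.liftSubst, castTo, Ty.bangCount]
  · simp only [ValueJudgment.typed_ap_iff, Typed.pair_iff, Typed.star_iff]
    exact Ctx.exists_split_isBang_right

theorem conv_ap_braiding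
    {T : ValueJudgment cty (Ty.bangs n (Ty.tensor A B)) (Ty.bangs n (Ty.tensor B A))}
    (hT : T.term = letPair n A B (var 0 (Ty.bangs n (Ty.tensor A B)))
      (pair n (var 0 (Ty.bangs n B)) (var 1 (Ty.bangs n A)))) :
    Conv cty (Ty.bangs n (Ty.tensor B A))
      (T.ap (pair n (var 1 (Ty.bangs n A)) (var 0 (Ty.bangs n B))))
      (pair n (var 0 (Ty.bangs n B)) (var 1 (Ty.bangs n A))) := by
  refine Red.conv (P := pair n (var 0 (Ty.bangs n B)) (var 1 (Ty.bangs n A)))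
    (Red.ap_pair hT (.var _ _) (.var _ _) rfl rfl ?_) (Red.refl _) fun Γ => ?_
  · simp [subst₂, subst, subst.liftSubst, castTo]
  · simp only [ValueJudgment.typed_ap_iff, Typed.pair_iff]
    exact Ctx.exists_split_comm

/-- The coherence maps and their inverses. -/
theorem conv_ap_repair (hA : Ty.bangs n A = Ty.bangs m A') (hB : Ty.bangs n B = Ty.bangs m B')
    {T : ValueJudgment cty (Ty.bangs n (Ty.tensor A B)) (Ty.bangs m (Ty.tensor A' B'))}
    (hT : T.term = letPair n A B (var 0 (Ty.bangs n (Ty.tensor A B)))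
      (pair m (var 1 (Ty.bangs m A')) (var 0 (Ty.bangs m B')))) :
    Conv cty (Ty.bangs m (Ty.tensor A' B'))
      (T.ap (pair n (var 1 (Ty.bangs n A)) (var 0 (Ty.bangs n B))))
      (pair m (var 1 (Ty.bangs m A')) (var 0 (Ty.bangs m B'))) := by
  refine Red.conv (P := pair m (var 1 (Ty.bangs m A')) (var 0 (Ty.bangs m B')))
    (Red.ap_pair hT (.var _ _) (.var _ _) rfl rfl ?_) (Red.refl _) fun Γ => ?_
  · simp [subst₂, subst, subst.liftSubst, castTo]
  · simp only [ValueJudgment.typed_ap_iff, Typed.pair_iff]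
    rw [hA, hB]

/-- A retyped variable, at a pair. -/
theorem conv_ap_cast_pair
    {T : ValueJudgment cty (Ty.bangs n (Ty.tensor A B)) (Ty.bangs m (Ty.tensor A B))}
    {V : ValueJudgment cty (Ty.bangs n A) (Ty.bangs m A)}
    {W : ValueJudgment cty (Ty.bangs n B) (Ty.bangs m B)}
    (hT : T.term = var 0 (Ty.bangs m (Ty.tensor A B))) (hV : V.term = var 0 (Ty.bangs m A))
    (hW : W.term = var 0 (Ty.bangs m B)) :
    Conv cty (Ty.bangs m (Ty.tensor A B))
      (T.ap (pair n (var 1 (Ty.bangs n A)) (var 0 (Ty.bangs n B))))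
      (pair m (V.ap (var 1 (Ty.bangs n A))) (W.ap (var 0 (Ty.bangs n B)))) := by
  refine Red.conv (P := pair m (var 1 (Ty.bangs m A)) (var 0 (Ty.bangs m B)))
    ((Red.ap T (.pair n (.var _ _) (.var _ _))).trans ?_)
    (Red.pair m ((Red.ap_var V 1).trans ?_) ((Red.ap_var W 0).trans ?_)) fun Γ => ?_
  · rw [ValueJudgment.inst, hT]
    simp only [subst, castTo, Ty.bangCount_bangs, Ty.core_bangs, Ty.bangCount, Ty.core, Ty.left,
      Ty.right]
    exact Red.refl _
  · rw [ValueJudgment.inst, hV]; exact Red.refl _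
  · rw [ValueJudgment.inst, hW]; exact Red.refl _
  · simp only [ValueJudgment.typed_ap_iff, Typed.pair_iff]

/-- The first alternative covers `ε` and `δ` at the unit type, the second `d_1` and its promotion.
-/
theorem conv_ap_cast_star {T : ValueJudgment cty (Ty.bangs n Ty.unit) (Ty.bangs m Ty.unit)}
    (hT : T.term = var 0 (Ty.bangs m Ty.unit) ∨ T.term = letUnit (var 0 Ty.unit) (star m)) :
    Conv cty (Ty.bangs m Ty.unit) (T.ap (star n)) (star m) := by
  refine Red.conv (P := star m) ((Red.ap T (.star n)).trans ?_) (Red.refl _) fun Γ => ?_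
  · rw [ValueJudgment.inst]
    rcases hT with hT | hT
    · rw [hT]
      simp only [subst, castTo, Ty.bangCount_bangs, Ty.bangCount]
      exact Red.refl _
    · rw [hT]
      simp only [subst, castTo, Ty.bangCount]
      exact Red.betaUnit _
  · simp only [ValueJudgment.typed_ap_iff, Typed.star_iff]

theorem conv_force_unit :
    Conv cty A (app ((ValueJudgment.unit (cty := cty) A).ap (var 0 A)) (star 0)) (var 0 A) := by
  refine Red.conv (P := var 0 A) (((Red.ap_var _ 0).app (Red.refl _)).trans ?_) (Red.refl _)
    fun Γ => ?_
  · rw [ValueJudgment.inst_var_zero]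
    exact Red.force_thunk _
  · rw [Typed.force_iff (ValueJudgment.tyOf_ap _ _), ValueJudgment.typed_ap_iff]

theorem conv_force_mult :
    Conv cty A (app ((ValueJudgment.mult (cty := cty) A).ap (var 0 (Ty.comp (Ty.comp A)))) (star 0))
      (app (app (var 0 (Ty.comp (Ty.comp A))) (star 0)) (star 0)) := by
  refine Red.conv (P := app (app (var 0 (Ty.comp (Ty.comp A))) (star 0)) (star 0))
    (((Red.ap_var _ 0).app (Red.refl _)).trans ?_) (Red.refl _) fun Γ => ?_
  · rw [ValueJudgment.inst_var_zero]
    exact Red.force_thunk _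
  · rw [Typed.force_iff (ValueJudgment.tyOf_ap _ _), ValueJudgment.typed_ap_iff,
      Typed.force_iff rfl, Typed.force_iff rfl]

theorem conv_force_star (V : ValueJudgment cty A (Ty.comp B)) :
    Conv cty B (app (V.star.ap (var 0 (Ty.comp A))) (Term.star 0))
      (app (V.ap (app (var 0 (Ty.comp A)) (Term.star 0))) (Term.star 0)) := by
  refine Red.conv
    (P := (Pat.var A).bind (app (var 0 (Ty.comp A)) (Term.star 0)) (app V.term (Term.star 0)))
    (((Red.ap_var _ 0).app (Red.refl _)).trans ?_) ?_ fun Γ => ?_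
  · rw [ValueJudgment.inst_var_zero]
    exact Red.force_thunk _
  -- On the right, `*` is moved into the body of `let x = y * in V`.
  · exact Red.of_conv_tyOf (Conv.app_let (B := B) _ V.typed.tyOf_eq _)
      (by rw [tyOf, ValueJudgment.tyOf_ap]; rfl)
  · rw [Typed.force_iff (ValueJudgment.tyOf_ap _ _), ValueJudgment.typed_ap_iff,
      Typed.force_iff (ValueJudgment.tyOf_ap _ _), ValueJudgment.typed_ap_iff, Typed.force_iff rfl]

theorem conv_force_strength :
    Conv cty (Ty.tensor A B)
      (app ((ValueJudgment.strength (cty := cty) A B).ap (pair 0 (var 1 A) (var 0 (Ty.comp B))))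
        (star 0))
      (pair 0 (var 1 A) (app (var 0 (Ty.comp B)) (star 0))) := by
  have h : Red cty ((ValueJudgment.strength (cty := cty) A B).ap
      (pair 0 (var 1 A) (var 0 (Ty.comp B))))
      (thunk (pair 0 (var 1 A) (app (var 0 (Ty.comp B)) (star 0)))) := by
    refine Red.ap_pair (n := 0) rfl (.var _ _) (.var _ _) rfl rfl ?_
    simp [subst₂, thunk, subst, subst.liftSubst, castTo, rename]
  refine Red.conv ((h.app (Red.refl _)).trans (Red.force_thunk _)) (Red.refl _) fun Γ => ?_
  rw [Typed.force_iff (ValueJudgment.tyOf_ap _ _), ValueJudgment.typed_ap_iff]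
  simp only [Typed.pair_zero_iff, Typed.force_iff (cty := cty) (M := var 0 (Ty.comp B)) rfl]

theorem conv_app_lolliMap (V : ValueJudgment cty A B) (W : ValueJudgment cty A' B') :
    Conv cty B' (app ((V.lolliMap W).ap (var 1 (Ty.lolli B A'))) (var 0 A))
      (W.ap (app (var 1 (Ty.lolli B A')) (V.ap (var 0 A)))) := by
  have h : Red cty ((V.lolliMap W).ap (var 1 (Ty.lolli B A')))
      (lam 0 A ((Pat.var A').bind (app (var 2 (Ty.lolli B A')) V.term) W.term)) := by
    refine (Red.ap_var _ 1).trans ?_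
    rw [ValueJudgment.inst]
    simp only [ValueJudgment.lolliMap, Pat.bind, subst, ValueJudgment.subst_term,
      liftSubst_one_zero, ValueJudgment.inst_var_zero]
    simp only [subst.liftSubst, rename]
    exact Red.refl _
  have h2 : subst₁ (var 0 A) ((Pat.var A').bind (app (var 2 (Ty.lolli B A')) V.term) W.term) =
      W.ap (app (var 1 (Ty.lolli B A')) V.term) := by
    simp only [subst₁, ValueJudgment.ap, Pat.bind, subst, ValueJudgment.subst_term,
      liftSubst_one_zero, castTo, ValueJudgment.inst_var_zero]
  refine Red.conv (P := W.ap (app (var 1 (Ty.lolli B A')) V.term))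
    ((h.app (Red.refl _)).trans ((Red.beta A (.var 0 A) _).trans ?_))
    (Red.let₁ _ (Red.app (Red.refl _) ((Red.ap_var V 0).trans ?_)) (Red.refl _)) fun Γ => ?_
  · rw [h2]; exact Red.refl _
  · rw [ValueJudgment.inst_var_zero]; exact Red.refl _
  · rw [Typed.app_iff (ValueJudgment.tyOf_ap _ _), ValueJudgment.typed_ap_iff, Typed.app_iff rfl]
    simp only [ValueJudgment.typed_ap_iff]

theorem conv_force_Phi (V : ValueJudgment cty A (Ty.lolli B C)) :
    Conv cty C (app (V.Phi.ap (pair 0 (var 1 A) (var 0 B))) (star 0))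
      (app (V.ap (var 1 A)) (var 0 B)) := by
  have h : Red cty (V.Phi.ap (pair 0 (var 1 A) (var 0 B)))
      (thunk (letPair 0 A B (pair 0 (var 1 A) (var 0 B))
        (app (V.inst fun X => var 1 X) (var 0 B)))) := by
    refine (Red.ap _ (.pair 0 (.var _ _) (.var _ _))).trans ?_
    rw [ValueJudgment.inst]
    simp only [ValueJudgment.Phi, thunk, subst, rename, ValueJudgment.rename_term,
      ValueJudgment.subst_inst, ValueJudgment.rename_inst, subst.liftSubst]
    simp [rename, castTo, liftVar, Ty.bangCount, Ty.core, Ty.left, Ty.right, Ty.bangs]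
    exact Red.refl _
  refine Red.conv (P := app (V.inst fun X => var 1 X) (var 0 B))
    ((h.app (Red.refl _)).trans ((Red.force_thunk _).trans
      ((Red.betaPair 0 A B (.var _ _) (.var _ _) _).trans ?_)))
    (Red.app (Red.ap_var V 1) (Red.refl _)) fun Γ => ?_
  · simp only [subst₂, subst, ValueJudgment.subst_inst, castTo]
    exact Red.refl _
  · rw [Typed.force_iff (ValueJudgment.tyOf_ap _ _), ValueJudgment.typed_ap_iff,
      Typed.pair_zero_iff, Typed.app_iff (ValueJudgment.tyOf_ap _ _)]
    simp only [ValueJudgment.typed_ap_iff]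

/-- `x : A ⊢ λ y. (let z = ⟨x, y⟩ in W) * : B ⊸ C`. -/
def ValueJudgment.curry (W : ValueJudgment cty (Ty.tensor A B) (Ty.comp C)) :
    ValueJudgment cty A (Ty.lolli B C) where
  term := lam 0 B (app (W.ap (pair 0 (var 1 A) (var 0 B))) (Term.star 0))
  value := .lam _ _ _
  typed := .lam ((Typed.force_iff (W.tyOf_ap _)).2 (W.typed_ap_iff.2 (Typed.pair_zero_iff.2
    ⟨_, _, ValueJudgment.split_pair A B, (Typed.var_zero (Ty.Sub.refl A)).rename_succ,
      .var_zero (Ty.Sub.refl B)⟩)))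

theorem conv_app_curry (W : ValueJudgment cty (Ty.tensor A B) (Ty.comp C)) :
    Conv cty C (app (W.curry.ap (var 1 A)) (var 0 B))
      (app (W.ap (pair 0 (var 1 A) (var 0 B))) (Term.star 0)) := by
  have h : Red cty (W.curry.ap (var 1 A))
      (lam 0 B (app (W.ap (pair 0 (var 2 A) (var 0 B))) (Term.star 0))) := by
    refine (Red.ap_var _ 1).trans ?_
    simp only [ValueJudgment.inst, ValueJudgment.curry, subst, ValueJudgment.subst_ap,
      subst.liftSubst]
    simp [rename]
    exact Red.refl _
  refine Red.conv (P := app (W.ap (pair 0 (var 1 A) (var 0 B))) (Term.star 0))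
    ((h.app (Red.refl _)).trans ((Red.beta B (.var 0 B) _).trans ?_)) (Red.refl _) fun Γ => ?_
  · simp only [subst₁, subst, ValueJudgment.subst_ap, castTo]
    exact Red.refl _
  · rw [Typed.force_iff (ValueJudgment.tyOf_ap _ _), ValueJudgment.typed_ap_iff,
      Typed.pair_zero_iff, Typed.app_iff (ValueJudgment.tyOf_ap _ _)]
    simp only [ValueJudgment.typed_ap_iff]

/-- `x : A ⊢ ⟨*, x⟩ : 1 ⊗ A`. -/
def ValueJudgment.leftUnitorInv (A : Ty α) : ValueJudgment cty A (Ty.tensor Ty.unit A) where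
  term := pair 0 (Term.star 0) (var 0 A)
  value := .pair _ (.star _) (.var _ _)
  typed := .pair (Ctx.Split.empty_left _) 0 (.star Ctx.IsBang.empty 0) (.var_zero (Ty.Sub.refl A))

theorem conv_ap_leftUnitorInv :
    Conv cty (Ty.tensor Ty.unit A) ((ValueJudgment.leftUnitorInv (cty := cty) A).ap (var 0 A))
      (pair 0 (star 0) (var 0 A)) := by
  refine Red.conv (Red.ap_var _ 0) ?_ fun Γ => ?_
  · rw [ValueJudgment.inst_var_zero]; exact Red.refl _
  · rw [ValueJudgment.typed_ap_iff, Typed.pair_zero_iff]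
    have : ∀ Γ : Ctx α, Typed cty Γ (Term.star 0 : Term α K) Ty.unit ↔ Γ.IsBang :=
      fun Γ => Typed.star_iff (n := 0)
    simp only [this]
    exact Ctx.exists_split_isBang_left.symm

theorem conv_ap_id (M : Term α K) :
    Conv cty A ((ValueJudgment.id (cty := cty) A).ap M) M := Conv.let_var A M

theorem conv_ap_comp (V : ValueJudgment cty A B) (W : ValueJudgment cty B C) (M : Term α K) :
    Conv cty C ((V.comp W).ap M) (W.ap (V.ap M)) := (W.ap_let A M V.term).symm

/-- For a value `V`, an application `V N` equals `let z = N in V z`. With `let * = u in *` for `N`,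
reassociation produces the left-hand side, while the η-rule of the unit type turns `N` into `u`. -/
theorem letUnit_app {V u : Term α K} (hV : V.Value) {Γ Γ₁ Γ₂ : Ctx α} (hs : Γ.Split Γ₁ Γ₂)
    (hu : Typed cty Γ₁ u Ty.unit) (h : Typed cty Γ₂ V (Ty.comp A)) :
    AxEq cty Γ (letUnit u (Term.app V (Term.star 0))) (Term.app V u) A := by
  have hVA := h.tyOf_eq
  have key : ∀ N, Conv cty A (Term.app V N) ((Pat.var Ty.unit).bind N
      (Term.app (V.rename fun i => i + 1) (Term.var 0 Ty.unit))) := fun N =>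
    ((Conv.refl _ V).app (Conv.let_var Ty.unit N).symm hVA hVA).trans
      (Conv.app_let_right N _ hV hVA)
  have hr : (Term.app (V.rename fun i => i + 1) (Term.var 0 Ty.unit)).rename
      (liftVar 1 fun i => i) = Term.app (V.rename fun i => i + 1) (Term.var 0 Ty.unit) := by
    rw [show liftVar 1 (fun i => i) = fun i => i from ?_, Term.rename_id]
    funext i
    rcases i with _ | i <;> simp [liftVar]
  have h1 := Typed.star (cty := cty) Ctx.IsBang.empty 0
  have h2 := (ValueJudgment.force_typed h)
  have h3 : AxEq cty Γ (letUnit u (Term.app V (Term.star 0))) _ A :=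
    .letUnit hs (.refl hu) ((key _ _).2 h2)
  have hu' : AxEq cty Γ₁ (letUnit u (Term.star 0)) u Ty.unit := by
    have := AxEq.etaUnit (n := 0) (N := u) (cty := cty) (Γ := Γ₁)
    rw [hu.castTo_self] at this
    exact this (.letUnit (Ctx.Split.empty_right _) hu h1) hu
  have h4 : Typed cty Γ (Term.app V (letUnit u (Term.star 0))) A :=
    .app hs.symm h hu'.typed.1
  have h5 := AxEq.letAssoc (.var Ty.unit) .unit ((key _ _).1.1 h4) (by
    simp only [Pat.size, Nat.add_zero]
    rw [hr]; exact h3.typed.2)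
  simp only [Pat.size, Nat.add_zero] at h5
  rw [hr] at h5
  exact h3.trans (h5.symm.trans (((key _ _).2 h4).symm.trans (.app hs.symm (.refl h) hu')))

/-- Two values of type `T A` are convertible if their elements are. -/
theorem Conv.of_force {V W : Term α K} (hV : V.Value) (hW : W.Value) (hVA : V.tyOf = Ty.comp A)
    (hWA : W.tyOf = Ty.comp A) (h : Conv cty A (Term.app V (Term.star 0)) (Term.app W (Term.star 0))) :
    Conv cty (Ty.comp A) V W := by
  -- A value `V` of type `1 ⊸ A` equals `λu. V u`, hence `λu. let * = u in V *`, which depends on `V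
  -- *` only.
  have key : ∀ {V : Term α K}, V.Value → ∀ {Γ}, Typed cty Γ V (Ty.comp A) →
      AxEq cty Γ (thunk (Term.app V (Term.star 0))) V (Ty.comp A) := by
    intro V hV Γ h
    have h1 := h.rename_succ
    have hs := (Ctx.Split.empty_left Γ).cons_left (some Ty.unit)
    have hu : Typed cty (Ctx.single Ty.unit) (Term.var 0 Ty.unit) Ty.unit :=
      .var_zero (Ty.Sub.refl _)
    have h2 : AxEq cty Γ _ _ (Ty.lolli Ty.unit A) := .lam (letUnit_app (hV.rename _) hs hu h1)
    refine h2.trans ?_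
    have h3 := AxEq.etaLam (n := 0) (A := Ty.unit) (B := A) hV (cty := cty) (Γ := Γ)
    rw [show V.castTo (Ty.lolli Ty.unit A) = V from h.castTo_self] at h3
    exact h3 (.lam (.app hs.symm h1 hu)) h
  intro Γ
  have h1 : Typed cty Γ V (Ty.comp A) ↔ Typed cty Γ W (Ty.comp A) := by
    rw [← Typed.force_iff hVA, ← Typed.force_iff hWA, (h Γ).1]
  exact ⟨h1, fun hl => (key hV hl).symm.trans
    (((h Γ).2 ((Typed.force_iff hVA).2 hl)).thunk.trans (key hW (h1.1 hl)))⟩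

end VariableRules

end Rules

/-! ### Arrows are determined at patterns -/

section Patterns
variable {α : Type u} {K : Type w} {cty : K → Ty α}

open Term

/-- Arrows with domain `A` are determined by their composition with `Γ ⊢ M : A`. -/
def Detects (cty : K → Ty α) (Γ : Ctx α) (M : Term α K) (A : Ty α) : Prop :=
  Typed cty Γ M A ∧ ∀ {B : Ty α} (V W : ValueJudgment cty A B),
    AxEq cty Γ (V.ap M) (W.ap M) B → AxEq cty (Ctx.single A) V.term W.term B

theorem ValueJudgment.ap_var_zero {A B : Ty α} (V : ValueJudgment cty A B) :
    AxEq cty (Ctx.single A) (V.ap (var 0 A)) V.term B := by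
  have := Red.ap_var V 0 (Ctx.single A) B (V.typed_ap_iff.2 (.var_zero (Ty.Sub.refl A)))
  rwa [ValueJudgment.inst_var_zero] at this

theorem Detects.var (A : Ty α) : Detects cty (Ctx.single A) (Term.var 0 A) A :=
  ⟨.var_zero (Ty.Sub.refl A), fun V W h => V.ap_var_zero.symm.trans (h.trans W.ap_var_zero)⟩

theorem Typed.rename_skip {Γ : Ctx α} {o : Option (Ty α)} {M : Term α K} {A : Ty α}
    (h : Typed cty (Γ.cons o) M A) :
    Typed cty ((Γ.cons none).cons o) (M.rename (liftVar 1 fun i => i + 1)) A := by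
  have hi : Function.Injective (fun i : ℕ => i + 1) := add_left_injective 1
  have := h.rename (liftVar_injective 1 hi)
  rwa [Ctx.map_cons hi, Ctx.map_succ] at this

theorem let_var_self (A : Ty α) (M : Term α K) :
    subst₁ (Term.var 0 A) (M.rename (liftVar 1 fun i => i + 1)) = M := by
  rw [subst₁, subst_rename]
  convert M.subst_var using 2
  funext i X
  rcases i with _ | i <;> simp [liftVar, castTo]

/-- The substitution that splits the variable `0` into a pair. -/
def pairSubst (n : ℕ) (A B : Ty α) : ℕ → Ty α → Term α K
  | 0, X => (Term.pair n (Term.var 1 (Ty.bangs n A)) (Term.var 0 (Ty.bangs n B))).castTo X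
  | i + 1, X => Term.var (i + 2) X

/-- The substitution of `*` for the variable `0`. -/
def starSubst (n : ℕ) : ℕ → Ty α → Term α K
  | 0, X => (Term.star n).castTo X
  | i + 1, X => Term.var (i + 1) X

/-- Write `M` as `let z = z in M`, expand the bound `z` by η into `let ⟨x, y⟩^n = z in ⟨x, y⟩^n`,
pull this binding out by associativity, and substitute the pair of variables for `z`. -/
theorem axEq_split_pair {Γ : Ctx α} {n : ℕ} {A B C : Ty α} {M : Term α K}
    (h : Typed cty (Γ.cons (some (Ty.bangs n (Ty.tensor A B)))) M C) :
    AxEq cty (Γ.cons (some (Ty.bangs n (Ty.tensor A B)))) M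
      (letPair n A B (Term.var 0 (Ty.bangs n (Ty.tensor A B)))
        ((M.subst (pairSubst n A B)).rename (liftVar 2 fun i => i + 1))) C := by
  set Z := Ty.bangs n (Ty.tensor A B) with hZ
  have hs : (Γ.cons (some Z)).Split (Γ.cons none) (Ctx.single Z) :=
    (Ctx.Split.empty_right Γ).cons_right (some Z)
  have hz : Typed cty (Ctx.single Z) (Term.var 0 Z) Z := .var_zero (Ty.Sub.refl Z)
  have h1 : Typed cty (Γ.cons (some Z))
      ((Pat.var Z).bind (Term.var 0 Z) (M.rename (liftVar 1 fun i => i + 1))) C :=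
    .let₁ hs h.rename_skip hz
  have e1 := Red.beta Z (.var 0 Z) _ _ _ h1
  rw [let_var_self] at e1
  have hp : Typed cty ((Ctx.empty.cons (some (Ty.bangs n A))).cons (some (Ty.bangs n B)))
      (Term.pair n (Term.var 1 (Ty.bangs n A)) (Term.var 0 (Ty.bangs n B))) Z :=
    .pair (ValueJudgment.split_pair _ _) n (Typed.var_zero (Ty.Sub.refl _)).rename_succ
      (.var_zero (Ty.Sub.refl _))
  have hl : Typed cty (Ctx.single Z) (letPair n A B (Term.var 0 Z)
      (Term.pair n (Term.var 1 (Ty.bangs n A)) (Term.var 0 (Ty.bangs n B)))) Z :=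
    .letPair (Ctx.Split.empty_right _) hz hp
  have e2 : AxEq cty (Γ.cons (some Z)) ((Pat.var Z).bind (letPair n A B (Term.var 0 Z)
      (Term.pair n (Term.var 1 (Ty.bangs n A)) (Term.var 0 (Ty.bangs n B))))
      (M.rename (liftVar 1 fun i => i + 1))) _ C :=
    .app hs (.lam (.refl h.rename_skip)) (.etaPair hl hz)
  have h2 : Typed cty (((Γ.cons none).cons (some (Ty.bangs n A))).cons (some (Ty.bangs n B)))
      ((Pat.var Z).bind (Term.pair n (Term.var 1 (Ty.bangs n A)) (Term.var 0 (Ty.bangs n B)))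
        ((M.rename (liftVar 1 fun i => i + 1)).rename (liftVar 1 fun i => i + 2))) C := by
    refine .let₁ ((((Ctx.Split.empty_left (Γ.cons none)).cons_left _).cons_left _).symm) ?_ hp
    have := h.rename_skip.rename_skip.rename_skip
    simp only [rename_rename] at this ⊢
    convert this using 2
    funext i
    rcases i with _ | i <;> simp [liftVar]
  have e3 := AxEq.letAssoc (.var Z) (.pair n A B) e2.typed.1 (.letPair hs.symm hz h2)
  refine e1.symm.trans (e2.symm.trans (e3.trans (.letPair hs.symm (.refl hz) ?_)))
  have e4 := Red.beta Z (.pair n (.var _ _) (.var _ _)) _ _ _ h2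
  convert e4 using 1
  · rfl
  simp only [subst₁, subst_rename, rename_subst]
  congr 1
  funext i X
  rcases i with _ | i
  · simp [pairSubst, liftVar, castTo, rename]
  · simp [pairSubst, liftVar, rename]

/-- As for pairs. The variable has type `!^n 1`, but it is scrutinised at the type `1`, as in the
η-rule. -/
theorem axEq_split_unit {Γ : Ctx α} {n : ℕ} {C : Ty α} {M : Term α K}
    (h : Typed cty (Γ.cons (some (Ty.bangs n Ty.unit))) M C) :
    AxEq cty (Γ.cons (some (Ty.bangs n Ty.unit))) M
      (letUnit (Term.var 0 Ty.unit) (M.subst (starSubst n))) C := by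
  set Z : Ty α := Ty.bangs n Ty.unit with hZ
  have hs : (Γ.cons (some Z)).Split (Γ.cons none) (Ctx.single Z) :=
    (Ctx.Split.empty_right Γ).cons_right (some Z)
  have hz : Typed cty (Ctx.single Z) (Term.var 0 Z) Z := .var_zero (Ty.Sub.refl Z)
  have hz' : Typed cty (Ctx.single Z) (Term.var 0 Ty.unit) Ty.unit := .var_zero (.of_bangs n _)
  have h1 : Typed cty (Γ.cons (some Z))
      ((Pat.var Z).bind (Term.var 0 Z) (M.rename (liftVar 1 fun i => i + 1))) C :=
    .let₁ hs h.rename_skip hz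
  have e1 := Red.beta Z (.var 0 Z) _ _ _ h1
  rw [let_var_self] at e1
  have hp : Typed cty Ctx.empty (Term.star n) Z := .star Ctx.IsBang.empty n
  have hl : Typed cty (Ctx.single Z) (letUnit (Term.var 0 Ty.unit) (Term.star n)) Z :=
    .letUnit (Ctx.Split.empty_right _) hz' hp
  have e2 : AxEq cty (Γ.cons (some Z)) ((Pat.var Z).bind (letUnit (Term.var 0 Ty.unit)
      (Term.star n)) (M.rename (liftVar 1 fun i => i + 1))) _ C :=
    .app hs (.lam (.refl h.rename_skip)) (.etaUnit (N := Term.var 0 Z) hl hz)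
  have h2 : Typed cty (Γ.cons none)
      ((Pat.var Z).bind (Term.star n) ((M.rename (liftVar 1 fun i => i + 1)).rename
        (liftVar 1 fun i => i + 0))) C := by
    refine .let₁ (Ctx.Split.empty_right _) ?_ hp
    convert h.rename_skip using 1
    rw [rename_rename]
    congr 1
    funext i
    rcases i with _ | i <;> simp [liftVar]
  have e3 := AxEq.letAssoc (.var Z) .unit e2.typed.1 (.letUnit hs.symm hz' h2)
  refine e1.symm.trans (e2.symm.trans (e3.trans (.letUnit hs.symm (.refl hz') ?_)))
  have e4 := Red.beta Z (.star n) _ _ _ h2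
  convert e4 using 1
  · rfl
  simp only [subst₁, subst_rename]
  congr 1
  funext i X
  rcases i with _ | i
  · simp [starSubst, liftVar]
  · simp [starSubst, liftVar]

/-- After splitting the variable, the equation to be shown is an instance of congruence for `let ⟨x,
y⟩^n = z in -`, applied to the given equation over the two components. -/
theorem Detects.pair {Γ : Ctx α} {n : ℕ} {A B X : Ty α} {M : Term α K}
    (h : Detects cty (Γ.cons (some (Ty.bangs n (Ty.tensor A B)))) M X) :
    Detects cty ((Γ.cons (some (Ty.bangs n A))).cons (some (Ty.bangs n B)))
      (M.subst (pairSubst n A B)) X := by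
  have hi : Function.Injective (fun i : ℕ => i + 1) := add_left_injective 1
  have hp : Typed cty ((Γ.cons (some (Ty.bangs n A))).cons (some (Ty.bangs n B)))
      ((Pat.var (Ty.bangs n (Ty.tensor A B))).bind
        (Term.pair n (Term.var 1 (Ty.bangs n A)) (Term.var 0 (Ty.bangs n B)))
        (M.rename (liftVar 1 fun i => i + 2))) X := by
    refine .let₁ ((((Ctx.Split.empty_left Γ).cons_left _).cons_left _).symm)
      ?_ (.pair (ValueJudgment.split_pair _ _) n (Typed.var_zero (Ty.Sub.refl _)).rename_succ
      (.var_zero (Ty.Sub.refl _)))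
    have := h.1.rename_skip.rename_skip
    simp only [rename_rename] at this
    convert this using 2
    funext i
    rcases i with _ | i <;> simp [liftVar]
  refine ⟨?_, fun V W e => h.2 V W ?_⟩
  · have e := (Red.beta _ (.pair n (.var _ _) (.var _ _)) _ _ _ hp).typed.2
    convert e using 1
    simp only [subst₁, subst_rename]
    congr 1
    funext i X
    rcases i with _ | i <;> simp [pairSubst, liftVar]
  -- Substitution passes through the arrows and reaches only the pattern to which they are applied.
  · refine (axEq_split_pair (V.typed_ap_iff.2 h.1)).trans (.trans ?_
      (axEq_split_pair (W.typed_ap_iff.2 h.1)).symm)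
    refine .letPair (Ctx.Split.empty_left Γ |>.cons_left _) (.refl (.var_zero (Ty.Sub.refl _))) ?_
    rw [V.subst_ap, W.subst_ap]
    have := e.rename (liftVar_injective 2 hi)
    rwa [Ctx.map_cons₂ hi, Ctx.map_succ] at this

theorem Detects.star {Γ : Ctx α} {n : ℕ} {X : Ty α} {M : Term α K}
    (h : Detects cty (Γ.cons (some (Ty.bangs n Ty.unit))) M X) :
    Detects cty (Γ.cons none) (M.subst (starSubst n)) X := by
  have hp : Typed cty (Γ.cons none)
      ((Pat.var (Ty.bangs n Ty.unit)).bind (Term.star n)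
        (M.rename (liftVar 1 fun i => i + 1))) X :=
    .let₁ (Ctx.Split.empty_right _) h.1.rename_skip (.star Ctx.IsBang.empty n)
  refine ⟨?_, fun V W e => h.2 V W ?_⟩
  · have e := (Red.beta _ (.star n) _ _ _ hp).typed.2
    convert e using 1
    simp only [subst₁, subst_rename]
    congr 1
    funext i X
    rcases i with _ | i <;> simp [starSubst, liftVar]
  · refine (axEq_split_unit (V.typed_ap_iff.2 h.1)).trans (.trans ?_
      (axEq_split_unit (W.typed_ap_iff.2 h.1)).symm)
    refine .letUnit (Ctx.Split.empty_left Γ |>.cons_left _) (.refl (.var_zero (.of_bangs n _))) ?_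
    rwa [V.subst_ap, W.subst_ap]

end Patterns

/-! ### Terms up to convertibility -/

section Terms
variable {α : Type u} {K : Type w} {cty : K → Ty α}

/-- Convertibility of terms with the type `A`. -/
def Tm.setoid (cty : K → Ty α) (A : Ty α) : Setoid {M : Term α K // M.tyOf = A} where
  r M N := Conv cty A M N
  iseqv := ⟨fun M => .refl A M.1, fun h => h.symm, fun h h' => h.trans h'⟩

/-- The terms with the type `A`, up to convertibility. -/
def Tm (cty : K → Ty α) (A : Ty α) : Type (max u w) := Quotient (Tm.setoid cty A)

namespace Tm
variable {A B C D : Ty α}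

/-- The class of a term. -/
def mk (M : Term α K) (h : M.tyOf = A) : Tm cty A := Quotient.mk (Tm.setoid cty A) ⟨M, h⟩

theorem sound {M N : Term α K} {hM : M.tyOf = A} {hN : N.tyOf = A} (h : Conv cty A M N) :
    (mk M hM : Tm cty A) = mk N hN := Quotient.sound h

theorem exact {M N : Term α K} {hM : M.tyOf = A} {hN : N.tyOf = A}
    (h : (mk M hM : Tm cty A) = mk N hN) : Conv cty A M N := Quotient.exact h

theorem ind {p : Tm cty A → Prop} (h : ∀ M hM, p (mk M hM)) (t : Tm cty A) : p t := by
  induction t using Quotient.inductionOn with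
  | h M => exact h M.1 M.2

/-- The variable with index `i`. -/
def var (i : ℕ) (A : Ty α) : Tm cty A := mk (Term.var i A) rfl

/-- `*^n` -/
def star (n : ℕ) : Tm cty (Ty.bangs n Ty.unit) := mk (Term.star n) rfl

theorem tyOf_pair {n : ℕ} {M N : Term α K} (hM : M.tyOf = Ty.bangs n A)
    (hN : N.tyOf = Ty.bangs n B) :
    (Term.pair n M N).tyOf = Ty.bangs n (Ty.tensor A B) := by
  simp only [Term.tyOf, hM, hN, Ty.unbang_bangs]

/-- `⟨M, N⟩^n` -/
def pair (n : ℕ) (s : Tm cty (Ty.bangs n A)) (t : Tm cty (Ty.bangs n B)) :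
    Tm cty (Ty.bangs n (Ty.tensor A B)) :=
  Quotient.map₂ (fun M N => ⟨Term.pair n M.1 N.1, tyOf_pair M.2 N.2⟩)
    (fun _ _ h _ _ h' => Conv.pair h h') s t

/-- `M N` -/
def app (s : Tm cty (Ty.lolli A B)) (t : Tm cty A) : Tm cty B :=
  Quotient.map₂ (fun M N => ⟨Term.app M.1 N.1, by rw [Term.tyOf, M.2]; rfl⟩)
    (fun M M' h _ _ h' => Conv.app h h' M.2 M'.2) s t

/-- `M *` -/
def force (s : Tm cty (Ty.comp A)) : Tm cty A := app s (star 0)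

/-- `let x = M in N` -/
def let₁ (s : Tm cty A) (t : Tm cty B) : Tm cty B :=
  Quotient.map₂ (fun M N => ⟨(Pat.var A).bind M.1 N.1, (show N.1.tyOf = B from N.2)⟩)
    (fun _ _ h _ _ h' => Conv.let₁ h h') s t

/-- Weakening by a new innermost variable. -/
def shift (s : Tm cty A) : Tm cty A :=
  Quotient.liftOn s
    (fun M => mk (M.1.rename fun i => i + 1) (by rw [Term.tyOf_rename, M.2]))
    (fun M N h => sound (Conv.rename (M := M.1) (N := N.1) h (add_left_injective 1)))

/-- `let x = M in V` for the class of `x : A ⊢ V : B`. -/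
def ap (f : YAQ.Hom cty A B) (t : Tm cty A) : Tm cty B :=
  Quotient.liftOn₂ f t (fun V M => mk (V.ap M.1) (V.tyOf_ap M.1))
    (fun V M W N h h' => sound
      (ValueJudgment.ap_congr (V := V) (V' := W) (M := M.1) (M' := N.1) h h'))

/-- Classes of values. -/
def IsVal (t : Tm cty A) : Prop := ∃ V hV, V.Value ∧ t = mk V hV

/-- Classes of values that are only typed in contexts of the form `!Δ`. -/
def Dup (t : Tm cty A) : Prop :=
  ∃ V hV, V.Value ∧ t = mk V hV ∧ ∀ Γ, Typed cty Γ V A → Γ.IsBang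

theorem Dup.isVal {t : Tm cty A} : t.Dup → t.IsVal := fun ⟨V, hV, h, e, _⟩ => ⟨V, hV, h, e⟩

/-! Computation of weakenings. -/

@[simp] theorem shift_var (i : ℕ) (A : Ty α) : shift (var i A : Tm cty A) = var (i + 1) A := rfl

@[simp] theorem shift_pair (n : ℕ) (s : Tm cty (Ty.bangs n A)) (t : Tm cty (Ty.bangs n B)) :
    shift (pair n s t) = pair n s.shift t.shift := by
  induction s using ind; induction t using ind; rfl

@[simp] theorem shift_app (s : Tm cty (Ty.lolli A B)) (t : Tm cty A) :
    shift (app s t) = app s.shift t.shift := by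
  induction s using ind; induction t using ind; rfl

@[simp] theorem shift_force (s : Tm cty (Ty.comp A)) : shift (force s) = force s.shift :=
  shift_app _ _

@[simp] theorem shift_ap (f : YAQ.Hom cty A B) (t : Tm cty A) : shift (ap f t) = ap f t.shift := by
  induction f using Quotient.inductionOn with
  | h V =>
    induction t using ind with
    | h M hM => exact sound (by rw [V.rename_ap]; exact .refl _ _)

/-! Values. -/

theorem isVal_var (i : ℕ) (A : Ty α) : (var i A : Tm cty A).IsVal := ⟨_, _, .var i A, rfl⟩

theorem isVal_star (n : ℕ) : (star n : Tm cty _).IsVal := ⟨_, _, .star n, rfl⟩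

theorem IsVal.pair {n : ℕ} {s : Tm cty (Ty.bangs n A)} {t : Tm cty (Ty.bangs n B)}
    (hs : s.IsVal) (ht : t.IsVal) : (Tm.pair n s t).IsVal := by
  obtain ⟨V, hV, h, rfl⟩ := hs
  obtain ⟨W, hW, h', rfl⟩ := ht
  exact ⟨_, tyOf_pair hV hW, .pair n h h', rfl⟩

theorem IsVal.ap {t : Tm cty A} (ht : t.IsVal) (f : YAQ.Hom cty A B) : (Tm.ap f t).IsVal := by
  obtain ⟨V, hV, h, rfl⟩ := ht
  induction f using Quotient.inductionOn with
  | h W => exact ⟨_, W.tyOf_ap V, W.value_ap h, rfl⟩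

theorem dup_var (i : ℕ) (A : Ty α) : (var i (Ty.bang A) : Tm cty _).Dup :=
  ⟨_, _, .var _ _, rfl, fun _ h => (Term.Simple.var i (Ty.bang A)).isBang h⟩

theorem dup_star (n : ℕ) : (star n : Tm cty _).Dup :=
  ⟨_, _, .star _, rfl, fun _ h => Typed.star_iff.1 h⟩

theorem Dup.pair {n : ℕ} {s : Tm cty (Ty.bangs n A)} {t : Tm cty (Ty.bangs n B)}
    (hs : s.Dup) (ht : t.Dup) : (Tm.pair n s t).Dup := by
  obtain ⟨V, hV, h, rfl, h1⟩ := hs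
  obtain ⟨W, hW, h', rfl, h2⟩ := ht
  refine ⟨_, tyOf_pair hV hW, .pair n h h', rfl, fun Γ hl => ?_⟩
  obtain ⟨Γ₁, Γ₂, hs, h3, h4⟩ := Typed.pair_iff.1 hl
  exact Ctx.IsBang.of_split hs (h1 _ h3) (h2 _ h4)

theorem Dup.ap {t : Tm cty A} (ht : t.Dup) (f : YAQ.Hom cty A B) : (Tm.ap f t).Dup := by
  obtain ⟨V, hV, h, rfl, h1⟩ := ht
  induction f using Quotient.inductionOn with
  | h W => exact ⟨_, W.tyOf_ap V, W.value_ap h, rfl, fun Γ hl => h1 Γ (W.typed_ap_iff.1 hl)⟩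

/-! Commutation of `let`. -/

theorem let_var (s : Tm cty A) : let₁ s (var 0 A) = s := by
  induction s using ind with | h M hM => exact sound (.let_var A M)

theorem ap_let (f : YAQ.Hom cty B C) (s : Tm cty A) (t : Tm cty B) :
    ap f (let₁ s t) = let₁ s (ap f t) := by
  induction f using Quotient.inductionOn with
  | h V =>
    induction s using ind; induction t using ind
    exact sound (V.ap_let A _ _)

theorem pair_let_left (n : ℕ) (s : Tm cty C) (t : Tm cty (Ty.bangs n A))
    (r : Tm cty (Ty.bangs n B)) :
    pair n (let₁ s t) r = let₁ s (pair n t r.shift) := by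
  induction s using ind; induction t using ind; induction r using ind
  exact sound (.pair_let_left n A B C _ _ _)

theorem pair_let_right (n : ℕ) {r : Tm cty (Ty.bangs n A)} (hr : r.IsVal) (s : Tm cty C)
    (t : Tm cty (Ty.bangs n B)) :
    pair n r (let₁ s t) = let₁ s (pair n r.shift t) := by
  obtain ⟨V, hV, h, rfl⟩ := hr
  induction s using ind; induction t using ind
  exact sound (.pair_let_right n A B C _ _ h)

theorem app_let_left (s : Tm cty C) (t : Tm cty (Ty.lolli A B)) (r : Tm cty A) :
    app (let₁ s t) r = let₁ s (app t r.shift) := by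
  induction s using ind; induction t using ind with | h N hN => ?_
  induction r using ind
  exact sound (.app_let _ hN _)

theorem force_let (s : Tm cty C) (t : Tm cty (Ty.comp A)) :
    force (let₁ s t) = let₁ s (force t) := app_let_left _ _ _

theorem app_let_right {r : Tm cty (Ty.lolli A B)} (hr : r.IsVal) (s : Tm cty C) (t : Tm cty A) :
    app r (let₁ s t) = let₁ s (app r.shift t) := by
  obtain ⟨V, hV, h, rfl⟩ := hr
  induction s using ind; induction t using ind
  exact sound (.app_let_right _ _ h hV)

/-- Naming the components reduces an equation about a pair of arbitrary terms to a pair of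
variables; `ap_eq` does the same for the argument of an arrow. -/
theorem pair_eq (n : ℕ) (s : Tm cty (Ty.bangs n A)) (t : Tm cty (Ty.bangs n B)) :
    pair n s t = let₁ s (let₁ t.shift (pair n (var 1 _) (var 0 _))) := by
  induction s using ind; induction t using ind
  exact sound (.pair_let_let n A B _ _)

theorem ap_eq (f : YAQ.Hom cty A B) (s : Tm cty A) : ap f s = let₁ s (ap f (var 0 A)) := by
  rw [← ap_let, let_var]

theorem pair_ap_ap {n : ℕ} {A' B' : Ty α} (f : YAQ.Hom cty A' (Ty.bangs n A))
    (g : YAQ.Hom cty B' (Ty.bangs n B)) (s : Tm cty A') (t : Tm cty B') :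
    pair n (ap f s) (ap g t) =
      let₁ s (let₁ t.shift (pair n (ap f (var 1 _)) (ap g (var 0 _)))) := by
  rw [ap_eq f s, pair_let_left, shift_ap, ap_eq g,
    pair_let_right _ ((isVal_var _ _).ap _), shift_ap, shift_var]

theorem app_ap_ap {A' B' : Ty α} (f : YAQ.Hom cty A' (Ty.lolli A B))
    (g : YAQ.Hom cty B' A) (s : Tm cty A') (t : Tm cty B') :
    app (ap f s) (ap g t) =
      let₁ s (let₁ t.shift (app (ap f (var 1 _)) (ap g (var 0 _)))) := by
  rw [ap_eq f s, app_let_left, shift_ap, ap_eq g,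
    app_let_right ((isVal_var _ _).ap _), shift_ap, shift_var]

theorem pair_pair_right (n : ℕ) (r : Tm cty (Ty.bangs n A)) (s : Tm cty (Ty.bangs n B))
    (t : Tm cty (Ty.bangs n C)) :
    pair n r (pair n s t) = let₁ r (let₁ s.shift (let₁ t.shift.shift
      (pair n (var 2 _) (pair n (var 1 _) (var 0 _))))) := by
  conv_lhs => rw [← let_var r]
  rw [pair_let_left, shift_pair, pair_eq n s.shift, pair_let_right _ (isVal_var _ _),
    shift_var, pair_let_right _ (isVal_var _ _)]
  rfl

theorem pair_pair_left (n : ℕ) (r : Tm cty (Ty.bangs n A)) (s : Tm cty (Ty.bangs n B))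
    (t : Tm cty (Ty.bangs n C)) :
    pair n (pair n r s) t = let₁ r (let₁ s.shift (let₁ t.shift.shift
      (pair n (pair n (var 2 _) (var 1 _)) (var 0 _)))) := by
  rw [pair_eq n r s, pair_let_left, pair_let_left]
  conv_lhs => rw [← let_var t.shift.shift]
  rw [pair_let_right _ ((isVal_var _ _).pair (isVal_var _ _))]
  rfl

/-! Arrows applied to patterns. -/

/-- `⟨M, N⟩` -/
def tens (s : Tm cty A) (t : Tm cty B) : Tm cty (Ty.tensor A B) := pair (A := A) (B := B) 0 s t

/-- `*` -/
def one : Tm cty (Ty.unit : Ty α) := star 0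

theorem isVal_one : (one : Tm cty _).IsVal := isVal_star 0

theorem IsVal.tens {s : Tm cty A} {t : Tm cty B} (hs : s.IsVal) (ht : t.IsVal) :
    (tens s t).IsVal := IsVal.pair (A := A) (B := B) hs ht

theorem tens_let_left (s : Tm cty C) (t : Tm cty A) (r : Tm cty B) :
    tens (let₁ s t) r = let₁ s (tens t r.shift) := pair_let_left (A := A) (B := B) 0 s t r

theorem tens_let_right {r : Tm cty A} (hr : r.IsVal) (s : Tm cty C) (t : Tm cty B) :
    tens r (let₁ s t) = let₁ s (tens r.shift t) := pair_let_right (A := A) (B := B) 0 hr s t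

theorem tens_eq (s : Tm cty A) (t : Tm cty B) :
    tens s t = let₁ s (let₁ t.shift (tens (var 1 A) (var 0 B))) :=
  pair_eq (A := A) (B := B) 0 s t

theorem ap_id (t : Tm cty A) : ap (ValueJudgment.id A).cls t = t := by
  induction t using ind with | h M hM => exact sound (conv_ap_id M)

theorem ap_comp {A B C : YAQ cty} (f : A ⟶ B) (g : B ⟶ C) (t : Tm cty A) :
    ap (f ≫ g) t = ap g (ap f t) := by
  induction f using Quotient.inductionOn with | h V => ?_
  induction g using Quotient.inductionOn with | h W => ?_
  induction t using ind with | h M hM => exact sound (conv_ap_comp V W M)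

section Rules
variable {n m : ℕ} {A' B' : Ty α}

theorem ap_tensor
    {T : ValueJudgment cty (Ty.bangs n (Ty.tensor A B)) (Ty.bangs n (Ty.tensor A' B'))}
    {V : ValueJudgment cty (Ty.bangs n A) (Ty.bangs n A')}
    {W : ValueJudgment cty (Ty.bangs n B) (Ty.bangs n B')}
    (hT : T.term = .letPair n A B (.var 0 (Ty.bangs n (Ty.tensor A B)))
      (.pair n (V.term.rename fun i => i + 1) W.term))
    (s : Tm cty (Ty.bangs n A)) (t : Tm cty (Ty.bangs n B)) :
    ap T.cls (pair n s t) = pair n (ap V.cls s) (ap W.cls t) := by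
  rw [pair_eq, ap_let, ap_let, pair_ap_ap]
  -- Both sides are now the same two bindings around an equation between terms in variables.
  congr 2
  exact sound (conv_ap_tensor hT)

theorem ap_assoc
    {T : ValueJudgment cty (Ty.bangs n (Ty.tensor A (Ty.tensor B C)))
      (Ty.bangs n (Ty.tensor (Ty.tensor A B) C))}
    (hT : T.term = .letPair n A (Ty.tensor B C)
      (.var 0 (Ty.bangs n (Ty.tensor A (Ty.tensor B C))))
      (.letPair n B C (.var 0 (Ty.bangs n (Ty.tensor B C)))
        (.pair n (.pair n (.var 3 (Ty.bangs n A)) (.var 1 (Ty.bangs n B)))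
          (.var 0 (Ty.bangs n C)))))
    (r : Tm cty (Ty.bangs n A)) (s : Tm cty (Ty.bangs n B)) (t : Tm cty (Ty.bangs n C)) :
    ap T.cls (pair n r (pair n s t)) = pair n (pair n r s) t := by
  rw [pair_pair_right, pair_pair_left, ap_let, ap_let, ap_let]
  congr 3
  exact sound (conv_ap_assoc hT)

theorem ap_leftUnitor
    {T : ValueJudgment cty (Ty.bangs n (Ty.tensor Ty.unit A)) (Ty.bangs n A)}
    (hT : T.term = .letPair n Ty.unit A (.var 0 (Ty.bangs n (Ty.tensor Ty.unit A)))
      (.letUnit (.var 1 Ty.unit) (.var 0 (Ty.bangs n A)))) (s : Tm cty (Ty.bangs n A)) :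
    ap T.cls (pair n (star n) s) = s := by
  conv_lhs => rw [← let_var s]
  rw [pair_let_right _ (isVal_star n), ap_let]
  conv_rhs => rw [← let_var s]
  congr 1
  exact sound (conv_ap_leftUnitor hT)

theorem ap_rightUnitor
    {T : ValueJudgment cty (Ty.bangs n (Ty.tensor A Ty.unit)) (Ty.bangs n A)}
    (hT : T.term = .letPair n A Ty.unit (.var 0 (Ty.bangs n (Ty.tensor A Ty.unit)))
      (.letUnit (.var 0 Ty.unit) (.var 1 (Ty.bangs n A)))) (s : Tm cty (Ty.bangs n A)) :
    ap T.cls (pair n s (star n)) = s := by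
  conv_lhs => rw [← let_var s]
  rw [pair_let_left, ap_let]
  conv_rhs => rw [← let_var s]
  congr 1
  exact sound (conv_ap_rightUnitor hT)

/-- Components are evaluated from left to right; the order is immaterial as soon as one of them is a
value. -/
theorem pair_swap {s : Tm cty (Ty.bangs n A)} {t : Tm cty (Ty.bangs n B)}
    (h : s.IsVal ∨ t.IsVal) :
    let₁ s (let₁ t.shift (pair n (var 0 (Ty.bangs n B)) (var 1 (Ty.bangs n A)))) =
      pair n t s := by
  rcases h with ⟨V, hV, h, rfl⟩ | h
  · induction t using ind with
    | h N hN =>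
      rw [pair_eq n (mk N hN)]
      exact sound (Conv.let_swap (A := Ty.bangs n A) (B := Ty.bangs n B) h N (tyOf_pair rfl rfl))
  · conv_rhs => rw [← let_var s, pair_let_right _ h, ← let_var t.shift, pair_let_left]
    rfl

theorem ap_braiding
    {T : ValueJudgment cty (Ty.bangs n (Ty.tensor A B)) (Ty.bangs n (Ty.tensor B A))}
    (hT : T.term = .letPair n A B (.var 0 (Ty.bangs n (Ty.tensor A B)))
      (.pair n (.var 0 (Ty.bangs n B)) (.var 1 (Ty.bangs n A))))
    {s : Tm cty (Ty.bangs n A)} {t : Tm cty (Ty.bangs n B)} (h : s.IsVal ∨ t.IsVal) :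
    ap T.cls (pair n s t) = pair n t s := by
  rw [pair_eq, ap_let, ap_let, ← pair_swap h]
  congr 2
  exact sound (conv_ap_braiding hT)

/-- `⟨x, y⟩^n` with the index `m`. -/
theorem ap_repair (hA : Ty.bangs n A = Ty.bangs m A') (hB : Ty.bangs n B = Ty.bangs m B')
    {T : ValueJudgment cty (Ty.bangs n (Ty.tensor A B)) (Ty.bangs m (Ty.tensor A' B'))}
    (hT : T.term = .letPair n A B (.var 0 (Ty.bangs n (Ty.tensor A B)))
      (.pair m (.var 1 (Ty.bangs m A')) (.var 0 (Ty.bangs m B'))))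
    (s : Tm cty (Ty.bangs n A)) (t : Tm cty (Ty.bangs n B))
    (s' : Tm cty (Ty.bangs m A')) (t' : Tm cty (Ty.bangs m B')) (hs : s ≍ s') (ht : t ≍ t') :
    ap T.cls (pair n s t) = pair m s' t' := by
  have e : let₁ s (let₁ t.shift (pair m (var 1 (Ty.bangs m A')) (var 0 (Ty.bangs m B')))) =
      pair m s' t' := by
    rw [pair_eq m s' t']
    -- The types `!^n A` and `!^m A'` are equal but presented differently; hiding the presentations
    -- lets the equalities be eliminated.
    generalize (pair m (var 1 (Ty.bangs m A')) (var 0 (Ty.bangs m B')) : Tm cty _) = p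
    generalize Ty.bangs m (Ty.tensor A' B') = Z at p
    clear hT T
    generalize Ty.bangs m A' = X at *
    generalize Ty.bangs m B' = Y at *
    subst hA hB hs ht
    rfl
  rw [pair_eq, ap_let, ap_let, ← e]
  congr 2
  exact sound (conv_ap_repair hA hB hT)

theorem ap_cast_pair
    {T : ValueJudgment cty (Ty.bangs n (Ty.tensor A B)) (Ty.bangs m (Ty.tensor A B))}
    {V : ValueJudgment cty (Ty.bangs n A) (Ty.bangs m A)}
    {W : ValueJudgment cty (Ty.bangs n B) (Ty.bangs m B)}
    (hT : T.term = .var 0 (Ty.bangs m (Ty.tensor A B))) (hV : V.term = .var 0 (Ty.bangs m A))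
    (hW : W.term = .var 0 (Ty.bangs m B))
    (s : Tm cty (Ty.bangs n A)) (t : Tm cty (Ty.bangs n B)) :
    ap T.cls (pair n s t) = pair m (ap V.cls s) (ap W.cls t) := by
  rw [pair_eq, ap_let, ap_let, pair_ap_ap]
  congr 2
  exact sound (conv_ap_cast_pair hT hV hW)

theorem ap_cast_star {T : ValueJudgment cty (Ty.bangs n Ty.unit) (Ty.bangs m Ty.unit)}
    (hT : T.term = .var 0 (Ty.bangs m Ty.unit) ∨
      T.term = .letUnit (.var 0 Ty.unit) (.star m)) :
    ap T.cls (star n) = star m := sound (conv_ap_cast_star hT)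

theorem force_unit (s : Tm cty A) : force (ap (ValueJudgment.unit A).cls s) = s := by
  rw [ap_eq, force_let]
  conv_rhs => rw [← let_var s]
  congr 1
  exact sound conv_force_unit

theorem force_mult (s : Tm cty (Ty.comp (Ty.comp A))) :
    force (ap (ValueJudgment.mult A).cls s) = force (force s) := by
  rw [ap_eq, force_let]
  conv_rhs => rw [← let_var s, force_let, force_let]
  congr 1
  exact sound conv_force_mult

theorem force_star (V : ValueJudgment cty A (Ty.comp B)) (s : Tm cty (Ty.comp A)) :
    force (ap V.star.cls s) = force (ap V.cls (force s)) := by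
  rw [ap_eq, force_let]
  conv_rhs => rw [← let_var s, force_let, ap_let, force_let]
  congr 1
  exact sound (conv_force_star V)

theorem force_strength (s : Tm cty A) (t : Tm cty (Ty.comp B)) :
    force (ap (ValueJudgment.strength A B).cls (tens s t)) = tens s (force t) := by
  rw [tens_eq, ap_let, ap_let, force_let, force_let]
  have e : tens s (force t) =
      let₁ s (let₁ t.shift (tens (var 1 A) (force (var 0 (Ty.comp B))))) := by
    conv_lhs => rw [← let_var s, tens_let_left, shift_force, ← let_var t.shift, force_let,
      tens_let_right (isVal_var _ _)]
    rfl
  rw [e]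
  congr 2
  exact sound conv_force_strength

theorem app_lolliMap (V : ValueJudgment cty A B) (W : ValueJudgment cty A' B')
    (s : Tm cty (Ty.lolli B A')) (t : Tm cty A) :
    app (ap (V.lolliMap W).cls s) t = ap W.cls (app s (ap V.cls t)) := by
  have h1 := app_ap_ap (V.lolliMap W).cls (ValueJudgment.id A).cls s t
  have h2 := app_ap_ap (ValueJudgment.id (Ty.lolli B A')).cls V.cls s t
  rw [ap_id, ap_id] at h1 h2
  rw [h1, h2, ap_let, ap_let]
  congr 2
  exact sound (conv_app_lolliMap V W)

theorem force_Phi (V : ValueJudgment cty A (Ty.lolli B C)) (s : Tm cty A) (t : Tm cty B) :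
    force (ap V.Phi.cls (tens s t)) = app (ap V.cls s) t := by
  have h1 := app_ap_ap V.cls (ValueJudgment.id B).cls s t
  rw [ap_id, ap_id] at h1
  rw [h1, tens_eq, ap_let, ap_let, force_let, force_let]
  congr 2
  exact sound (conv_force_Phi V)

theorem app_curry (W : ValueJudgment cty (Ty.tensor A B) (Ty.comp C)) (s : Tm cty A)
    (t : Tm cty B) :
    app (ap W.curry.cls s) t = force (ap W.cls (tens s t)) := by
  have h1 := app_ap_ap W.curry.cls (ValueJudgment.id B).cls s t
  rw [ap_id, ap_id] at h1
  rw [h1, tens_eq, ap_let, ap_let, force_let, force_let]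
  congr 2
  exact sound (conv_app_curry W)

theorem ap_leftUnitorInv (s : Tm cty A) :
    ap (ValueJudgment.leftUnitorInv A).cls s = tens one s := by
  rw [ap_eq]
  conv_rhs => rw [← let_var s, tens_let_right isVal_one]
  congr 1
  exact sound conv_ap_leftUnitorInv

/-! Duplication and discarding. -/

/-- The value need not be simple, for instance it may be an arrow applied to a variable. β is still
available, because its contexts have the form `!Δ`, so that it can be typed twice. -/
theorem ap_dup {T : ValueJudgment cty B (Ty.bangs n (Ty.tensor A A))}
    (hB : B = Ty.bangs n A) (hT : T.term = .pair n (.var 0 B) (.var 0 B))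
    {s : Tm cty B} (hs : s.Dup) : ap T.cls s = pair n (hB ▸ s) (hB ▸ s) := by
  subst hB
  obtain ⟨V, hV, h, rfl, hb⟩ := hs
  refine sound fun Γ => ?_
  have h1 : Typed cty Γ (T.ap V) (Ty.bangs n (Ty.tensor A A)) ↔
      Typed cty Γ (.pair n V V) (Ty.bangs n (Ty.tensor A A)) := by
    rw [T.typed_ap_iff, Typed.pair_iff]
    exact ⟨fun hl => ⟨Γ, Γ, (hb Γ hl).split_self, hl, hl⟩,
      fun ⟨Γ₁, Γ₂, hs, h1, h2⟩ => h1.mono (hs.le_left (hb _ h2))⟩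
  refine ⟨h1, fun hl => ?_⟩
  have hV' := T.typed_ap_iff.1 hl
  have e : Term.subst₁ V T.term = .pair n V V := by
    rw [hT]
    simp only [Term.subst₁, Term.subst, hV'.castTo_self]
  have := AxEq.betaLam h hl (by rw [e]; exact h1.1 hl)
  rwa [e] at this

/-- The contexts of a term. -/
def TypedIn (Γ : Ctx α) (t : Tm cty A) : Prop :=
  Quotient.lift (fun M : {M : Term α K // M.tyOf = A} => Typed cty Γ M.1 A)
    (fun _ _ h => propext (h Γ).1) t

theorem typedIn_ap (Γ : Ctx α) (f : YAQ.Hom cty A B) (t : Tm cty A) :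
    TypedIn Γ (ap f t) ↔ TypedIn Γ t := by
  induction f using Quotient.inductionOn with | h V => ?_
  induction t using ind
  exact V.typed_ap_iff

theorem typedIn_pair (Γ : Ctx α) (s : Tm cty (Ty.bangs n A)) (t : Tm cty (Ty.bangs n B)) :
    TypedIn Γ (pair n s t) ↔ ∃ Γ₁ Γ₂, Γ.Split Γ₁ Γ₂ ∧ TypedIn Γ₁ s ∧ TypedIn Γ₂ t := by
  induction s using ind; induction t using ind
  exact Typed.pair_iff

/-- Terms that are equivalent to `*^n` wherever they are typed. -/
def Discards (t : Tm cty (Ty.bangs n Ty.unit)) : Prop :=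
  ∃ M hM, t = mk M hM ∧ ∀ Γ, Typed cty Γ M (Ty.bangs n Ty.unit) →
    AxEq cty Γ M (.star n) (Ty.bangs n Ty.unit)

/-- The counit applied to a variable equals `*` wherever it is typed, but unlike `*` it is not typed
in the empty context, so the two are different elements of `Tm`. Contexts are all that remains to be
compared. -/
theorem Discards.eq {s t : Tm cty (Ty.bangs n Ty.unit)} (hs : s.Discards) (ht : t.Discards)
    (h : ∀ Γ, TypedIn Γ s ↔ TypedIn Γ t) : s = t := by
  obtain ⟨M, hM, rfl, h1⟩ := hs
  obtain ⟨N, hN, rfl, h2⟩ := ht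
  exact sound fun Γ => ⟨h Γ, fun hl => (h1 Γ hl).trans (h2 Γ ((h Γ).1 hl)).symm⟩

theorem discards_star : (star n : Tm cty _).Discards := ⟨_, _, rfl, fun _ h => .refl h⟩

theorem discards_ap {T : ValueJudgment cty A (Ty.bangs n Ty.unit)} (hT : T.term = .star n)
    {s : Tm cty A} (hs : s.Dup) : (ap T.cls s).Discards := by
  obtain ⟨V, hV, h, rfl, hb⟩ := hs
  refine ⟨_, T.tyOf_ap V, rfl, fun Γ hl => ?_⟩
  have e : Term.subst₁ V T.term = .star n := by rw [hT]; rfl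
  have := AxEq.betaLam h hl (by rw [e]; exact .star (hb Γ (T.typed_ap_iff.1 hl)) n)
  rwa [e] at this

theorem Discards.ap {T : ValueJudgment cty (Ty.bangs n Ty.unit) (Ty.bangs m Ty.unit)}
    (hT : T.term = .var 0 (Ty.bangs m Ty.unit) ∨
      T.term = .letUnit (.var 0 Ty.unit) (.star m))
    {s : Tm cty (Ty.bangs n Ty.unit)} (hs : s.Discards) : (Tm.ap T.cls s).Discards := by
  obtain ⟨M, hM, rfl, h⟩ := hs
  refine ⟨_, T.tyOf_ap M, rfl, fun Γ hl => ?_⟩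
  have h1 : AxEq cty Γ (T.ap M) (T.ap (.star n)) _ :=
    .app (Ctx.Split.empty_left Γ) (.lam (.refl T.typed)) (h Γ (T.typed_ap_iff.1 hl))
  exact h1.trans ((conv_ap_cast_star hT Γ).2 h1.typed.2)

theorem Discards.leftUnitor
    {T : ValueJudgment cty (Ty.bangs n (Ty.tensor Ty.unit Ty.unit)) (Ty.bangs n Ty.unit)}
    (hT : T.term = .letPair n Ty.unit Ty.unit (.var 0 (Ty.bangs n (Ty.tensor Ty.unit Ty.unit)))
      (.letUnit (.var 1 Ty.unit) (.var 0 (Ty.bangs n Ty.unit))))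
    {s t : Tm cty (Ty.bangs n Ty.unit)} (hs : s.Discards) (ht : t.Discards) :
    (Tm.ap T.cls (Tm.pair n s t)).Discards := by
  obtain ⟨M, hM, rfl, h⟩ := hs
  obtain ⟨N, hN, rfl, h'⟩ := ht
  refine ⟨_, T.tyOf_ap _, rfl, fun Γ hl => ?_⟩
  obtain ⟨Γ₁, Γ₂, hs, h1, h2⟩ := (T.typed_ap_iff.1 hl).pair_inv
  have e1 : AxEq cty Γ (T.ap (.pair n M N)) (T.ap (.pair n (.star n) (.star n))) _ :=
    .app (Ctx.Split.empty_left Γ) (.lam (.refl T.typed)) (.pair hs n (h _ h1) (h' _ h2))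
  exact e1.trans ((exact (ap_leftUnitor hT (star n)) Γ).2 e1.typed.2)

/-- Next to `t` the variables of `s` are not lost: `t` requires the same contexts, and these can be
shared. -/
theorem pair_discards_left {s : Tm cty (Ty.bangs n Ty.unit)} (hs : s.Discards)
    {t : Tm cty (Ty.bangs n A)} (ht : t.Dup) (h : ∀ Γ, TypedIn Γ s ↔ TypedIn Γ t) :
    Tm.pair n s t = Tm.pair n (star n) t := by
  obtain ⟨M, hM, rfl, h1⟩ := hs
  obtain ⟨V, hV, -, rfl, hb⟩ := ht
  refine sound fun Γ => ⟨?_, fun hl => ?_⟩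
  · rw [Typed.pair_iff, Typed.pair_iff]
    constructor
    · rintro ⟨Γ₁, Γ₂, hs, h2, h3⟩
      exact ⟨Γ₁, Γ₂, hs, .star (hb _ ((h _).1 h2)) n, h3⟩
    · rintro ⟨Γ₁, Γ₂, hs, h2, h3⟩
      have h4 := h3.mono (hs.le_right (Typed.star_iff.1 h2))
      exact ⟨Γ, Γ, (hb _ h4).split_self, (h _).2 h4, h4⟩
  · obtain ⟨Γ₁, Γ₂, hs, h2, h3⟩ := hl.pair_inv
    exact .pair hs n (h1 _ h2) (.refl h3)

end Rules

/-! Equality of arrows. -/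

theorem _root_.LinLam.Detects.ext {Γ : Ctx α} {M : Term α K} {hM : M.tyOf = A}
    (h : Detects cty Γ M A) {f g : YAQ.Hom cty A B} (e : ap f (mk M hM) = ap g (mk M hM)) :
    f = g := by
  induction f using Quotient.inductionOn with | h V => ?_
  induction g using Quotient.inductionOn with | h W => ?_
  exact Quotient.sound (h.2 V W ((exact e Γ).2 (V.typed_ap_iff.2 h.1)))

theorem hom_ext {f g : YAQ.Hom cty A B} (e : ap f (var 0 A) = ap g (var 0 A)) : f = g :=
  (Detects.var A).ext e

theorem force_ext {s t : Tm cty (Ty.comp A)} (hs : s.IsVal) (ht : t.IsVal)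
    (h : force s = force t) : s = t := by
  obtain ⟨V, hV, h1, rfl⟩ := hs
  obtain ⟨W, hW, h2, rfl⟩ := ht
  exact sound (Conv.of_force h1 h2 hV hW (exact h))

/-- By η, the value of an arrow into `B ⊸ C` at a variable is `λy. f y`, so a congruence under the
abstraction suffices. -/
theorem lolli_ext {f g : YAQ.Hom cty A (Ty.lolli B C)}
    (h : app (ap f (var 1 A)) (var 0 B) = app (ap g (var 1 A)) (var 0 B)) : f = g := by
  induction f using Quotient.inductionOn with | h V => ?_
  induction g using Quotient.inductionOn with | h W => ?_
  refine Quotient.sound ((Detects.var A).2 V W ?_)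
  have hA : Typed cty ((Ctx.single A).cons none) (.var 1 A : Term α K) A :=
    (Typed.var_zero (Ty.Sub.refl A)).rename_succ
  have key : ∀ V : ValueJudgment cty A (Ty.lolli B C), AxEq cty (Ctx.single A)
      (.lam 0 B (.app (V.ap (.var 1 A)) (.var 0 B))) (V.ap (.var 0 A)) (Ty.lolli B C) := by
    intro V
    have h0 : Typed cty (Ctx.single A) (V.ap (.var 0 A)) (Ty.lolli B C) :=
      V.typed_ap_iff.2 (.var_zero (Ty.Sub.refl A))
    have := AxEq.etaLam (n := 0) (V.value_ap (.var 0 A)) (cty := cty) (Γ := Ctx.single A)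
      (A := B) (B := C)
    rw [h0.castTo_self, V.rename_ap] at this
    exact this (.lam (.app (ValueJudgment.split_pair A B) (V.typed_ap_iff.2 hA)
      (.var_zero (Ty.Sub.refl B)))) h0
  refine (key V).symm.trans (.trans (.lam ((exact h _).2 ?_)) (key W))
  exact .app (ValueJudgment.split_pair A B) (V.typed_ap_iff.2 hA) (.var_zero (Ty.Sub.refl B))

end Tm

end Terms

/-! ### Symmetric monoidal structure, strong monad and exponentials -/

namespace YAQ.Hom
variable {α : Type u} {K : Type w} {cty : K → Ty α} {A B C D A' B' C' D' : Ty α}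

/-- The identity. -/
def id (A : Ty α) : YAQ.Hom cty A A := (ValueJudgment.id A).cls

/-- Composition. -/
def comp (f : YAQ.Hom cty A B) (g : YAQ.Hom cty B C) : YAQ.Hom cty A C :=
  Quotient.map₂ ValueJudgment.comp (fun _ _ hV _ _ hW => ValueJudgment.comp_congr hV hW) f g

/-- The tensor product of arrows. -/
def tensor (f : YAQ.Hom cty A A') (g : YAQ.Hom cty B B') :
    YAQ.Hom cty (Ty.tensor A B) (Ty.tensor A' B') := (YAQ.data cty).tensorHom f g

/-- The Kleisli extension. -/
def star (f : YAQ.Hom cty A (Ty.comp B)) : YAQ.Hom cty (Ty.comp A) (Ty.comp B) :=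
  (YAQ.data cty).star f

/-- The exponential of arrows. -/
def lolli (f : YAQ.Hom cty A B) (g : YAQ.Hom cty C D) :
    YAQ.Hom cty (Ty.lolli B C) (Ty.lolli A D) := (YAQ.data cty).lolliMap f g

/-- `Φ` -/
def Phi (f : YAQ.Hom cty A (Ty.lolli B C)) : YAQ.Hom cty (Ty.tensor A B) (Ty.comp C) :=
  (YAQ.data cty).Phi f

end YAQ.Hom

section Laws
variable {α : Type u} {K : Type w} {cty : K → Ty α} {A B C D A' B' C' D' : Ty α}

open YAQ.Hom

namespace Tm

theorem ap_hom_id (t : Tm cty A) : ap (YAQ.Hom.id A) t = t := ap_id t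

theorem ap_hom_comp (f : YAQ.Hom cty A B) (g : YAQ.Hom cty B C) (t : Tm cty A) :
    ap (f.comp g) t = ap g (ap f t) := ap_comp (A := A) (B := B) (C := C) f g t

theorem ap_hom_tensor (f : YAQ.Hom cty A A') (g : YAQ.Hom cty B B') (s : Tm cty A) (t : Tm cty B) :
    ap (f.tensor g) (tens s t) = tens (ap f s) (ap g t) := by
  induction f using Quotient.inductionOn with | h V => ?_
  induction g using Quotient.inductionOn with | h W => ?_
  exact ap_tensor (n := 0) (T := V.tensorHom W) rfl s t

theorem ap_hom_assoc (r : Tm cty A) (s : Tm cty B) (t : Tm cty C) :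
    ap (ValueJudgment.assoc A B C).cls (tens r (tens s t)) = tens (tens r s) t :=
  ap_assoc (n := 0) rfl r s t

theorem ap_hom_leftUnitor (s : Tm cty A) :
    ap (ValueJudgment.leftUnitor A).cls (tens one s) = s := ap_leftUnitor (n := 0) rfl s

theorem ap_hom_rightUnitor (s : Tm cty A) :
    ap (ValueJudgment.rightUnitor A).cls (tens s one) = s := ap_rightUnitor (n := 0) rfl s

theorem ap_hom_braiding {s : Tm cty A} {t : Tm cty B} (h : s.IsVal ∨ t.IsVal) :
    ap (ValueJudgment.braiding A B).cls (tens s t) = tens t s := ap_braiding (n := 0) rfl h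

theorem force_hom_star (f : YAQ.Hom cty A (Ty.comp B)) (s : Tm cty (Ty.comp A)) :
    force (ap f.star s) = force (ap f (force s)) := by
  induction f using Quotient.inductionOn with | h V => ?_
  exact force_star V s

theorem app_hom_lolli (f : YAQ.Hom cty A B) (g : YAQ.Hom cty C D) (s : Tm cty (Ty.lolli B C))
    (t : Tm cty A) : app (ap (f.lolli g) s) t = ap g (app s (ap f t)) := by
  induction f using Quotient.inductionOn with | h V => ?_
  induction g using Quotient.inductionOn with | h W => ?_
  exact app_lolliMap V W s t

theorem force_hom_Phi (f : YAQ.Hom cty A (Ty.lolli B C)) (s : Tm cty A) (t : Tm cty B) :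
    force (ap f.Phi (tens s t)) = app (ap f s) t := by
  induction f using Quotient.inductionOn with | h V => ?_
  exact force_Phi V s t

/-- Terms that tell arrows from their type apart. -/
structure Det (t : Tm cty A) : Prop where
  ext : ∀ {B : Ty α} {f g : YAQ.Hom cty A B}, ap f t = ap g t → f = g

/-- A split epimorphism `e` can be cancelled. Patterns of other shapes arise in this way from
right-nested ones, by braiding and reassociating. -/
theorem Det.ap {t : Tm cty A} (ht : t.Det) {e : YAQ.Hom cty A B} {e' : YAQ.Hom cty B A}
    (h : e'.comp e = YAQ.Hom.id B) : (Tm.ap e t).Det := by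
  refine ⟨fun {C f g} hfg => ?_⟩
  rw [← ap_hom_comp, ← ap_hom_comp] at hfg
  have h1 := congrArg e'.comp (ht.ext hfg)
  have ha : ∀ f : YAQ.Hom cty B C, e'.comp (e.comp f) = f := fun f => by
    refine hom_ext ?_
    rw [ap_hom_comp, ap_hom_comp, ← ap_hom_comp e', h, ap_hom_id]
  rwa [ha, ha] at h1

theorem det_var (A : Ty α) : (var 0 A : Tm cty A).Det := ⟨fun h => hom_ext h⟩

/-- The pattern is, by computation, what results from splitting the single variable; longer patterns
come from splitting its last component again. -/
theorem det_two (A B : Ty α) : (tens (var 1 A) (var 0 B) : Tm cty _).Det := ⟨fun h =>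
  (Detects.pair (Γ := Ctx.empty) (n := 0) (A := A) (B := B) (.var _)).ext (hM := rfl) h⟩

theorem det_three (A B C : Ty α) :
    (tens (var 2 A) (tens (var 1 B) (var 0 C)) : Tm cty _).Det := ⟨fun h =>
  (Detects.pair (Γ := Ctx.empty.cons (some A)) (n := 0) (A := B) (B := C)
    (Detects.pair (Γ := Ctx.empty) (n := 0) (A := A) (.var _))).ext (hM := rfl) h⟩

theorem det_four (A B C D : Ty α) :
    (tens (var 3 A) (tens (var 2 B) (tens (var 1 C) (var 0 D))) : Tm cty _).Det := ⟨fun h =>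
  (Detects.pair (Γ := (Ctx.empty.cons (some A)).cons (some B)) (n := 0) (A := C) (B := D)
    (Detects.pair (Γ := Ctx.empty.cons (some A)) (n := 0) (A := B)
    (Detects.pair (Γ := Ctx.empty) (n := 0) (A := A) (.var _)))).ext (hM := rfl) h⟩

theorem det_one : (one : Tm cty _).Det := ⟨fun h =>
  (Detects.star (Γ := Ctx.empty) (n := 0) (.var _)).ext (hM := rfl) h⟩

theorem det_var_one (A : Ty α) : (tens (var 1 A) one : Tm cty _).Det := ⟨fun h =>
  (Detects.star (Γ := Ctx.empty.cons (some A)) (n := 0)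
    (Detects.pair (Γ := Ctx.empty) (n := 0) (A := A) (.var _))).ext (hM := rfl) h⟩

theorem det_var_var_one (A B : Ty α) :
    (tens (var 2 A) (tens (var 1 B) one) : Tm cty _).Det := ⟨fun h =>
  (Detects.star (Γ := (Ctx.empty.cons (some A)).cons (some B)) (n := 0)
    (Detects.pair (Γ := Ctx.empty.cons (some A)) (n := 0) (A := B)
      (Detects.pair (Γ := Ctx.empty) (n := 0) (A := A) (.var _)))).ext (hM := rfl) h⟩

end Tm

open Tm

/-- Arrows into `T B` are determined by forcing. -/
theorem YAQ.Hom.force_ext {t : Tm cty A} (hd : t.Det) (ht : t.IsVal)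
    {f g : YAQ.Hom cty A (Ty.comp B)} (h : force (ap f t) = force (ap g t)) : f = g :=
  hd.ext (Tm.force_ext (ht.ap f) (ht.ap g) h)


namespace YAQ.Hom

/-! The symmetric monoidal structure. -/

/-- The model for the coherence laws below: at a pattern that determines arrows, the rules for
`Tm.ap` rewrite both sides to the same pattern. -/
theorem id_tensor_id : (YAQ.Hom.id A).tensor (YAQ.Hom.id B) = YAQ.Hom.id (cty := cty) _ :=
  (det_two A B).ext (by simp only [ap_hom_tensor, ap_hom_id])

theorem tensor_comp_tensor (f : YAQ.Hom cty A B) (f' : YAQ.Hom cty A' B') (g : YAQ.Hom cty B C)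
    (g' : YAQ.Hom cty B' C') : (f.tensor f').comp (g.tensor g') = (f.comp g).tensor (f'.comp g') :=
  (det_two A A').ext (by simp only [ap_hom_tensor, ap_hom_comp])

theorem braiding_braiding (A B : Ty α) :
    (ValueJudgment.braiding A B).cls.comp (ValueJudgment.braiding B A).cls =
      YAQ.Hom.id (cty := cty) _ :=
  (det_two A B).ext (by simp only [ap_hom_comp, ap_hom_braiding, isVal_var, true_or, ap_hom_id])

theorem braiding_natural (f : YAQ.Hom cty A A') (g : YAQ.Hom cty B B') :
    (f.tensor g).comp (ValueJudgment.braiding A' B').cls =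
      (ValueJudgment.braiding A B).cls.comp (g.tensor f) :=
  (det_two A B).ext (by simp only [ap_hom_comp, ap_hom_tensor, ap_hom_braiding, isVal_var, IsVal.ap,
    true_or])

/-- The inverse of the associativity isomorphism `A ⊗ (B ⊗ C) → (A ⊗ B) ⊗ C`. -/
def associator (A B C : Ty α) :
    YAQ.Hom cty (Ty.tensor (Ty.tensor A B) C) (Ty.tensor A (Ty.tensor B C)) :=
  ((ValueJudgment.braiding (Ty.tensor A B) C).cls.comp
    (ValueJudgment.assoc C A B).cls).comp
      ((ValueJudgment.braiding (Ty.tensor C A) B).cls.comp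
        ((ValueJudgment.assoc B C A).cls.comp (ValueJudgment.braiding (Ty.tensor B C) A).cls))

end YAQ.Hom

theorem Tm.Det.braid {s : Tm cty A} {t : Tm cty B} (h : (tens s t).Det) (hv : s.IsVal ∨ t.IsVal) :
    (tens t s).Det := by
  have := h.ap (braiding_braiding B A)
  rwa [ap_hom_braiding hv] at this

namespace YAQ.Hom

theorem assoc_associator (A B C : Ty α) :
    (ValueJudgment.assoc A B C).cls.comp (associator A B C) = YAQ.Hom.id (cty := cty) _ :=
  (det_three A B C).ext (by
    simp only [associator, ap_hom_comp, ap_hom_assoc, ap_hom_braiding, isVal_var, IsVal.tens,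
      true_or, ap_hom_id])

theorem associator_assoc (A B C : Ty α) :
    (associator A B C).comp (ValueJudgment.assoc A B C).cls = YAQ.Hom.id (cty := cty) _ :=
  -- The pattern `⟨⟨x, y⟩, z⟩` is obtained by braiding `⟨z, ⟨x, y⟩⟩`; obtaining it by reassociation
  -- would presuppose the present equation.
  ((det_three C A B).braid (.inl (isVal_var _ _))).ext (by
    simp only [associator, ap_hom_comp, ap_hom_assoc, ap_hom_braiding, isVal_var, IsVal.tens,
      true_or, ap_hom_id])

end YAQ.Hom

theorem Tm.ap_hom_associator (r : Tm cty A) (s : Tm cty B) (t : Tm cty C) :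
    ap (associator A B C) (tens (tens r s) t) = tens r (tens s t) := by
  rw [← ap_hom_assoc, ← ap_hom_comp, assoc_associator, ap_hom_id]

theorem Tm.Det.assoc {r : Tm cty A} {s : Tm cty B} {t : Tm cty C}
    (h : (tens r (tens s t)).Det) : (tens (tens r s) t).Det := by
  have := h.ap (associator_assoc A B C)
  rwa [ap_hom_assoc] at this

theorem Tm.ap_hom_leftUnitorInv (s : Tm cty A) :
    ap (ValueJudgment.leftUnitorInv A).cls s = tens one s := ap_leftUnitorInv s

namespace YAQ.Hom

theorem det_one_var (A : Ty α) : (tens one (var 1 A) : Tm cty _).Det :=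
  (det_var_one A).braid (.inl (isVal_var _ _))

theorem leftUnitor_inv (A : Ty α) :
    (ValueJudgment.leftUnitor A).cls.comp (ValueJudgment.leftUnitorInv A).cls =
      YAQ.Hom.id (cty := cty) _ :=
  (det_one_var A).ext (by simp only [ap_hom_comp, ap_hom_leftUnitor, ap_hom_leftUnitorInv, ap_hom_id])

theorem inv_leftUnitor (A : Ty α) :
    (ValueJudgment.leftUnitorInv A).cls.comp (ValueJudgment.leftUnitor A).cls =
      YAQ.Hom.id (cty := cty) _ :=
  (det_var A).ext (by simp only [ap_hom_comp, ap_hom_leftUnitor, ap_hom_leftUnitorInv, ap_hom_id])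

/-- The inverse of the right unit isomorphism. -/
def rightUnitorInv (A : Ty α) : YAQ.Hom cty A (Ty.tensor A Ty.unit) :=
  (ValueJudgment.leftUnitorInv A).cls.comp (ValueJudgment.braiding Ty.unit A).cls

end YAQ.Hom

theorem Tm.ap_hom_rightUnitorInv (s : Tm cty A) :
    ap (rightUnitorInv A) s = tens s one := by
  simp only [rightUnitorInv, ap_hom_comp, ap_hom_leftUnitorInv, ap_hom_braiding, isVal_one, true_or]

namespace YAQ.Hom

theorem rightUnitor_inv (A : Ty α) :
    (ValueJudgment.rightUnitor A).cls.comp (rightUnitorInv A) = YAQ.Hom.id (cty := cty) _ :=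
  (det_var_one A).ext (by simp only [ap_hom_comp, ap_hom_rightUnitor, ap_hom_rightUnitorInv, ap_hom_id])

theorem inv_rightUnitor (A : Ty α) :
    (rightUnitorInv A).comp (ValueJudgment.rightUnitor A).cls = YAQ.Hom.id (cty := cty) _ :=
  (det_var A).ext (by simp only [ap_hom_comp, ap_hom_rightUnitor, ap_hom_rightUnitorInv, ap_hom_id])

theorem associator_natural (f : YAQ.Hom cty A A') (g : YAQ.Hom cty B B') (h : YAQ.Hom cty C C') :
    ((f.tensor g).tensor h).comp (associator A' B' C') =
      (associator A B C).comp (f.tensor (g.tensor h)) :=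
  (det_three A B C).assoc.ext (by simp only [ap_hom_comp, ap_hom_tensor, ap_hom_associator])

theorem leftUnitor_natural (f : YAQ.Hom cty A B) :
    ((YAQ.Hom.id Ty.unit).tensor f).comp (ValueJudgment.leftUnitor B).cls =
      (ValueJudgment.leftUnitor A).cls.comp f :=
  (det_one_var A).ext (by simp only [ap_hom_comp, ap_hom_tensor, ap_hom_leftUnitor, ap_hom_id])

theorem rightUnitor_natural (f : YAQ.Hom cty A B) :
    (f.tensor (YAQ.Hom.id Ty.unit)).comp (ValueJudgment.rightUnitor B).cls =
      (ValueJudgment.rightUnitor A).cls.comp f :=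
  (det_var_one A).ext (by simp only [ap_hom_comp, ap_hom_tensor, ap_hom_rightUnitor, ap_hom_id])

theorem pentagon (A B C D : Ty α) :
    ((associator A B C).tensor (YAQ.Hom.id D)).comp
        ((associator A (Ty.tensor B C) D).comp ((YAQ.Hom.id A).tensor (associator B C D))) =
      (associator (Ty.tensor A B) C D).comp (associator (cty := cty) A B (Ty.tensor C D)) :=
  (det_four A B C D).assoc.assoc.ext (by
    simp only [ap_hom_comp, ap_hom_tensor, ap_hom_associator, ap_hom_id])

theorem triangle (A B : Ty α) :
    (associator A Ty.unit B).comp ((YAQ.Hom.id A).tensor (ValueJudgment.leftUnitor B).cls) =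
      (ValueJudgment.rightUnitor A).cls.tensor (YAQ.Hom.id (cty := cty) B) := by
  -- Braiding `⟨y, ⟨x, *⟩⟩` gives the required pattern `⟨⟨x, *⟩, y⟩`.
  refine ((det_var_var_one B A).braid (.inl (isVal_var _ _))).ext ?_
  simp only [ap_hom_comp, ap_hom_tensor, ap_hom_associator, ap_hom_id, ap_hom_leftUnitor,
    ap_hom_rightUnitor]

theorem hexagon (A B C : Ty α) :
    (associator A B C).comp ((ValueJudgment.braiding A (Ty.tensor B C)).cls.comp
        (associator B C A)) =
      ((ValueJudgment.braiding A B).cls.tensor (YAQ.Hom.id C)).comp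
        ((associator B A C).comp ((YAQ.Hom.id B).tensor
          (ValueJudgment.braiding (cty := cty) A C).cls)) :=
  (det_three A B C).assoc.ext (by
    simp only [ap_hom_comp, ap_hom_tensor, ap_hom_associator, ap_hom_id, ap_hom_braiding,
      isVal_var, true_or])

/-! The strong monad. -/

/-- The action of `T` on arrows. -/
def thunk (f : YAQ.Hom cty A B) : YAQ.Hom cty (Ty.comp A) (Ty.comp B) :=
  (f.comp (ValueJudgment.unit B).cls).star

end YAQ.Hom

theorem Tm.force_hom_thunk (f : YAQ.Hom cty A B) (s : Tm cty (Ty.comp A)) :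
    force (ap f.thunk s) = ap f (force s) := by
  rw [YAQ.Hom.thunk, force_hom_star, ap_hom_comp, force_unit]

namespace YAQ.Hom

/-- Ties the explicit Kleisli extension of the theorem to the monad. Like all laws for arrows into
`T B`, it is checked after forcing. -/
theorem thunk_mult (f : YAQ.Hom cty A (Ty.comp B)) :
    f.thunk.comp (ValueJudgment.mult B).cls = f.star :=
  force_ext (det_var _) (isVal_var _ _) (by
    simp only [ap_hom_comp, force_mult, force_hom_thunk, force_hom_star])

theorem thunk_id (A : Ty α) : (YAQ.Hom.id A).thunk = YAQ.Hom.id (cty := cty) _ :=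
  force_ext (det_var _) (isVal_var _ _) (by simp only [force_hom_thunk, ap_hom_id])

theorem thunk_comp (f : YAQ.Hom cty A B) (g : YAQ.Hom cty B C) :
    (f.comp g).thunk = f.thunk.comp g.thunk :=
  force_ext (det_var _) (isVal_var _ _) (by simp only [force_hom_thunk, ap_hom_comp])

theorem unit_natural (f : YAQ.Hom cty A B) :
    f.comp (ValueJudgment.unit B).cls = (ValueJudgment.unit A).cls.comp f.thunk :=
  force_ext (det_var _) (isVal_var _ _) (by
    simp only [force_hom_thunk, ap_hom_comp, force_unit])

theorem mult_natural (f : YAQ.Hom cty A B) :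
    f.thunk.thunk.comp (ValueJudgment.mult B).cls = (ValueJudgment.mult A).cls.comp f.thunk :=
  force_ext (det_var _) (isVal_var _ _) (by
    simp only [force_hom_thunk, ap_hom_comp, force_mult])

theorem mult_assoc (A : Ty α) :
    (ValueJudgment.mult (cty := cty) A).cls.thunk.comp (ValueJudgment.mult A).cls =
      (ValueJudgment.mult (Ty.comp A)).cls.comp (ValueJudgment.mult A).cls :=
  force_ext (det_var _) (isVal_var _ _) (by
    simp only [force_hom_thunk, ap_hom_comp, force_mult])

theorem unit_mult (A : Ty α) :
    (ValueJudgment.unit (Ty.comp A)).cls.comp (ValueJudgment.mult A).cls =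
      YAQ.Hom.id (cty := cty) _ :=
  force_ext (det_var _) (isVal_var _ _) (by
    simp only [ap_hom_comp, force_mult, force_unit, ap_hom_id])

theorem thunk_unit_mult (A : Ty α) :
    (ValueJudgment.unit A).cls.thunk.comp (ValueJudgment.mult A).cls =
      YAQ.Hom.id (cty := cty) _ :=
  force_ext (det_var _) (isVal_var _ _) (by
    simp only [ap_hom_comp, force_mult, force_unit, ap_hom_id, force_hom_thunk])

theorem strength_natural (f : YAQ.Hom cty A A') (g : YAQ.Hom cty B B') :
    (f.tensor g.thunk).comp (ValueJudgment.strength A' B').cls =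
      (ValueJudgment.strength A B).cls.comp (f.tensor g).thunk :=
  force_ext (det_two _ _) ((isVal_var _ _).tens (isVal_var _ _)) (by
    simp only [force_hom_thunk, ap_hom_comp, force_strength, ap_hom_tensor])

theorem strength_leftUnitor (A : Ty α) :
    (ValueJudgment.strength Ty.unit A).cls.comp (ValueJudgment.leftUnitor A).cls.thunk =
      (ValueJudgment.leftUnitor (cty := cty) (Ty.comp A)).cls :=
  force_ext (det_one_var _) (isVal_one.tens (isVal_var _ _)) (by
    simp only [force_hom_thunk, ap_hom_comp, force_strength, ap_hom_leftUnitor])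

theorem strength_associator (A B C : Ty α) :
    (ValueJudgment.strength (Ty.tensor A B) C).cls.comp (associator A B C).thunk =
      (associator A B (Ty.comp C)).comp
        (((YAQ.Hom.id A).tensor (ValueJudgment.strength B C).cls).comp
          (ValueJudgment.strength (cty := cty) A (Ty.tensor B C)).cls) :=
  force_ext (det_three _ _ _).assoc
    (((isVal_var _ _).tens (isVal_var _ _)).tens (isVal_var _ _)) (by
    simp only [force_hom_thunk, ap_hom_comp, force_strength, ap_hom_associator, ap_hom_tensor,
      ap_hom_id])

theorem strength_unit (A B : Ty α) :
    ((YAQ.Hom.id A).tensor (ValueJudgment.unit B).cls).comp (ValueJudgment.strength A B).cls =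
      (ValueJudgment.unit (cty := cty) (Ty.tensor A B)).cls :=
  force_ext (det_two _ _) ((isVal_var _ _).tens (isVal_var _ _)) (by
    simp only [ap_hom_comp, force_strength, ap_hom_tensor, ap_hom_id, force_unit])

theorem strength_mult (A B : Ty α) :
    ((YAQ.Hom.id A).tensor (ValueJudgment.mult B).cls).comp (ValueJudgment.strength A B).cls =
      (ValueJudgment.strength A (Ty.comp B)).cls.comp
        ((ValueJudgment.strength A B).cls.thunk.comp
          (ValueJudgment.mult (cty := cty) (Ty.tensor A B)).cls) :=
  force_ext (det_two _ _) ((isVal_var _ _).tens (isVal_var _ _)) (by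
    simp only [ap_hom_comp, force_strength, ap_hom_tensor, ap_hom_id, force_mult,
      force_hom_thunk])

/-! The Kleisli exponentials. -/

theorem lolli_id (A B : Ty α) :
    (YAQ.Hom.id A).lolli (YAQ.Hom.id B) = YAQ.Hom.id (cty := cty) (Ty.lolli A B) :=
  lolli_ext (by simp only [app_hom_lolli, ap_hom_id])

theorem lolli_comp (f : YAQ.Hom cty A B) (f' : YAQ.Hom cty B C) (g : YAQ.Hom cty A' B')
    (g' : YAQ.Hom cty B' C') :
    (f.comp f').lolli (g.comp g') = (f'.lolli g).comp (f.lolli g') :=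
  lolli_ext (by simp only [app_hom_lolli, ap_hom_comp])

/-- By extensionality, currying depends on the class only: its application is computed by
`app_curry` from the class of `V`. -/
theorem curry_congr {V W : ValueJudgment cty (Ty.tensor A B) (Ty.comp C)}
    (h : V.cls = W.cls) : V.curry.cls = W.curry.cls :=
  lolli_ext (by simp only [app_curry, h])

/-- The inverse of `Φ`. -/
def curry (f : YAQ.Hom cty (Ty.tensor A B) (Ty.comp C)) : YAQ.Hom cty A (Ty.lolli B C) :=
  Quotient.lift (fun V => V.curry.cls) (fun _ _ h => curry_congr (Quotient.sound h)) f

end YAQ.Hom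

theorem Tm.app_hom_curry (f : YAQ.Hom cty (Ty.tensor A B) (Ty.comp C)) (s : Tm cty A)
    (t : Tm cty B) : app (ap f.curry s) t = force (ap f (tens s t)) := by
  induction f using Quotient.inductionOn with | h V => ?_
  exact app_curry V s t

namespace YAQ.Hom

theorem curry_Phi (f : YAQ.Hom cty A (Ty.lolli B C)) : f.Phi.curry = f :=
  lolli_ext (by simp only [app_hom_curry, force_hom_Phi])

theorem Phi_curry (f : YAQ.Hom cty (Ty.tensor A B) (Ty.comp C)) : f.curry.Phi = f :=
  force_ext (det_two _ _) ((isVal_var _ _).tens (isVal_var _ _)) (by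
    simp only [app_hom_curry, force_hom_Phi])

/-- Naturality in all three arguments at once; inserting identities gives the three separate
conditions. -/
theorem Phi_natural (f : YAQ.Hom cty A' A) (h : YAQ.Hom cty B' B) (k : YAQ.Hom cty C C')
    (g : YAQ.Hom cty A (Ty.lolli B C)) :
    Phi (f.comp (g.comp (h.lolli k))) = (f.tensor h).comp (g.Phi.comp k.thunk) :=
  force_ext (det_two _ _) ((isVal_var _ _).tens (isVal_var _ _)) (by
    simp only [ap_hom_comp, force_hom_Phi, app_hom_lolli, ap_hom_tensor, force_hom_thunk])

end YAQ.Hom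

end Laws

/-! ### Casts and promotion -/

section Casts
variable {α : Type u} {K : Type w} {cty : K → Ty α}

open Term

/-- A cast is a binding whose body uses the variable at the larger type: `let x^B = [M] in x^B`,
where the cast axiom shifts the cast from `M` to the occurrence of `x`. -/
theorem AxEq.castTo_let {Γ : Ctx α} {A B : Ty α} {M : Term α K} (h : Typed cty Γ M A)
    (hs : Ty.Sub A B) : AxEq cty Γ (M.castTo B) ((Pat.var A).bind M (var 0 B)) B := by
  have h1 : Typed cty Γ ((Pat.var B).bind (M.castTo B) (var 0 B)) B :=
    .let₁ (Ctx.Split.empty_left Γ) (.var_zero (Ty.Sub.refl B)) (h.castTo hs)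
  exact (AxEq.etaLet h1 (h.castTo hs)).symm.trans
    (.castLet hs h1 (.let₁ (Ctx.Split.empty_left Γ) (.var_zero hs) h))

/-- Casting rewrites annotations throughout a term and is not visibly a congruence; as a `let` it is
one. -/
theorem AxEq.castTo {Γ : Ctx α} {A B : Ty α} {M N : Term α K} (h : AxEq cty Γ M N A)
    (hs : Ty.Sub A B) : AxEq cty Γ (M.castTo B) (N.castTo B) B :=
  (AxEq.castTo_let h.typed.1 hs).trans
    (.trans (.app (Ctx.Split.empty_left Γ) (.lam (.refl (.var_zero hs))) h)
      (AxEq.castTo_let h.typed.2 hs).symm)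

theorem Typed.letPair_inv {Γ : Ctx α} {n : ℕ} {A B C : Ty α} {M N : Term α K}
    (h : Typed cty Γ (Term.letPair n A B M N) C) :
    ∃ Γ₁ Γ₂, Γ.Split Γ₁ Γ₂ ∧ Typed cty Γ₁ M (Ty.bangs n (Ty.tensor A B)) ∧
      Typed cty ((Γ₂.cons (some (Ty.bangs n A))).cons (some (Ty.bangs n B))) N C := by
  cases h with
  | letPair hs hM hN => exact ⟨_, _, hs, hM, hN⟩

theorem Typed.letUnit_inv {Γ : Ctx α} {C : Ty α} {M N : Term α K}
    (h : Typed cty Γ (Term.letUnit M N) C) :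
    ∃ Γ₁ Γ₂, Γ.Split Γ₁ Γ₂ ∧ Typed cty Γ₁ M Ty.unit ∧ Typed cty Γ₂ N C := by
  cases h with
  | letUnit hs hM hN => exact ⟨_, _, hs, hM, hN⟩

theorem Ty.Sub.bangs_bang (n : ℕ) (A : Ty α) : Ty.Sub (Ty.bangs (n + 1) A) (Ty.bangs n A) :=
  (Ty.Sub.refl _).bang_of

/-- The naturality of `ε` at the level of terms. A cast reaches only the body of a `let`, so the
bound value stays promoted, and the cast axioms are needed to undo this. -/
theorem AxEq.promote_castTo {V : Term α K} (hV : V.Value) : ∀ {Δ : Ctx α} {A : Ty α},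
    Typed cty Δ V A → AxEq cty Δ.bang (V.promote.castTo A) V A := by
  induction hV with
  | var i A =>
    intro Δ B h
    cases h.tyOf_eq
    exact .refl h.bang_narrow
  | const c A =>
    intro Δ B h
    cases h.tyOf_eq
    exact .refl h.bang_narrow
  | star n =>
    intro Δ B h
    cases h.tyOf_eq
    simp only [Term.promote, Term.castTo, Term.tyOf, Ty.bangCount_bangs, Ty.bangCount]
    exact .refl h.bang_narrow
  | lam n A M =>
    intro Δ B h
    have e : (Term.lam n A M).promote.castTo B = (Term.lam n A M).castTo B := rfl
    rw [e, h.castTo_self]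
    exact .refl h.bang_narrow
  | @pair n V W hV hW ihV ihW =>
    intro Δ C h
    cases h with
    | @pair _ _ _ hs _ A B _ _ h1 h2 =>
      simp only [Term.promote, Term.castTo, Ty.bangCount_bangs, Ty.bangCount, Ty.core_bangs,
        Ty.core, Ty.left, Ty.right, Nat.add_zero]
      exact .pair hs.bang n (ihV h1) (ihW h2)
  | @letVar A V W hV hW ihV ihW =>
    intro Δ C h
    obtain ⟨Δ₁, Δ₂, hs, h1, h2⟩ := h.bind_var_inv
    have iV := ihV h2
    have iW := ihW h1
    rw [Ctx.bang_cons] at iW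
    have e : (Term.app (Term.lam 0 A W) V).promote.castTo C =
      (Pat.var (Ty.bang A)).bind V.promote (W.promote.castTo C) := rfl
    rw [e]
    have h3 : AxEq cty Δ.bang ((Pat.var (Ty.bang A)).bind V.promote (W.promote.castTo C))
        ((Pat.var (Ty.bang A)).bind V.promote W) C :=
      .app hs.bang (.lam iW) (.refl (hV.promote_typed h2))
    have h4 : AxEq cty Δ.bang ((Pat.var A).bind (V.promote.castTo A) W)
        ((Pat.var A).bind V W) C :=
      .app hs.bang (.lam (.refl (h1.narrow fun i => by
        rcases i with _ | i
        · exact Or.inl rfl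
        · exact Or.inr rfl))) iV
    -- The binding of `V'` at `!A` becomes a binding of `[V']` at `A`, to which the induction
    -- hypothesis for `V` applies.
    exact h3.trans ((AxEq.castLet (Ty.Sub.refl A).bang_of h4.typed.1 h3.typed.2).symm.trans h4)
  | @letPair n A B V W hV hW ihV ihW =>
    intro Δ C h
    obtain ⟨Δ₁, Δ₂, hs, h1, h2⟩ := h.letPair_inv
    have iV := ihV h1
    have iW := ihW h2
    rw [Ctx.bang_cons, Ctx.bang_cons] at iW
    have e : (Term.letPair n A B V W).promote.castTo C =
      Term.letPair (n + 1) A B V.promote (W.promote.castTo C) := rfl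
    rw [e]
    have h3 : AxEq cty Δ.bang (Term.letPair (n + 1) A B V.promote (W.promote.castTo C))
        (Term.letPair (n + 1) A B V.promote W) C :=
      .letPair hs.bang (.refl (hV.promote_typed h1)) iW
    have h4 : AxEq cty Δ.bang
        (Term.letPair n A B (V.promote.castTo (Ty.bangs n (Ty.tensor A B))) W)
        (Term.letPair n A B V W) C :=
      .letPair hs.bang iV (.refl (h2.narrow fun i => by
        rcases i with _ | _ | i
        · exact Or.inl rfl
        · exact Or.inl rfl
        · exact Or.inr rfl))
    exact h3.trans ((AxEq.castPair (n := n + 1) (hV.promote_typed h1) (Ty.Sub.bangs_bang _ _)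
      h4.typed.1 h3.typed.2).symm.trans h4)
  | @letUnit V W hV hW ihV ihW =>
    intro Δ C h
    obtain ⟨Δ₁, Δ₂, hs, h1, h2⟩ := h.letUnit_inv
    exact .letUnit hs.bang (.refl h1.bang_narrow) (ihW h2)

/-- Because of `!A <: !!A`, a second promotion, which is typed over `!!Γ` at first, is typed over
`!Γ` too. -/
theorem Ctx.Le.bang_bang (Γ : Ctx α) : Γ.bang.Le Γ.bang.bang := by
  intro i
  cases h : Γ i with
  | none => exact Or.inr ⟨by simp [Ctx.bang, h], by simp [Ctx.bang, h]⟩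
  | some A =>
    exact Or.inl ⟨Ty.bang A, Ty.bang (Ty.bang A), by simp [Ctx.bang, h], by simp [Ctx.bang, h],
      Ty.Sub.digging A⟩

theorem Term.Value.promote_promote_typed {V : Term α K} (hV : V.Value) {Δ : Ctx α} {A : Ty α}
    (h : Typed cty Δ V A) : Typed cty Δ.bang V.promote.promote (Ty.bang (Ty.bang A)) :=
  (hV.promote_value.promote_typed (hV.promote_typed h)).mono (Ctx.Le.bang_bang Δ)

/-- The naturality of `δ` at the level of terms, with the same use of the cast axioms as for `ε`. -/
theorem AxEq.promote_promote {V : Term α K} (hV : V.Value) : ∀ {Δ : Ctx α} {A : Ty α},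
    Typed cty Δ V A →
      AxEq cty Δ.bang (V.promote.castTo (Ty.bang (Ty.bang A))) V.promote.promote
        (Ty.bang (Ty.bang A)) := by
  induction hV with
  | var i A =>
    intro Δ B h
    have := (Term.Value.var i A).promote_promote_typed h
    cases h.tyOf_eq
    exact .refl this
  | const c A =>
    intro Δ B h
    have := (Term.Value.const c A).promote_promote_typed h
    cases h.tyOf_eq
    exact .refl this
  | star n =>
    intro Δ B h
    have := (Term.Value.star n).promote_promote_typed h
    cases h.tyOf_eq
    simp only [Term.promote, Term.castTo, Term.tyOf, Ty.bangCount_bangs, Ty.bangCount] at this ⊢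
    exact .refl this
  | lam n A M =>
    intro Δ B h
    have := (Term.Value.lam n A M).promote_promote_typed h
    obtain ⟨D, rfl, -, hM⟩ := h.lam_inv
    simp only [Term.promote, Term.castTo, Ty.bangCount_bangs, Ty.bangCount, Ty.core_bangs,
        Ty.core, Ty.left, Ty.right, Nat.add_zero, hM.castTo_self] at this ⊢
    exact .refl this
  | @pair n V W hV hW ihV ihW =>
    intro Δ C h
    cases h with
    | @pair _ _ _ hs _ A B _ _ h1 h2 =>
      simp only [Term.promote, Term.castTo, Ty.bangCount_bangs, Ty.bangCount, Ty.core_bangs,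
        Ty.core, Ty.left, Ty.right, Nat.add_zero]
      exact .pair hs.bang (n + 1 + 1) (ihV h1) (ihW h2)
  | @letVar A V W hV hW ihV ihW =>
    intro Δ C h
    obtain ⟨Δ₁, Δ₂, hs, h1, h2⟩ := h.bind_var_inv
    have iV := ihV h2
    have iW := ihW h1
    rw [Ctx.bang_cons] at iW
    have h3 : AxEq cty Δ.bang
        ((Pat.var (Ty.bang A)).bind V.promote (W.promote.castTo (Ty.bang (Ty.bang C))))
        ((Pat.var (Ty.bang A)).bind V.promote W.promote.promote) (Ty.bang (Ty.bang C)) :=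
      .app hs.bang (.lam iW) (.refl (hV.promote_typed h2))
    have h5 := hW.promote_value.promote_typed (hW.promote_typed h1)
    rw [Ctx.bang_cons, Ctx.bang_cons] at h5
    have h4 : AxEq cty Δ.bang ((Pat.var (Ty.bang (Ty.bang A))).bind
        (V.promote.castTo (Ty.bang (Ty.bang A))) W.promote.promote)
        ((Pat.var (Ty.bang (Ty.bang A))).bind V.promote.promote W.promote.promote)
        (Ty.bang (Ty.bang C)) :=
      .app hs.bang (.lam (.refl (h5.mono ((Ctx.Le.bang_bang _).cons (Ty.Sub.refl _))))) iV
    exact h3.trans ((AxEq.castLet (Ty.Sub.digging A) h4.typed.1 h3.typed.2).symm.trans h4)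
  | @letPair n A B V W hV hW ihV ihW =>
    intro Δ C h
    obtain ⟨Δ₁, Δ₂, hs, h1, h2⟩ := h.letPair_inv
    have iV := ihV h1
    have iW := ihW h2
    rw [Ctx.bang_cons, Ctx.bang_cons] at iW
    have h3 : AxEq cty Δ.bang
        (Term.letPair (n + 1) A B V.promote (W.promote.castTo (Ty.bang (Ty.bang C))))
        (Term.letPair (n + 1) A B V.promote W.promote.promote) (Ty.bang (Ty.bang C)) :=
      .letPair hs.bang (.refl (hV.promote_typed h1)) iW
    have h5 := hW.promote_value.promote_typed (hW.promote_typed h2)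
    rw [Ctx.bang_cons, Ctx.bang_cons, Ctx.bang_cons, Ctx.bang_cons] at h5
    have h4 : AxEq cty Δ.bang
        (Term.letPair (n + 2) A B (V.promote.castTo (Ty.bangs (n + 2) (Ty.tensor A B)))
          W.promote.promote)
        (Term.letPair (n + 2) A B V.promote.promote W.promote.promote) (Ty.bang (Ty.bang C)) :=
      .letPair hs.bang iV
        (.refl (h5.mono (((Ctx.Le.bang_bang _).cons (Ty.Sub.refl _)).cons (Ty.Sub.refl _))))
    exact h3.trans ((AxEq.castPair (n := n + 1) (n' := n + 2) (A' := A) (B' := B) (hV.promote_typed h1) (Ty.Sub.digging (Ty.bangs n (Ty.tensor A B)))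
      h4.typed.1 h3.typed.2).symm.trans h4)
  | @letUnit V W hV hW ihV ihW =>
    intro Δ C h
    obtain ⟨Δ₁, Δ₂, hs, h1, h2⟩ := h.letUnit_inv
    exact .letUnit hs.bang (.refl h1.bang_narrow) (ihW h2)

end Casts

/-! ### Evaluation -/

section Evaluation
variable {α : Type u} {K : Type w} {cty : K → Ty α}

open Term

/-- Semantic values: values of the type `!A` that are not evaluated any further, `*`, pairs and
closures of the bodies of abstractions. -/
inductive Sem (α : Type u) (K : Type w) : Type (max u w)
  | ne (A : Ty α) (V : Term α K) (hV : V.Value)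
  | star
  | pair (a b : Sem α K)
  | clo (M : Term α K) (ρ : ℕ → Sem α K)

namespace Sem

/-- The value of the type `C` that a semantic value stands for. -/
def read : Sem α K → Ty α → Term α K
  | ne _ V _, C => V.castTo C
  | star, C => Term.star C.bangCount
  | pair a b, C => Term.pair C.bangCount (a.read (Ty.bangs C.bangCount C.core.left))
      (b.read (Ty.bangs C.bangCount C.core.right))
  | clo M ρ, C => Term.lam C.bangCount C.core.left
      ((M.castTo C.core.right).subst (subst.liftSubst 1 fun i D => (ρ i).read D))

theorem read_value (d : Sem α K) : ∀ C, (d.read C).Value := by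
  induction d with
  | ne A V hV => exact fun C => hV.castTo C
  | star => exact fun C => .star _
  | pair a b iha ihb => exact fun C => .pair _ (iha _) (ihb _)
  | clo M ρ ih => exact fun C => .lam _ _ _

/-- The first component. -/
def fst : Sem α K → Sem α K
  -- The cast to `!A.core` leaves exactly one mark, as the index `1` of the `letPair` demands; the
  -- component thus has one mark over `A.core.left`.
  | ne A V hV => ne A.core.left
      (Term.letPair 1 A.core.left A.core.right (V.castTo (Ty.bang A.core))
        (Term.var 1 (Ty.bang A.core.left))) (.letPair _ _ _ (hV.castTo _) (.var _ _))
  | pair a _ => a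
  -- A default that is never met at a tensor type.
  | d => d

/-- The second component. -/
def snd : Sem α K → Sem α K
  | ne A V hV => ne A.core.right
      (Term.letPair 1 A.core.left A.core.right (V.castTo (Ty.bang A.core))
        (Term.var 0 (Ty.bang A.core.right))) (.letPair _ _ _ (hV.castTo _) (.var _ _))
  | pair _ b => b
  | d => d

/-- Extension of an environment. -/
def cons (d : Sem α K) (ρ : ℕ → Sem α K) : ℕ → Sem α K
  | 0 => d
  | i + 1 => ρ i

end Sem

/-- Evaluation `M ⇓ r` in the environment `ρ`. -/
inductive Ev (cty : K → Ty α) : (ℕ → Sem α K) → Term α K → Sem α K → Prop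
  | var (ρ : ℕ → Sem α K) (i : ℕ) (A : Ty α) : Ev cty ρ (Term.var i A) (ρ i)
  -- The annotation of the occurrence is forgotten: the constant is kept at its assigned type, from
  -- which every use is a cast.
  | const (ρ : ℕ → Sem α K) (c : K) (A : Ty α) :
      Ev cty ρ (Term.const c A) (.ne (cty c) (Term.const c (Ty.bang (cty c))) (.const _ _))
  | star (ρ : ℕ → Sem α K) (n : ℕ) : Ev cty ρ (Term.star n) .star
  | lam (ρ : ℕ → Sem α K) (n : ℕ) (A : Ty α) (M : Term α K) : Ev cty ρ (Term.lam n A M) (.clo M ρ)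
  -- There is no rule for the application of an `ne`, so evaluation is partial.
  | app {ρ τ : ℕ → Sem α K} {M N P : Term α K} {e r : Sem α K} (hM : Ev cty ρ M (.clo P τ))
      (hN : Ev cty ρ N e) (hP : Ev cty (Sem.cons e τ) P r) : Ev cty ρ (Term.app M N) r
  | pair {ρ : ℕ → Sem α K} (n : ℕ) {M N : Term α K} {a b : Sem α K} (hM : Ev cty ρ M a)
      (hN : Ev cty ρ N b) : Ev cty ρ (Term.pair n M N) (.pair a b)
  | letPair {ρ : ℕ → Sem α K} (n : ℕ) (A B : Ty α) {M N : Term α K} {d r : Sem α K}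
      (hM : Ev cty ρ M d) (hN : Ev cty (Sem.cons d.snd (Sem.cons d.fst ρ)) N r) :
      Ev cty ρ (Term.letPair n A B M N) r
  -- The result `d` is not inspected, since it may be an `ne`; it only has to exist.
  | letUnit {ρ : ℕ → Sem α K} {M N : Term α K} {d r : Sem α K} (hM : Ev cty ρ M d)
      (hN : Ev cty ρ N r) : Ev cty ρ (Term.letUnit M N) r

theorem Ev.det {ρ : ℕ → Sem α K} {M : Term α K} {r r' : Sem α K} (h : Ev cty ρ M r) :
    Ev cty ρ M r' → r = r' := by
  induction h generalizing r' with
  | var | const | star | lam => intro h; cases h; rfl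
  | app hM hN hP ihM ihN ihP =>
    intro h
    cases h with
    | app h1 h2 h3 => cases ihM h1; cases ihN h2; exact ihP h3
  | pair n hM hN ihM ihN =>
    intro h
    cases h with
    | pair _ h1 h2 => cases ihM h1; cases ihN h2; rfl
  | letPair n A B hM hN ihM ihN =>
    intro h
    cases h with
    | letPair _ _ _ h1 h2 => cases ihM h1; exact ihN h2
  | letUnit hM hN ihM ihN =>
    intro h
    cases h with
    | letUnit h1 h2 => exact ihN h2

/-- The only applications evaluated inside a value are `let`s, whose function is an abstraction and
gives a closure at once. -/
theorem Term.Value.exists_ev {V : Term α K} (hV : V.Value) : ∀ ρ : ℕ → Sem α K,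
    ∃ r, Ev cty ρ V r := by
  induction hV with
  | var i A => exact fun ρ => ⟨_, .var ρ i A⟩
  | const c A => exact fun ρ => ⟨_, .const ρ c A⟩
  | star n => exact fun ρ => ⟨_, .star ρ n⟩
  | lam n A M => exact fun ρ => ⟨_, .lam ρ n A M⟩
  | pair n _ _ ihV ihW =>
    intro ρ
    obtain ⟨a, ha⟩ := ihV ρ
    obtain ⟨b, hb⟩ := ihW ρ
    exact ⟨_, .pair n ha hb⟩
  | letVar A _ _ ihV ihW =>
    intro ρ
    obtain ⟨e, he⟩ := ihV ρ
    obtain ⟨r, hr⟩ := ihW (Sem.cons e ρ)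
    exact ⟨r, .app (.lam _ _ _ _) he hr⟩
  | letPair n A B _ _ ihV ihW =>
    intro ρ
    obtain ⟨d, hd⟩ := ihV ρ
    obtain ⟨r, hr⟩ := ihW (Sem.cons d.snd (Sem.cons d.fst ρ))
    exact ⟨r, .letPair _ _ _ hd hr⟩
  | letUnit _ _ ihV ihW =>
    intro ρ
    obtain ⟨d, hd⟩ := ihV ρ
    obtain ⟨r, hr⟩ := ihW ρ
    exact ⟨r, .letUnit hd hr⟩

/-- Sequential composition of evaluations. -/
def obind (S : Sem α K → Prop) (T : Sem α K → Sem α K → Prop) (r : Sem α K) : Prop :=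
  ∃ d, S d ∧ T d r

/-- Application of semantic values. -/
def Sem.App (cty : K → Ty α) (d e r : Sem α K) : Prop :=
  ∃ P τ, d = .clo P τ ∧ Ev cty (Sem.cons e τ) P r

theorem ev_var (ρ : ℕ → Sem α K) (i : ℕ) (A : Ty α) : Ev cty ρ (Term.var i A) = (· = ρ i) := by
  funext r
  exact propext ⟨fun h => by cases h; rfl, fun h => h ▸ .var ρ i A⟩

theorem ev_app (ρ : ℕ → Sem α K) (M N : Term α K) :
    Ev cty ρ (Term.app M N) =
      obind (Ev cty ρ M) fun d => obind (Ev cty ρ N) fun e => d.App cty e := by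
  funext r
  refine propext ⟨fun h => ?_, ?_⟩
  · cases h with
    | app hM hN hP => exact ⟨_, hM, _, hN, _, _, rfl, hP⟩
  · rintro ⟨_, hM, e, hN, P, τ, rfl, hP⟩
    exact .app hM hN hP

theorem ev_pair (ρ : ℕ → Sem α K) (n : ℕ) (M N : Term α K) :
    Ev cty ρ (Term.pair n M N) =
      obind (Ev cty ρ M) fun a => obind (Ev cty ρ N) fun b => (· = Sem.pair a b) := by
  funext r
  refine propext ⟨fun h => ?_, ?_⟩
  · cases h with
    | pair _ hM hN => exact ⟨_, hM, _, hN, rfl⟩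
  · rintro ⟨_, hM, _, hN, rfl⟩
    exact .pair n hM hN

/-- The environment for the body of `let p = d in M`. -/
def Pat.env (d : Sem α K) (ρ : ℕ → Sem α K) : Pat α → ℕ → Sem α K
  | .var _ => Sem.cons d ρ
  | .unit => ρ
  | .pair _ _ _ => Sem.cons d.snd (Sem.cons d.fst ρ)

theorem ev_bind (ρ : ℕ → Sem α K) (p : Pat α) (M N : Term α K) :
    Ev cty ρ (p.bind M N) = obind (Ev cty ρ M) fun d => Ev cty (p.env d ρ) N := by
  funext r
  refine propext ⟨fun h => ?_, ?_⟩
  · cases p with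
    | var A =>
      cases h with
      | app hM hN hP => cases hM; exact ⟨_, hN, hP⟩
    | unit => cases h with | letUnit hM hN => exact ⟨_, hM, hN⟩
    | pair n A B => cases h with | letPair _ _ _ hM hN => exact ⟨_, hM, hN⟩
  · rintro ⟨d, hM, hN⟩
    cases p with
    | var A => exact .app (.lam _ _ _ _) hM hN
    | unit => exact .letUnit hM hN
    | pair n A B => exact .letPair _ _ _ hM hN

theorem Ev.eq_of {ρ : ℕ → Sem α K} {M : Term α K} {r : Sem α K} (h : Ev cty ρ M r) :
    Ev cty ρ M = (· = r) := by
  funext r'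
  exact propext ⟨fun h' => h'.det h, fun h' => h' ▸ h⟩

/-! Equivalence of semantic values, relative to a context `Γ`. -/

/-- `d` stands for values of the type `A`. -/
structure Sem.Wf (cty : K → Ty α) (Γ : Ctx α) (A : Ty α) (d : Sem α K) : Prop where
  ne : ∀ {A' V hV}, d = .ne A' V hV → Typed cty Γ V (Ty.bang A') ∧ Ty.Sub (Ty.bang A') (Ty.bang A)
  cast : ∀ {C D}, Ty.Sub (Ty.bang A) C → Ty.Sub C D → (d.read C).castTo D = d.read D

/-- `d` and `d'` stand for equivalent values of the type `A`. -/
structure Sem.Eqv (cty : K → Ty α) (Γ : Ctx α) (A : Ty α) (d d' : Sem α K) : Prop where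
  left : d.Wf cty Γ A
  right : d'.Wf cty Γ A
  -- A semantic value stands for a duplicable value, so it is read back at the supertypes of `!A`
  -- and not only at those of `A`.
  eq : ∀ {C}, Ty.Sub (Ty.bang A) C → AxEq cty Γ (d.read C) (d'.read C) C

/-- Two evaluations are related if their results are. -/
def ORel (R : Sem α K → Sem α K → Prop) (S S' : Sem α K → Prop) : Prop :=
  -- In particular, if one of the evaluations is stuck, then so is the other.
  (∀ r, S r → ∃ r', S' r' ∧ R r r') ∧ ∀ r', S' r' → ∃ r, S r ∧ R r r'

/-- The logical relation. -/
def Rel (cty : K → Ty α) (Γ : Ctx α) : Ty α → Sem α K → Sem α K → Prop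
  | .const a, d, d' => Sem.Eqv cty Γ (.const a) d d'
  | .unit, d, d' => Sem.Eqv cty Γ .unit d d'
  -- Semantic values are duplicable already, so the exclamation mark adds nothing.
  | .bang A, d, d' => Rel cty Γ A d d'
  | .tensor A B, d, d' => Sem.Eqv cty Γ (.tensor A B) d d' ∧
      Rel cty Γ A d.fst d'.fst ∧ Rel cty Γ B d.snd d'.snd
  -- Equivalence of the read-backs is part of the clause and is not derived by applying to fresh
  -- variables, so the context `Γ` can stay fixed.
  | .lolli A B, d, d' => Sem.Eqv cty Γ (.lolli A B) d d' ∧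
      ∀ e e', Rel cty Γ A e e' → ORel (Rel cty Γ B) (d.App cty e) (d'.App cty e')

theorem rel_bangs {Γ : Ctx α} {A : Ty α} (n : ℕ) {d d' : Sem α K} :
    Rel cty Γ (Ty.bangs n A) d d' ↔ Rel cty Γ A d d' := by
  induction n with
  | zero => rfl
  | succ n ih => exact ih

theorem Ty.Sub.bang_bang_iff {A C : Ty α} :
    Ty.Sub (Ty.bang (Ty.bang A)) C ↔ Ty.Sub (Ty.bang A) C :=
  ⟨fun h => (Ty.Sub.digging A).trans h, fun h => h.bang_of⟩

theorem Sem.Wf.bang {Γ : Ctx α} {A : Ty α} {d : Sem α K} :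
    d.Wf cty Γ (Ty.bang A) ↔ d.Wf cty Γ A := by
  constructor
  · exact fun h => ⟨fun e => ⟨(h.ne e).1, (h.ne e).2.trans (Ty.Sub.refl _).bang_of⟩,
      fun hC => h.cast (Ty.Sub.bang_bang_iff.2 hC)⟩
  · exact fun h => ⟨fun e => ⟨(h.ne e).1, (h.ne e).2.trans (Ty.Sub.digging _)⟩,
      fun hC => h.cast (Ty.Sub.bang_bang_iff.1 hC)⟩

theorem Rel.eqv {Γ : Ctx α} : ∀ {A : Ty α} {d d' : Sem α K}, Rel cty Γ A d d' →
    Sem.Eqv cty Γ A d d'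
  | .const _, _, _, h => h
  | .unit, _, _, h => h
  | .bang A, _, _, h =>
    have h := Rel.eqv (A := A) h
    ⟨Sem.Wf.bang.2 h.left, Sem.Wf.bang.2 h.right, fun hC => h.eq (Ty.Sub.bang_bang_iff.1 hC)⟩
  | .tensor _ _, _, _, h => h.1
  | .lolli _ _, _, _, h => h.1

theorem Sem.Eqv.symm {Γ : Ctx α} {A : Ty α} {d d' : Sem α K} (h : d.Eqv cty Γ A d') :
    d'.Eqv cty Γ A d := ⟨h.right, h.left, fun hC => (h.eq hC).symm⟩

theorem Sem.Eqv.trans {Γ : Ctx α} {A : Ty α} {d d' d'' : Sem α K} (h : d.Eqv cty Γ A d')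
    (h' : d'.Eqv cty Γ A d'') : d.Eqv cty Γ A d'' :=
  ⟨h.left, h'.right, fun hC => (h.eq hC).trans (h'.eq hC)⟩

theorem ORel.symm {R : Sem α K → Sem α K → Prop} (hR : ∀ {d d'}, R d d' → R d' d)
    {S S' : Sem α K → Prop} (h : ORel R S S') : ORel R S' S :=
  ⟨fun r hr => let ⟨r', h1, h2⟩ := h.2 r hr; ⟨r', h1, hR h2⟩,
    fun r hr => let ⟨r', h1, h2⟩ := h.1 r hr; ⟨r', h1, hR h2⟩⟩

theorem ORel.trans {R : Sem α K → Sem α K → Prop} (hR : ∀ {d d' d''}, R d d' → R d' d'' → R d d'')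
    {S S' S'' : Sem α K → Prop} (h : ORel R S S') (h' : ORel R S' S'') : ORel R S S'' :=
  ⟨fun r hr => let ⟨r', h1, h2⟩ := h.1 r hr; let ⟨r'', h3, h4⟩ := h'.1 r' h1; ⟨r'', h3, hR h2 h4⟩,
    fun r hr => let ⟨r', h1, h2⟩ := h'.2 r hr; let ⟨r'', h3, h4⟩ := h.2 r' h1; ⟨r'', h3, hR h4 h2⟩⟩

theorem ORel.imp {R R' : Sem α K → Sem α K → Prop} (hR : ∀ {d d'}, R d d' → R' d d')
    {S S' : Sem α K → Prop} (h : ORel R S S') : ORel R' S S' :=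
  ⟨fun r hr => let ⟨r', h1, h2⟩ := h.1 r hr; ⟨r', h1, hR h2⟩,
    fun r hr => let ⟨r', h1, h2⟩ := h.2 r hr; ⟨r', h1, hR h2⟩⟩

theorem ORel.pure {R : Sem α K → Sem α K → Prop} {d d' : Sem α K} (h : R d d') :
    ORel R (· = d) (· = d') :=
  ⟨fun _ e => ⟨d', rfl, e ▸ h⟩, fun _ e => ⟨d, rfl, e ▸ h⟩⟩

theorem ORel.bind {R R' : Sem α K → Sem α K → Prop} {S S' : Sem α K → Prop}
    {T T' : Sem α K → Sem α K → Prop} (h : ORel R S S')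
    (h' : ∀ d d', R d d' → ORel R' (T d) (T' d')) : ORel R' (obind S T) (obind S' T') := by
  refine ⟨?_, ?_⟩
  · rintro r ⟨d, hd, hr⟩
    obtain ⟨d', h1, h2⟩ := h.1 d hd
    obtain ⟨r', h3, h4⟩ := (h' d d' h2).1 r hr
    exact ⟨r', ⟨d', h1, h3⟩, h4⟩
  · rintro r ⟨d, hd, hr⟩
    obtain ⟨d', h1, h2⟩ := h.2 d hd
    obtain ⟨r', h3, h4⟩ := (h' d' d h2).2 r hr
    exact ⟨r', ⟨d', h1, h3⟩, h4⟩

theorem obind_pure (d : Sem α K) (T : Sem α K → Sem α K → Prop) : obind (· = d) T = T d := by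
  funext r
  exact propext ⟨fun ⟨_, e, h⟩ => e ▸ h, fun h => ⟨d, rfl, h⟩⟩

theorem obind_pure_right (S : Sem α K → Prop) : obind S (fun d => (· = d)) = S := by
  funext r
  exact propext ⟨fun ⟨_, h, e⟩ => e ▸ h, fun h => ⟨r, h, rfl⟩⟩

theorem obind_obind (S : Sem α K → Prop) (T U : Sem α K → Sem α K → Prop) :
    obind (obind S T) U = obind S fun d => obind (T d) U := by
  funext r
  exact propext ⟨fun ⟨e, ⟨d, h1, h2⟩, h3⟩ => ⟨d, h1, e, h2, h3⟩,
    fun ⟨d, h1, e, h2, h3⟩ => ⟨e, ⟨d, h1, h2⟩, h3⟩⟩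

theorem obind_comm (S T : Sem α K → Prop) (U : Sem α K → Sem α K → Sem α K → Prop) :
    obind S (fun d => obind T fun e => U d e) = obind T fun e => obind S fun d => U d e := by
  funext r
  exact propext ⟨fun ⟨d, h1, e, h2, h3⟩ => ⟨e, h2, d, h1, h3⟩,
    fun ⟨d, h1, e, h2, h3⟩ => ⟨e, h2, d, h1, h3⟩⟩

theorem Rel.symm {Γ : Ctx α} : ∀ {A : Ty α} {d d' : Sem α K}, Rel cty Γ A d d' →
    Rel cty Γ A d' d
  | .const _, _, _, h => Sem.Eqv.symm h
  | .unit, _, _, h => Sem.Eqv.symm h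
  | .bang A, _, _, h => Rel.symm (A := A) h
  | .tensor _ _, _, _, h => ⟨h.1.symm, Rel.symm h.2.1, Rel.symm h.2.2⟩
  | .lolli _ _, _, _, h => ⟨h.1.symm, fun e e' he => (h.2 e' e (Rel.symm he)).symm Rel.symm⟩

theorem Rel.trans {Γ : Ctx α} : ∀ {A : Ty α} {d d' d'' : Sem α K}, Rel cty Γ A d d' →
    Rel cty Γ A d' d'' → Rel cty Γ A d d''
  | .const _, _, _, _, h, h' => Sem.Eqv.trans h h'
  | .unit, _, _, _, h, h' => Sem.Eqv.trans h h'
  | .bang A, _, _, _, h, h' => Rel.trans (A := A) h h'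
  | .tensor _ _, _, _, _, h, h' =>
    ⟨h.1.trans h'.1, Rel.trans h.2.1 h'.2.1, Rel.trans h.2.2 h'.2.2⟩
  | .lolli _ B, _, _, _, h, h' =>
    ⟨h.1.trans h'.1, fun e e' he =>
      ORel.trans (R := Rel cty Γ B) (fun h h' => Rel.trans h h') (h.2 e e (Rel.trans he (Rel.symm he)))
        (h'.2 e e' he)⟩

theorem Sem.Eqv.sub {Γ : Ctx α} {A B : Ty α} {d d' : Sem α K} (h : d.Eqv cty Γ A d')
    (hs : Ty.Sub A B) : d.Eqv cty Γ B d' :=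
  have key : ∀ {d : Sem α K}, d.Wf cty Γ A → d.Wf cty Γ B := fun h =>
    ⟨fun e => ⟨(h.ne e).1, (h.ne e).2.trans hs.bang_bang⟩, fun hC => h.cast (hs.bang_bang.trans hC)⟩
  ⟨key h.left, key h.right, fun hC => h.eq (hs.bang_bang.trans hC)⟩

/-- Subsumption acts as the identity on semantic values, because evaluation ignores annotations and
the relation ignores exclamation marks. -/
theorem Rel.sub {Γ : Ctx α} {A B : Ty α} (hs : Ty.Sub A B) : ∀ {d d' : Sem α K},
    Rel cty Γ A d d' → Rel cty Γ B d d' := by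
  induction hs with
  | const h a => intro d d'; rw [rel_bangs, rel_bangs]; exact fun h => h
  | unit h => intro d d'; rw [rel_bangs, rel_bangs]; exact fun h => h
  | lolli h hA hB ihA ihB =>
    intro d d'
    rw [rel_bangs, rel_bangs]
    exact fun h => ⟨h.1.sub (.lolli_lolli hA hB), fun e e' he => (h.2 e e' (ihA he)).imp ihB⟩
  | tensor h hA hB ihA ihB =>
    intro d d'
    rw [rel_bangs, rel_bangs]
    exact fun h => ⟨h.1.sub (.tensor_tensor hA hB), ihA h.2.1, ihB h.2.2⟩

end Evaluation

/-! ### The fundamental lemma -/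

section Fundamental
variable {α : Type u} {K : Type w} {cty : K → Ty α}

open Term

/-- Substitutions that are compatible with casts. -/
structure CastSubst (Δ : Ctx α) (σ : ℕ → Ty α → Term α K) : Prop where
  cast : ∀ {i A B C}, Δ i = some A → Ty.Sub A B → Ty.Sub B C → (σ i B).castTo C = σ i C
  tyOf : ∀ {i A B}, Δ i = some A → Ty.Sub A B → (σ i B).tyOf = B

theorem CastSubst.mono {Δ Δ' : Ctx α} {σ : ℕ → Ty α → Term α K} (h : CastSubst Δ σ)
    (hΔ : ∀ {i A}, Δ' i = some A → Δ i = some A) : CastSubst Δ' σ :=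
  ⟨fun hi => h.cast (hΔ hi), fun hi => h.tyOf (hΔ hi)⟩

theorem CastSubst.lift {Δ : Ctx α} {σ : ℕ → Ty α → Term α K} (h : CastSubst Δ σ) (A : Ty α) :
    CastSubst (Δ.cons (some A)) (subst.liftSubst 1 σ) := by
  refine ⟨fun {i B C D} hi hB hC => ?_, fun {i B C} hi hB => ?_⟩
  · rcases i with _ | i
    · rfl
    · have e : ∀ D, subst.liftSubst 1 σ (i + 1) D = (σ i D).rename fun j => j + 1 := fun D => by
        simp [subst.liftSubst]
      rw [e, e, Term.castTo_rename, h.cast (i := i) hi hB hC]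
  · rcases i with _ | i
    · rfl
    · have e : subst.liftSubst 1 σ (i + 1) C = (σ i C).rename fun j => j + 1 := by
        simp [subst.liftSubst]
      rw [e, Term.tyOf_rename, h.tyOf (i := i) hi hB]

theorem Typed.tyOf_subst {Δ : Ctx α} {M : Term α K} {A : Ty α} (h : Typed cty Δ M A) :
    ∀ {σ : ℕ → Ty α → Term α K}, CastSubst Δ σ → (M.subst σ).tyOf = A := by
  induction h with
  | var hi hΔ h => intro σ hσ; exact hσ.tyOf hi h
  | const hΔ h => intros; rfl
  | star hΔ n => intros; rfl
  | lam hM ih => intro σ hσ; simp only [Term.subst, Term.tyOf, ih (hσ.lift _)]; rfl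
  | lamBang hΔ n hM ih => intro σ hσ; simp only [Term.subst, Term.tyOf, ih (hσ.lift _)]
  | app hΔ hM hN ihM ihN =>
    intro σ hσ
    simp only [Term.subst, Term.tyOf, ihM (hσ.mono hΔ.some_left)]; rfl
  | pair hΔ n hM hN ihM ihN =>
    intro σ hσ
    simp only [Term.subst, Term.tyOf, ihM (hσ.mono hΔ.some_left), ihN (hσ.mono hΔ.some_right),
      Ty.unbang_bangs]
  | letPair hΔ hM hN ihM ihN =>
    intro σ hσ
    simp only [Term.subst, Term.tyOf, liftSubst_two]
    exact ihN (((hσ.mono hΔ.some_right).lift _).lift _)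
  | letUnit hΔ hM hN ihM ihN => intro σ hσ; exact ihN (hσ.mono hΔ.some_right)

/-- The variant of `Typed.castTo_subst` for substitutions that are not known to be well-typed over
one context, which is the situation of the fundamental lemma. -/
theorem Typed.castTo_subst_comm {Δ : Ctx α} {M : Term α K} {A : Ty α} (h : Typed cty Δ M A) :
    ∀ {σ : ℕ → Ty α → Term α K}, CastSubst Δ σ →
      ∀ {B : Ty α}, Ty.Sub A B → (M.castTo B).subst σ = (M.subst σ).castTo B := by
  induction h with
  | var hi hΔ h => intro σ hσ B hB; exact (hσ.cast hi h hB).symm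
  | const hΔ h => intros; rfl
  | star hΔ n => intros; rfl
  | lam hM ih =>
    intro σ hσ C hC
    obtain ⟨A', B', h1, h2, hA, hB⟩ := Ty.Sub.of_lolli (n := 0) hC
    simp only [Term.castTo, Term.subst, h2, Ty.right, ih (hσ.lift _) hB]
  | lamBang hΔ n hM ih =>
    intro σ hσ C hC
    obtain ⟨A', B', h1, h2, hA, hB⟩ := Ty.Sub.of_lolli hC
    simp only [Term.castTo, Term.subst, h2, Ty.right, ih (hσ.lift _) hB]
  | app hΔ hM hN ihM ihN =>
    intro σ hσ C hC
    have h1 := hσ.mono hΔ.some_left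
    simp only [Term.castTo, Term.subst, hM.tyOf_subst h1, hM.tyOf_eq, Ty.left,
      ihM h1 (Ty.Sub.lolli_lolli (Ty.Sub.refl _) hC)]
  | pair hΔ n hM hN ihM ihN =>
    intro σ hσ C hC
    obtain ⟨A', B', h1, h2, hA, hB⟩ := Ty.Sub.of_tensor hC
    have hc := hC.count
    simp only [Ty.bangCount_bangs, Ty.bangCount, add_zero] at hc
    simp only [Term.castTo, Term.subst, h2, Ty.left, Ty.right,
      ihM (hσ.mono hΔ.some_left) (hA.bangs_of hc), ihN (hσ.mono hΔ.some_right) (hB.bangs_of hc)]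
  | letPair hΔ hM hN ihM ihN =>
    intro σ hσ C hC
    simp only [Term.castTo, Term.subst, liftSubst_two,
      ihN (((hσ.mono hΔ.some_right).lift _).lift _) hC]
  | letUnit hΔ hM hN ihM ihN =>
    intro σ hσ C hC
    simp only [Term.castTo, Term.subst, ihN (hσ.mono hΔ.some_right) hC]

variable {Γ : Ctx α}

/-- Over a context `!Γ` there is no linear variable to own, so any ownership function will do. -/
theorem SubstEq.of_isBang (hΓ : Γ.IsBang) {Δ : Ctx α} {σ σ' : ℕ → Ty α → Term α K}
    (h : ∀ {i A C}, Δ i = some A → Ty.Sub A C → AxEq cty Γ (σ i C) (σ' i C) C) :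
    SubstEq cty Δ Γ σ σ' fun j => j := by
  refine ⟨fun {i A C} hi hA => ?_, fun {j A} hj hA => ?_⟩
  · have e : (Γ.restrict fun j => j = i) = Γ := by
      funext j
      cases hj : Γ j with
      | none => exact Ctx.restrict_none _ hj
      | some B =>
        obtain ⟨B, rfl⟩ := hΓ j B hj
        exact Ctx.restrict_bang _ hj
    rw [e]
    exact h hi hA
  · obtain ⟨B, rfl⟩ := hΓ j A hj
    exact hA.elim

/-- The values that an environment stands for. -/
def Sem.readEnv (ρ : ℕ → Sem α K) : ℕ → Ty α → Term α K := fun i D => (ρ i).read D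

/-- Related environments. -/
structure EnvRel (cty : K → Ty α) (Γ Δ : Ctx α) (ρ ρ' : ℕ → Sem α K) : Prop where
  rel : ∀ {i A}, Δ i = some A → Rel cty Γ A (ρ i) (ρ' i)

section Env
variable {Δ : Ctx α} {ρ ρ' : ℕ → Sem α K}

theorem EnvRel.symm (h : EnvRel cty Γ Δ ρ ρ') : EnvRel cty Γ Δ ρ' ρ :=
  ⟨fun hi => (h.rel hi).symm⟩

theorem EnvRel.left (h : EnvRel cty Γ Δ ρ ρ') : EnvRel cty Γ Δ ρ ρ :=
  ⟨fun hi => (h.rel hi).trans (h.rel hi).symm⟩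

theorem EnvRel.right (h : EnvRel cty Γ Δ ρ ρ') : EnvRel cty Γ Δ ρ' ρ' := h.symm.left

theorem EnvRel.mono {Δ' : Ctx α} (h : EnvRel cty Γ Δ ρ ρ')
    (hΔ : ∀ {i A}, Δ' i = some A → Δ i = some A) : EnvRel cty Γ Δ' ρ ρ' :=
  ⟨fun hi => h.rel (hΔ hi)⟩

theorem EnvRel.cons (h : EnvRel cty Γ Δ ρ ρ') {A : Ty α} {e e' : Sem α K}
    (he : Rel cty Γ A e e') :
    EnvRel cty Γ (Δ.cons (some A)) (Sem.cons e ρ) (Sem.cons e' ρ') := by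
  refine ⟨fun {i B} hi => ?_⟩
  rcases i with _ | i
  · cases hi; exact he
  · exact h.rel (i := i) hi

theorem EnvRel.bang (h : EnvRel cty Γ Δ ρ ρ') : EnvRel cty Γ Δ.bang ρ ρ' := by
  refine ⟨fun {i B} hi => ?_⟩
  obtain ⟨A, hA, rfl⟩ := Option.map_eq_some_iff.1 hi
  exact (h.rel hA : Rel cty Γ A _ _)

theorem EnvRel.castSubst (h : EnvRel cty Γ Δ ρ ρ) : CastSubst Δ (Sem.readEnv ρ) :=
  ⟨fun hi hB hC => (h.rel hi).eqv.left.cast hB.bang_of hC,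
    fun hi hB => ((h.rel hi).eqv.eq hB.bang_of).typed.1.tyOf_eq⟩

theorem EnvRel.substEq (hΓ : Γ.IsBang) (h : EnvRel cty Γ Δ ρ ρ') :
    SubstEq cty Δ Γ (Sem.readEnv ρ) (Sem.readEnv ρ') fun j => j :=
  .of_isBang hΓ fun hi hC => (h.rel hi).eqv.eq hC.bang_of

theorem EnvRel.valSubst (hΓ : Γ.IsBang) (h : EnvRel cty Γ Δ ρ ρ) :
    ValSubst cty Δ Γ (Sem.readEnv ρ) fun j => j :=
  ⟨h.substEq hΓ, fun i A => (ρ i).read_value A, h.castSubst.cast⟩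

end Env

/-! Related semantic values. -/

theorem app_clo (P : Term α K) (τ : ℕ → Sem α K) (e : Sem α K) :
    (Sem.clo P τ).App cty e = Ev cty (Sem.cons e τ) P := by
  funext r
  exact propext ⟨fun ⟨_, _, e, h⟩ => by cases e; exact h, fun h => ⟨_, _, rfl, h⟩⟩

theorem Sem.Eqv.pair (hΓ : Γ.IsBang) {A B : Ty α} {a a' b b' : Sem α K}
    (ha : a.Eqv cty Γ A a') (hb : b.Eqv cty Γ B b') :
    (Sem.pair a b).Eqv cty Γ (Ty.tensor A B) (.pair a' b') := by
  have key : ∀ {a b : Sem α K}, a.Wf cty Γ A → b.Wf cty Γ B →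
      (Sem.pair a b).Wf cty Γ (Ty.tensor A B) := by
    intro a b ha hb
    refine ⟨fun e => (by cases e), fun {C D} hC hD => ?_⟩
    obtain ⟨A₁, B₁, h1, h2, hA, hB⟩ := Ty.Sub.of_tensor (n := 1) hC
    rw [h1] at hD
    obtain ⟨A₂, B₂, h3, h4, hA', hB'⟩ := Ty.Sub.of_tensor hD
    have hc := hD.count
    simp only [Ty.bangCount_bangs, Ty.bangCount, add_zero] at hc
    simp only [Sem.read, Term.castTo, h2, h4, Ty.left, Ty.right,
      ha.cast (hA.bangs_of (m := C.bangCount) (n := 1) (.inr le_rfl)) (hA'.bangs_of hc),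
      hb.cast (hB.bangs_of (m := C.bangCount) (n := 1) (.inr le_rfl)) (hB'.bangs_of hc)]
  refine ⟨key ha.left hb.left, key ha.right hb.right, fun {C} hC => ?_⟩
  obtain ⟨A₁, B₁, h1, h2, hA, hB⟩ := Ty.Sub.of_tensor (n := 1) hC
  have := AxEq.pair hΓ.split_self C.bangCount
    (ha.eq (hA.bangs_of (m := C.bangCount) (n := 1) (.inr le_rfl)))
    (hb.eq (hB.bangs_of (m := C.bangCount) (n := 1) (.inr le_rfl)))
  rw [← h1] at this
  simpa only [Sem.read, h2, Ty.left, Ty.right] using this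

/-- The body of a closure, at the type `B`. -/
def Sem.body (M : Term α K) (ρ : ℕ → Sem α K) (B : Ty α) : Term α K :=
  (M.castTo B).subst (subst.liftSubst 1 (Sem.readEnv ρ))

/-- A closure is read back at every function type above `A ⊸ B`, hence the bodies have to agree for
all smaller argument types and all larger result types. Any index on the abstraction is permitted,
as the context has the form `!Γ`. -/
theorem Sem.Eqv.clo (hΓ : Γ.IsBang) {A B : Ty α} {M M' : Term α K} {ρ ρ' : ℕ → Sem α K}
    (hM : ∀ {C D}, Ty.Sub B C → Ty.Sub C D → (Sem.body M ρ C).castTo D = Sem.body M ρ D)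
    (hM' : ∀ {C D}, Ty.Sub B C → Ty.Sub C D → (Sem.body M' ρ' C).castTo D = Sem.body M' ρ' D)
    (h : ∀ {C D}, Ty.Sub C A → Ty.Sub B D →
      AxEq cty (Γ.cons (some C)) (Sem.body M ρ D) (Sem.body M' ρ' D) D) :
    (Sem.clo M ρ).Eqv cty Γ (Ty.lolli A B) (.clo M' ρ') := by
  have key : ∀ {M : Term α K} {ρ : ℕ → Sem α K},
      (∀ {C D}, Ty.Sub B C → Ty.Sub C D → (Sem.body M ρ C).castTo D = Sem.body M ρ D) →
      (Sem.clo M ρ).Wf cty Γ (Ty.lolli A B) := by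
    intro M ρ hM
    refine ⟨fun e => (by cases e), fun {C D} hC hD => ?_⟩
    obtain ⟨A₁, B₁, h1, h2, hA, hB⟩ := Ty.Sub.of_lolli (n := 1) hC
    rw [h1] at hD
    obtain ⟨A₂, B₂, h3, h4, hA', hB'⟩ := Ty.Sub.of_lolli hD
    have := hM hB hB'
    unfold Sem.body Sem.readEnv at this
    simp only [Sem.read, Term.castTo, h2, h4, Ty.left, Ty.right, this]
  refine ⟨key hM, key hM', fun {C} hC => ?_⟩
  obtain ⟨A₁, B₁, h1, h2, hA, hB⟩ := Ty.Sub.of_lolli (n := 1) hC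
  have := AxEq.lam_bangs (n := C.bangCount) (.inr hΓ) (h hA hB)
  rw [← h1] at this
  unfold Sem.body Sem.readEnv at this
  simpa only [Sem.read, h2, Ty.left, Ty.right] using this

theorem EnvRel.body_castTo {Δ : Ctx α} {ρ : ℕ → Sem α K} (h : EnvRel cty Γ Δ ρ ρ)
    {A B : Ty α} {M : Term α K} (hM : Typed cty (Δ.cons (some A)) M B) {C D : Ty α}
    (hC : Ty.Sub B C) (hD : Ty.Sub C D) : (Sem.body M ρ C).castTo D = Sem.body M ρ D := by
  unfold Sem.body
  rw [← (hM.castTo hC).castTo_subst_comm (h.castSubst.lift A) hD, hM.castTo_castTo hC]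

theorem Ctx.Le.cons_sub {A B : Ty α} (Δ : Ctx α) (h : Ty.Sub A B) :
    (Δ.cons (some A)).Le (Δ.cons (some B)) := (Ctx.Le.refl Δ).cons h

theorem Sem.Eqv.ne {A A' : Ty α} {V : Term α K} (hV : V.Value) (h : Typed cty Γ V (Ty.bang A'))
    (hs : Ty.Sub (Ty.bang A') (Ty.bang A)) :
    (Sem.ne A' V hV).Eqv cty Γ A (.ne A' V hV) := by
  have key : (Sem.ne A' V hV).Wf cty Γ A :=
    ⟨fun e => by cases e; exact ⟨h, hs⟩,
      fun {C D} hC _ => h.castTo_castTo (hs.bang_right.trans (Ty.Sub.bang_bang_iff.2 hC)) D⟩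
  exact ⟨key, key, fun {C} hC =>
    .refl (h.castTo (hs.bang_right.trans (Ty.Sub.bang_bang_iff.2 hC)))⟩

/-- At function types an `ne` cannot be applied, so both evaluations are empty; at tensor types the
projections are again of the form `ne`. The number `n` collects the marks that the induction strips
off. -/
theorem Rel.ne : ∀ {A : Ty α} (n : ℕ) {V : Term α K} (hV : V.Value),
    Typed cty Γ V (Ty.bang (Ty.bangs n A)) →
      Rel cty Γ A (.ne (Ty.bangs n A) V hV) (.ne (Ty.bangs n A) V hV) := by
  have hsub : ∀ (n : ℕ) (A : Ty α), Ty.Sub (Ty.bang (Ty.bangs n A)) (Ty.bang A) := fun n A =>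
    (Ty.Sub.refl A).bangs_of (n := n + 1) (m := 1) (.inr (by omega))
  intro A
  induction A with
  | const a => intro n V hV h; exact Sem.Eqv.ne hV h (hsub n _)
  | unit => intro n V hV h; exact Sem.Eqv.ne hV h (hsub n _)
  | lolli A B ihA ihB =>
    intro n V hV h
    refine ⟨Sem.Eqv.ne hV h (hsub n _), fun e e' _ => ⟨?_, ?_⟩⟩
    · rintro r ⟨P, τ, e, -⟩; cases e
    · rintro r ⟨P, τ, e, -⟩; cases e
  | bang A ih =>
    intro n V hV h
    have e : Ty.bangs n (Ty.bang A) = Ty.bangs (n + 1) A := Ty.bangs_bang n A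
    have := ih (n + 1) hV (by rw [← e]; exact h)
    rw [← e] at this
    exact this
  | tensor A B ihA ihB =>
    intro n V hV h
    have h' := h.castTo (hsub n (Ty.tensor A B))
    refine ⟨Sem.Eqv.ne hV h (hsub n _), ?_, ?_⟩
    · simp only [Sem.fst, Ty.core_bangs, Ty.core, Ty.left, Ty.right]
      exact ihA 0 _ (.letPair (Ctx.Split.empty_right Γ) h'
        (.var rfl (by
          intro j C hj hC
          rcases j with _ | _ | j
          · cases hC; exact ⟨_, rfl⟩
          · exact absurd rfl hj
          · cases hC) (Ty.Sub.refl _)))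
    · simp only [Sem.snd, Ty.core_bangs, Ty.core, Ty.left, Ty.right]
      exact ihB 0 _ (.letPair (Ctx.Split.empty_right Γ) h'
        (.var rfl (by
          intro j C hj hC
          rcases j with _ | _ | j
          · exact absurd rfl hj
          · cases hC; exact ⟨_, rfl⟩
          · cases hC) (Ty.Sub.refl _)))

theorem Rel.star (hΓ : Γ.IsBang) : Rel cty Γ Ty.unit (.star : Sem α K) .star := by
  have key : (Sem.star : Sem α K).Wf cty Γ Ty.unit := ⟨fun e => (by cases e), fun _ _ => rfl⟩
  refine ⟨key, key, fun {C} hC => .refl ?_⟩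
  have := Typed.star (cty := cty) hΓ C.bangCount
  rwa [← Ty.Sub.of_unit (n := 1) hC] at this

theorem Rel.pair (hΓ : Γ.IsBang) {A B : Ty α} {a a' b b' : Sem α K} (ha : Rel cty Γ A a a')
    (hb : Rel cty Γ B b b') : Rel cty Γ (Ty.tensor A B) (.pair a b) (.pair a' b') :=
  ⟨ha.eqv.pair hΓ hb.eqv, ha, hb⟩

/-! Substitution. -/

/-- `σ` evaluates in `ρ` to `ρ'`. -/
structure SubRel (cty : K → Ty α) (Γ Δ : Ctx α) (σ : ℕ → Ty α → Term α K)
    (ρ ρ' : ℕ → Sem α K) : Prop where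
  cast : CastSubst Δ σ
  castRead : CastSubst Δ fun i D => (σ i D).subst (Sem.readEnv ρ)
  -- Stated for all renamings into larger environments, in order to survive the passage under
  -- binders.
  ev : ∀ {i A D f ρ₂}, Δ i = some A → Ty.Sub A D → (∀ j, ρ₂ (f j) = ρ j) →
    ORel (Rel cty Γ D) (Ev cty ρ₂ ((σ i D).rename f)) (· = ρ' i)
  -- Closures do not evaluate their bodies, so their comparison needs the substituted terms to be
  -- equivalent to the read-backs too.
  read : ∀ {i A D}, Δ i = some A → Ty.Sub A D →
    AxEq cty Γ ((σ i D).subst (Sem.readEnv ρ)) ((ρ' i).read D) D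

theorem SubRel.mono {Δ Δ' : Ctx α} {σ : ℕ → Ty α → Term α K} {ρ ρ' : ℕ → Sem α K}
    (h : SubRel cty Γ Δ σ ρ ρ') (hΔ : ∀ {i A}, Δ' i = some A → Δ i = some A) :
    SubRel cty Γ Δ' σ ρ ρ' :=
  ⟨h.cast.mono hΔ, h.castRead.mono hΔ, fun hi => h.ev (hΔ hi), fun hi => h.read (hΔ hi)⟩

theorem liftSubst_readEnv (σ : ℕ → Ty α → Term α K) (e : Sem α K) (ρ : ℕ → Sem α K) (i : ℕ)
    (D : Ty α) : (subst.liftSubst 1 σ (i + 1) D).subst (Sem.readEnv (Sem.cons e ρ)) =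
      (σ i D).subst (Sem.readEnv ρ) := by
  simp only [subst.liftSubst, Nat.add_sub_cancel, Nat.not_lt.2 (Nat.le_add_left 1 i), if_false,
    subst_rename]
  rfl

theorem SubRel.lift {Δ : Ctx α} {σ : ℕ → Ty α → Term α K} {ρ ρ' : ℕ → Sem α K}
    (h : SubRel cty Γ Δ σ ρ ρ') {A : Ty α} {e e' : Sem α K} (he : Rel cty Γ A e e') :
    SubRel cty Γ (Δ.cons (some A)) (subst.liftSubst 1 σ) (Sem.cons e ρ) (Sem.cons e' ρ') := by
  refine ⟨h.cast.lift A, ⟨fun {i B C D} hi hB hC => ?_, fun {i B C} hi hB => ?_⟩,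
    fun {i B D f ρ₂} hi hB hf => ?_, fun {i B D} hi hB => ?_⟩
  · rcases i with _ | i
    · cases hi; exact he.eqv.left.cast hB.bang_of hC
    · rw [liftSubst_readEnv, liftSubst_readEnv]
      exact h.castRead.cast (i := i) hi hB hC
  · rcases i with _ | i
    · cases hi; exact (he.eqv.eq hB.bang_of).typed.1.tyOf_eq
    · rw [liftSubst_readEnv]
      exact h.castRead.tyOf (i := i) hi hB
  · rcases i with _ | i
    · cases hi
      have e1 : Ev cty ρ₂ ((subst.liftSubst 1 σ 0 D).rename f) = (· = ρ₂ (f 0)) := ev_var _ _ _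
      rw [e1, hf 0]
      exact ORel.pure (he.sub hB)
    · have e1 : (subst.liftSubst 1 σ (i + 1) D).rename f = (σ i D).rename fun j => f (j + 1) := by
        simp [subst.liftSubst, Term.rename_rename]
      rw [e1]
      exact h.ev (i := i) hi hB fun j => hf (j + 1)
  · rcases i with _ | i
    · cases hi; exact he.eqv.eq hB.bang_of
    · rw [liftSubst_readEnv]
      exact h.read (i := i) hi hB

/-- Casts, substitutions and changes of environment are treated in a single induction, because a
closure keeps the cast and the substitution inside its unevaluated body. A renaming as `σ` gives
invariance under weakening and casts; a value in place of a variable gives soundness of β. -/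
theorem Typed.fundamental (hΓ : Γ.IsBang) {Δ : Ctx α} {M : Term α K} {A : Ty α}
    (h : Typed cty Δ M A) : ∀ {C : Ty α} {σ : ℕ → Ty α → Term α K} {ρ ρ' : ℕ → Sem α K},
      Ty.Sub A C → EnvRel cty Γ Δ ρ' ρ' → SubRel cty Γ Δ σ ρ ρ' →
        ORel (Rel cty Γ C) (Ev cty ρ ((M.castTo C).subst σ)) (Ev cty ρ' M) := by
  have hlam : ∀ {Δ : Ctx α} {n : ℕ} {A B : Ty α} {M : Term α K},
      Typed cty (Δ.cons (some A)) M B →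
      (∀ {C : Ty α} {σ : ℕ → Ty α → Term α K} {ρ ρ' : ℕ → Sem α K}, Ty.Sub B C →
        EnvRel cty Γ (Δ.cons (some A)) ρ' ρ' → SubRel cty Γ (Δ.cons (some A)) σ ρ ρ' →
        ORel (Rel cty Γ C) (Ev cty ρ ((M.castTo C).subst σ)) (Ev cty ρ' M)) →
      ∀ {C : Ty α} {σ : ℕ → Ty α → Term α K} {ρ ρ' : ℕ → Sem α K},
        Ty.Sub (Ty.bangs n (Ty.lolli A B)) C → EnvRel cty Γ Δ ρ' ρ' → SubRel cty Γ Δ σ ρ ρ' →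
        ORel (Rel cty Γ C) (Ev cty ρ (((Term.lam n A M).castTo C).subst σ))
          (Ev cty ρ' (Term.lam n A M)) := by
    intro Δ n A B M hM ih C σ ρ ρ' hC hρ hσ
    obtain ⟨A', B', h1, h2, hA, hB⟩ := Ty.Sub.of_lolli hC
    rw [(Ev.lam ρ' n A M).eq_of]
    simp only [Term.castTo, Term.subst]
    rw [(Ev.lam ρ _ _ _).eq_of, h1]
    simp only [Ty.core_bangs, Ty.core, Ty.right]
    refine ORel.pure ((rel_bangs _).2 ⟨?_, fun e e' he => ?_⟩)
    -- The body read back on the left is cast, substituted by `σ` and then by the read-back of `ρ`;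
    -- these merge into one cast and one substitution, which is compared with the read-back of `ρ'`.
    · have hb : ∀ {C}, Ty.Sub B' C →
          Sem.body ((M.castTo B').subst (subst.liftSubst 1 σ)) ρ C =
            (M.castTo C).subst (subst.liftSubst 1 fun i D => (σ i D).subst (Sem.readEnv ρ)) := by
        intro C hC
        rw [Sem.body, ← (hM.castTo hB).castTo_subst_comm (hσ.cast.lift A) hC,
          hM.castTo_castTo hB, subst_subst, liftSubst_comp]
      refine Sem.Eqv.clo hΓ (fun {C D} hC hD => ?_)
        (fun hC hD => hρ.body_castTo hM (hB.trans hC) hD) fun {C D} hC hD => ?_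
      · rw [hb hC, hb (hC.trans hD),
          ← (hM.castTo (hB.trans hC)).castTo_subst_comm (hσ.castRead.lift A) hD,
          hM.castTo_castTo (hB.trans hC)]
      · rw [hb hD]
        exact ((hM.castTo (hB.trans hD)).mono (Ctx.Le.cons_sub Δ (hC.trans hA))).subst_congr
          ((SubstEq.of_isBang hΓ hσ.read).lift C)
    · rw [app_clo, app_clo]
      have he' := he.sub hA
      exact ih hB (hρ.cons (he'.symm.trans he')) (hσ.lift he')
  induction h with
  | @var Δ i A B hi hΔ h =>
    intro C σ ρ ρ' hC hρ hσ
    rw [ev_var]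
    have := hσ.ev (f := fun j => j) (ρ₂ := ρ) hi (h.trans hC) fun _ => rfl
    rwa [rename_id] at this
  | @const Δ c B hΔ h =>
    intro C σ ρ ρ' hC hρ hσ
    rw [(Ev.const ρ' c B).eq_of]
    have e : Ev cty ρ (((Term.const c B).castTo C).subst σ) = _ := (Ev.const ρ c C).eq_of
    rw [e]
    -- Both occurrences evaluate to the same semantic value, related at the assigned type of the
    -- constant and hence at every larger one.
    refine ORel.pure (Rel.sub ((Ty.Sub.refl _).trans (h.trans hC)) (A := Ty.bang (cty c)) ?_)
    exact Rel.ne (A := cty c) 0 _ (.const hΓ (Ty.Sub.refl _))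
  | @star Δ hΔ n =>
    intro C σ ρ ρ' hC hρ hσ
    rw [(Ev.star ρ' n).eq_of]
    have e : Ev cty ρ (((Term.star n).castTo C).subst σ) = _ := (Ev.star ρ C.bangCount).eq_of
    rw [e, Ty.Sub.of_unit hC]
    exact ORel.pure ((rel_bangs _).2 (Rel.star hΓ))
  | lam hM ih => exact hlam (n := 0) hM ih
  | lamBang hΔ n hM ih => exact hlam hM ih
  | @app Δ Δ₁ Δ₂ hs A B M N hM hN ihM ihN =>
    intro C σ ρ ρ' hC hρ hσ
    simp only [Term.castTo, Term.subst, hM.tyOf_eq, Ty.left]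
    rw [ev_app, ev_app]
    refine (ihM (Ty.Sub.lolli_lolli (Ty.Sub.refl A) hC) (hρ.mono hs.some_left)
      (hσ.mono hs.some_left)).bind fun d d' hd => ?_
    have := ihN (Ty.Sub.refl A) (hρ.mono hs.some_right) (hσ.mono hs.some_right)
    rw [hN.castTo_self] at this
    exact this.bind fun e e' he => hd.2 e e' he
  | @pair Δ Δ₁ Δ₂ hs n A B M N hM hN ihM ihN =>
    intro C σ ρ ρ' hC hρ hσ
    obtain ⟨A', B', h1, h2, hA, hB⟩ := Ty.Sub.of_tensor hC
    have hc := hC.count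
    simp only [Ty.bangCount_bangs, Ty.bangCount, add_zero] at hc
    simp only [Term.castTo, Term.subst, h2, Ty.left, Ty.right]
    rw [ev_pair, ev_pair, h1]
    simp only [Ty.bangCount_bangs, Ty.bangCount, add_zero]
    refine (ihM (hA.bangs_of hc) (hρ.mono hs.some_left)
      (hσ.mono hs.some_left)).bind fun a a' ha => ?_
    refine (ihN (hB.bangs_of hc) (hρ.mono hs.some_right)
      (hσ.mono hs.some_right)).bind fun b b' hb => ?_
    exact ORel.pure ((rel_bangs _).2 (Rel.pair hΓ ((rel_bangs _).1 ha) ((rel_bangs _).1 hb)))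
  | @letPair Δ Δ₁ Δ₂ hs n A B C M N hM hN ihM ihN =>
    intro D σ ρ ρ' hC hρ hσ
    simp only [Term.castTo, Term.subst]
    have e1 := ev_bind (cty := cty) ρ (.pair n A B) (M.subst σ)
      ((N.castTo D).subst (subst.liftSubst 2 σ))
    have e2 := ev_bind (cty := cty) ρ' (.pair n A B) M N
    simp only [Pat.bind] at e1 e2
    rw [e1, e2]
    have := ihM (Ty.Sub.refl _) (hρ.mono hs.some_left) (hσ.mono hs.some_left)
    rw [hM.castTo_self] at this
    refine this.bind fun d d' hd => ?_
    have hd := (rel_bangs _).1 hd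
    rw [liftSubst_two]
    exact ihN hC (((hρ.mono hs.some_right).cons ((rel_bangs n).2 (hd.symm.trans hd).2.1)).cons
        ((rel_bangs n).2 (hd.symm.trans hd).2.2))
      (((hσ.mono hs.some_right).lift ((rel_bangs n).2 hd.2.1)).lift ((rel_bangs n).2 hd.2.2))
  | @letUnit Δ Δ₁ Δ₂ hs C M N hM hN ihM ihN =>
    intro D σ ρ ρ' hC hρ hσ
    simp only [Term.castTo, Term.subst]
    have e1 := ev_bind (cty := cty) ρ .unit (M.subst σ) ((N.castTo D).subst σ)
    have e2 := ev_bind (cty := cty) ρ' .unit M N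
    simp only [Pat.bind] at e1 e2
    rw [e1, e2]
    have := ihM (Ty.Sub.refl _) (hρ.mono hs.some_left) (hσ.mono hs.some_left)
    rw [hM.castTo_self] at this
    exact this.bind fun d d' hd => ihN hC (hρ.mono hs.some_right) (hσ.mono hs.some_right)

end Fundamental

/-! ### Evaluation of values -/

section Adequacy
variable {α : Type u} {K : Type w} {cty : K → Ty α} {Γ : Ctx α}

open Term

theorem SubRel.rename {Δ : Ctx α} {f : ℕ → ℕ} {ρ ρ' : ℕ → Sem α K}
    (h : EnvRel cty Γ Δ (fun i => ρ (f i)) ρ') :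
    SubRel cty Γ Δ (fun i A => Term.var (f i) A) ρ ρ' :=
  ⟨⟨fun _ _ _ => rfl, fun _ _ => rfl⟩, h.left.castSubst,
    fun {i A D g ρ₂} hi hD hg => by
      have e : Ev cty ρ₂ ((Term.var (f i) D).rename g) = (· = ρ₂ (g (f i))) := ev_var _ _ _
      rw [e, hg]
      exact ORel.pure ((h.rel hi).sub hD),
    fun hi hD => (h.rel hi).eqv.eq hD.bang_of⟩

/-- The fundamental lemma for a substitution of variables for variables. -/
theorem Typed.ev_rename (hΓ : Γ.IsBang) {Δ : Ctx α} {M : Term α K} {A C : Ty α}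
    (hM : Typed cty Δ M A) (hC : Ty.Sub A C) {f : ℕ → ℕ} {ρ ρ' : ℕ → Sem α K}
    (h : EnvRel cty Γ Δ (fun i => ρ (f i)) ρ') :
    ORel (Rel cty Γ C) (Ev cty ρ ((M.castTo C).rename f)) (Ev cty ρ' M) := by
  rw [rename_eq_subst]
  exact hM.fundamental hΓ hC h.right (.rename h)

theorem Typed.ev_castTo (hΓ : Γ.IsBang) {Δ : Ctx α} {M : Term α K} {A C : Ty α}
    (hM : Typed cty Δ M A) (hC : Ty.Sub A C) {ρ ρ' : ℕ → Sem α K}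
    (h : EnvRel cty Γ Δ ρ ρ') : ORel (Rel cty Γ C) (Ev cty ρ (M.castTo C)) (Ev cty ρ' M) := by
  have := hM.ev_rename hΓ hC (f := fun i => i) h
  rwa [rename_id] at this

theorem Typed.ev (hΓ : Γ.IsBang) {Δ : Ctx α} {M : Term α K} {A : Ty α}
    (hM : Typed cty Δ M A) {ρ ρ' : ℕ → Sem α K}
    (h : EnvRel cty Γ Δ ρ ρ') : ORel (Rel cty Γ A) (Ev cty ρ M) (Ev cty ρ' M) := by
  have := hM.ev_castTo hΓ (Ty.Sub.refl A) h
  rwa [hM.castTo_self] at this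

theorem Typed.rel_of_ev (hΓ : Γ.IsBang) {Δ : Ctx α} {M : Term α K} {A : Ty α}
    (hM : Typed cty Δ M A) {ρ ρ' : ℕ → Sem α K} (h : EnvRel cty Γ Δ ρ ρ') {r r' : Sem α K}
    (hr : Ev cty ρ M r) (hr' : Ev cty ρ' M r') : Rel cty Γ A r r' := by
  obtain ⟨s, h1, h2⟩ := (hM.ev hΓ h).1 r hr
  cases h1.det hr'
  exact h2

/-- Substitution of one value. -/
theorem AxEq.subst_one (hΓ : Γ.IsBang) {A B : Ty α} {M N V : Term α K}
    (h : AxEq cty (Ctx.single A) M N B) (hV : V.Value) (hVA : Typed cty Γ V A) :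
    AxEq cty Γ (M.subst fun _ D => V.castTo D) (N.subst fun _ D => V.castTo D) B := by
  have key : ∀ {i X}, Ctx.single A i = some X → X = A := by
    intro i X hi
    rcases i with _ | i <;> cases hi
    rfl
  refine h.subst (own := fun j => j) ⟨.of_isBang hΓ fun {i X C} hi hC => ?_,
    fun i D => hV.castTo D, fun {i X C D} hi hC hD => ?_⟩
  · cases key hi; exact .refl (hVA.castTo hC)
  · cases key hi; exact hVA.castTo_castTo hC D

/-- Surjective pairing with both components projected separately, which is possible as the variable
has a type `!(A ⊗ B)` and may be used twice. Splitting the variable into a pair on both sides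
reduces it to β. -/
theorem AxEq.projections {k : ℕ} {A B A' B' : Ty α} (hA : Ty.Sub A A') (hB : Ty.Sub B B') :
    AxEq cty (Ctx.single (Ty.bang (Ty.tensor A B)))
      (Term.pair k
        (Term.letPair 1 A B (Term.var 0 (Ty.bang (Ty.tensor A B))) (Term.var 1 (Ty.bangs k A')))
        (Term.letPair 1 A B (Term.var 0 (Ty.bang (Ty.tensor A B))) (Term.var 0 (Ty.bangs k B'))))
      (Term.var 0 (Ty.bangs k (Ty.tensor A' B')) : Term α K) (Ty.bangs k (Ty.tensor A' B')) := by
  have hk : ∀ {A A' : Ty α}, Ty.Sub A A' → Ty.Sub (Ty.bang A) (Ty.bangs k A') := fun h =>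
    h.bangs_of (n := 1) (.inr le_rfl)
  have hΔ : ((Ctx.empty.cons (some (Ty.bang A))).cons (some (Ty.bang B))).IsBang := by
    intro j C hC
    rcases j with _ | _ | j
    · cases hC; exact ⟨_, rfl⟩
    · cases hC; exact ⟨_, rfl⟩
    · cases hC
  have hvar : ∀ {Γ : Ctx α} {i : ℕ} {A B : Ty α}, Γ.IsBang → Γ i = some A → Ty.Sub A B →
      Typed cty Γ (Term.var i B : Term α K) B := fun hΓ hi h => .var hi (fun j C _ hj => hΓ j C hj) h
  have hΔ' : ∀ {Γ : Ctx α}, Γ.IsBang →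
      ((Γ.cons (some (Ty.bang A))).cons (some (Ty.bang B))).IsBang := by
    intro Γ hΓ j C hC
    rcases j with _ | _ | j
    · cases hC; exact ⟨_, rfl⟩
    · cases hC; exact ⟨_, rfl⟩
    · exact hΓ j C hC
  have hS : (Ctx.single (Ty.bang (Ty.tensor A B))).IsBang := by
    rw [← Ctx.bang_single]; exact Ctx.bang_isBang _
  have h1 : ∀ {Γ : Ctx α} {V : Term α K}, Γ.IsBang →
      Typed cty Γ V (Ty.bang (Ty.tensor A B)) →
      Typed cty Γ (Term.pair k (Term.letPair 1 A B V (Term.var 1 (Ty.bangs k A')))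
        (Term.letPair 1 A B V (Term.var 0 (Ty.bangs k B')))) (Ty.bangs k (Ty.tensor A' B')) :=
    fun hΓ hV => .pair hΓ.split_self k
      (.letPair hΓ.split_self hV (hvar (hΔ' hΓ) rfl (hk hA)))
      (.letPair hΓ.split_self hV (hvar (hΔ' hΓ) rfl (hk hB)))
  have hp : Typed cty ((Ctx.empty.cons (some (Ty.bang A))).cons (some (Ty.bang B)))
      (Term.pair 1 (Term.var 1 (Ty.bang A)) (Term.var 0 (Ty.bang B)) : Term α K)
      (Ty.bang (Ty.tensor A B)) :=
    .pair hΔ.split_self 1 (hvar hΔ rfl (Ty.Sub.refl _)) (hvar hΔ rfl (Ty.Sub.refl _))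
  have e1 := axEq_split_pair (Γ := Ctx.empty) (n := 1) (h1 hS (.var_zero (Ty.Sub.refl _)))
  have e2 := axEq_split_pair (Γ := Ctx.empty) (n := 1) (A := A) (B := B)
    (.var_zero (cty := cty) (hk (Ty.Sub.tensor_tensor hA hB)))
  refine e1.trans (.trans ?_ e2.symm)
  refine .letPair (Ctx.Split.empty_right _) (.refl (.var_zero (Ty.Sub.refl _))) ?_
  have e3 : (Term.var 0 (Ty.bangs k (Ty.tensor A' B')) : Term α K).subst (pairSubst 1 A B) =
      Term.pair k (Term.var 1 (Ty.bangs k A')) (Term.var 0 (Ty.bangs k B')) := by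
    simp only [Term.subst, pairSubst, Term.castTo, Ty.bangCount_bangs, Ty.bangCount, add_zero,
      Ty.core_bangs, Ty.core, Ty.left, Ty.right]
  rw [e3]
  have hl : ∀ {A' : Ty α} (i : ℕ) {X : Ty α},
      ((((Ctx.empty.cons (some (Ty.bang A))).cons (some (Ty.bang B))).cons
        (some (Ty.bang A))).cons (some (Ty.bang B))) i = some (Ty.bang X) → Ty.Sub X A' →
      Typed cty ((Ctx.empty.cons (some (Ty.bang A))).cons (some (Ty.bang B)))
        (Term.letPair 1 A B (Term.pair 1 (Term.var 1 (Ty.bang A)) (Term.var 0 (Ty.bang B)))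
          (Term.var i (Ty.bangs k A')) : Term α K) (Ty.bangs k A') := fun i X hi h =>
    .letPair hΔ.split_self hp (hvar (hΔ' hΔ) hi (hk h))
  exact .pair hΔ.split_self k
    (.betaPair (.var _ _) (.var _ _) (hl 1 rfl hA) (hvar hΔ rfl (hk hA)))
    (.betaPair (.var _ _) (.var _ _) (hl 0 rfl hB) (hvar hΔ rfl (hk hB)))

theorem Ty.Sub.to_tensor {n : ℕ} {A B C : Ty α} (h : Ty.Sub C (Ty.bangs n (Ty.tensor A B))) :
    ∃ A' B', C.core = Ty.tensor A' B' ∧ Ty.Sub A' A ∧ Ty.Sub B' B := by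
  have h' := (Ty.sub_iff.1 h).2
  simp only [Ty.core_bangs, Ty.core] at h'
  generalize C.core = X at h'
  cases X <;> simp [Ty.CoreSub] at h'
  exact ⟨_, _, rfl, h'.1, h'.2⟩

/-- The evaluation of `let ⟨x, y⟩ = M in ⟨x, y⟩`. -/
theorem Rel.eta_tensor (hΓ : Γ.IsBang) {A B : Ty α} {d : Sem α K}
    (h : Rel cty Γ (Ty.tensor A B) d d) : Rel cty Γ (Ty.tensor A B) (.pair d.fst d.snd) d := by
  refine ⟨?_, h.2⟩
  have hp := Rel.pair hΓ h.2.1 h.2.2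
  refine ⟨hp.eqv.left, h.eqv.left, fun {C} hC => ?_⟩
  have hty := (h.eqv.eq (Ty.Sub.refl _)).typed.1.tyOf_eq
  cases d with
  -- This case and the next do not occur: the read-back at `!(A ⊗ B)` would not have that type.
  | star => cases hty
  | clo M ρ => cases hty
  | pair a b => exact hp.eqv.eq hC
  -- The components of an `ne` are `let`-projections of `V`, and `AxEq.projections` at `V`
  -- reassembles them.
  | ne A₀ V hV =>
    obtain ⟨hVt, hs⟩ := h.eqv.left.ne rfl
    obtain ⟨l, r, hc, hl, hr⟩ := Ty.Sub.to_tensor (n := 1) hs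
    have hc : A₀.core = Ty.tensor l r := hc
    have h0 : Ty.bangs A₀.bangCount (Ty.tensor l r) = A₀ := by rw [← hc, Ty.bangs_core]
    have hs' : Ty.Sub (Ty.bang A₀) (Ty.bang (Ty.tensor l r)) := by
      rw [← h0]
      exact (Ty.Sub.refl _).bangs_of (n := A₀.bangCount + 1) (m := 1) (.inr (by omega))
    obtain ⟨A', B', h1, h2, hA, hB⟩ := Ty.Sub.of_tensor (n := 1) hC
    have := (AxEq.projections (cty := cty) (K := K) (k := C.bangCount) (hl.trans hA)
      (hr.trans hB)).subst_one hΓ (hV.castTo (Ty.bang (Ty.tensor l r))) (hVt.castTo hs')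
    rw [← h1] at this
    simp only [Term.subst, subst.liftSubst, hVt.castTo_castTo hs', Nat.one_lt_two,
      Nat.zero_lt_two, if_true] at this
    simpa only [Sem.read, Sem.fst, Sem.snd, hc, h2, Ty.left, Ty.right, Term.castTo] using this

/-- The evaluation of `let * = M in *`. -/
theorem Rel.eta_unit (hΓ : Γ.IsBang) {d : Sem α K} (h : Rel cty Γ Ty.unit d d) :
    Rel cty Γ Ty.unit .star d := by
  refine ⟨(Rel.star hΓ).eqv.left, h.eqv.left, fun {C} hC => ?_⟩
  have hS : (Ctx.single (Ty.bang (Ty.unit : Ty α))).IsBang := by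
    rw [← Ctx.bang_single]; exact Ctx.bang_isBang _
  -- Over a variable of type `!1`, both `*^1` and the variable itself are equivalent to the same
  -- `let * = - in *^1`.
  have e1 := axEq_split_unit (cty := cty) (Γ := Ctx.empty) (n := 1)
    (Typed.star (cty := cty) hS 1 : Typed cty _ (Term.star 1 : Term α K) _)
  have e2 := axEq_split_unit (cty := cty) (Γ := Ctx.empty) (n := 1)
    (.var_zero (Ty.Sub.refl _) : Typed cty _ (Term.var 0 (Ty.bangs 1 Ty.unit) : Term α K) _)
  have hd := (h.eqv.eq (Ty.Sub.refl _)).typed.1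
  have e3 := (e1.trans e2.symm).subst_one hΓ (d.read_value _) hd
  simp only [Term.subst] at e3
  have e4 := e3.castTo (B := C) hC
  have e5 : (d.read (Ty.bang Ty.unit)).castTo (Ty.bangs 1 Ty.unit) = d.read (Ty.bang Ty.unit) :=
    h.eqv.left.cast (Ty.Sub.refl _) (Ty.Sub.refl _)
  rw [e5, h.eqv.left.cast (Ty.Sub.refl _) hC] at e4
  exact e4

theorem subst_consSubst (M V : Term α K) (σ : ℕ → Ty α → Term α K) :
    (M.subst (subst.liftSubst 1 σ)).subst (consSubst V Term.var) = M.subst (consSubst V σ) := by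
  rw [subst_subst]
  congr 1
  funext i A
  rcases i with _ | i
  · rfl
  · simp only [subst.liftSubst, Nat.add_sub_cancel, Nat.not_lt.2 (Nat.le_add_left 1 i), if_false,
      subst_rename]
    exact subst_var _

theorem subst_consSubst_two (M V W : Term α K) (σ : ℕ → Ty α → Term α K) :
    (M.subst (subst.liftSubst 2 σ)).subst (consSubst W (consSubst V Term.var)) =
      M.subst (consSubst W (consSubst V σ)) := by
  rw [subst_subst]
  congr 1
  funext i A
  rcases i with _ | _ | i
  · rfl
  · rfl
  · have h : ¬ (i + 2 < 2) := by omega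
    simp only [subst.liftSubst, h, if_false, subst_rename]
    exact subst_var _

/-- The value of a value. -/
theorem Term.Value.adequate (hΓ : Γ.IsBang) {V : Term α K} (hV : V.Value) :
    ∀ {Δ : Ctx α} {A : Ty α} {ρ : ℕ → Sem α K} {r : Sem α K}, Typed cty Δ V A →
      EnvRel cty Γ Δ ρ ρ → Ev cty ρ V r →
        AxEq cty Γ (V.promote.subst (Sem.readEnv ρ)) (r.read (Ty.bang A)) (Ty.bang A) := by
  have key : ∀ {V : Term α K} {Δ : Ctx α} {A : Ty α} {ρ : ℕ → Sem α K} {r : Sem α K},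
      Typed cty Δ V A → EnvRel cty Γ Δ ρ ρ → Ev cty ρ V r →
        V.promote.subst (Sem.readEnv ρ) = r.read (Ty.bang A) →
        AxEq cty Γ (V.promote.subst (Sem.readEnv ρ)) (r.read (Ty.bang A)) (Ty.bang A) := by
    intro V Δ A ρ r h hρ hr e
    rw [e]
    exact (h.rel_of_ev hΓ hρ hr hr).eqv.eq (Ty.Sub.refl _)
  induction hV with
  | var i B =>
    intro Δ A ρ r h hρ hr
    cases hr
    cases h.tyOf_eq
    exact key h hρ (.var ρ i _) rfl
  | const c B =>
    intro Δ A ρ r h hρ hr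
    cases hr
    cases h.tyOf_eq
    exact key h hρ (.const ρ c _) rfl
  | star n =>
    intro Δ A ρ r h hρ hr
    cases hr
    cases h.tyOf_eq
    refine key h hρ (.star ρ n) ?_
    simp [Term.promote, Sem.read, Term.subst, Ty.bangCount, Ty.bangCount_bangs, Term.tyOf]
  | lam n A M =>
    intro Δ C ρ r h hρ hr
    cases hr
    obtain ⟨B, rfl, hn, hM⟩ := h.lam_inv
    refine key h hρ (.lam ρ n A M) ?_
    simp only [Term.promote, Sem.read, Term.subst, Ty.bangCount, Ty.bangCount_bangs, Ty.core,
      Ty.core_bangs, Ty.left, Ty.right, hM.castTo_self, add_zero]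
    rfl
  | @pair n V W hV hW ihV ihW =>
    intro Δ C ρ r h hρ hr
    cases hr with
    | pair _ ha hb =>
      cases h with
      | pair hs _ h1 h2 =>
        have := AxEq.pair hΓ.split_self (n + 1) (ihV h1 (hρ.mono hs.some_left) ha)
          (ihW h2 (hρ.mono hs.some_right) hb)
        simpa [Term.promote, Sem.read, Term.subst, Ty.bangCount, Ty.bangCount_bangs, Ty.core,
          Ty.core_bangs, Ty.left, Ty.right, Ty.bangs] using this
  | @letVar B V W hV hW ihV ihW =>
    intro Δ C ρ r h hρ hr
    obtain ⟨Δ₁, Δ₂, hs, h2, h1⟩ := Typed.bind_var_inv h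
    cases hr with
    | @app _ _ _ _ _ e _ hL he hr =>
      cases hL
      have hrel := h1.rel_of_ev hΓ (hρ.mono hs.some_right) he he
      have e1 := ihV h1 (hρ.mono hs.some_right) he
      have hρ' := (hρ.mono hs.some_left).cons hrel
      have e2 := ihW h2 hρ' hr
      have h3 := hW.promote_typed h2
      rw [Ctx.bang_cons] at h3
      have h4 : Typed cty (Γ.cons (some (Ty.bang B)))
          (W.promote.subst (subst.liftSubst 1 (Sem.readEnv ρ))) (Ty.bang C) :=
        h3.subst (((hρ.mono hs.some_left).bang.substEq hΓ).lift _)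
      refine .trans (.app hΓ.split_self (.lam (.refl h4)) e1) (.trans ?_ e2)
      -- Once the bound value is replaced by the read-back of its evaluation, the β-reduct is the
      -- body in the extended environment, to which the induction hypothesis applies.
      have e4 : subst₁ (e.read (Ty.bang B)) (W.promote.subst (subst.liftSubst 1
          (Sem.readEnv ρ))) = W.promote.subst (Sem.readEnv (Sem.cons e ρ)) := by
        rw [subst₁_eq, subst_consSubst]
        refine h3.subst_ext fun i X D hi hD => ?_
        rcases i with _ | i
        · cases hi
          exact hrel.eqv.left.cast (Ty.Sub.refl _) hD
        · rfl
      have e5 := AxEq.betaLam (e.read_value _)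
        (.app hΓ.split_self (.lam h4) e1.typed.2) (by rw [e4]; exact e2.typed.1)
      rw [e4] at e5
      exact e5
  | @letPair n A B V W hV hW ihV ihW =>
    intro Δ C ρ r h hρ hr
    obtain ⟨Δ₁, Δ₂, hs, h1, h2⟩ := Typed.letPair_inv h
    cases hr with
    | @letPair _ _ _ _ _ _ d _ hd hr =>
      have hrel := (rel_bangs _).1 (h1.rel_of_ev hΓ (hρ.mono hs.some_left) hd hd)
      have e1 := ihV h1 (hρ.mono hs.some_left) hd
      -- An `ne` is first expanded into a pair of its projections, so that β for pairs can be used.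
      have e0 := (hrel.eta_tensor hΓ).eqv.eq (C := Ty.bangs (n + 1) (Ty.tensor A B))
        ((Ty.Sub.refl _).bangs_of (n := 1) (.inr le_rfl))
      simp only [Sem.read, Ty.bangCount_bangs, Ty.bangCount, Ty.core_bangs, Ty.core, Ty.left,
        Ty.right, add_zero] at e0
      have hρ' := ((hρ.mono hs.some_right).cons ((rel_bangs n).2 hrel.2.1)).cons
        ((rel_bangs n).2 hrel.2.2)
      have e2 := ihW h2 hρ' hr
      have h3 := hW.promote_typed h2
      rw [Ctx.bang_cons, Ctx.bang_cons] at h3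
      have h4 : Typed cty ((Γ.cons (some (Ty.bang (Ty.bangs n A)))).cons
          (some (Ty.bang (Ty.bangs n B))))
          (W.promote.subst (subst.liftSubst 2 (Sem.readEnv ρ))) (Ty.bang C) := by
        rw [liftSubst_two]
        exact h3.subst ((((hρ.mono hs.some_right).bang.substEq hΓ).lift _).lift _)
      refine .trans (.letPair (n := n + 1) hΓ.split_self (e1.trans e0.symm) (.refl h4))
        (.trans ?_ e2)
      have e4 : subst₂ (d.fst.read (Ty.bangs (n + 1) A)) (d.snd.read (Ty.bangs (n + 1) B))
          (W.promote.subst (subst.liftSubst 2 (Sem.readEnv ρ))) =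
          W.promote.subst (Sem.readEnv (Sem.cons d.snd (Sem.cons d.fst ρ))) := by
        rw [subst₂_eq, subst_consSubst_two]
        refine h3.subst_ext fun i X D hi hD => ?_
        rcases i with _ | _ | i
        · cases hi
          exact hrel.2.2.eqv.left.cast ((Ty.Sub.refl _).bangs_of (n := 1) (.inr le_rfl)) hD
        · cases hi
          exact hrel.2.1.eqv.left.cast ((Ty.Sub.refl _).bangs_of (n := 1) (.inr le_rfl)) hD
        · rfl
      have e5 := AxEq.betaPair (d.fst.read_value _) (d.snd.read_value _)
        (.letPair hΓ.split_self e0.typed.1 h4) (by rw [e4]; exact e2.typed.1)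
      rw [e4] at e5
      exact e5
  | @letUnit V W hV hW ihV ihW =>
    intro Δ C ρ r h hρ hr
    obtain ⟨Δ₁, Δ₂, hs, h1, h2⟩ := Typed.letUnit_inv h
    cases hr with
    | @letUnit _ _ _ d _ hd hr =>
      have hrel := h1.rel_of_ev hΓ (hρ.mono hs.some_left) hd hd
      have e1 := (ihV h1 (hρ.mono hs.some_left) hd).castTo (B := Ty.unit) (Ty.Sub.refl _).bang_of
      have hσ := (hρ.mono hs.some_left).bang
      rw [← (hV.promote_typed h1).castTo_subst_comm hσ.castSubst (Ty.Sub.refl _).bang_of,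
        hrel.eqv.left.cast (Ty.Sub.refl _) (Ty.Sub.refl _).bang_of] at e1
      -- Promotion leaves the scrutinee of `let *` alone, whereas the induction hypothesis is about
      -- its promotion; casting that to `1` gives the scrutinee back.
      have e3 := (AxEq.promote_castTo hV h1).subst (hσ.valSubst hΓ)
      have e0 := (hrel.eta_unit hΓ).eqv.eq (C := Ty.unit) (Ty.Sub.refl _).bang_of
      have e2 := ihW h2 (hρ.mono hs.some_right) hr
      refine .trans (.letUnit hΓ.split_self (e3.symm.trans (e1.trans e0.symm)) (.refl e2.typed.1))
        (.trans ?_ e2)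
      exact .betaUnit (.letUnit hΓ.split_self e0.typed.1 e2.typed.1) e2.typed.1

/-- Adequacy without promotion: cast the equation for the promotion down, and use that the cast
promotion is the value itself. -/
theorem Term.Value.adequate_castTo (hΓ : Γ.IsBang) {V : Term α K} (hV : V.Value) {Δ : Ctx α}
    {A D : Ty α} {ρ : ℕ → Sem α K} {r : Sem α K} (h : Typed cty Δ V A)
    (hρ : EnvRel cty Γ Δ ρ ρ) (hr : Ev cty ρ V r) (hD : Ty.Sub A D) :
    AxEq cty Γ ((V.castTo D).subst (Sem.readEnv ρ)) (r.read D) D := by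
  have e1 := (hV.adequate hΓ h hρ hr).castTo hD.bang_of
  have h' := hV.promote_typed h
  rw [← h'.castTo_subst_comm hρ.bang.castSubst hD.bang_of,
    (h.rel_of_ev hΓ hρ hr hr).eqv.left.cast (Ty.Sub.refl _) hD.bang_of] at e1
  have e2 := ((AxEq.promote_castTo hV h).castTo hD).subst (hρ.bang.valSubst hΓ)
  rw [h'.castTo_castTo (Ty.Sub.refl A).bang_of] at e2
  exact e2.symm.trans e1

/-- The substitution performed by β is matched by extending the environment with the result of `V`.
Adequacy provides the clause on read-backs, and this is where it enters the proof of soundness. -/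
theorem SubRel.consSubst (hΓ : Γ.IsBang) {Δ Δ' : Ctx α} {σ : ℕ → Ty α → Term α K}
    {ρ ρ' : ℕ → Sem α K} (h : SubRel cty Γ Δ σ ρ ρ') {V : Term α K} (hV : V.Value) {A : Ty α}
    (hVA : Typed cty Δ' V A) (hρ : EnvRel cty Γ Δ' ρ ρ) {e : Sem α K} (he : Ev cty ρ V e) :
    SubRel cty Γ (Δ.cons (some A)) (consSubst V σ) ρ (Sem.cons e ρ') := by
  refine ⟨⟨fun {i B C D} hi hB hC => ?_, fun {i B C} hi hB => ?_⟩,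
    ⟨fun {i B C D} hi hB hC => ?_, fun {i B C} hi hB => ?_⟩,
    fun {i B D f ρ₂} hi hB hf => ?_, fun {i B D} hi hB => ?_⟩ <;> rcases i with _ | i
  · cases hi; exact hVA.castTo_castTo hB D
  · exact h.cast.cast (i := i) hi hB hC
  · cases hi; exact (hVA.castTo hB).tyOf_eq
  · exact h.cast.tyOf (i := i) hi hB
  · cases hi
    simp only [LinLam.consSubst]
    rw [← (hVA.castTo hB).castTo_subst_comm hρ.castSubst hC, hVA.castTo_castTo hB]
  · exact h.castRead.cast (i := i) hi hB hC
  · cases hi; exact (hVA.castTo hB).tyOf_subst hρ.castSubst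
  · exact h.castRead.tyOf (i := i) hi hB
  · cases hi
    have e1 := hVA.ev_rename hΓ hB (f := f) (ρ := ρ₂) (ρ' := ρ)
      (by rw [show (fun i => ρ₂ (f i)) = ρ from funext hf]; exact hρ)
    rw [he.eq_of] at e1
    exact e1
  · exact h.ev (i := i) hi hB hf
  · cases hi; exact hV.adequate_castTo hΓ hVA hρ he hB
  · exact h.read (i := i) hi hB

end Adequacy

/-! ### Soundness of the axiomatic equivalence for the evaluation -/

section Soundness
variable {α : Type u} {K : Type w} {cty : K → Ty α} {Γ : Ctx α}

open Term

/-- The type of the term that is bound to a pattern. -/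
def Pat.ty : Pat α → Ty α
  | .var A => A
  | .unit => Ty.unit
  | .pair n A B => Ty.bangs n (Ty.tensor A B)

/-- The context of the body of a binding. -/
def Pat.ctx (Δ : Ctx α) : Pat α → Ctx α
  | .var A => Δ.cons (some A)
  | .unit => Δ
  | .pair n A B => (Δ.cons (some (Ty.bangs n A))).cons (some (Ty.bangs n B))

theorem Typed.bind_inv {p : Pat α} {Δ : Ctx α} {M N : Term α K} {C : Ty α}
    (h : Typed cty Δ (p.bind M N) C) :
    ∃ Δ₁ Δ₂, Δ.Split Δ₁ Δ₂ ∧ Typed cty Δ₁ M p.ty ∧ Typed cty (p.ctx Δ₂) N C := by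
  cases p with
  | var A =>
    obtain ⟨Δ₁, Δ₂, hs, h1, h2⟩ := h.bind_var_inv
    exact ⟨Δ₂, Δ₁, hs.symm, h2, h1⟩
  | unit => exact h.letUnit_inv
  | pair n A B => exact h.letPair_inv

theorem EnvRel.pat {Δ : Ctx α} {ρ ρ' : ℕ → Sem α K} (h : EnvRel cty Γ Δ ρ ρ') (p : Pat α)
    {d d' : Sem α K} (hd : Rel cty Γ p.ty d d') :
    EnvRel cty Γ (p.ctx Δ) (p.env d ρ) (p.env d' ρ') := by
  cases p with
  | var A => exact h.cons hd
  | unit => exact h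
  | pair n A B =>
    have hd := (rel_bangs n).1 hd
    exact (h.cons ((rel_bangs n).2 hd.2.1)).cons ((rel_bangs n).2 hd.2.2)

theorem Pat.env_add (p : Pat α) (d : Sem α K) (ρ : ℕ → Sem α K) (i : ℕ) :
    p.env d ρ (i + p.size) = ρ i := by
  cases p <;> rfl

theorem Pat.env_congr (p : Pat α) (d : Sem α K) (ρ ρ' : ℕ → Sem α K) {i : ℕ} (hi : i < p.size) :
    p.env d ρ i = p.env d ρ' i := by
  cases p with
  | var A => rcases i with _ | i; · rfl
             · exact absurd hi (by simp [Pat.size])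
  | unit => exact absurd hi (by simp [Pat.size])
  | pair n A B =>
    rcases i with _ | _ | i
    · rfl
    · rfl
    · exact absurd hi (by simp [Pat.size])

theorem Pat.env_skip (p q : Pat α) (d e : Sem α K) (ρ : ℕ → Sem α K) :
    (fun i => p.env e (q.env d ρ) (liftVar p.size (fun i => i + q.size) i)) = p.env e ρ := by
  funext i
  by_cases hi : i < p.size
  · simp only [liftVar, hi, if_true]
    exact p.env_congr e _ _ hi
  · obtain ⟨j, rfl⟩ := Nat.exists_eq_add_of_le' (Nat.not_lt.1 hi)
    simp only [liftVar, hi, if_false, Nat.add_sub_cancel, Pat.env_add]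

theorem Pat.env_swap (p q : Pat α) (d e : Sem α K) (ρ : ℕ → Sem α K) :
    (fun i => p.env d (q.env e ρ) (swapVar q.size p.size i)) = q.env e (p.env d ρ) := by
  funext i
  by_cases hi : i < q.size
  · simp only [swapVar, hi, if_true, Pat.env_add]
    exact q.env_congr e _ _ hi
  · obtain ⟨j, rfl⟩ := Nat.exists_eq_add_of_le' (Nat.not_lt.1 hi)
    by_cases hj : j < p.size
    · have : j + q.size < q.size + p.size := by omega
      simp only [swapVar, hi, if_false, this, if_true, Nat.add_sub_cancel, Pat.env_add]
      exact p.env_congr d _ _ hj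
    · obtain ⟨k, rfl⟩ := Nat.exists_eq_add_of_le' (Nat.not_lt.1 hj)
      have h1 : ¬ (k + p.size + q.size < q.size + p.size) := by omega
      simp only [swapVar, hi, if_false, h1, Pat.env_add]
      rw [show k + p.size + q.size = k + q.size + p.size by omega, Pat.env_add, Pat.env_add]

theorem Typed.ev_rename_self (hΓ : Γ.IsBang) {Δ : Ctx α} {M : Term α K} {A : Ty α}
    (hM : Typed cty Δ M A) {f : ℕ → ℕ} {ρ ρ' : ℕ → Sem α K}
    (h : EnvRel cty Γ Δ (fun i => ρ (f i)) ρ') :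
    ORel (Rel cty Γ A) (Ev cty ρ (M.rename f)) (Ev cty ρ' M) := by
  have := hM.ev_rename hΓ (Ty.Sub.refl A) h
  rwa [hM.castTo_self] at this

theorem Typed.ev_shift (hΓ : Γ.IsBang) {Δ : Ctx α} {M : Term α K} {A : Ty α}
    (hM : Typed cty Δ M A) (p : Pat α) {d : Sem α K} {ρ : ℕ → Sem α K}
    (h : EnvRel cty Γ Δ ρ ρ) :
    ORel (Rel cty Γ A) (Ev cty (p.env d ρ) (M.rename fun i => i + p.size)) (Ev cty ρ M) :=
  hM.ev_rename_self hΓ (by simpa only [Pat.env_add] using h)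

theorem rel_trans {A : Ty α} {S S' S'' : Sem α K → Prop} (h : ORel (Rel cty Γ A) S S')
    (h' : ORel (Rel cty Γ A) S' S'') : ORel (Rel cty Γ A) S S'' :=
  h.trans Rel.trans h'

theorem rel_symm {A : Ty α} {S S' : Sem α K → Prop} (h : ORel (Rel cty Γ A) S S') :
    ORel (Rel cty Γ A) S' S := h.symm Rel.symm

section
variable {Δ : Ctx α} {ρ : ℕ → Sem α K}

/-- Sequential composition of evaluations is associative; what is left is the invariance of `P`
under weakening. -/
theorem ev_letAssoc (hΓ : Γ.IsBang) (p q : Pat α) {C : Ty α} {M N P : Term α K}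
    (hl : Typed cty Δ (p.bind (q.bind M N) P) C) (hρ : EnvRel cty Γ Δ ρ ρ) :
    ORel (Rel cty Γ C) (Ev cty ρ (p.bind (q.bind M N) P))
      (Ev cty ρ (q.bind M (p.bind N (P.rename (liftVar p.size fun i => i + q.size))))) := by
  obtain ⟨Δ₁, Δ₂, hs, h1, hP⟩ := hl.bind_inv
  obtain ⟨Δ₃, Δ₄, hs', hM, hN⟩ := h1.bind_inv
  rw [ev_bind, ev_bind, obind_obind, ev_bind]
  refine (hM.ev hΓ ((hρ.mono hs.some_left).mono hs'.some_left)).bind fun d d' hd => ?_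
  rw [ev_bind]
  refine (hN.ev hΓ (((hρ.mono hs.some_left).mono hs'.some_right).pat q hd)).bind fun e e' he => ?_
  refine rel_symm (hP.ev_rename_self hΓ ?_)
  rw [Pat.env_skip]
  exact (hρ.mono hs.some_right).pat p he.symm

/-- Two independent evaluations can be exchanged by `obind_comm`. The left typing supplies that of
`V` and `M`, the right one that of the unshifted `W`. -/
theorem ev_letSwap (hΓ : Γ.IsBang) (p q : Pat α) {C : Ty α} {V W M : Term α K}
    (hl : Typed cty Δ (p.bind V (q.bind (W.rename fun i => i + p.size) M)) C)
    (hr : Typed cty Δ (q.bind W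
        (p.bind (V.rename fun i => i + q.size) (M.rename (swapVar q.size p.size)))) C)
    (hρ : EnvRel cty Γ Δ ρ ρ) :
    ORel (Rel cty Γ C) (Ev cty ρ (p.bind V (q.bind (W.rename fun i => i + p.size) M)))
      (Ev cty ρ (q.bind W
        (p.bind (V.rename fun i => i + q.size) (M.rename (swapVar q.size p.size))))) := by
  obtain ⟨Δ₁, Δ₂, hs, hV, h2⟩ := hl.bind_inv
  obtain ⟨Δ₃, Δ₄, hs', -, hM⟩ := h2.bind_inv
  obtain ⟨Δ₅, Δ₆, hs'', hW, -⟩ := hr.bind_inv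
  have hρV := hρ.mono hs.some_left
  have hρW := hρ.mono hs''.some_left
  rw [ev_bind, ev_bind]
  have hMρ : ∀ {d d' e e'}, Rel cty Γ p.ty d d' → Rel cty Γ q.ty e e' →
      EnvRel cty Γ (q.ctx Δ₄) (q.env e (p.env d ρ)) (q.env e' (p.env d' ρ)) := fun hd he =>
    (((hρ.mono hs.some_right).pat p hd).mono hs'.some_right).pat q he
  have e1 : ORel (Rel cty Γ C)
      (obind (Ev cty ρ V) fun d => Ev cty (p.env d ρ) (q.bind (W.rename fun i => i + p.size) M))
      (obind (Ev cty ρ V) fun d => obind (Ev cty ρ W) fun e =>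
        Ev cty (q.env e (p.env d ρ)) M) := by
    refine (hV.ev hΓ hρV).bind fun d d' hd => ?_
    rw [ev_bind]
    exact (hW.ev_shift hΓ p hρW).bind fun e e' he => hM.ev hΓ (hMρ hd he)
  refine rel_trans e1 (rel_symm ?_)
  rw [obind_comm]
  refine (hW.ev hΓ hρW).bind fun e e' he => ?_
  rw [ev_bind]
  refine (hV.ev_shift hΓ q hρV).bind fun d d' hd => hM.ev_rename_self hΓ ?_
  rw [Pat.env_swap]
  exact hMρ hd he

/-- Applied to an argument, the closure evaluates `V` once more and applies the result. The
read-backs agree by adequacy for `V` followed by the η-axiom for the read-back of its result. -/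
theorem ev_etaLam (hΓ : Γ.IsBang) {n : ℕ} {A B : Ty α} {V : Term α K} (hV : V.Value)
    (hl : Typed cty Δ
      (lam n A (app ((V.castTo (Ty.lolli A B)).rename (fun i => i + 1)) (var 0 A)))
      (Ty.bangs n (Ty.lolli A B)))
    (hr : Typed cty Δ V (Ty.bangs n (Ty.lolli A B))) (hρ : EnvRel cty Γ Δ ρ ρ) :
    ORel (Rel cty Γ (Ty.bangs n (Ty.lolli A B)))
      (Ev cty ρ (lam n A (app ((V.castTo (Ty.lolli A B)).rename (fun i => i + 1)) (var 0 A))))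
      (Ev cty ρ V) := by
  obtain ⟨r, hVr⟩ := hV.exists_ev (cty := cty) ρ
  have hsub : Ty.Sub (Ty.bangs n (Ty.lolli A B)) (Ty.lolli A B) :=
    (Ty.Sub.refl _).bangs_of (m := 0) (.inl rfl)
  have h1 := (rel_bangs n).1 (hl.rel_of_ev hΓ hρ (.lam _ _ _ _) (.lam _ _ _ _))
  have h2 := (rel_bangs n).1 (hr.rel_of_ev hΓ hρ hVr hVr)
  rw [hVr.eq_of, (Ev.lam ρ n A _).eq_of]
  refine ORel.pure ((rel_bangs n).2 ⟨⟨h1.eqv.left, h2.eqv.left, fun {C} hC => ?_⟩,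
    fun e e' he => ?_⟩)
  · obtain ⟨A', B', h3, h4, hA, hB⟩ := Ty.Sub.of_lolli (n := 1) hC
    have hs1 : Ty.Sub (Ty.lolli A B) (Ty.lolli A B') := .lolli_lolli (.refl A) hB
    have hs2 : Ty.Sub (Ty.lolli A B') (Ty.lolli A' B') := .lolli_lolli hA (.refl B')
    have hs3 : Ty.Sub C (Ty.lolli A' B') := by
      rw [h3]; exact (Ty.Sub.refl _).bangs_of (m := 0) (.inl rfl)
    have hrC := (h2.eqv.eq hC).typed.1
    have hcast : ∀ {X Y}, Ty.Sub (Ty.lolli A B) X → Ty.Sub X Y →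
        (r.read X).castTo Y = r.read Y := fun h h' => h2.eqv.left.cast h.bang_of h'
    have hrd : ∀ {X}, Ty.Sub (Ty.lolli A B) X → Typed cty Γ (r.read X) X := fun h =>
      (h2.eqv.eq h.bang_of).typed.1
    have hsh : ∀ {M N : Term α K} {X}, AxEq cty Γ M N X →
        AxEq cty (Γ.cons none) (M.rename fun i => i + 1) (N.rename fun i => i + 1) X :=
      fun h => h.rename_succ
    have hv : ∀ {X}, Ty.Sub A' X →
        Typed cty ((Ctx.empty : Ctx α).cons (some A')) (var 0 X : Term α K) X := fun h =>
      .var_zero h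
    have hsp : (Γ.cons (some A')).Split (Γ.cons none) ((Ctx.empty : Ctx α).cons (some A')) :=
      (Ctx.Split.empty_right Γ).cons_right _
    have e1 := AxEq.app hsp (hsh (hV.adequate_castTo hΓ hr hρ hVr (hsub.trans hs1)))
      (.refl (hv hA))
    -- Read back at a larger function type, the closure binds `x` at the smaller type `A'` but still
    -- uses it at `A`; the cast axiom for applications moves this cast to the function.
    have e2 := AxEq.castApp (cty := cty) (n := 0) hsp (hsh (.refl (hrd hs1))).typed.1
      (hv (Ty.Sub.refl A')) hs2 (Ty.Sub.refl A')
      (by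
        refine .app hsp ?_ (hv (Ty.Sub.refl A'))
        exact ((hsh (.refl (hrd hs1))).typed.1).castTo hs2)
      (by
        refine Typed.castTo (.app hsp ?_ (hv hA)) (Ty.Sub.refl B')
        exact ((hsh (.refl (hrd hs1))).typed.1).castTo (Ty.Sub.refl _))
    have e3 := (hsh (.refl (hrd hs1))).typed.1
    simp only [Term.castTo, e3.castTo_self, e3.tyOf_eq, Ty.left, Term.castTo_rename,
      hcast hs1 hs2] at e2
    have e4 := AxEq.lam_bangs (n := C.bangCount) (.inr hΓ) (e1.trans e2.symm)
    have e5 := AxEq.etaLam (cty := cty) (Γ := Γ) (n := C.bangCount) (A := A') (B := B')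
      (V := r.read C) (r.read_value C)
      (by
        rw [h2.eqv.left.cast hC hs3]
        exact e4.typed.2)
      (by rw [← h3]; exact hrC)
    rw [h2.eqv.left.cast hC hs3] at e5
    have e6 := e4.trans e5
    rw [← h3] at e6
    convert e6 using 1
    simp only [Sem.read, h4, Ty.left, Ty.right, Term.castTo, Term.subst, Term.castTo_rename,
      Term.tyOf_rename, (hr.castTo hsub).tyOf_eq, hr.castTo_castTo hsub]
    rw [subst_shift]
    rfl
  · rw [app_clo, ev_app, ev_var]
    have e1 : ORel _ (Ev cty (Sem.cons e ρ) _) _ :=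
      hr.ev_rename hΓ hsub (f := fun i => i + 1) (ρ := Sem.cons e ρ) (ρ' := ρ) hρ
    rw [hVr.eq_of] at e1
    have e2 := ORel.bind (T := fun d => obind (· = e) fun e => d.App cty e)
      (T' := fun d => d.App cty e') e1 fun d d' hd => by
        rw [obind_pure]; exact hd.2 e e' he
    rwa [obind_pure r] at e2

/-- One side evaluates `V` before the closure is formed, the other at each application, with related
results. Under the abstraction, the read-backs differ by a β-step for `V` and by adequacy. -/
theorem ev_letLam (hΓ : Γ.IsBang) {n : ℕ} {D A C : Ty α} {V M : Term α K} (hV : V.Value)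
    (hl : Typed cty Δ ((Pat.var D).bind V (lam n A M)) C)
    (hr : Typed cty Δ
      (lam n A ((Pat.var D).bind (V.rename fun i => i + 1) (M.rename (swapVar 1 1)))) C)
    (hρ : EnvRel cty Γ Δ ρ ρ) :
    ORel (Rel cty Γ C) (Ev cty ρ ((Pat.var D).bind V (lam n A M)))
      (Ev cty ρ
        (lam n A ((Pat.var D).bind (V.rename fun i => i + 1) (M.rename (swapVar 1 1))))) := by
  obtain ⟨Δ₁, Δ₂, hs, hL, hVD⟩ := hl.bind_var_inv
  obtain ⟨B, rfl, hn, hM⟩ := hL.lam_inv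
  obtain ⟨B', hB', hn', hM'⟩ := hr.lam_inv
  have := congrArg (Ty.unbang n) hB'
  simp only [Ty.unbang_bangs] at this
  cases this
  obtain ⟨v, hv⟩ := hV.exists_ev (cty := cty) ρ
  have hρ₂ := hρ.mono hs.some_right
  have hρ₁ := hρ.mono hs.some_left
  have hvr := hVD.rel_of_ev hΓ hρ₂ hv hv
  have hρv := hρ₁.cons hvr
  rw [ev_bind, hv.eq_of, obind_pure, (Ev.lam _ _ _ _).eq_of, (Ev.lam _ _ _ _).eq_of]
  refine ORel.pure ((rel_bangs n).2 ⟨Sem.Eqv.clo hΓ (hρv.body_castTo hM) (hρ.body_castTo hM')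
    fun {C D'} hC hD => ?_, fun e e' he => ?_⟩)
  · have hVσ : (V.subst (Sem.readEnv ρ)).Value := hV.subst fun i A => (ρ i).read_value A
    have hτ : SubstEq cty (Δ₁.cons (some D)) Γ (Sem.readEnv (Sem.cons v ρ))
        (consSubst (V.subst (Sem.readEnv ρ)) (Sem.readEnv ρ)) fun j => j := by
      refine .of_isBang hΓ fun {i X Y} hi hY => ?_
      rcases i with _ | i
      · cases hi
        have := hV.adequate_castTo hΓ hVD hρ₂ hv hY
        rw [hVD.castTo_subst_comm hρ₂.castSubst hY] at this
        exact this.symm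
      · exact .refl ((hρ₁.rel (i := i) hi).eqv.eq hY.bang_of).typed.1
    have e1 := ((hM.castTo hD).mono (Ctx.Le.cons_sub _ hC)).subst_congr (hτ.lift C)
    have e2 := ((hM'.castTo hD).mono (Ctx.Le.cons_sub _ hC)).subst ((hρ.substEq hΓ).lift C)
    have e3 : (((Pat.var D).bind (V.rename fun i => i + 1) (M.rename (swapVar 1 1))).castTo
        D').subst (subst.liftSubst 1 (Sem.readEnv ρ)) =
        (Pat.var D).bind ((V.subst (Sem.readEnv ρ)).rename fun i => i + 1)
          (((M.castTo D').subst (subst.liftSubst 1 (subst.liftSubst 1 (Sem.readEnv ρ)))).rename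
            (swapVar 1 1)) := by
      rw [← subst_shift, ← subst_swap]
      simp [Pat.bind, Term.castTo, Term.subst, Term.tyOf, Ty.bangs, Ty.left, Ty.bangCount,
        Ty.core, Ty.right, Term.castTo_rename]
    have e4 : subst₁ ((V.subst (Sem.readEnv ρ)).rename fun i => i + 1)
        (((M.castTo D').subst (subst.liftSubst 1 (subst.liftSubst 1 (Sem.readEnv ρ)))).rename
          (swapVar 1 1)) = (M.castTo D').subst (subst.liftSubst 1
            (consSubst (V.subst (Sem.readEnv ρ)) (Sem.readEnv ρ))) := by
      rw [subst₁_eq, subst_rename, subst_subst]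
      congr 1
      funext i X
      rcases i with _ | _ | i
      · rfl
      · simp [subst.liftSubst, Term.subst, swapVar, consSubst, Term.castTo_rename, Term.rename]
      · simp only [subst.liftSubst]
        simp [swapVar, consSubst, rename_eq_subst, subst_subst, Term.subst]
    rw [e3] at e2
    unfold Sem.body
    rw [e3]
    rw [← e4] at e1
    exact e1.trans (AxEq.betaLam (hVσ.rename _) e2 e1.typed.2).symm
  · rw [app_clo, app_clo, ev_bind]
    have e1 := rel_symm (hVD.ev_shift hΓ (.var A) (d := e') hρ₂)
    rw [hv.eq_of] at e1
    have e2 := e1.bind (R' := Rel cty Γ B) (T := fun v => Ev cty (Sem.cons e (Sem.cons v ρ)) M)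
      (T' := fun d => Ev cty (Sem.cons d (Sem.cons e' ρ)) (M.rename (swapVar 1 1)))
      fun d d' hd => rel_symm (hM.ev_rename_self hΓ (by
        have := Pat.env_swap (α := α) (.var D) (.var A) d' e' ρ
        exact this ▸ (hρ₁.cons hd.symm).cons he.symm))
    rw [obind_pure] at e2
    exact e2

/-- Either side is related to the evaluation of `M N` without casts. -/
theorem ev_castApp (hΓ : Γ.IsBang) {Δ₁ Δ₂ : Ctx α} (hs : Δ.Split Δ₁ Δ₂) {n : ℕ}
    {A B C D D' : Ty α} {M N : Term α K} (hM : Typed cty Δ₁ M (Ty.bangs n (Ty.lolli A D)))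
    (hN : Typed cty Δ₂ N C)
    (hB : Ty.Sub (Ty.bangs n (Ty.lolli A D)) (Ty.lolli B D')) (hC : Ty.Sub C B)
    (hρ : EnvRel cty Γ Δ ρ ρ) :
    ORel (Rel cty Γ D') (Ev cty ρ (app (M.castTo (Ty.lolli B D')) (N.castTo B)))
      (Ev cty ρ ((app (M.castTo (Ty.lolli A D)) (N.castTo A)).castTo D')) := by
  have key : ∀ {X}, Ty.Sub (Ty.bangs n (Ty.lolli A D)) (Ty.lolli X D') → Ty.Sub C X →
      ORel (Rel cty Γ D') (Ev cty ρ (app (M.castTo (Ty.lolli X D')) (N.castTo X)))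
        (Ev cty ρ (app M N)) := by
    intro X hX hC
    rw [ev_app, ev_app]
    exact (hM.ev_castTo hΓ hX (hρ.mono hs.some_left)).bind fun d d' hd =>
      (hN.ev_castTo hΓ hC (hρ.mono hs.some_right)).bind fun e e' he => hd.2 e e' he
  have hsub : Ty.Sub (Ty.bangs n (Ty.lolli A D)) (Ty.lolli A D) :=
    (Ty.Sub.refl _).bangs_of (m := 0) (.inl rfl)
  have h := Ty.Sub.lolli_inv (n := 0) hB
  have e : (app (M.castTo (Ty.lolli A D)) (N.castTo A)).castTo D' =
      app (M.castTo (Ty.lolli A D')) (N.castTo A) := by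
    simp only [Term.castTo, (hM.castTo hsub).tyOf_eq, Ty.left, hM.castTo_castTo hsub]
  rw [e]
  exact rel_trans (key hB hC) (rel_symm (key (hsub.trans (.lolli_lolli (.refl A) h.2))
    (hC.trans h.1)))

end

theorem ev_lam (hΓ : Γ.IsBang) {Δ : Ctx α} {ρ ρ' : ℕ → Sem α K} {n : ℕ} {A B : Ty α}
    {M M' : Term α K} (h : AxEq cty (Δ.cons (some A)) M M' B)
    (ih : ∀ {ρ ρ'}, EnvRel cty Γ (Δ.cons (some A)) ρ ρ' →
      ORel (Rel cty Γ B) (Ev cty ρ M) (Ev cty ρ' M')) (hρ : EnvRel cty Γ Δ ρ ρ') :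
    ORel (Rel cty Γ (Ty.bangs n (Ty.lolli A B))) (Ev cty ρ (lam n A M))
      (Ev cty ρ' (lam n A M')) := by
  rw [(Ev.lam _ _ _ _).eq_of, (Ev.lam _ _ _ _).eq_of]
  refine ORel.pure ((rel_bangs n).2 ⟨Sem.Eqv.clo hΓ (hρ.left.body_castTo h.typed.1)
    (hρ.right.body_castTo h.typed.2) fun {C D} hC hD => ?_, fun e e' he => ?_⟩)
  · have e1 := (h.castTo hD).mono (Ctx.Le.cons_sub _ hC)
    exact (e1.subst ((hρ.left.valSubst hΓ).lift C)).trans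
      (e1.typed.2.subst_congr ((hρ.substEq hΓ).lift C))
  · rw [app_clo, app_clo]
    exact ih (hρ.cons he)

/-- Equivalent terms have related evaluations. -/
theorem AxEq.ev (hΓ : Γ.IsBang) {Δ : Ctx α} {M N : Term α K} {A : Ty α}
    (h : AxEq cty Δ M N A) : ∀ {ρ ρ' : ℕ → Sem α K}, EnvRel cty Γ Δ ρ ρ' →
      ORel (Rel cty Γ A) (Ev cty ρ M) (Ev cty ρ' N) := by
  -- For an axiom it suffices to treat one environment on both sides; the change of environment is
  -- then made in the right-hand side alone.
  have key : ∀ {Δ : Ctx α} {M N : Term α K} {A : Ty α}, Typed cty Δ N A →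
      (∀ {ρ : ℕ → Sem α K}, EnvRel cty Γ Δ ρ ρ →
        ORel (Rel cty Γ A) (Ev cty ρ M) (Ev cty ρ N)) →
      ∀ {ρ ρ' : ℕ → Sem α K}, EnvRel cty Γ Δ ρ ρ' →
        ORel (Rel cty Γ A) (Ev cty ρ M) (Ev cty ρ' N) :=
    fun h h' _ _ hρ => rel_trans (h' hρ.left) (h.ev hΓ hρ)
  induction h with
  | refl h => exact h.ev hΓ
  | symm _ ih => exact fun hρ => rel_symm (ih hρ.symm)
  | trans _ _ ih ih' => exact fun hρ => rel_trans (ih hρ) (ih' hρ.right)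
  | lam hM ih => exact fun hρ => ev_lam (n := 0) hΓ hM ih hρ
  | lamBang hΔ n hM ih => exact fun hρ => ev_lam hΓ hM ih hρ
  | app hs hM hN ihM ihN =>
    intro ρ ρ' hρ
    rw [ev_app, ev_app]
    exact (ihM (hρ.mono hs.some_left)).bind fun d d' hd =>
      (ihN (hρ.mono hs.some_right)).bind fun e e' he => hd.2 e e' he
  | pair hs n hM hN ihM ihN =>
    intro ρ ρ' hρ
    rw [ev_pair, ev_pair]
    exact (ihM (hρ.mono hs.some_left)).bind fun d d' hd =>
      (ihN (hρ.mono hs.some_right)).bind fun e e' he =>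
        ORel.pure ((rel_bangs n).2 (Rel.pair hΓ ((rel_bangs n).1 hd) ((rel_bangs n).1 he)))
  | @letPair Δ Δ₁ Δ₂ hs n A B C M M' N N' hM hN ihM ihN =>
    intro ρ ρ' hρ
    have e := fun ρ M N => ev_bind (cty := cty) (K := K) ρ (.pair n A B) M N
    simp only [Pat.bind] at e
    rw [e, e]
    exact (ihM (hρ.mono hs.some_left)).bind fun d d' hd =>
      ihN ((hρ.mono hs.some_right).pat (.pair n A B) hd)
  | @letUnit Δ Δ₁ Δ₂ hs C M M' N N' hM hN ihM ihN =>
    intro ρ ρ' hρ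
    have e := fun ρ M N => ev_bind (cty := cty) (K := K) ρ .unit M N
    simp only [Pat.bind] at e
    rw [e, e]
    exact (ihM (hρ.mono hs.some_left)).bind fun d d' hd => ihN (hρ.mono hs.some_right)
  | @betaLam Δ A B V M hV hl hr =>
    refine @key _ _ _ _ hr fun {ρ} hρ => rel_symm ?_
    obtain ⟨Δ₁, Δ₂, hs, hM, hVA⟩ := hl.bind_var_inv
    obtain ⟨v, hv⟩ := hV.exists_ev (cty := cty) ρ
    have hρ₂ := hρ.mono hs.some_right
    -- Compares the substituted body in `ρ` with the body itself in `ρ` extended by the result of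
    -- `V`.
    have := hM.fundamental hΓ (Ty.Sub.refl _) ((hρ.mono hs.some_left).cons
      (hVA.rel_of_ev hΓ hρ₂ hv hv))
      ((SubRel.rename (f := fun i => i) (hρ.mono hs.some_left)).consSubst hΓ hV hVA hρ₂ hv)
    rw [hM.castTo_self] at this
    rw [ev_bind, hv.eq_of, obind_pure, subst₁_eq]
    exact this
  | @betaPair Δ n A B C V W M hV hW hl hr =>
    refine @key _ _ _ _ hr fun {ρ} hρ => rel_symm ?_
    obtain ⟨Δ₁, Δ₂, hs, hp, hM⟩ := hl.letPair_inv
    obtain ⟨Δ₃, Δ₄, hs', hVA, hWB⟩ := hp.pair_inv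
    obtain ⟨v, hv⟩ := hV.exists_ev (cty := cty) ρ
    obtain ⟨w, hw⟩ := hW.exists_ev (cty := cty) ρ
    have hρ₁ := (hρ.mono hs.some_left).mono hs'.some_left
    have hρ₂ := (hρ.mono hs.some_left).mono hs'.some_right
    have := hM.fundamental hΓ (Ty.Sub.refl _) (((hρ.mono hs.some_right).cons
      (hVA.rel_of_ev hΓ hρ₁ hv hv)).cons (hWB.rel_of_ev hΓ hρ₂ hw hw))
      (((SubRel.rename (f := fun i => i) (hρ.mono hs.some_right)).consSubst hΓ hV hVA hρ₁
        hv).consSubst hΓ hW hWB hρ₂ hw)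
    rw [hM.castTo_self] at this
    have e := ev_bind (cty := cty) ρ (.pair n A B) (Term.pair n V W) M
    simp only [Pat.bind] at e
    rw [e, (Ev.pair n hv hw).eq_of, obind_pure, subst₂_eq]
    exact this
  | @betaUnit Δ C M hl hr =>
    refine @key _ _ _ _ hr fun {ρ} hρ => ?_
    have e := ev_bind (cty := cty) ρ .unit (Term.star 0) M
    simp only [Pat.bind] at e
    rw [e, (Ev.star ρ 0).eq_of, obind_pure]
    exact hr.ev hΓ hρ
  | etaLam hV hl hr => exact @key _ _ _ _ hr (ev_etaLam hΓ hV hl hr)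
  | @etaLet Δ A N hl hr =>
    refine @key _ _ _ _ hr fun {ρ} hρ => ?_
    rw [ev_bind]
    simp only [ev_var]
    have e : (obind (Ev cty ρ N) fun d => (· = (Pat.var A).env d ρ 0)) = Ev cty ρ N :=
      obind_pure_right _
    rw [e]
    exact hr.ev hΓ hρ
  | @etaPair Δ n A B N hl hr =>
    refine @key _ _ _ _ hr fun {ρ} hρ => ?_
    have e := ev_bind (cty := cty) ρ (.pair n A B) N
      (Term.pair n (var 1 (Ty.bangs n A)) (var 0 (Ty.bangs n B)))
    simp only [Pat.bind] at e
    rw [e]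
    have := (hr.ev hΓ hρ).bind (R' := Rel cty Γ (Ty.bangs n (Ty.tensor A B)))
      (T := fun d => (· = Sem.pair d.fst d.snd)) (T' := fun d => (· = d)) fun d d' hd =>
        ORel.pure ((rel_bangs n).2 ((((rel_bangs n).1 (hd.trans hd.symm)).eta_tensor hΓ).trans
          ((rel_bangs n).1 hd)))
    rw [obind_pure_right] at this
    convert this using 3 with d
    exact (Ev.pair n (.var _ _ _) (.var _ _ _)).eq_of
  | @etaUnit Δ n N hl hr =>
    refine @key _ _ _ _ hr fun {ρ} hρ => ?_
    have e := ev_bind (cty := cty) ρ .unit (N.castTo Ty.unit) (Term.star n)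
    simp only [Pat.bind] at e
    rw [e]
    have := (hr.ev_castTo hΓ ((Ty.Sub.refl Ty.unit).bangs_of (m := 0) (.inl rfl)) hρ).bind
      (R' := Rel cty Γ (Ty.bangs n Ty.unit))
      (T := fun d => (· = Sem.star)) (T' := fun d => (· = d)) fun d d' hd =>
        ORel.pure ((rel_bangs n).2 (((Rel.trans hd (Rel.symm hd)).eta_unit hΓ).trans hd))
    rw [obind_pure_right] at this
    convert this using 3 with d
    · rfl
    · exact (Ev.star _ n).eq_of
  | letAssoc p q hl hr => exact @key _ _ _ _ hr (ev_letAssoc hΓ p q hl)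
  | letSwap p q hV hW hl hr => exact @key _ _ _ _ hr (ev_letSwap hΓ p q hl hr)
  | @letApp Δ A B M N hl hr =>
    refine @key _ _ _ _ hr fun {ρ} hρ => ?_
    obtain ⟨Δ₁, Δ₂, hs, -, hM⟩ := hl.bind_var_inv
    cases hr with
    | @app _ Δ₃ Δ₄ hs' A' _ _ _ hM' hN =>
      have := hM.tyOf_eq.symm.trans hM'.tyOf_eq
      cases this
      rw [ev_bind, ev_app]
      refine (hM'.ev hΓ (hρ.mono hs'.some_left)).bind fun d d' hd => ?_
      rw [ev_bind]
      refine (hN.ev_shift hΓ (.var _) (hρ.mono hs'.some_right)).bind fun e e' he => ?_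
      rw [ev_app, ev_var, ev_var, obind_pure, obind_pure]
      exact hd.2 e e' he
  | letLam hV hl hr => exact @key _ _ _ _ hr (ev_letLam hΓ hV hl hr)
  | @letTensor Δ n A B C M N hl hr =>
    refine @key _ _ _ _ hr fun {ρ} hρ => ?_
    cases hr with
    | @pair _ Δ₃ Δ₄ hs' _ A' B' _ _ hM hN =>
      rw [ev_bind, ev_pair]
      refine (hM.ev hΓ (hρ.mono hs'.some_left)).bind fun d d' hd => ?_
      rw [ev_bind]
      refine (hN.ev_shift hΓ (.var _) (hρ.mono hs'.some_right)).bind fun e e' he => ?_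
      rw [ev_pair, ev_var, ev_var, obind_pure, obind_pure]
      exact ORel.pure ((rel_bangs n).2 (Rel.pair hΓ ((rel_bangs n).1 hd) ((rel_bangs n).1 he)))
  | castApp hs hM hN hB hC hl hr => exact @key _ _ _ _ hr (ev_castApp hΓ hs hM hN hB hC)
  | @castPair Δ Δ₁ n n' A A' B B' C M N hM hs hl hr =>
    refine @key _ _ _ _ hr fun {ρ} hρ => ?_
    obtain ⟨Δ₂, Δ₃, hs', -, hN⟩ := hl.letPair_inv
    obtain ⟨Δ₄, Δ₅, hs'', hM', -⟩ := hr.letPair_inv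
    have e := fun n A B M N => ev_bind (cty := cty) (K := K) ρ (.pair n A B) M N
    simp only [Pat.bind] at e
    rw [e, e]
    exact (hM'.ev_castTo hΓ hs (hρ.mono hs''.some_left)).bind fun d d' hd =>
      hN.ev hΓ ((hρ.mono hs'.some_right).pat (.pair n' A' B') hd)
  | @castLet Δ A A' C M N hs hl hr =>
    refine @key _ _ _ _ hr fun {ρ} hρ => ?_
    obtain ⟨Δ₂, Δ₃, hs', hN, -⟩ := hl.bind_var_inv
    obtain ⟨Δ₄, Δ₅, hs'', -, hM⟩ := hr.bind_var_inv
    rw [ev_bind, ev_bind]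
    exact (hM.ev_castTo hΓ hs (hρ.mono hs''.some_right)).bind fun d d' hd =>
      hN.ev hΓ ((hρ.mono hs'.some_left).cons hd)
  | castUnit hM hs hl hr =>
    refine @key _ _ _ _ hr fun {ρ} hρ => ?_
    rw [hM.castTo_castTo hs]
    exact hr.ev hΓ hρ

/-- Promotion preserves equivalence. -/
theorem AxEq.promote {A B : Ty α} {V W : Term α K} (hV : V.Value) (hW : W.Value)
    (h : AxEq cty (Ctx.single A) V W B) :
    AxEq cty (Ctx.single (Ty.bang A)) V.promote W.promote (Ty.bang B) := by
  have hΓ : (Ctx.single (Ty.bang A)).IsBang := by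
    rw [← Ctx.bang_single]; exact Ctx.bang_isBang _
  -- The variable stands for itself at the type `!A`, so that reading back this environment is the
  -- identity substitution.
  let ρ : ℕ → Sem α K := fun i => .ne A (Term.var i (Ty.bang A)) (.var _ _)
  have hρ : EnvRel cty (Ctx.single (Ty.bang A)) (Ctx.single A) ρ ρ := by
    refine ⟨fun {i X} hi => ?_⟩
    rcases i with _ | i <;> cases hi
    exact Rel.ne 0 (.var _ _) (.var_zero (Ty.Sub.refl _))
  have hread : ∀ {V : Term α K} {X : Ty α}, Typed cty (Ctx.single (Ty.bang A)) V X →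
      V.subst (Sem.readEnv ρ) = V := by
    intro V X h
    exact (h.subst_ext fun i X Y hi hX => rfl).trans V.subst_var
  obtain ⟨r, hr⟩ := hV.exists_ev (cty := cty) ρ
  obtain ⟨r', hr', hrr⟩ := (h.ev hΓ hρ).1 r hr
  have hV' := hV.promote_typed h.typed.1
  have hW' := hW.promote_typed h.typed.2
  rw [Ctx.bang_single] at hV' hW'
  have e1 := hV.adequate hΓ h.typed.1 hρ hr
  have e2 := hW.adequate hΓ h.typed.2 hρ hr'
  rw [hread hV'] at e1
  rw [hread hW'] at e2
  exact e1.trans ((hrr.eqv.eq (Ty.Sub.refl _)).trans e2.symm)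

end Soundness

/-! ### The comonad `L` -/

section Comonad
variable {α : Type u} {K : Type w} {cty : K → Ty α} {A B C A' B' : Ty α}

open Tm YAQ.Hom

theorem Term.Value.promote_rename {V : Term α K} (hV : V.Value) : ∀ ρ : ℕ → ℕ,
    (V.rename ρ).promote = V.promote.rename ρ := by
  induction hV with
  | var | const | star | lam => intro ρ; rfl
  | pair n _ _ ihV ihW => intro ρ; simp only [Term.rename, Term.promote, ihV, ihW]
  | letVar A _ _ ihV ihW => intro ρ; simp only [Term.rename, Term.promote, ihV, ihW]
  | letPair n A B _ _ ihV ihW => intro ρ; simp only [Term.rename, Term.promote, ihV, ihW]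
  | letUnit _ _ ihV ihW => intro ρ; simp only [Term.rename, Term.promote, ihW]

namespace YAQ.Hom

/-- The action of `L` on arrows. -/
def bang (f : YAQ.Hom cty A B) : YAQ.Hom cty (Ty.bang A) (Ty.bang B) :=
  Quotient.map ValueJudgment.promote
    (fun V W h => AxEq.promote V.value W.value h) f

/-- Precomposition with a retyped variable disappears by β, since occurrences in `V` carry their own
types; dually, postcomposition with one is a cast. -/
theorem cast_comp {V : ValueJudgment cty A B} {W : ValueJudgment cty A' B}
    {T : ValueJudgment cty A' A} (hT : T.term = .var 0 A) (h : AxEq cty (Ctx.single A') V.term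
      W.term B) : T.cls.comp V.cls = W.cls := by
  refine Quotient.sound (.trans ?_ h)
  have e : Term.subst₁ T.term V.term = V.term := by
    rw [hT]
    refine V.typed.subst_eq ?_
    intro i C hi D
    rcases i with _ | i
    · rfl
    · cases hi
  have := AxEq.betaLam (cty := cty) (Γ := Ctx.single A') T.value (T.comp V).typed
    (e.symm ▸ h.typed.1)
  rw [e] at this
  exact this

theorem comp_cast {V : ValueJudgment cty A B} {W : ValueJudgment cty A B'}
    {T : ValueJudgment cty B B'} (hT : T.term = .var 0 B') (hB : Ty.Sub B B')
    (h : AxEq cty (Ctx.single A) (V.term.castTo B') W.term B') : V.cls.comp T.cls = W.cls := by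
  refine Quotient.sound (.trans ?_ h)
  have := (AxEq.castTo_let V.typed hB).symm
  rw [← hT] at this
  exact this

theorem bang_id (A : Ty α) : (YAQ.Hom.id A).bang = YAQ.Hom.id (cty := cty) (Ty.bang A) := rfl

/-- Promotion of a `let` is the `let` of the promotions, so the representatives coincide. -/
theorem bang_comp (f : YAQ.Hom cty A B) (g : YAQ.Hom cty B C) :
    (f.comp g).bang = f.bang.comp g.bang := by
  induction f using Quotient.inductionOn with | h V => ?_
  induction g using Quotient.inductionOn with | h W => ?_
  rfl

theorem counit_natural (f : YAQ.Hom cty A B) :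
    f.bang.comp (ValueJudgment.counit B).cls = (ValueJudgment.counit A).cls.comp f := by
  induction f using Quotient.inductionOn with | h V => ?_
  have h := AxEq.promote_castTo V.value V.typed
  rw [Ctx.bang_single] at h
  exact (comp_cast (V := V.promote) (W := ⟨V.term, V.value, h.typed.2⟩) rfl (Ty.Sub.refl B).bang_of
    h).trans (cast_comp (V := V) (T := ValueJudgment.counit A) rfl (.refl h.typed.2)).symm

theorem comult_natural (f : YAQ.Hom cty A B) :
    f.bang.comp (ValueJudgment.comult B).cls = (ValueJudgment.comult A).cls.comp f.bang.bang := by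
  induction f using Quotient.inductionOn with | h V => ?_
  have h := AxEq.promote_promote V.value V.typed
  rw [Ctx.bang_single] at h
  exact (comp_cast (V := V.promote) (W := ⟨_, V.promote.promote.value, h.typed.2⟩) rfl
    (Ty.Sub.digging B) h).trans
      (cast_comp (V := V.promote.promote) (W := ⟨_, V.promote.promote.value, h.typed.2⟩)
        (T := ValueJudgment.comult A) rfl (.refl h.typed.2)).symm

theorem comult_counit (A : Ty α) : (ValueJudgment.comult A).cls.comp
    (ValueJudgment.counit (Ty.bang A)).cls = YAQ.Hom.id (cty := cty) (Ty.bang A) :=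
  comp_cast (W := ValueJudgment.id (Ty.bang A)) rfl (Ty.Sub.refl _).bang_of
    (.refl (ValueJudgment.id _).typed)

/-- The idempotence of `L`: all arrows involved are retyped variables, and the composite cast is the
identity. -/
theorem counit_comult (A : Ty α) : (ValueJudgment.counit (Ty.bang A)).cls.comp
    (ValueJudgment.comult A).cls = YAQ.Hom.id (cty := cty) (Ty.bang (Ty.bang A)) :=
  comp_cast (W := ValueJudgment.id (Ty.bang (Ty.bang A))) rfl (Ty.Sub.digging A)
    (.refl (ValueJudgment.id _).typed)

end YAQ.Hom

namespace Tm

/-- `⟨M, N⟩^1` -/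
def tens₁ (s : Tm cty (Ty.bang A)) (t : Tm cty (Ty.bang B)) : Tm cty (Ty.bang (Ty.tensor A B)) :=
  pair (A := A) (B := B) 1 s t

/-- `⟨M, N⟩^2` -/
def tens₂ (s : Tm cty (Ty.bang (Ty.bang A))) (t : Tm cty (Ty.bang (Ty.bang B))) :
    Tm cty (Ty.bang (Ty.bang (Ty.tensor A B))) := pair (A := A) (B := B) 2 s t

/-- `*^1` -/
def one₁ : Tm cty (Ty.bang (Ty.unit : Ty α)) := star 1

/-- `*^2` -/
def one₂ : Tm cty (Ty.bang (Ty.bang (Ty.unit : Ty α))) := star 2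

theorem dup_one₁ : (one₁ : Tm cty _).Dup := dup_star 1

theorem Dup.tens₁ {s : Tm cty (Ty.bang A)} {t : Tm cty (Ty.bang B)} (hs : s.Dup) (ht : t.Dup) :
    (Tm.tens₁ s t).Dup := Dup.pair (A := A) (B := B) (n := 1) hs ht

/-- Splitting at index `1` turns a variable of type `!(A ⊗ B)` into variables of types `!A` and
`!B`; this makes `d` invertible. -/
theorem det_tens₁ (A B : Ty α) :
    (tens₁ (var 1 (Ty.bang A)) (var 0 (Ty.bang B)) : Tm cty _).Det := ⟨fun h =>
  (Detects.pair (Γ := Ctx.empty) (n := 1) (A := A) (B := B) (.var _)).ext (hM := rfl) h⟩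

theorem det_one₁ : (one₁ : Tm cty _).Det := ⟨fun h =>
  (Detects.star (Γ := Ctx.empty) (n := 1) (.var _)).ext (hM := rfl) h⟩

/-- The rule for the tensor product at index `1`, applied to the promoted arrows; promotion commutes
with the shift of `V`. -/
theorem ap_bang_tensor (f : YAQ.Hom cty A A') (g : YAQ.Hom cty B B') (s : Tm cty (Ty.bang A))
    (t : Tm cty (Ty.bang B)) :
    ap (f.tensor g).bang (tens₁ s t) = tens₁ (ap f.bang s) (ap g.bang t) := by
  induction f using Quotient.inductionOn with | h V => ?_
  induction g using Quotient.inductionOn with | h W => ?_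
  refine ap_tensor (n := 1) (T := (V.tensorHom W).promote) (V := V.promote) (W := W.promote) ?_ s t
  simp only [ValueJudgment.promote, ValueJudgment.tensorHom, Term.promote,
    V.value.promote_rename]
  rfl

theorem ap_bang_assoc (r : Tm cty (Ty.bang A)) (s : Tm cty (Ty.bang B)) (t : Tm cty (Ty.bang C)) :
    ap (ValueJudgment.assoc A B C).cls.bang (tens₁ r (tens₁ s t)) = tens₁ (tens₁ r s) t :=
  ap_assoc (n := 1) (T := (ValueJudgment.assoc A B C).promote) rfl r s t

theorem ap_bang_associator (r : Tm cty (Ty.bang A)) (s : Tm cty (Ty.bang B))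
    (t : Tm cty (Ty.bang C)) :
    ap (associator A B C).bang (tens₁ (tens₁ r s) t) = tens₁ r (tens₁ s t) := by
  rw [← ap_bang_assoc, ← ap_hom_comp, ← bang_comp, assoc_associator, bang_id, ap_hom_id]

theorem ap_bang_leftUnitor (s : Tm cty (Ty.bang A)) :
    ap (ValueJudgment.leftUnitor A).cls.bang (tens₁ one₁ s) = s :=
  ap_leftUnitor (n := 1) (T := (ValueJudgment.leftUnitor A).promote) rfl s

theorem ap_bang_rightUnitor (s : Tm cty (Ty.bang A)) :
    ap (ValueJudgment.rightUnitor A).cls.bang (tens₁ s one₁) = s :=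
  ap_rightUnitor (n := 1) (T := (ValueJudgment.rightUnitor A).promote) rfl s

theorem ap_bang_braiding {s : Tm cty (Ty.bang A)} {t : Tm cty (Ty.bang B)}
    (h : s.IsVal ∨ t.IsVal) :
    ap (ValueJudgment.braiding A B).cls.bang (tens₁ s t) = tens₁ t s :=
  ap_braiding (n := 1) (T := (ValueJudgment.braiding A B).promote) rfl h

theorem ap_cohTensor (s : Tm cty (Ty.bang A)) (t : Tm cty (Ty.bang B)) :
    ap (ValueJudgment.cohTensor A B).cls (tens s t) = tens₁ s t :=
  ap_repair (n := 0) (m := 1) (A := Ty.bang A) (B := Ty.bang B) (A' := A) (B' := B) rfl rfl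
    (T := ValueJudgment.cohTensor A B) rfl s t s t HEq.rfl HEq.rfl

theorem ap_cohUnit : ap ValueJudgment.cohUnit.cls one = (one₁ : Tm cty _) :=
  ap_cast_star (n := 0) (m := 1) (T := ValueJudgment.cohUnit) (.inr rfl)

theorem ap_bang_cohTensor (s : Tm cty (Ty.bang (Ty.bang A))) (t : Tm cty (Ty.bang (Ty.bang B))) :
    ap (ValueJudgment.cohTensor A B).cls.bang (tens₁ s t) = tens₂ s t :=
  ap_repair (n := 1) (m := 2) (A := Ty.bang A) (B := Ty.bang B) (A' := A) (B' := B) rfl rfl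
    (T := (ValueJudgment.cohTensor A B).promote) rfl s t s t HEq.rfl HEq.rfl

theorem ap_bang_cohUnit : ap ValueJudgment.cohUnit.cls.bang one₁ = (one₂ : Tm cty _) :=
  ap_cast_star (n := 1) (m := 2) (T := ValueJudgment.cohUnit.promote) (.inr rfl)

theorem ap_counit_tens₁ (s : Tm cty (Ty.bang A)) (t : Tm cty (Ty.bang B)) :
    ap (ValueJudgment.counit (Ty.tensor A B)).cls (tens₁ s t) =
      tens (ap (ValueJudgment.counit A).cls s) (ap (ValueJudgment.counit B).cls t) :=
  ap_cast_pair (n := 1) (m := 0) (T := ValueJudgment.counit (Ty.tensor A B))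
    (V := ValueJudgment.counit A) (W := ValueJudgment.counit B) rfl rfl rfl s t

theorem ap_counit_one₁ : ap (ValueJudgment.counit Ty.unit).cls one₁ = (one : Tm cty _) :=
  ap_cast_star (n := 1) (m := 0) (T := ValueJudgment.counit Ty.unit) (.inl rfl)

theorem ap_comult_tens₁ (s : Tm cty (Ty.bang A)) (t : Tm cty (Ty.bang B)) :
    ap (ValueJudgment.comult (Ty.tensor A B)).cls (tens₁ s t) =
      tens₂ (ap (ValueJudgment.comult A).cls s) (ap (ValueJudgment.comult B).cls t) :=
  ap_cast_pair (n := 1) (m := 2) (T := ValueJudgment.comult (Ty.tensor A B))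
    (V := ValueJudgment.comult A) (W := ValueJudgment.comult B) rfl rfl rfl s t

theorem ap_comult_one₁ : ap (ValueJudgment.comult Ty.unit).cls one₁ = (one₂ : Tm cty _) :=
  ap_cast_star (n := 1) (m := 2) (T := ValueJudgment.comult Ty.unit) (.inl rfl)

theorem ap_comonMul {s : Tm cty (Ty.bang A)} (hs : s.Dup) :
    ap (ValueJudgment.comonMul A).cls s = tens s s :=
  ap_dup (n := 0) (T := ValueJudgment.comonMul A) rfl rfl hs

theorem ap_bang_comonMul {s : Tm cty (Ty.bang (Ty.bang A))} (hs : s.Dup) :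
    ap (ValueJudgment.comonMul A).cls.bang s = tens₁ s s :=
  ap_dup (n := 1) (A := Ty.bang A) (T := (ValueJudgment.comonMul A).promote) rfl rfl hs

theorem discards_comonUnit {s : Tm cty (Ty.bang A)} (hs : s.Dup) :
    Discards (n := 0) (ap (ValueJudgment.comonUnit A).cls s) :=
  discards_ap (n := 0) (T := ValueJudgment.comonUnit A) rfl hs

theorem discards_bang_comonUnit {s : Tm cty (Ty.bang (Ty.bang A))} (hs : s.Dup) :
    Discards (n := 1) (ap (ValueJudgment.comonUnit A).cls.bang s) :=
  discards_ap (n := 1) (T := (ValueJudgment.comonUnit A).promote) rfl hs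

theorem tens_comonUnit_left {s : Tm cty (Ty.bang A)} (hs : s.Dup) :
    tens (ap (ValueJudgment.comonUnit A).cls s) s = tens one s :=
  pair_discards_left (n := 0) (A := Ty.bang A) (discards_comonUnit hs) hs
    fun Γ => typedIn_ap Γ _ s

theorem tens_comonUnit_right {s : Tm cty (Ty.bang A)} (hs : s.Dup) :
    tens s (ap (ValueJudgment.comonUnit A).cls s) = tens s one := by
  rw [← ap_hom_braiding (.inr hs.isVal), tens_comonUnit_left hs,
    ap_hom_braiding (.inr hs.isVal)]

end Tm

/-- `z : !(A ⊗ B) ⊢ let ⟨x, y⟩^1 = z in ⟨x, y⟩ : !A ⊗ !B`. -/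
def ValueJudgment.cohTensorInv (A B : Ty α) :
    ValueJudgment cty (Ty.bang (Ty.tensor A B)) (Ty.tensor (Ty.bang A) (Ty.bang B)) where
  term := .letPair 1 A B (.var 0 (Ty.bang (Ty.tensor A B)))
    (.pair 0 (.var 1 (Ty.bang A)) (.var 0 (Ty.bang B)))
  value := .letPair _ _ _ (.var _ _) (.pair _ (.var _ _) (.var _ _))
  typed := .letPair (n := 1) (Ctx.Split.empty_right _) (.var_zero (Ty.Sub.refl _))
    (.pair (ValueJudgment.split_pair _ _) 0
      (Typed.var_zero (Ty.Sub.refl _)).rename_succ (.var_zero (Ty.Sub.refl _)))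

theorem Tm.ap_cohTensorInv (s : Tm cty (Ty.bang A)) (t : Tm cty (Ty.bang B)) :
    ap (ValueJudgment.cohTensorInv A B).cls (tens₁ s t) = tens s t :=
  ap_repair (n := 1) (m := 0) (A' := Ty.bang A) (B' := Ty.bang B) (A := A) (B := B) rfl rfl
    (T := ValueJudgment.cohTensorInv A B) rfl s t s t HEq.rfl HEq.rfl

namespace YAQ.Hom

theorem cohTensor_inv (A B : Ty α) : (ValueJudgment.cohTensor A B).cls.comp
    (ValueJudgment.cohTensorInv A B).cls = YAQ.Hom.id (cty := cty) _ :=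
  (det_two _ _).ext (by simp only [ap_hom_comp, ap_cohTensor, ap_cohTensorInv, ap_hom_id])

theorem inv_cohTensor (A B : Ty α) : (ValueJudgment.cohTensorInv A B).cls.comp
    (ValueJudgment.cohTensor A B).cls = YAQ.Hom.id (cty := cty) _ :=
  (det_tens₁ _ _).ext (by simp only [ap_hom_comp, ap_cohTensor, ap_cohTensorInv, ap_hom_id])

theorem cohUnit_counit : ValueJudgment.cohUnit.cls.comp (ValueJudgment.counit Ty.unit).cls =
    YAQ.Hom.id (cty := cty) _ :=
  det_one.ext (by simp only [ap_hom_comp, ap_cohUnit, ap_counit_one₁, ap_hom_id])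

theorem counit_cohUnit : (ValueJudgment.counit Ty.unit).cls.comp ValueJudgment.cohUnit.cls =
    YAQ.Hom.id (cty := cty) _ :=
  det_one₁.ext (by simp only [ap_hom_comp, ap_cohUnit, ap_counit_one₁, ap_hom_id])

theorem cohTensor_natural (f : YAQ.Hom cty A A') (g : YAQ.Hom cty B B') :
    (f.bang.tensor g.bang).comp (ValueJudgment.cohTensor A' B').cls =
      (ValueJudgment.cohTensor A B).cls.comp (f.tensor g).bang :=
  (det_two _ _).ext (by
    simp only [ap_hom_comp, ap_cohTensor, ap_hom_tensor, ap_bang_tensor])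

theorem cohTensor_associator (A B C : Ty α) :
    ((ValueJudgment.cohTensor A B).cls.tensor (YAQ.Hom.id (Ty.bang C))).comp
        ((ValueJudgment.cohTensor (Ty.tensor A B) C).cls.comp (associator A B C).bang) =
      (associator (Ty.bang A) (Ty.bang B) (Ty.bang C)).comp
        (((YAQ.Hom.id (Ty.bang A)).tensor (ValueJudgment.cohTensor B C).cls).comp
          (ValueJudgment.cohTensor (cty := cty) A (Ty.tensor B C)).cls) :=
  (det_three _ _ _).assoc.ext (by
    simp only [ap_hom_comp, ap_hom_tensor, ap_hom_associator, ap_hom_id, ap_cohTensor,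
      ap_bang_associator])

theorem cohUnit_leftUnitor (A : Ty α) :
    (ValueJudgment.cohUnit.cls.tensor (YAQ.Hom.id (Ty.bang A))).comp
        ((ValueJudgment.cohTensor Ty.unit A).cls.comp (ValueJudgment.leftUnitor A).cls.bang) =
      (ValueJudgment.leftUnitor (cty := cty) (Ty.bang A)).cls :=
  (det_one_var _).ext (by
    simp only [ap_hom_comp, ap_hom_tensor, ap_hom_leftUnitor, ap_hom_id, ap_cohTensor,
      ap_cohUnit, ap_bang_leftUnitor])

theorem cohUnit_rightUnitor (A : Ty α) :
    ((YAQ.Hom.id (Ty.bang A)).tensor ValueJudgment.cohUnit.cls).comp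
        ((ValueJudgment.cohTensor A Ty.unit).cls.comp (ValueJudgment.rightUnitor A).cls.bang) =
      (ValueJudgment.rightUnitor (cty := cty) (Ty.bang A)).cls :=
  (det_var_one _).ext (by
    simp only [ap_hom_comp, ap_hom_tensor, ap_hom_rightUnitor, ap_hom_id, ap_cohTensor,
      ap_cohUnit, ap_bang_rightUnitor])

theorem cohTensor_braiding (A B : Ty α) :
    (ValueJudgment.cohTensor A B).cls.comp (ValueJudgment.braiding A B).cls.bang =
      (ValueJudgment.braiding (Ty.bang A) (Ty.bang B)).cls.comp
        (ValueJudgment.cohTensor (cty := cty) B A).cls :=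
  (det_two _ _).ext (by
    simp only [ap_hom_comp, ap_hom_braiding, ap_bang_braiding, isVal_var, true_or, ap_cohTensor])

theorem cohTensor_counit (A B : Ty α) :
    (ValueJudgment.cohTensor A B).cls.comp (ValueJudgment.counit (Ty.tensor A B)).cls =
      (ValueJudgment.counit A).cls.tensor (ValueJudgment.counit (cty := cty) B).cls :=
  (det_two _ _).ext (by
    simp only [ap_hom_comp, ap_cohTensor, ap_counit_tens₁, ap_hom_tensor])

theorem cohUnit_comult : ValueJudgment.cohUnit.cls.comp (ValueJudgment.comult Ty.unit).cls =
    (ValueJudgment.cohUnit (cty := cty)).cls.comp ValueJudgment.cohUnit.cls.bang :=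
  det_one.ext (by simp only [ap_hom_comp, ap_cohUnit, ap_comult_one₁, ap_bang_cohUnit])

theorem cohTensor_comult (A B : Ty α) :
    (ValueJudgment.cohTensor A B).cls.comp (ValueJudgment.comult (Ty.tensor A B)).cls =
      ((ValueJudgment.comult A).cls.tensor (ValueJudgment.comult B).cls).comp
        ((ValueJudgment.cohTensor (Ty.bang A) (Ty.bang B)).cls.comp
          (ValueJudgment.cohTensor (cty := cty) A B).cls.bang) :=
  (det_two _ _).ext (by
    simp only [ap_hom_comp, ap_cohTensor, ap_comult_tens₁, ap_hom_tensor, ap_bang_cohTensor])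

/-! The comonoids. -/

theorem comonMul_comonUnit_left (A : Ty α) :
    (ValueJudgment.comonMul A).cls.comp
        ((ValueJudgment.comonUnit A).cls.tensor (YAQ.Hom.id (Ty.bang A))) =
      (ValueJudgment.leftUnitorInv (cty := cty) (Ty.bang A)).cls :=
  (det_var _).ext (by
    simp only [ap_hom_comp, ap_comonMul (dup_var 0 A), ap_hom_tensor, ap_hom_id,
      tens_comonUnit_left (dup_var 0 A), ap_hom_leftUnitorInv])

theorem comonMul_comonUnit_right (A : Ty α) :
    (ValueJudgment.comonMul A).cls.comp
        ((YAQ.Hom.id (Ty.bang A)).tensor (ValueJudgment.comonUnit A).cls) =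
      rightUnitorInv (cty := cty) (Ty.bang A) :=
  (det_var _).ext (by
    simp only [ap_hom_comp, ap_comonMul (dup_var 0 A), ap_hom_tensor, ap_hom_id,
      tens_comonUnit_right (dup_var 0 A), ap_hom_rightUnitorInv])

theorem comonMul_assoc (A : Ty α) :
    (ValueJudgment.comonMul A).cls.comp
        ((YAQ.Hom.id (Ty.bang A)).tensor (ValueJudgment.comonMul A).cls) =
      (ValueJudgment.comonMul A).cls.comp
        (((ValueJudgment.comonMul A).cls.tensor (YAQ.Hom.id (Ty.bang A))).comp
          (associator (cty := cty) (Ty.bang A) (Ty.bang A) (Ty.bang A))) :=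
  (det_var _).ext (by
    simp only [ap_hom_comp, ap_comonMul (dup_var 0 A), ap_hom_tensor, ap_hom_id,
      ap_hom_associator])

theorem comonMul_comm (A : Ty α) :
    (ValueJudgment.comonMul A).cls.comp (ValueJudgment.braiding (Ty.bang A) (Ty.bang A)).cls =
      (ValueJudgment.comonMul (cty := cty) A).cls :=
  (det_var _).ext (by
    simp only [ap_hom_comp, ap_comonMul (dup_var 0 A), ap_hom_braiding, isVal_var, true_or])

theorem comonMul_natural (f : YAQ.Hom cty A B) :
    f.bang.comp (ValueJudgment.comonMul B).cls =
      (ValueJudgment.comonMul A).cls.comp (f.bang.tensor f.bang) :=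
  (det_var _).ext (by
    simp only [ap_hom_comp, ap_comonMul (dup_var 0 A), ap_comonMul ((dup_var 0 A).ap _),
      ap_hom_tensor])

/-- Both sides discard a duplicable value, and arrows do not change contexts. -/
theorem comonUnit_natural (f : YAQ.Hom cty A B) :
    f.bang.comp (ValueJudgment.comonUnit B).cls = (ValueJudgment.comonUnit A).cls :=
  (det_var _).ext (by
    rw [ap_hom_comp]
    exact Discards.eq (n := 0) (discards_comonUnit ((dup_var 0 A).ap _))
      (discards_comonUnit (dup_var 0 A)) fun Γ =>
        ((typedIn_ap Γ (ValueJudgment.comonUnit B).cls _).trans (typedIn_ap Γ f.bang _)).trans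
          (typedIn_ap Γ (ValueJudgment.comonUnit A).cls _).symm)

/-- The long composite is `tensorμ` written out, the exchange of the two middle factors. -/
theorem cohTensor_comonMul (A B : Ty α) :
    (ValueJudgment.cohTensor A B).cls.comp (ValueJudgment.comonMul (Ty.tensor A B)).cls =
      ((ValueJudgment.comonMul A).cls.tensor (ValueJudgment.comonMul B).cls).comp
        (((associator (Ty.bang A) (Ty.bang A) (Ty.tensor (Ty.bang B) (Ty.bang B))).comp
          (((YAQ.Hom.id (Ty.bang A)).tensor
            (ValueJudgment.assoc (Ty.bang A) (Ty.bang B) (Ty.bang B)).cls).comp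
          (((YAQ.Hom.id (Ty.bang A)).tensor
            ((ValueJudgment.braiding (Ty.bang A) (Ty.bang B)).cls.tensor
              (YAQ.Hom.id (Ty.bang B)))).comp
          (((YAQ.Hom.id (Ty.bang A)).tensor
            (associator (Ty.bang B) (Ty.bang A) (Ty.bang B))).comp
          (ValueJudgment.assoc (Ty.bang A) (Ty.bang B) (Ty.tensor (Ty.bang A) (Ty.bang B))).cls)))
          ).comp
          ((ValueJudgment.cohTensor A B).cls.tensor
            (ValueJudgment.cohTensor (cty := cty) A B).cls)) :=
  (det_two _ _).ext (by
    simp only [ap_hom_comp, ap_cohTensor, ap_comonMul ((dup_var 1 A).tens₁ (dup_var 0 B)),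
      ap_hom_tensor, ap_comonMul (dup_var 1 A), ap_comonMul (dup_var 0 B), ap_hom_associator,
      ap_hom_id, ap_hom_assoc, ap_hom_braiding, isVal_var, true_or])

theorem cohUnit_comonMul : ValueJudgment.cohUnit.cls.comp (ValueJudgment.comonMul Ty.unit).cls =
    (ValueJudgment.leftUnitorInv Ty.unit).cls.comp
      ((ValueJudgment.cohUnit (cty := cty)).cls.tensor ValueJudgment.cohUnit.cls) :=
  det_one.ext (by
    simp only [ap_hom_comp, ap_cohUnit, ap_comonMul dup_one₁, ap_hom_leftUnitorInv, ap_hom_tensor])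

theorem cohTensor_comonUnit (A B : Ty α) :
    (ValueJudgment.cohTensor A B).cls.comp (ValueJudgment.comonUnit (Ty.tensor A B)).cls =
      ((ValueJudgment.comonUnit A).cls.tensor (ValueJudgment.comonUnit B).cls).comp
        (ValueJudgment.leftUnitor (cty := cty) Ty.unit).cls :=
  (det_two _ _).ext (by
    rw [ap_hom_comp, ap_cohTensor, ap_hom_comp, ap_hom_tensor]
    refine Discards.eq (n := 0) (discards_comonUnit ((dup_var 1 A).tens₁ (dup_var 0 B)))
      (Discards.leftUnitor (n := 0) rfl (discards_comonUnit (dup_var 1 A))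
        (discards_comonUnit (dup_var 0 B))) fun Γ => ?_
    refine (typedIn_ap Γ (ValueJudgment.comonUnit (Ty.tensor A B)).cls _).trans
      (Iff.trans ?_ (typedIn_ap Γ (ValueJudgment.leftUnitor Ty.unit).cls _).symm)
    refine (typedIn_pair (n := 1) Γ _ _).trans
      (Iff.trans ?_ (typedIn_pair (n := 0) (A := Ty.unit) (B := Ty.unit) Γ _ _).symm)
    exact exists_congr fun Γ₁ => exists_congr fun Γ₂ => and_congr_right fun _ =>
      and_congr (typedIn_ap Γ₁ (ValueJudgment.comonUnit A).cls _).symm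
        (typedIn_ap Γ₂ (ValueJudgment.comonUnit B).cls _).symm)

theorem cohUnit_comonUnit : ValueJudgment.cohUnit.cls.comp (ValueJudgment.comonUnit Ty.unit).cls =
    YAQ.Hom.id (cty := cty) _ :=
  det_one.ext (by
    rw [ap_hom_comp, ap_cohUnit, ap_hom_id]
    refine Discards.eq (n := 0) (discards_comonUnit dup_one₁) (discards_star (n := 0)) fun Γ => ?_
    exact (typedIn_ap Γ (ValueJudgment.comonUnit Ty.unit).cls _).trans
      (Typed.star_iff.trans Typed.star_iff.symm))

theorem comult_bang_comonMul (A : Ty α) :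
    (ValueJudgment.comult A).cls.comp (ValueJudgment.comonMul A).cls.bang =
      (ValueJudgment.comonMul A).cls.comp
        (((ValueJudgment.comult A).cls.tensor (ValueJudgment.comult A).cls).comp
          (ValueJudgment.cohTensor (cty := cty) (Ty.bang A) (Ty.bang A)).cls) :=
  (det_var _).ext (by
    simp only [ap_hom_comp, ap_comonMul (dup_var 0 A), ap_bang_comonMul ((dup_var 0 A).ap _),
      ap_hom_tensor, ap_cohTensor])

theorem comult_bang_comonUnit (A : Ty α) :
    (ValueJudgment.comult A).cls.comp (ValueJudgment.comonUnit A).cls.bang =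
      (ValueJudgment.comonUnit A).cls.comp (ValueJudgment.cohUnit (cty := cty)).cls :=
  (det_var _).ext (by
    rw [ap_hom_comp, ap_hom_comp]
    refine Discards.eq (n := 1) (discards_bang_comonUnit ((dup_var 0 A).ap _))
      (Discards.ap (n := 0) (m := 1) (T := ValueJudgment.cohUnit) (.inr rfl)
        (discards_comonUnit (dup_var 0 A))) fun Γ => ?_
    exact (((typedIn_ap Γ _ _).trans (typedIn_ap Γ _ _)).trans
      (typedIn_ap Γ (ValueJudgment.comonUnit A).cls _).symm).trans (typedIn_ap Γ _ _).symm)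

theorem comult_comonMul (A : Ty α) :
    (ValueJudgment.comult A).cls.comp (ValueJudgment.comonMul (Ty.bang A)).cls =
      (ValueJudgment.comonMul A).cls.comp
        ((ValueJudgment.comult A).cls.tensor (ValueJudgment.comult (cty := cty) A).cls) :=
  (det_var _).ext (by
    simp only [ap_hom_comp, ap_comonMul (dup_var 0 A), ap_comonMul ((dup_var 0 A).ap _),
      ap_hom_tensor])

theorem comult_comonUnit (A : Ty α) :
    (ValueJudgment.comult A).cls.comp (ValueJudgment.comonUnit (Ty.bang A)).cls =
      (ValueJudgment.comonUnit (cty := cty) A).cls :=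
  (det_var _).ext (by
    rw [ap_hom_comp]
    exact Discards.eq (n := 0) (discards_comonUnit ((dup_var 0 A).ap _))
      (discards_comonUnit (dup_var 0 A)) fun Γ =>
        ((typedIn_ap Γ (ValueJudgment.comonUnit (Ty.bang A)).cls _).trans
          (typedIn_ap Γ (ValueJudgment.comult A).cls _)).trans
            (typedIn_ap Γ (ValueJudgment.comonUnit A).cls _).symm)

end YAQ.Hom

end Comonad

/-! ### Assembly of the monoidal category, the comonad, the monad and the exponentials -/

namespace YAQ
variable {α : Type u} {K : Type w} {cty : K → Ty α}

namespace Hom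

theorem id_comp {A B : Ty α} (f : YAQ.Hom cty A B) : (YAQ.Hom.id A).comp f = f :=
  Category.id_comp (obj := YAQ cty) (X := A) (Y := B) f

theorem comp_id {A B : Ty α} (f : YAQ.Hom cty A B) : f.comp (YAQ.Hom.id B) = f :=
  Category.comp_id (obj := YAQ cty) (X := A) (Y := B) f

theorem hexagon_reverse (A B C : Ty α) :
    (ValueJudgment.assoc A B C).cls.comp
        ((ValueJudgment.braiding (Ty.tensor A B) C).cls.comp (ValueJudgment.assoc C A B).cls) =
      ((YAQ.Hom.id A).tensor (ValueJudgment.braiding B C).cls).comp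
        ((ValueJudgment.assoc A C B).cls.comp
          ((ValueJudgment.braiding A C).cls.tensor (YAQ.Hom.id (cty := cty) B))) :=
  (Tm.det_three A B C).ext (by
    simp only [Tm.ap_hom_comp, Tm.ap_hom_tensor, Tm.ap_hom_assoc, Tm.ap_hom_id,
      Tm.ap_hom_braiding, Tm.isVal_var, Tm.IsVal.tens, or_true])

theorem lolli_id_comp (A : Ty α) {B C D : Ty α} (f : YAQ.Hom cty B C) (g : YAQ.Hom cty C D) :
    (YAQ.Hom.id A).lolli (f.comp g) =
      ((YAQ.Hom.id A).lolli f).comp ((YAQ.Hom.id A).lolli g) := by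
  simpa only [id_comp] using lolli_comp (YAQ.Hom.id A) (YAQ.Hom.id A) f g

theorem lolli_comp_id {A B C : Ty α} (f : YAQ.Hom cty A B) (g : YAQ.Hom cty B C) (D : Ty α) :
    (f.comp g).lolli (YAQ.Hom.id D) =
      (g.lolli (YAQ.Hom.id D)).comp (f.lolli (YAQ.Hom.id D)) := by
  simpa only [id_comp] using lolli_comp f g (YAQ.Hom.id D) (YAQ.Hom.id D)

theorem lolli_id_comp_lolli_id {A B C D : Ty α} (f : YAQ.Hom cty A B) (g : YAQ.Hom cty C D) :
    ((YAQ.Hom.id B).lolli g).comp (f.lolli (YAQ.Hom.id D)) = f.lolli g := by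
  simpa only [id_comp, comp_id] using (lolli_comp f (YAQ.Hom.id B) g (YAQ.Hom.id D)).symm

theorem lolli_id_comp_id_lolli {A B C D : Ty α} (f : YAQ.Hom cty A B) (g : YAQ.Hom cty C D) :
    (f.lolli (YAQ.Hom.id C)).comp ((YAQ.Hom.id A).lolli g) = f.lolli g := by
  simpa only [id_comp, comp_id] using (lolli_comp (YAQ.Hom.id A) f (YAQ.Hom.id C) g).symm

theorem Phi_comp {A A' B C : Ty α} (f : YAQ.Hom cty A' A) (g : YAQ.Hom cty A (Ty.lolli B C)) :
    (f.comp g).Phi = (f.tensor (YAQ.Hom.id B)).comp g.Phi := by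
  simpa only [lolli_id, thunk_id, comp_id] using Phi_natural f (YAQ.Hom.id B) (YAQ.Hom.id C) g

theorem Phi_comp_lolli_id {A B B' C : Ty α} (f : YAQ.Hom cty B' B)
    (g : YAQ.Hom cty A (Ty.lolli B C)) :
    (g.comp (f.lolli (YAQ.Hom.id C))).Phi = ((YAQ.Hom.id A).tensor f).comp g.Phi := by
  simpa only [id_comp, thunk_id, comp_id] using Phi_natural (YAQ.Hom.id A) f (YAQ.Hom.id C) g

theorem Phi_comp_id_lolli {A B C C' : Ty α} (f : YAQ.Hom cty C C')
    (g : YAQ.Hom cty A (Ty.lolli B C)) :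
    (g.comp ((YAQ.Hom.id B).lolli f)).Phi = g.Phi.comp f.thunk := by
  simpa only [id_comp, id_tensor_id] using Phi_natural (YAQ.Hom.id A) (YAQ.Hom.id B) f g

end Hom

variable (cty)

instance monoidalStruct : MonoidalCategoryStruct (YAQ cty) where
  tensorObj A B := Ty.tensor A B
  tensorHom f g := YAQ.Hom.tensor f g
  whiskerLeft A _ _ f := (YAQ.Hom.id A).tensor f
  whiskerRight f B := YAQ.Hom.tensor f (YAQ.Hom.id B)
  tensorUnit := Ty.unit
  -- The theorem's `α` goes from `A ⊗ (B ⊗ C)` to `(A ⊗ B) ⊗ C` and is therefore the inverse here.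
  associator A B C :=
    { hom := YAQ.Hom.associator A B C
      inv := (ValueJudgment.assoc A B C).cls
      hom_inv_id := YAQ.Hom.associator_assoc A B C
      inv_hom_id := YAQ.Hom.assoc_associator A B C }
  leftUnitor A :=
    { hom := (ValueJudgment.leftUnitor A).cls
      inv := (ValueJudgment.leftUnitorInv A).cls
      hom_inv_id := YAQ.Hom.leftUnitor_inv A
      inv_hom_id := YAQ.Hom.inv_leftUnitor A }
  rightUnitor A :=
    { hom := (ValueJudgment.rightUnitor A).cls
      inv := YAQ.Hom.rightUnitorInv A
      hom_inv_id := YAQ.Hom.rightUnitor_inv A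
      inv_hom_id := YAQ.Hom.inv_rightUnitor A }

instance monoidal : MonoidalCategory (YAQ cty) :=
  .ofTensorHom
    (id_tensorHom_id := fun _ _ => YAQ.Hom.id_tensor_id)
    (id_tensorHom := fun _ _ _ _ => rfl)
    (tensorHom_id := fun _ _ => rfl)
    (tensorHom_comp_tensorHom := fun f f' g g' => YAQ.Hom.tensor_comp_tensor f f' g g')
    (associator_naturality := fun f g h => YAQ.Hom.associator_natural f g h)
    (leftUnitor_naturality := fun f => YAQ.Hom.leftUnitor_natural f)
    (rightUnitor_naturality := fun f => YAQ.Hom.rightUnitor_natural f)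
    (pentagon := fun A B C D => YAQ.Hom.pentagon A B C D)
    (triangle := fun A B => YAQ.Hom.triangle A B)

instance symmetric : SymmetricCategory (YAQ cty) where
  braiding A B :=
    { hom := (ValueJudgment.braiding A B).cls
      inv := (ValueJudgment.braiding B A).cls
      hom_inv_id := YAQ.Hom.braiding_braiding A B
      inv_hom_id := YAQ.Hom.braiding_braiding B A }
  braiding_naturality_right A _ _ f := YAQ.Hom.braiding_natural (YAQ.Hom.id A) f
  braiding_naturality_left f C := YAQ.Hom.braiding_natural f (YAQ.Hom.id C)
  hexagon_forward A B C := YAQ.Hom.hexagon A B C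
  hexagon_reverse A B C := YAQ.Hom.hexagon_reverse A B C
  symmetry A B := YAQ.Hom.braiding_braiding A B

/-- The comonad `L = !`. -/
def bangComonad : Comonad (YAQ cty) where
  obj A := Ty.bang A
  map f := YAQ.Hom.bang f
  map_id A := YAQ.Hom.bang_id A
  map_comp f g := YAQ.Hom.bang_comp f g
  ε := { app := fun A => (ValueJudgment.counit A).cls
         naturality := fun _ _ f => YAQ.Hom.counit_natural f }
  δ := { app := fun A => (ValueJudgment.comult A).cls
         naturality := fun _ _ f => YAQ.Hom.comult_natural f }
  -- The representatives of `L δ_A` and `δ_{!A}` are the same retyped variable.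
  coassoc _ := rfl
  left_counit A := YAQ.Hom.comult_counit A
  -- Likewise `L ε_A` and `ε_{!A}` have the same representative, so both counit laws are one
  -- equation.
  right_counit A := YAQ.Hom.comult_counit A

instance bangLax : (bangComonad cty).toFunctor.LaxBraided where
  toLaxMonoidal := .ofTensorHom
    (ε := ValueJudgment.cohUnit.cls)
    (μ := fun A B => (ValueJudgment.cohTensor A B).cls)
    (μ_natural := fun f g => YAQ.Hom.cohTensor_natural f g)
    (associativity := fun A B C => YAQ.Hom.cohTensor_associator A B C)
    (left_unitality := fun A => (YAQ.Hom.cohUnit_leftUnitor A).symm)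
    (right_unitality := fun A => (YAQ.Hom.cohUnit_rightUnitor A).symm)
  braided A B := YAQ.Hom.cohTensor_braiding A B

instance bangComon (A : YAQ cty) : ComonObj ((bangComonad cty).obj A) where
  counit := (ValueJudgment.comonUnit A).cls
  comul := (ValueJudgment.comonMul A).cls
  counit_comul := YAQ.Hom.comonMul_comonUnit_left A
  comul_counit := YAQ.Hom.comonMul_comonUnit_right A
  comul_assoc := YAQ.Hom.comonMul_assoc A

/-- The monad `T = 1 ⊸ -`. -/
def compMonad : Monad (YAQ cty) where
  obj A := Ty.comp A
  map f := YAQ.Hom.thunk f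
  map_id A := YAQ.Hom.thunk_id A
  map_comp f g := YAQ.Hom.thunk_comp f g
  η := { app := fun A => (ValueJudgment.unit A).cls
         naturality := fun _ _ f => YAQ.Hom.unit_natural f }
  μ := { app := fun A => (ValueJudgment.mult A).cls
         naturality := fun _ _ f => YAQ.Hom.mult_natural f }
  assoc A := YAQ.Hom.mult_assoc A
  left_unit A := YAQ.Hom.unit_mult A
  right_unit A := YAQ.Hom.thunk_unit_mult A

/-- The exponential bifunctor. -/
def lolliFunctor : (YAQ cty)ᵒᵖ ⥤ YAQ cty ⥤ YAQ cty where
  obj A :=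
    { obj := fun B => Ty.lolli A.unop B
      map := fun g => YAQ.Hom.lolli (YAQ.Hom.id A.unop) g
      map_id := fun B => YAQ.Hom.lolli_id A.unop B
      map_comp := fun f g => YAQ.Hom.lolli_id_comp A.unop f g }
  map f :=
    { app := fun B => YAQ.Hom.lolli f.unop (YAQ.Hom.id B)
      naturality := fun _ _ g => (YAQ.Hom.lolli_id_comp_lolli_id f.unop g).trans
        (YAQ.Hom.lolli_id_comp_id_lolli f.unop g).symm }
  map_id A := NatTrans.ext (funext fun B => YAQ.Hom.lolli_id A.unop B)
  map_comp f g := NatTrans.ext (funext fun B => YAQ.Hom.lolli_comp_id g.unop f.unop B)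

/-- The linear category for duplication `YAQ`. -/
def linearCategory : LinearCategoryForDuplication (YAQ cty) where
  L := bangComonad cty
  counit_monoidal :=
    { unit := YAQ.Hom.cohUnit_counit
      tensor := fun A B => (YAQ.Hom.cohTensor_counit A B).trans (YAQ.Hom.comp_id _).symm }
  comult_monoidal :=
    { unit := YAQ.Hom.cohUnit_comult
      tensor := fun A B => YAQ.Hom.cohTensor_comult A B }
  idempotent A := ⟨(ValueJudgment.counit (Ty.bang A)).cls, YAQ.Hom.comult_counit A,
    YAQ.Hom.counit_comult A⟩
  strong_unit := ⟨(ValueJudgment.counit Ty.unit).cls, YAQ.Hom.cohUnit_counit,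
    YAQ.Hom.counit_cohUnit⟩
  strong_tensor A B := ⟨(ValueJudgment.cohTensorInv A B).cls, YAQ.Hom.cohTensor_inv A B,
    YAQ.Hom.inv_cohTensor A B⟩
  comm A := { comul_comm := YAQ.Hom.comonMul_comm A }
  comul_natural f := YAQ.Hom.comonMul_natural f
  counit_natural f := YAQ.Hom.comonUnit_natural f
  comul_tensor A B := YAQ.Hom.cohTensor_comonMul A B
  comul_unit := YAQ.Hom.cohUnit_comonMul
  counit_tensor A B := YAQ.Hom.cohTensor_comonUnit A B
  counit_unit := YAQ.Hom.cohUnit_comonUnit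
  comul_coalgebra A := YAQ.Hom.comult_bang_comonMul A
  counit_coalgebra A := YAQ.Hom.comult_bang_comonUnit A
  comult_comul A := YAQ.Hom.comult_comonMul A
  comult_counit A := YAQ.Hom.comult_comonUnit A
  T := compMonad cty
  strength A B := (ValueJudgment.strength A B).cls
  strength_natural f g := YAQ.Hom.strength_natural f g
  strength_leftUnitor A := YAQ.Hom.strength_leftUnitor A
  strength_associator A B C := YAQ.Hom.strength_associator A B C
  strength_unit A B := YAQ.Hom.strength_unit A B
  strength_mult A B := YAQ.Hom.strength_mult A B
  lolli := lolliFunctor cty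
  Phi :=
    { toFun := YAQ.Hom.Phi
      invFun := YAQ.Hom.curry
      left_inv := YAQ.Hom.curry_Phi
      right_inv := YAQ.Hom.Phi_curry }
  Phi_natural_left f g := YAQ.Hom.Phi_comp f g
  Phi_natural_middle f g := YAQ.Hom.Phi_comp_lolli_id f g
  Phi_natural_right f g := YAQ.Hom.Phi_comp_id_lolli f g

/-- All operations agree by definition, except three: the action of `L`, given there as a graph; the
Kleisli extension, which is `T f` followed by `μ`; and `⊸` on arrows, which the bifunctor composes
from its two one-sided actions. -/
theorem toData_linearCategory : (linearCategory cty).toData = YAQ.data cty := by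
  refine DuplicationData.ext rfl rfl HEq.rfl HEq.rfl HEq.rfl HEq.rfl HEq.rfl rfl
    (heq_of_eq ?_) HEq.rfl HEq.rfl HEq.rfl HEq.rfl HEq.rfl HEq.rfl rfl HEq.rfl HEq.rfl HEq.rfl
    (heq_of_eq ?_) rfl (heq_of_eq ?_) HEq.rfl
  · funext A B f g
    refine propext ⟨fun h => ?_, ?_⟩
    · obtain ⟨V, rfl⟩ := Quotient.exists_rep f
      exact ⟨V, rfl, h.symm⟩
    · rintro ⟨V, rfl, rfl⟩
      rfl
  · funext A B f
    exact YAQ.Hom.thunk_mult f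
  · funext A B D E f g
    exact YAQ.Hom.lolli_id_comp_id_lolli f g

end YAQ

end LinLam

theorem mainTheorem3 {α : Type*} {K : Type*} (cty : K → LinLam.Ty α) :
    ∃ S : LinLam.LinearCategoryForDuplication (LinLam.YAQ cty),
      S.toData = LinLam.YAQ.data cty := by
  exact ⟨LinLam.YAQ.linearCategory cty, LinLam.YAQ.toData_linearCategory cty⟩
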